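/- Let $k$ be a field of characteristic $0$. Operads are non-unital, $\mathbb Z$-graded, over $k$; permutations act by relabelling inputs; $f\circ_i g$ are the partial compositions, with the usual Koszul signs. Let $\mathcal Gerst$ be the quadratic operad generated in arity $2$ by a product $\circ$ (two planar corollas, degree $0$, spanning $k[\mathbb S_2]$) and a bracket $[\ \bullet\ ]$ (one space corolla, degree $-1$, trivial representation of $\mathbb S_2$), subject to associativity of $\circ$, the (odd) Jacobi identity for $[\ \bullet\ ]$, and the Poisson identity $[(x_1\circ x_2)\bullet x_3]=[x_1\bullet x_3]\circ x_2+x_1\circ[x_2\bullet x_3]$ (as an identity between operations). Let $\mathcal Gerst^!$ be its Koszul dual, $Free(E^*\otimes\Lambda_2)/\langle R^\perp\rangle$ where $E$ and $R$ are the generators and relations of $\mathcal Gerst$ and $\Lambda_n$ is the sign representation. Let $\mathcal Gerst_\infty=\mathcal D(\mathcal Gerst^!)$ be its cobar construction: the free operad on the S-module with components $\mathcal Gerst^!(n)^*\otimes\Lambda_n$, an element dual to degree $j$ having degree $2-n-j$, with the degree-one derivation $d$ (the cobar differential) whose restriction to generators is the dual of the compositions of $\mathcal Gerst^!\{-1\}$,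 where $\mathcal O\{-1\}=\mathcal O\otimes End(k[1])$. There is exactly one such derivation. Then the S-module of generators of $\mathcal Gerst_\infty$ can be identified with the S-module with basis the following labelled corollas with $n\ge 2$ inputs: * the space corolla $\nu_n$, of degree $3-2n$, fixed by $\mathbb S_n$; * for $2\le p\le n$ and pairwise distinct $i_1,\dots,i_p\in[n]$, the partially planar corolla $\mu(i_1,\dots,i_p\,|\,S)$ with ordered planar inputs $i_1,\dots,i_p$ and unordered space inputs $S=[n]\setminus\{i_1,\dots,i_p\}$, of degree $2-p-2(n-p)$. In arity $2$ the identification is the canonical one with the generators of $\mathcal Gerst$, and the cobar differential is given on generators by the following formula. For corollas $x,y$, let $T(x,y)$ be the tree obtained by grafting $y$ onto the input $*$ of $x$, with decorations ordered from top to bottom: as an element of the free operad, $T(x,y)$ is $(-1)^{|x||y|}$ times the composite of $x$ and $y$ at $*$. Write $\nu(A)$ for the space corolla with input set $A$. Then $$d\,\nu([n])=\sum_{I_1\sqcup I_2=[n],\ \#I_1\ge2,\ \#I_2\ge1}T\big(\nu(\{*\}\cup I_2),\nu(I_1)\big),$$ and, all outer sums being over $I_1\sqcup I_2=S$, $$\begin{aligned}d\,\mu(i_1,\dots,i_p|S)={}&\sum_{\#I_1\ge2,\,\#I_2\ge0}T\big(\mu(i_1,\dots,i_p|\{*\}\cup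 I_2),\nu(I_1)\big)\\&-(-1)^p\sum_{\#I_1\ge0,\,\#I_2\ge1}T\big(\nu(\{*\}\cup I_2),\mu(i_1,\dots,i_p|I_1)\big)\\&+\sum_{\#I_1\ge1,\,\#I_2\ge0}\ \sum_{s=1}^pT\big(\mu(i_1,\dots,i_{s-1},*,i_{s+1},\dots,i_p|I_2),\nu(\{i_s\}\cup I_1)\big)\\&+\sum_{\#I_1\ge0,\,\#I_2\ge0}\ \sum_{l+m=p+1,\ l,m\ge2}\ \sum_{s=0}^{m-1}(-1)^{l+s(l+1)}T\big(\mu(i_1,\dots,i_s,*,i_{s+l+1},\dots,i_p|I_2),\mu(i_{s+1},\dots,i_{s+l}|I_1)\big).\end{aligned}$$ -/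

import Mathlib

open Module Finset

universe u

noncomputable section

namespace GerstInfty

/-! ### Graded S-modules and (non-unital) operads

Everything of arity `n ≥ 1` is indexed by `r = n - 1`, so that arities add under partial
composition.  `V r d` is the homogeneous component of arity `r + 1` and degree `d`. -/

/-- The sign `(-1)^n`. -/
def ksign (k : Type u) [Field k] (n : ℤ) : k := if Even n then 1 else -1

/-- A `ℤ`-graded S-module: `V r d` is the part of arity `r + 1` and degree `d`.  The permutation
`σ` acts by relabelling: the input labelled `i` becomes the input labelled `σ i`. -/
structure SMod (k : Type u) [Field k] where
  V : ℕ → ℤ → Type u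
  [acg : ∀ r d, AddCommGroup (V r d)]
  [mod : ∀ r d, Module k (V r d)]
  act : ∀ r d, Representation k (Equiv.Perm (Fin (r + 1))) (V r d)

attribute [instance] SMod.acg SMod.mod

/-- Isomorphisms of graded S-modules. -/
structure SModIso {k : Type u} [Field k] (A B : SMod k) where
  toEquiv : ∀ r d, A.V r d ≃ₗ[k] B.V r d
  equivariant : ∀ r d (σ : Equiv.Perm (Fin (r + 1))) (x : A.V r d),
    toEquiv r d (A.act r d σ x) = B.act r d σ (toEquiv r d x)

/-- In a composite `f ∘_i g` (arities `r + 1`, `s + 1`), the place of the `j`-th input of `f`,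
for `j ≠ i`. -/
def leafLower {r s N : ℕ} (h : r + s = N) (i j : Fin (r + 1)) : Fin (N + 1) :=
  if j < i then ⟨j, by omega⟩ else ⟨j + s, by omega⟩

/-- In a composite `f ∘_i g` (arities `r + 1`, `s + 1`), the place of the `l`-th input of `g`. -/
def leafUpper {r s N : ℕ} (h : r + s = N) (i : Fin (r + 1)) (l : Fin (s + 1)) : Fin (N + 1) :=
  ⟨i + l, by omega⟩

/-- Non-unital graded operads with partial compositions `f ∘_i g` (`i` counted from `0`).
The proofs `h : r + s = N` and `hd : d + e = D` only serve to avoid casts. -/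
structure Operad (k : Type u) [Field k] extends SMod k where
  comp : ∀ {r s N : ℕ} (_ : r + s = N) {d e D : ℤ} (_ : d + e = D) (_ : Fin (r + 1)),
    V r d →ₗ[k] V s e →ₗ[k] V N D
  equivariant : ∀ {r s N : ℕ} (h : r + s = N) {d e D : ℤ} (hd : d + e = D) (i : Fin (r + 1))
    (σ : Equiv.Perm (Fin (r + 1))) (τ : Equiv.Perm (Fin (s + 1))) (ρ : Equiv.Perm (Fin (N + 1)))
    (_ : ∀ l, ρ (leafUpper h i l) = leafUpper h (σ i) (τ l))
    (_ : ∀ j, j ≠ i → ρ (leafLower h i j) = leafLower h (σ i) (σ j))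
    (f : V r d) (g : V s e),
    comp h hd (σ i) (act r d σ f) (act s e τ g) = act N D ρ (comp h hd i f g)
  parallel : ∀ {r s t A B N : ℕ} (hA : r + s = A) (hAN : A + t = N) (hB : r + t = B)
    (hBN : B + s = N) {d e c dA dB D : ℤ} (hdA : d + e = dA) (hdAN : dA + c = D)
    (hdB : d + c = dB) (hdBN : dB + e = D) (i j : Fin (r + 1)) (_ : i < j)
    (f : V r d) (g : V s e) (g' : V t c),
    comp hAN hdAN (leafLower hA i j) (comp hA hdA i f g) g' =
      ksign k (e * c) • comp hBN hdBN (leafLower hB j i) (comp hB hdB j f g') g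
  sequential : ∀ {r s t A B N : ℕ} (hA : r + s = A) (hAN : A + t = N) (hB : s + t = B)
    (hBN : r + B = N) {d e c dA dB D : ℤ} (hdA : d + e = dA) (hdAN : dA + c = D)
    (hdB : e + c = dB) (hdBN : d + dB = D) (i : Fin (r + 1)) (j : Fin (s + 1))
    (f : V r d) (g : V s e) (g' : V t c),
    comp hBN hdBN i f (comp hB hdB j g g') =
      comp hAN hdAN (leafUpper hA i j) (comp hA hdA i f g) g'

/-! ### The free operad on a graded S-module

It is the left adjoint of the forgetful functor from operads to S-modules, built as formal
expressions modulo the congruence generated by the axioms. -/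

/-- Formal expressions in the generators `E`. -/
inductive Pre {k : Type u} [Field k] (E : SMod k) : ℕ → ℤ → Type u
  | gen {r : ℕ} {d : ℤ} (x : E.V r d) : Pre E r d
  | zero {r : ℕ} {d : ℤ} : Pre E r d
  | add {r : ℕ} {d : ℤ} (x y : Pre E r d) : Pre E r d
  | smul {r : ℕ} {d : ℤ} (c : k) (x : Pre E r d) : Pre E r d
  | act {r : ℕ} {d : ℤ} (σ : Equiv.Perm (Fin (r + 1))) (x : Pre E r d) : Pre E r d
  | comp {r s N : ℕ} (h : r + s = N) {d e D : ℤ} (hd : d + e = D) (i : Fin (r + 1))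
      (x : Pre E r d) (y : Pre E s e) : Pre E N D

/-- The smallest congruence for which the expressions form an operad and `gen` is a morphism of
S-modules. -/
inductive Rel {k : Type u} [Field k] (E : SMod k) : ∀ {r : ℕ} {d : ℤ}, Pre E r d → Pre E r d → Prop
  | refl {r d} (x : Pre E r d) : Rel E x x
  | symm {r d} {x y : Pre E r d} : Rel E x y → Rel E y x
  | trans {r d} {x y z : Pre E r d} : Rel E x y → Rel E y z → Rel E x z
  | add_congr {r d} {x x' y y' : Pre E r d} : Rel E x x' → Rel E y y' →
      Rel E (x.add y) (x'.add y')
  | smul_congr {r d} (c : k) {x x' : Pre E r d} : Rel E x x' → Rel E (x.smul c) (x'.smul c)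
  | act_congr {r d} (σ : Equiv.Perm (Fin (r + 1))) {x x' : Pre E r d} : Rel E x x' →
      Rel E (x.act σ) (x'.act σ)
  | comp_congr {r s N : ℕ} (h : r + s = N) {d e D : ℤ} (hd : d + e = D) (i : Fin (r + 1))
      {x x' : Pre E r d} {y y' : Pre E s e} : Rel E x x' → Rel E y y' →
      Rel E (Pre.comp h hd i x y) (Pre.comp h hd i x' y')
  | add_assoc {r d} (x y z : Pre E r d) : Rel E ((x.add y).add z) (x.add (y.add z))
  | add_comm {r d} (x y : Pre E r d) : Rel E (x.add y) (y.add x)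
  | zero_add {r d} (x : Pre E r d) : Rel E (Pre.zero.add x) x
  | neg_add {r d} (x : Pre E r d) : Rel E ((x.smul (-1)).add x) Pre.zero
  | smul_add {r d} (c : k) (x y : Pre E r d) :
      Rel E ((x.add y).smul c) ((x.smul c).add (y.smul c))
  | add_smul {r d} (a b : k) (x : Pre E r d) :
      Rel E (x.smul (a + b)) ((x.smul a).add (x.smul b))
  | mul_smul {r d} (a b : k) (x : Pre E r d) : Rel E (x.smul (a * b)) ((x.smul b).smul a)
  | one_smul {r d} (x : Pre E r d) : Rel E (x.smul 1) x
  | gen_add {r d} (x y : E.V r d) : Rel E (Pre.gen (x + y)) ((Pre.gen x).add (Pre.gen y))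
  | gen_smul {r d} (c : k) (x : E.V r d) : Rel E (Pre.gen (c • x)) ((Pre.gen x).smul c)
  | gen_act {r d} (σ : Equiv.Perm (Fin (r + 1))) (x : E.V r d) :
      Rel E (Pre.gen (E.act r d σ x)) ((Pre.gen x).act σ)
  | act_add {r d} (σ : Equiv.Perm (Fin (r + 1))) (x y : Pre E r d) :
      Rel E ((x.add y).act σ) ((x.act σ).add (y.act σ))
  | act_smul {r d} (σ : Equiv.Perm (Fin (r + 1))) (c : k) (x : Pre E r d) :
      Rel E ((x.smul c).act σ) ((x.act σ).smul c)
  | act_one {r d} (x : Pre E r d) : Rel E (x.act 1) x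
  | act_mul {r d} (σ τ : Equiv.Perm (Fin (r + 1))) (x : Pre E r d) :
      Rel E (x.act (σ * τ)) ((x.act τ).act σ)
  | comp_add_left {r s N : ℕ} (h : r + s = N) {d e D : ℤ} (hd : d + e = D) (i : Fin (r + 1))
      (x x' : Pre E r d) (y : Pre E s e) : Rel E (Pre.comp h hd i (x.add x') y)
        ((Pre.comp h hd i x y).add (Pre.comp h hd i x' y))
  | comp_smul_left {r s N : ℕ} (h : r + s = N) {d e D : ℤ} (hd : d + e = D) (i : Fin (r + 1))
      (c : k) (x : Pre E r d) (y : Pre E s e) : Rel E (Pre.comp h hd i (x.smul c) y)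
        ((Pre.comp h hd i x y).smul c)
  | comp_add_right {r s N : ℕ} (h : r + s = N) {d e D : ℤ} (hd : d + e = D) (i : Fin (r + 1))
      (x : Pre E r d) (y y' : Pre E s e) : Rel E (Pre.comp h hd i x (y.add y'))
        ((Pre.comp h hd i x y).add (Pre.comp h hd i x y'))
  | comp_smul_right {r s N : ℕ} (h : r + s = N) {d e D : ℤ} (hd : d + e = D) (i : Fin (r + 1))
      (c : k) (x : Pre E r d) (y : Pre E s e) : Rel E (Pre.comp h hd i x (y.smul c))
        ((Pre.comp h hd i x y).smul c)
  | equivariant {r s N : ℕ} (h : r + s = N) {d e D : ℤ} (hd : d + e = D) (i : Fin (r + 1))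
      (σ : Equiv.Perm (Fin (r + 1))) (τ : Equiv.Perm (Fin (s + 1)))
      (ρ : Equiv.Perm (Fin (N + 1)))
      (h₁ : ∀ l, ρ (leafUpper h i l) = leafUpper h (σ i) (τ l))
      (h₂ : ∀ j, j ≠ i → ρ (leafLower h i j) = leafLower h (σ i) (σ j))
      (x : Pre E r d) (y : Pre E s e) :
      Rel E (Pre.comp h hd (σ i) (x.act σ) (y.act τ)) ((Pre.comp h hd i x y).act ρ)
  | parallel {r s t A B N : ℕ} (hA : r + s = A) (hAN : A + t = N) (hB : r + t = B)
      (hBN : B + s = N) {d e c dA dB D : ℤ} (hdA : d + e = dA) (hdAN : dA + c = D)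
      (hdB : d + c = dB) (hdBN : dB + e = D) (i j : Fin (r + 1)) (hij : i < j)
      (x : Pre E r d) (y : Pre E s e) (z : Pre E t c) :
      Rel E (Pre.comp hAN hdAN (leafLower hA i j) (Pre.comp hA hdA i x y) z)
        ((Pre.comp hBN hdBN (leafLower hB j i) (Pre.comp hB hdB j x z) y).smul
          (ksign k (e * c)))
  | sequential {r s t A B N : ℕ} (hA : r + s = A) (hAN : A + t = N) (hB : s + t = B)
      (hBN : r + B = N) {d e c dA dB D : ℤ} (hdA : d + e = dA) (hdAN : dA + c = D)
      (hdB : e + c = dB) (hdBN : d + dB = D) (i : Fin (r + 1)) (j : Fin (s + 1))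
      (x : Pre E r d) (y : Pre E s e) (z : Pre E t c) :
      Rel E (Pre.comp hBN hdBN i x (Pre.comp hB hdB j y z))
        (Pre.comp hAN hdAN (leafUpper hA i j) (Pre.comp hA hdA i x y) z)

section Free

variable {k : Type u} [Field k] (E : SMod k)

/-- The setoid of `Rel`. -/
def relSetoid (r : ℕ) (d : ℤ) : Setoid (Pre E r d) where
  r := Rel E
  iseqv := ⟨Rel.refl, Rel.symm, Rel.trans⟩

/-- The components of the free operad. -/
def FreeV (r : ℕ) (d : ℤ) : Type u := Quotient (relSetoid E r d)

instance (r : ℕ) (d : ℤ) : Add (FreeV E r d) where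
  add := Quotient.map₂ Pre.add fun _ _ h _ _ h' => Rel.add_congr h h'

instance (r : ℕ) (d : ℤ) : Zero (FreeV E r d) where
  zero := Quotient.mk _ Pre.zero

instance (r : ℕ) (d : ℤ) : Neg (FreeV E r d) where
  neg := Quotient.map (Pre.smul (-1)) fun _ _ h => Rel.smul_congr _ h

instance (r : ℕ) (d : ℤ) : AddCommGroup (FreeV E r d) where
  nsmul := nsmulRec
  zsmul := zsmulRec
  add_assoc := by
    rintro ⟨x⟩ ⟨y⟩ ⟨z⟩
    exact Quotient.sound (Rel.add_assoc x y z)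
  add_comm := by
    rintro ⟨x⟩ ⟨y⟩
    exact Quotient.sound (Rel.add_comm x y)
  zero_add := by
    rintro ⟨x⟩
    exact Quotient.sound (Rel.zero_add x)
  add_zero := by
    rintro ⟨x⟩
    exact Quotient.sound ((Rel.add_comm x Pre.zero).trans (Rel.zero_add x))
  neg_add_cancel := by
    rintro ⟨x⟩
    exact Quotient.sound (Rel.neg_add x)

instance (r : ℕ) (d : ℤ) : SMul k (FreeV E r d) where
  smul c := Quotient.map (Pre.smul c) fun _ _ h => Rel.smul_congr c h

instance (r : ℕ) (d : ℤ) : Module k (FreeV E r d) :=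
  Module.ofMinimalAxioms
    (by
      rintro c ⟨x⟩ ⟨y⟩
      exact Quotient.sound (Rel.smul_add c x y))
    (by
      rintro a b ⟨x⟩
      exact Quotient.sound (Rel.add_smul a b x))
    (by
      rintro a b ⟨x⟩
      exact Quotient.sound (Rel.mul_smul a b x))
    (by
      rintro ⟨x⟩
      exact Quotient.sound (Rel.one_smul x))

/-- The free operad on the S-module `E`. -/
def free : Operad k where
  V := FreeV E
  act r d :=
    { toFun := fun σ =>
        { toFun := Quotient.map (Pre.act σ) fun _ _ h => Rel.act_congr σ h
          map_add' := by
            rintro ⟨x⟩ ⟨y⟩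
            exact Quotient.sound (Rel.act_add σ x y)
          map_smul' := by
            rintro c ⟨x⟩
            exact Quotient.sound (Rel.act_smul σ c x) }
      map_one' := by
        ext ⟨x⟩
        exact Quotient.sound (Rel.act_one x)
      map_mul' := by
        intro σ τ
        ext ⟨x⟩
        exact Quotient.sound (Rel.act_mul σ τ x) }
  comp h _ _ _ hd i :=
    LinearMap.mk₂ k
      (Quotient.map₂ (Pre.comp h hd i) fun _ _ h₁ _ _ h₂ => Rel.comp_congr h hd i h₁ h₂)
      (by
        rintro ⟨x⟩ ⟨x'⟩ ⟨y⟩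
        exact Quotient.sound (Rel.comp_add_left h hd i x x' y))
      (by
        rintro c ⟨x⟩ ⟨y⟩
        exact Quotient.sound (Rel.comp_smul_left h hd i c x y))
      (by
        rintro ⟨x⟩ ⟨y⟩ ⟨y'⟩
        exact Quotient.sound (Rel.comp_add_right h hd i x y y'))
      (by
        rintro c ⟨x⟩ ⟨y⟩
        exact Quotient.sound (Rel.comp_smul_right h hd i c x y))
  equivariant := by
    rintro r s N h d e D hd i σ τ ρ h₁ h₂ ⟨x⟩ ⟨y⟩
    exact Quotient.sound (Rel.equivariant h hd i σ τ ρ h₁ h₂ x y)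
  parallel := by
    rintro r s t A B N hA hAN hB hBN d e c dA dB D hdA hdAN hdB hdBN i j hij ⟨x⟩ ⟨y⟩ ⟨z⟩
    exact Quotient.sound (Rel.parallel hA hAN hB hBN hdA hdAN hdB hdBN i j hij x y z)
  sequential := by
    rintro r s t A B N hA hAN hB hBN d e c dA dB D hdA hdAN hdB hdBN i j ⟨x⟩ ⟨y⟩ ⟨z⟩
    exact Quotient.sound (Rel.sequential hA hAN hB hBN hdA hdAN hdB hdBN i j x y z)

/-- The inclusion of the generators into the free operad. -/
def ι {r : ℕ} {d : ℤ} : E.V r d →ₗ[k] (free E).V r d where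
  toFun x := Quotient.mk (relSetoid E r d) (Pre.gen x)
  map_add' x y := Quotient.sound (Rel.gen_add x y)
  map_smul' c x := Quotient.sound (Rel.gen_smul c x)

end Free

/-! ### Ideals and quotient operads -/

section Quotient

variable {k : Type u} [Field k] (O : Operad k)

/-- Membership in the operadic ideal generated by the subsets `S r d`. -/
inductive IdealMem (S : ∀ r d, O.V r d → Prop) : ∀ {r : ℕ} {d : ℤ}, O.V r d → Prop
  | of {r d} {x : O.V r d} : S r d x → IdealMem S x
  | zero {r d} : IdealMem S (0 : O.V r d)
  | add {r d} {x y : O.V r d} : IdealMem S x → IdealMem S y → IdealMem S (x + y)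
  | smul {r d} (c : k) {x : O.V r d} : IdealMem S x → IdealMem S (c • x)
  | act {r d} (σ : Equiv.Perm (Fin (r + 1))) {x : O.V r d} : IdealMem S x →
      IdealMem S (O.act r d σ x)
  | comp_left {r s N : ℕ} (h : r + s = N) {d e D : ℤ} (hd : d + e = D) (i : Fin (r + 1))
      {x : O.V r d} (y : O.V s e) : IdealMem S x → IdealMem S (O.comp h hd i x y)
  | comp_right {r s N : ℕ} (h : r + s = N) {d e D : ℤ} (hd : d + e = D) (i : Fin (r + 1))
      (x : O.V r d) {y : O.V s e} : IdealMem S y → IdealMem S (O.comp h hd i x y)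

/-- The components of the ideal generated by `S`. -/
def idealSub (S : ∀ r d, O.V r d → Prop) (r : ℕ) (d : ℤ) : Submodule k (O.V r d) where
  carrier := {x | IdealMem O S x}
  add_mem' := IdealMem.add
  zero_mem' := IdealMem.zero
  smul_mem' c _ := IdealMem.smul c

/-- The quotient of an operad by the ideal generated by `S`. -/
def quotientOperad (S : ∀ r d, O.V r d → Prop) : Operad k where
  V r d := O.V r d ⧸ idealSub O S r d
  act r d :=
    { toFun := fun σ => (idealSub O S r d).mapQ (idealSub O S r d) (O.act r d σ)
        fun _ hx => IdealMem.act σ hx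
      map_one' := by
        ext x
        simp
      map_mul' := by
        intro σ τ
        ext x
        exact congrArg (idealSub O S r d).mkQ (by simp) }
  comp {r s N} h {d e D} hd i :=
    (idealSub O S r d).liftQ
      (LinearMap.mk₂ k
        (fun x => (idealSub O S s e).mapQ (idealSub O S N D) (O.comp h hd i x)
          fun _ hy => IdealMem.comp_right h hd i x hy)
        (by
          rintro x x' ⟨y⟩
          exact congrArg (idealSub O S N D).mkQ (by simp))
        (by
          rintro c x ⟨y⟩
          exact congrArg (idealSub O S N D).mkQ (by simp))
        (fun x y y' => map_add _ y y')
        (fun c x y => map_smul _ c y))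
      (by
        intro x hx
        rw [LinearMap.mem_ker]
        ext y
        exact (Submodule.Quotient.mk_eq_zero _).2 (IdealMem.comp_left h hd i y hx))
  equivariant := by
    rintro r s N h d e D hd i σ τ ρ h₁ h₂ ⟨x⟩ ⟨y⟩
    exact congrArg (idealSub O S N D).mkQ (O.equivariant h hd i σ τ ρ h₁ h₂ x y)
  parallel := by
    rintro r s t A B N hA hAN hB hBN d e c dA dB D hdA hdAN hdB hdBN i j hij ⟨x⟩ ⟨y⟩ ⟨z⟩
    exact congrArg (idealSub O S N D).mkQ
      (O.parallel hA hAN hB hBN hdA hdAN hdB hdBN i j hij x y z)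
  sequential := by
    rintro r s t A B N hA hAN hB hBN d e c dA dB D hdA hdAN hdB hdBN i j ⟨x⟩ ⟨y⟩ ⟨z⟩
    exact congrArg (idealSub O S N D).mkQ
      (O.sequential hA hAN hB hBN hdA hdAN hdB hdBN i j x y z)

/-- The projection onto the quotient operad. -/
def toQuotient (S : ∀ r d, O.V r d → Prop) {r : ℕ} {d : ℤ} :
    O.V r d →ₗ[k] (quotientOperad O S).V r d :=
  (idealSub O S r d).mkQ

end Quotient

/-! ### Two-vertex trees

A tree with two internal vertices and leaves labelled by `Fin (N + 1)` is determined by the set `J`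
of leaves attached to the upper vertex.  The inputs of the upper vertex are the elements of `J` in
increasing order; the input `0` of the lower vertex is the internal edge and its inputs
`1, 2, …` are the elements of the complement of `J` in increasing order. -/

section Trees

variable {N : ℕ} (J : Finset (Fin (N + 1)))

/-- The leaves, sorted into those on the upper and those on the lower vertex. -/
def splitEquiv : Fin #J ⊕ Fin #Jᶜ ≃ Fin (N + 1) := finSumEquivOfFinset rfl rfl

/-- The permutation sending the positions `0, …, N` to the elements of `J` in increasing order,
followed by the elements of the complement in increasing order. -/
def treePerm : Equiv.Perm (Fin (N + 1)) :=
  (finCongr (by rw [card_add_card_compl, Fintype.card_fin])).trans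
    (finSumFinEquiv.symm.trans (splitEquiv J))

/-- The input of the lower vertex through which the leaf `a` is reached. -/
def lowerIdx (a : Fin (N + 1)) : Fin (#Jᶜ + 1) :=
  Sum.elim (fun _ => 0) Fin.succ ((splitEquiv J).symm a)

/-- The input of the upper vertex at which the leaf `a ∈ J` sits (`0` if `a ∉ J`). -/
def upperIdx (a : Fin (N + 1)) : Fin (#J - 1 + 1) :=
  Sum.elim (Fin.castLE (by omega)) (fun _ => 0) ((splitEquiv J).symm a)

/-- The tree with upper leaves `J`, lower vertex decorated by `x` and upper vertex by `y`, as the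
composite of `x` and `y` in the operad `O`.  (It is set to `0` if arities or degrees do not fit.) -/
def tree {k : Type u} [Field k] (O : Operad k) (D : ℤ) {r s : ℕ} {d e : ℤ}
    (x : O.V r d) (y : O.V s e) : O.V N D :=
  if h : r + s = N ∧ #J = s + 1 ∧ d + e = D then
    O.act N D (treePerm J) (O.comp h.1 h.2.2 0 x y)
  else 0

end Trees

/-! ### Quadratic operads and Koszul duals -/

section Quadratic

variable {k : Type u} [Field k]

/-- The dual of a representation of a symmetric group, tensored with the sign representation. -/
def signDual {n : ℕ} {V : Type u} [AddCommGroup V] [Module k V]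
    (ρ : Representation k (Equiv.Perm (Fin n)) V) :
    Representation k (Equiv.Perm (Fin n)) (Dual k V) where
  toFun σ := ((Equiv.Perm.sign σ : ℤ) : k) • ρ.dual σ
  map_one' := by simp [map_one ρ.dual, -Representation.dual_apply]
  map_mul' σ τ := by
    rw [map_mul ρ.dual, map_mul Equiv.Perm.sign, smul_mul_smul_comm]
    simp

/-- Relations in arity three, viewed as a family of subsets in all arities. -/
inductive QuadRel (E : SMod k) (R : ∀ d, Submodule k ((free E).V 2 d)) :
    ∀ r d, (free E).V r d → Prop
  | mk {d : ℤ} {x : (free E).V 2 d} (hx : x ∈ R d) : QuadRel E R 2 d x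

/-- The quadratic operad `Free(E)/⟨R⟩`, with `R` in arity three. -/
def quadraticOperad (E : SMod k) (R : ∀ d, Submodule k ((free E).V 2 d)) : Operad k :=
  quotientOperad (free E) (QuadRel E R)

/-- The S-module `n ↦ E(n)^* ⊗ Λ_n`, with `Λ_n` the sign representation. -/
def SMod.hatDual (E : SMod k) : SMod k where
  V r d := Dual k (E.V r (-d))
  act r d := signDual (E.act r (-d))

/-- For `E` concentrated in arity two and finite-dimensional, the natural isomorphism
`Free(E)(3)^* ⊗ Λ_3 → Free(E^* ⊗ Λ)(3)` of degree-`D` parts: the two-vertex trees decorated by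
dual bases are, up to the sign of the labelling, dual to those decorated by bases. -/
def dualTrees (E : SMod k) (D : ℤ) (f : Dual k ((free E).V 2 (-D))) :
    (free E.hatDual).V 2 D :=
  ∑ J ∈ powersetCard 2 (univ : Finset (Fin 3)), ∑ᶠ d : ℤ,
    ∑ᶠ a : Basis.ofVectorSpaceIndex k (E.V 1 (-d)),
    ∑ᶠ b : Basis.ofVectorSpaceIndex k (E.V 1 (-(D - d))),
      (((Equiv.Perm.sign (treePerm J) : ℤ) : k) *
        f (tree J (free E) (-D) (ι E (Basis.ofVectorSpace k (E.V 1 (-d)) a))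
          (ι E (Basis.ofVectorSpace k (E.V 1 (-(D - d))) b)))) •
      tree J (free E.hatDual) D
        (ι E.hatDual (r := 1) (d := d) ((Basis.ofVectorSpace k (E.V 1 (-d))).coord a))
        (ι E.hatDual (r := 1) (d := D - d) ((Basis.ofVectorSpace k (E.V 1 (-(D - d)))).coord b))

/-- The annihilator `R^⊥` of `R`, inside `Free(E^* ⊗ Λ)(3)`. -/
def orthRel (E : SMod k) (R : ∀ d, Submodule k ((free E).V 2 d)) (D : ℤ) :
    Submodule k ((free E.hatDual).V 2 D) :=
  Submodule.span k {y | ∃ f : Dual k ((free E).V 2 (-D)), (∀ x ∈ R (-D), f x = 0) ∧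
    y = dualTrees E D f}

/-- The Koszul dual of the quadratic operad `Free(E)/⟨R⟩`. -/
def koszulDual (E : SMod k) (R : ∀ d, Submodule k ((free E).V 2 d)) : Operad k :=
  quadraticOperad E.hatDual (orthRel E R)

end Quadratic

/-! ### The cobar construction -/

section Cobar

variable {k : Type u} [Field k] (O : Operad k)

/-- The S-module of generators of the cobar construction of `O`: the dual, shifted by one, of
`O{-1}`, i.e. `O(n)^* ⊗ Λ_n`, where an element dual to degree `j` gets degree `2 - n - j`. -/
def cobarGen : SMod k where
  V r d := Dual k (O.V r (1 - r - d))
  act r d := signDual (O.act r (1 - r - d))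

/-- The pairing of a generator of the cobar construction with an element of `O`. -/
def cobarEval {r : ℕ} {d : ℤ} (c : (cobarGen O).V r d) (x : O.V r (1 - r - d)) : k :=
  (show Dual k (O.V r (1 - r - d)) from c) x

/-- The cobar differential on generators: the dual of the compositions of `O{-1} = O ⊗ End(k[1])`,
summed over all two-vertex trees.  In terms of dual bases, the tree with lower vertex `a^*` and
upper vertex `b^*` gets the coefficient `c (a ∘_J b)`, times the sign of the labelling
(`Λ`), the sign `(-1)^{r |b|}` of the composition in the tensor product `O ⊗ End(k[1])`, and the
sign `(-1)^{|a| + r}` (`|a| + r` being the degree of `a` in `O{-1}`) of the shift by one. -/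
def cobarOnGen {N : ℕ} {d : ℤ} (c : (cobarGen O).V N d) : (free (cobarGen O)).V N (d + 1) :=
  ∑ rs ∈ antidiagonal N, ∑ J ∈ powersetCard (rs.2 + 1) (univ : Finset (Fin (N + 1))),
    ∑ᶠ p : ℤ,
    ∑ᶠ a : Basis.ofVectorSpaceIndex k (O.V rs.1 (1 - rs.1 - p)),
    ∑ᶠ b : Basis.ofVectorSpaceIndex k (O.V rs.2 (1 - rs.2 - (d + 1 - p))),
      (((Equiv.Perm.sign (treePerm J) : ℤ) : k) *
        ksign k (rs.1 * (1 - rs.2 - (d + 1 - p))) * ksign k ((1 - rs.1 - p) + rs.1) *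
        cobarEval O c
          (tree J O (1 - N - d) (Basis.ofVectorSpace k (O.V rs.1 (1 - rs.1 - p)) a)
            (Basis.ofVectorSpace k (O.V rs.2 (1 - rs.2 - (d + 1 - p))) b))) •
      tree J (free (cobarGen O)) (d + 1)
        (ι (cobarGen O) (r := rs.1) (d := p)
          ((Basis.ofVectorSpace k (O.V rs.1 (1 - rs.1 - p))).coord a))
        (ι (cobarGen O) (r := rs.2) (d := d + 1 - p)
          ((Basis.ofVectorSpace k (O.V rs.2 (1 - rs.2 - (d + 1 - p)))).coord b))

/-- `δ` is the cobar differential of (the operad with zero differential) `O`: the degree-one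
derivation of the free operad on `cobarGen O` that is `cobarOnGen` on generators. -/
structure IsCobarDifferential
    (δ : ∀ r d, (free (cobarGen O)).V r d →ₗ[k] (free (cobarGen O)).V r (d + 1)) : Prop where
  equivariant : ∀ r d (σ : Equiv.Perm (Fin (r + 1))) (x : (free (cobarGen O)).V r d),
    δ r d ((free (cobarGen O)).act r d σ x) = (free (cobarGen O)).act r (d + 1) σ (δ r d x)
  leibniz : ∀ {r s N : ℕ} (h : r + s = N) {d e D : ℤ} (hd : d + e = D) (i : Fin (r + 1))
    (x : (free (cobarGen O)).V r d) (y : (free (cobarGen O)).V s e),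
    δ N D ((free (cobarGen O)).comp h hd i x y) =
      (free (cobarGen O)).comp h (show (d + 1) + e = D + 1 by omega) i (δ r d x) y +
      ksign k d • (free (cobarGen O)).comp h (show d + (e + 1) = D + 1 by omega) i x (δ s e y)
  on_gen : ∀ (r : ℕ) (d : ℤ) (c : (cobarGen O).V r d),
    δ r d (ι (cobarGen O) c) = cobarOnGen O c

end Cobar

/-! ### Space corollas and partially planar corollas -/

/-- Labelled corollas with `r + 1` inputs: the space corolla (at least two inputs), and the
corollas whose inputs `f 0, …, f (p - 1)`, `p ≥ 2`, are planar in this order while the remaining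
`r + 1 - p` inputs are space inputs. -/
inductive Corolla (r : ℕ) : Type
  | space (hr : 1 ≤ r) : Corolla r
  | mixed (p : ℕ) (hp : 2 ≤ p) (f : Fin p ↪ Fin (r + 1)) : Corolla r

namespace Corolla

/-- The degree: `3 - 2n` for the space corolla with `n = r + 1` inputs, and `2 - p - 2q` for the
corollas with `p` planar and `q = r + 1 - p` space inputs. -/
def degree {r : ℕ} : Corolla r → ℤ
  | space _ => 1 - 2 * r
  | mixed p _ _ => p - 2 * r

instance (r : ℕ) : MulAction (Equiv.Perm (Fin (r + 1))) (Corolla r) where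
  smul σ c := match c with
    | space hr => space hr
    | mixed p hp f => mixed p hp (f.trans σ.toEmbedding)
  one_smul c := by
    cases c <;> rfl
  mul_smul σ τ c := by
    cases c <;> rfl

theorem degree_smul {r : ℕ} (σ : Equiv.Perm (Fin (r + 1))) (c : Corolla r) :
    (σ • c).degree = c.degree := by
  cases c <;> rfl

end Corolla

/-- The S-module spanned by the corollas whose reduced arity satisfies `P`. -/
def corollaMod (k : Type u) [Field k] (P : ℕ → Prop) : SMod k where
  V r d := {c : Corolla r // P r ∧ c.degree = d} →₀ k
  act r d :=
    { toFun := fun σ => Finsupp.lmapDomain k k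
        fun c => ⟨σ • c.1, c.2.1, (Corolla.degree_smul σ c.1).trans c.2.2⟩
      map_one' := by
        ext c : 1
        ext
        simp
      map_mul' := by
        intro σ τ
        ext c : 1
        ext
        simp [mul_smul] }

/-- The basis vector of a corolla. -/
def corollaVec (k : Type u) [Field k] (P : ℕ → Prop) {r : ℕ} {d : ℤ} (c : Corolla r) (hP : P r)
    (hd : c.degree = d) : (corollaMod k P).V r d :=
  Finsupp.single (⟨c, hP, hd⟩ : {c : Corolla r // P r ∧ c.degree = d}) (1 : k)

/-! ### The operad of non-commutative Gerstenhaber algebras and its Koszul dual -/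

section Gerst

variable (k : Type u) [Field k]

/-- The binary generators: the space corolla of degree `-1` and two planar corollas of degree `0`. -/
abbrev gerstGen : SMod k := corollaMod k (fun r => r = 1)

/-- The planar corolla with inputs in the order `1, 2` in the free operad: the product. -/
def prod₂ : (free (gerstGen k)).V 1 0 :=
  ι (gerstGen k) (corollaVec k _ (.mixed 2 le_rfl (Function.Embedding.refl _)) rfl rfl)

/-- The space corolla with two inputs in the free operad: the bracket. -/
def brac₂ : (free (gerstGen k)).V 1 (-1) :=
  ι (gerstGen k) (corollaVec k _ (.space le_rfl) rfl rfl)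

/-- The relations: associativity, the Jacobi identity and the Poisson identity, with arbitrarily
permuted inputs. -/
inductive GerstRel : ∀ d, (free (gerstGen k)).V 2 d → Prop
  | assoc (σ : Equiv.Perm (Fin 3)) : GerstRel 0 ((free (gerstGen k)).act 2 0 σ
      ((free (gerstGen k)).comp rfl (add_zero 0) 0 (prod₂ k) (prod₂ k) -
        (free (gerstGen k)).comp rfl (add_zero 0) 1 (prod₂ k) (prod₂ k)))
  | jacobi : GerstRel (-2) (∑ i : Fin 3, (free (gerstGen k)).act 2 (-2) (finRotate 3 ^ (i : ℕ))
      ((free (gerstGen k)).comp rfl (by norm_num) 0 (brac₂ k) (brac₂ k)))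
  | poisson (σ : Equiv.Perm (Fin 3)) : GerstRel (-1) ((free (gerstGen k)).act 2 (-1) σ
      ((free (gerstGen k)).comp rfl (by norm_num) 0 (brac₂ k) (prod₂ k) -
        (free (gerstGen k)).act 2 (-1) (Equiv.swap 1 2)
          ((free (gerstGen k)).comp rfl (by norm_num) 0 (prod₂ k) (brac₂ k)) -
        (free (gerstGen k)).comp rfl (by norm_num) 1 (prod₂ k) (brac₂ k)))

/-- The space of quadratic relations. -/
def gerstRel (d : ℤ) : Submodule k ((free (gerstGen k)).V 2 d) :=
  Submodule.span k {x | GerstRel k d x}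

/-- The operad of (non-commutative) Gerstenhaber algebras. -/
def gerst : Operad k := quadraticOperad (gerstGen k) (gerstRel k)

/-- Its Koszul dual. -/
def gerstDual : Operad k := koszulDual (gerstGen k) (gerstRel k)

/-- The class in the Koszul dual of a linear form on the binary generators. -/
def gerstDualGen {d : ℤ} (φ : Dual k ((gerstGen k).V 1 (-d))) : (gerstDual k).V 1 d :=
  toQuotient (free (gerstGen k).hatDual) _ (ι (gerstGen k).hatDual (r := 1) (d := d) φ)

end Gerst

/-! ### The formula -/

section Formula

variable {k : Type u} [Field k] (F : Operad k) (x : ∀ (r : ℕ) (c : Corolla r), F.V r c.degree)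

/-- The space corolla with `r + 1 ≥ 2` inputs. -/
def spaceC (r : ℕ) : F.V r (1 - 2 * r) :=
  if h : 1 ≤ r then x r (.space h) else 0

/-- The corolla with planar inputs `g 0, …, g (p - 1)` (pairwise distinct, `p ≥ 2`). -/
def mixedC (r p : ℕ) (g : Fin p → Fin (r + 1)) : F.V r (p - 2 * r) :=
  if h : 2 ≤ p ∧ Function.Injective g then x r (.mixed p h.1 ⟨g, h.2⟩) else 0

/-- The decorated tree with upper leaves `J`, lower vertex `y` and upper vertex `z`, the
decorations being ordered from top to bottom: `(-1)^{|y||z|}` times the composite. -/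
def topTree {N : ℕ} (J : Finset (Fin (N + 1))) (D : ℤ) {r s : ℕ} {d e : ℤ}
    (y : F.V r d) (z : F.V s e) : F.V N D :=
  ksign k (d * e) • tree J F D y z

/-- Evaluation of `f : Fin p → Fin (N + 1)` at a natural number (`0` if out of range). -/
def atNat {N p : ℕ} (f : Fin p → Fin (N + 1)) (n : ℕ) : Fin (N + 1) :=
  if h : n < p then f ⟨n, h⟩ else 0

/-- The right-hand sides of the formula for the differential of a corolla, for corollas realized
in an operad `F` by `x`. -/
def corollaDiff {N : ℕ} : ∀ c : Corolla N, F.V N (c.degree + 1)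
  | .space _ =>
      ∑ I ∈ (univ : Finset (Fin (N + 1))).powerset with 2 ≤ #I ∧ 1 ≤ #Iᶜ,
        topTree F I _ (spaceC F x #Iᶜ) (spaceC F x (#I - 1))
  | .mixed p _ f =>
      (∑ I ∈ (univ \ univ.map f).powerset with 2 ≤ #I,
        topTree F I _ (mixedC F x #Iᶜ p (lowerIdx I ∘ f)) (spaceC F x (#I - 1))) -
      ksign k p • (∑ I ∈ (univ \ univ.map f).powerset with 1 ≤ #((univ \ univ.map f) \ I),
        topTree F (univ.map f ∪ I) _ (spaceC F x #(univ.map f ∪ I)ᶜ)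
          (mixedC F x (#(univ.map f ∪ I) - 1) p (upperIdx (univ.map f ∪ I) ∘ f))) +
      (∑ I ∈ (univ \ univ.map f).powerset with 1 ≤ #I, ∑ t : Fin p,
        topTree F ({f t} ∪ I) _
          (mixedC F x #({f t} ∪ I)ᶜ p (lowerIdx ({f t} ∪ I) ∘ f))
          (spaceC F x (#({f t} ∪ I) - 1))) +
      ∑ I ∈ (univ \ univ.map f).powerset,
        ∑ lm ∈ antidiagonal (p + 1) with 2 ≤ lm.1 ∧ 2 ≤ lm.2, ∑ t ∈ range lm.2,
          ksign k (lm.1 + t * (lm.1 + 1)) •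
          (let J := (univ.filter fun q : Fin p => t ≤ (q : ℕ) ∧ (q : ℕ) < t + lm.1).map f ∪ I
          topTree F J _
            (mixedC F x #Jᶜ lm.2 fun u =>
              lowerIdx J (atNat f (if (u : ℕ) ≤ t then u else u + lm.1 - 1)))
            (mixedC F x (#J - 1) lm.1 fun u => upperIdx J (atNat f (t + u))))

end Formula

end GerstInfty

end

open GerstInfty

noncomputable section
namespace GerstInfty

/-! ### Koszul signs -/

section Sign

variable (k : Type u) [Field k]

/-! The Koszul dual is generated by a product m of degree 0 and a skew bracket e of degree 1. Taking
the annihilator of associativity, Jacobi and Poisson gives the relations `DualRelations`: m is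
associative, a product one of whose factors is a bracket is a difference of two brackets of the form
[xy, z], and the double bracket is skew. These relations force [x₀x₁, x₂x₃] = 0 (`quad_eq_zero`).
Therefore every operation is a combination of relabelled iterated brackets, either of single inputs
or of one product x₁⋯x_p with further inputs y₁, …, y_q (`mem_stdSpan`). By skewness in the y's
there is, up to a scalar, one such element for each corolla.

Their independence is seen in a model, the operad of words. There an input is either an element of
an associative algebra or an odd scalar, and a word says which inputs are multiplied, in which
order, while the others are scalars. The product goes to the word 01 and the bracket to minus the
sum of the words ∅, 0 and 1 (`toWord`). A corolla with planar inputs goes to the word of these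
inputs, the space corolla to minus the sum of all words of length at most one. Each image is
detected at a word where all others vanish (`corollaWord_apply_word`). This yields a basis indexed
by corollas (`exists_corollaBasis`), and its structure constants are coefficients of words.

The cobar differential is dual to composition. The tree with vertices c₁ (lower) and c₂ (upper)
occurs in the differential of c according to the coefficient of the word of c in the composite of
the words of c₁ and c₂. That word must arise by substituting a word B for the letter 0, the internal
edge, in a word A; for given upper leaves this is possible in at most one way, and only if the
planar inputs on the upper vertex are consecutive. If there are none, or exactly one, then B has
length at most one and the upper vertex is a space corolla. If all of them are there, then A is the
single letter 0 and the lower vertex is a space corolla. Otherwise both vertices have planar inputs.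
These are the four sums of the formula. All signs reduce to the exponent in
`corollaWord_mul_wordTerm`, which depends only on the lengths of A and B and on the position of 0 in
A.

The derivation exists and is unique because a free operad carries exactly one derivation extending a
given linear equivariant map on generators (`existsUnique_isCobarDifferential`); linearity and
equivariance become visible once the differential is written in the corolla basis (`cobarOnGen_eq`,
`cobarOnGen_act`). -/

theorem ksign_add (a b : ℤ) : ksign k (a + b) = ksign k a * ksign k b := by
  unfold ksign
  by_cases ha : Even a <;> by_cases hb : Even b <;> simp [Int.even_add, ha, hb]

theorem ksign_zero : ksign k 0 = 1 := by simp [ksign]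

theorem ksign_one : ksign k 1 = -1 := by simp [ksign]

theorem ksign_eq_of_even {a b : ℤ} (h : Even (a + b)) : ksign k a = ksign k b := by
  unfold ksign
  rw [Int.even_add] at h
  simp [h]

theorem ksign_eq_one_or (a : ℤ) : ksign k a = 1 ∨ ksign k a = -1 := by
  unfold ksign
  split <;> simp

theorem ksign_ne_zero (a : ℤ) : ksign k a ≠ 0 := by
  rcases ksign_eq_one_or k a with h | h <;> simp [h]

/-- The sign of a permutation, in the field `k`. -/
def psign {n : ℕ} (σ : Equiv.Perm (Fin n)) : k := ((Equiv.Perm.sign σ : ℤ) : k)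

theorem psign_mul {n : ℕ} (σ τ : Equiv.Perm (Fin n)) :
    psign k (σ * τ) = psign k σ * psign k τ := by
  simp [psign]

theorem psign_one {n : ℕ} : psign k (1 : Equiv.Perm (Fin n)) = 1 := by
  simp [psign]

theorem psign_sq {n : ℕ} (σ : Equiv.Perm (Fin n)) : psign k σ * psign k σ = 1 := by
  rw [← psign_mul]
  simp [psign]

theorem psign_inv {n : ℕ} (σ : Equiv.Perm (Fin n)) : psign k σ⁻¹ = psign k σ := by
  simp [psign]

theorem psign_eq_one_or {n : ℕ} (σ : Equiv.Perm (Fin n)) : psign k σ = 1 ∨ psign k σ = -1 := by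
  rcases Int.units_eq_one_or (Equiv.Perm.sign σ) with h | h <;> simp [psign, h]

theorem psign_swap {n : ℕ} {a b : Fin n} (h : a ≠ b) : psign k (Equiv.swap a b) = -1 := by
  simp [psign, Equiv.Perm.sign_swap h]

end Sign

/-! ### Morphisms of operads -/

section Hom

variable {k : Type u} [Field k]

/-- Morphisms of operads. -/
structure OperadHom (O P : Operad k) where
  toFun : ∀ r d, O.V r d →ₗ[k] P.V r d
  map_act : ∀ r d (σ : Equiv.Perm (Fin (r + 1))) (x : O.V r d),
    toFun r d (O.act r d σ x) = P.act r d σ (toFun r d x)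
  map_comp : ∀ {r s N : ℕ} (h : r + s = N) {d e D : ℤ} (hd : d + e = D) (i : Fin (r + 1))
    (x : O.V r d) (y : O.V s e),
    toFun N D (O.comp h hd i x y) = P.comp h hd i (toFun r d x) (toFun s e y)

section Lift

variable {E : SMod k} {P : Operad k} (g : ∀ r d, E.V r d →ₗ[k] P.V r d)

/-- Evaluation of formal expressions in an operad. -/
def evalPre : ∀ {r : ℕ} {d : ℤ}, Pre E r d → P.V r d
  | _, _, .gen x => g _ _ x
  | _, _, .zero => 0
  | _, _, .add x y => evalPre x + evalPre y
  | _, _, .smul c x => c • evalPre x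
  | _, _, .act σ x => P.act _ _ σ (evalPre x)
  | _, _, .comp h hd i x y => P.comp h hd i (evalPre x) (evalPre y)

theorem evalPre_rel
    (hg : ∀ r d (σ : Equiv.Perm (Fin (r + 1))) (x : E.V r d),
      g r d (E.act r d σ x) = P.act r d σ (g r d x))
    {r : ℕ} {d : ℤ} {x y : Pre E r d} (h : Rel E x y) : evalPre g x = evalPre g y := by
  induction h with
  | refl => rfl
  | symm _ ih => exact ih.symm
  | trans _ _ ih₁ ih₂ => exact ih₁.trans ih₂
  | add_congr _ _ ih₁ ih₂ => simp only [evalPre, ih₁, ih₂]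
  | smul_congr _ _ ih => simp only [evalPre, ih]
  | act_congr _ _ ih => simp only [evalPre, ih]
  | comp_congr _ _ _ _ _ ih₁ ih₂ => simp only [evalPre, ih₁, ih₂]
  | add_assoc => simp only [evalPre, add_assoc]
  | add_comm => simp only [evalPre, add_comm]
  | zero_add => simp only [evalPre, zero_add]
  | neg_add => simp [evalPre]
  | smul_add => simp only [evalPre, smul_add]
  | add_smul => simp only [evalPre, add_smul]
  | mul_smul => simp only [evalPre, mul_smul]
  | one_smul => simp only [evalPre, one_smul]
  | gen_add => simp only [evalPre, map_add]
  | gen_smul => simp only [evalPre, map_smul]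
  | gen_act => simp only [evalPre, hg]
  | act_add => simp only [evalPre, map_add]
  | act_smul => simp only [evalPre, map_smul]
  | act_one => simp [evalPre]
  | act_mul => simp [evalPre]
  | comp_add_left => simp [evalPre]
  | comp_smul_left => simp [evalPre]
  | comp_add_right => simp [evalPre]
  | comp_smul_right => simp [evalPre]
  | equivariant h hd i σ τ ρ h₁ h₂ x y => exact P.equivariant h hd i σ τ ρ h₁ h₂ _ _
  | parallel hA hAN hB hBN hdA hdAN hdB hdBN i j hij x y z =>
    exact P.parallel hA hAN hB hBN hdA hdAN hdB hdBN i j hij _ _ _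
  | sequential hA hAN hB hBN hdA hdAN hdB hdBN i j x y z =>
    exact P.sequential hA hAN hB hBN hdA hdAN hdB hdBN i j _ _ _

/-- The universal property of the free operad. -/
def freeLift (hg : ∀ r d (σ : Equiv.Perm (Fin (r + 1))) (x : E.V r d),
      g r d (E.act r d σ x) = P.act r d σ (g r d x)) : OperadHom (free E) P where
  toFun r d :=
    { toFun := Quotient.lift (evalPre g) fun _ _ h => evalPre_rel g hg h
      map_add' := by
        rintro ⟨x⟩ ⟨y⟩
        rfl
      map_smul' := by
        rintro c ⟨x⟩
        rfl }
  map_act := by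
    rintro r d σ ⟨x⟩
    rfl
  map_comp := by
    rintro r s N h d e D hd i ⟨x⟩ ⟨y⟩
    rfl

end Lift

theorem ι_act (E : SMod k) {r : ℕ} {d : ℤ} (σ : Equiv.Perm (Fin (r + 1))) (x : E.V r d) :
    ι E (E.act r d σ x) = (free E).act r d σ (ι E x) :=
  Quotient.sound (Rel.gen_act σ x)

/-- The universal property of quotient operads. -/
def quotientLift {O P : Operad k} (F : OperadHom O P) (S : ∀ r d, O.V r d → Prop)
    (hS : ∀ r d x, S r d x → F.toFun r d x = 0) : OperadHom (quotientOperad O S) P where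
  toFun r d := (idealSub O S r d).liftQ (F.toFun r d) (by
    intro x hx
    rw [LinearMap.mem_ker]
    change IdealMem O S x at hx
    induction hx with
    | of h => exact hS _ _ _ h
    | zero => exact map_zero _
    | add _ _ ih₁ ih₂ => rw [map_add, ih₁, ih₂, add_zero]
    | smul c _ ih => rw [map_smul, ih, smul_zero]
    | act σ _ ih => rw [F.map_act, ih, map_zero]
    | comp_left h hd i y _ ih => rw [F.map_comp, ih, map_zero, LinearMap.zero_apply]
    | comp_right h hd i x _ ih => rw [F.map_comp, ih, map_zero])
  map_act := by
    rintro r d σ ⟨x⟩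
    exact F.map_act r d σ x
  map_comp := by
    rintro r s N h d e D hd i ⟨x⟩ ⟨y⟩
    exact F.map_comp h hd i x y

/-- The projection onto a quotient operad, as a morphism of operads. -/
def quotientHom (O : Operad k) (S : ∀ r d, O.V r d → Prop) :
    OperadHom O (quotientOperad O S) where
  toFun _ _ := toQuotient O S
  map_act _ _ _ _ := rfl
  map_comp _ _ _ _ _ _ _ _ := rfl

end Hom

/-! ### Permutations of the leaves of a composite -/

section Leaves

variable {r s N : ℕ} (h : r + s = N)

theorem leafUpper_injective (i : Fin (r + 1)) :
    Function.Injective (leafUpper h i : Fin (s + 1) → _) := by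
  intro a b hab
  simp only [leafUpper, Fin.mk.injEq] at hab
  exact Fin.ext (by omega)

theorem leafLower_lt_leafLower (i : Fin (r + 1)) {a b : Fin (r + 1)} (ha : a ≠ i) (hb : b ≠ i) :
    leafLower h i a < leafLower h i b ↔ a < b := by
  have ha' : (a : ℕ) ≠ i := fun e => ha (Fin.ext e)
  have hb' : (b : ℕ) ≠ i := fun e => hb (Fin.ext e)
  unfold leafLower
  split_ifs with h₁ h₂ h₂ <;> simp only [Fin.lt_def] at * <;> omega

theorem leafLower_injOn (i : Fin (r + 1)) {a b : Fin (r + 1)} (ha : a ≠ i) (hb : b ≠ i)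
    (hab : leafLower h i a = leafLower h i b) : a = b := by
  have h₁ := leafLower_lt_leafLower h i ha hb
  have h₂ := leafLower_lt_leafLower h i hb ha
  rw [hab] at h₁ h₂
  simp only [lt_self_iff_false, false_iff, not_lt] at h₁ h₂
  exact le_antisymm h₂ h₁

theorem leafLower_lt_leafUpper (i : Fin (r + 1)) {a : Fin (r + 1)} (ha : a ≠ i)
    (l : Fin (s + 1)) : leafLower h i a < leafUpper h i l ↔ a < i := by
  have ha' : (a : ℕ) ≠ i := fun e => ha (Fin.ext e)
  unfold leafLower leafUpper
  split_ifs with h₁ <;> simp only [Fin.lt_def] at * <;> omega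

theorem leafUpper_lt_leafLower (i : Fin (r + 1)) {a : Fin (r + 1)} (ha : a ≠ i)
    (l : Fin (s + 1)) : leafUpper h i l < leafLower h i a ↔ i < a := by
  have ha' : (a : ℕ) ≠ i := fun e => ha (Fin.ext e)
  unfold leafLower leafUpper
  split_ifs with h₁ <;> simp only [Fin.lt_def] at * <;> omega

theorem leafLower_ne_leafUpper (i : Fin (r + 1)) {a : Fin (r + 1)} (ha : a ≠ i)
    (l : Fin (s + 1)) : leafLower h i a ≠ leafUpper h i l := by
  intro e
  have h₁ := leafLower_lt_leafUpper h i ha l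
  have h₂ := leafUpper_lt_leafLower h i ha l
  rw [e] at h₁ h₂
  simp only [lt_self_iff_false, false_iff, not_lt] at h₁ h₂
  exact ha (le_antisymm h₂ h₁)

/-- The leaves of a composite, sorted into those of the lower and those of the upper factor. -/
def leafEquiv (i : Fin (r + 1)) : {j : Fin (r + 1) // j ≠ i} ⊕ Fin (s + 1) ≃ Fin (N + 1) :=
  Equiv.ofBijective (Sum.elim (fun j => leafLower h i j) (leafUpper h i)) (by
    rw [Fintype.bijective_iff_injective_and_card]
    constructor
    · rintro (a | a) (b | b) hab
      · exact congrArg _ (Subtype.ext (leafLower_injOn h i a.2 b.2 hab))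
      · exact (leafLower_ne_leafUpper h i a.2 b hab).elim
      · exact (leafLower_ne_leafUpper h i b.2 a hab.symm).elim
      · exact congrArg _ (leafUpper_injective h i hab)
    · simp [Fintype.card_subtype_compl]
      omega)

theorem leafEquiv_inl (i : Fin (r + 1)) (j : {j : Fin (r + 1) // j ≠ i}) :
    leafEquiv h i (Sum.inl j) = leafLower h i j := rfl

theorem leafEquiv_inr (i : Fin (r + 1)) (l : Fin (s + 1)) :
    leafEquiv h i (Sum.inr l) = leafUpper h i l := rfl

/-- The permutation `ρ` occurring in the equivariance axiom. -/
theorem exists_blockPerm (i : Fin (r + 1)) (σ : Equiv.Perm (Fin (r + 1)))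
    (τ : Equiv.Perm (Fin (s + 1))) :
    ∃ ρ : Equiv.Perm (Fin (N + 1)),
      (∀ l, ρ (leafUpper h i l) = leafUpper h (σ i) (τ l)) ∧
      (∀ j, j ≠ i → ρ (leafLower h i j) = leafLower h (σ i) (σ j)) := by
  let e : {j : Fin (r + 1) // j ≠ i} ≃ {j : Fin (r + 1) // j ≠ σ i} :=
    σ.subtypeEquiv (by simp)
  refine ⟨(leafEquiv h i).symm.trans ((Equiv.sumCongr e τ).trans (leafEquiv h (σ i))), ?_, ?_⟩
  · intro l
    have : (leafEquiv h i).symm (leafUpper h i l) = Sum.inr l :=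
      (Equiv.symm_apply_eq _).2 (leafEquiv_inr h i l).symm
    simp [this, leafEquiv_inr]
  · intro j hj
    have : (leafEquiv h i).symm (leafLower h i j) = Sum.inl ⟨j, hj⟩ :=
      (Equiv.symm_apply_eq _).2 (leafEquiv_inl h i ⟨j, hj⟩).symm
    simp [this, leafEquiv_inl, e]

/-- The number of inversions. -/
def inversions {n : ℕ} (σ : Equiv.Perm (Fin n)) : ℕ :=
  ∑ a : Fin n, ∑ b : Fin n, if a < b ∧ σ b < σ a then 1 else 0

theorem sign_eq_inversions {n : ℕ} (σ : Equiv.Perm (Fin n)) :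
    (Equiv.Perm.sign σ : ℤ) = (-1) ^ inversions σ := by
  rw [Equiv.Perm.sign_eq_prod_prod_Ioi, inversions, ← Finset.prod_pow_eq_pow_sum]
  push_cast
  refine Finset.prod_congr rfl fun a _ => ?_
  rw [← Finset.prod_pow_eq_pow_sum, ← Finset.prod_subset (Finset.subset_univ (Ioi a))]
  · refine Finset.prod_congr rfl fun b hb => ?_
    rw [mem_Ioi] at hb
    have : σ a ≠ σ b := fun e => hb.ne (σ.injective e)
    rcases this.lt_or_gt with h | h
    · simp [h, h.not_gt]
    · simp [h, hb, h.not_gt]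
  · intro b _ hb
    rw [mem_Ioi] at hb
    simp [hb]

theorem psign_eq_ksign (k : Type u) [Field k] {n : ℕ} (σ : Equiv.Perm (Fin n)) :
    psign k σ = ksign k (inversions σ) := by
  rw [psign, sign_eq_inversions]
  unfold ksign
  split_ifs with hh
  · simp [Even.neg_one_pow ((Int.even_coe_nat _).1 hh)]
  · rw [Int.even_coe_nat, Nat.not_even_iff_odd] at hh
    simp [Odd.neg_one_pow hh]

/-- The number of inversions involving `i`. -/
def inversionsAt {n : ℕ} (σ : Equiv.Perm (Fin n)) (i : Fin n) : ℕ :=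
  ∑ j : Fin n, ((if j < i ∧ σ i < σ j then 1 else 0) + (if i < j ∧ σ j < σ i then 1 else 0))

/-- The number i counts the j before i, and σ i counts the j whose image lies before that of i.
Added to the inversions at i, every j with j < i or σ j < σ i is counted exactly twice. -/
theorem inversionsAt_even {n : ℕ} (σ : Equiv.Perm (Fin n)) (i : Fin n) :
    Even ((inversionsAt σ i : ℤ) + ((i : ℕ) + (σ i : ℕ))) := by
  have h₁ : (i : ℕ) = ∑ j : Fin n, if j < i then 1 else 0 := by
    rw [Finset.sum_boole, Nat.cast_id, ← Fin.card_Iio i]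
    congr 1
    ext; simp
  have h₂ : (σ i : ℕ) = ∑ j : Fin n, if σ j < σ i then 1 else 0 := by
    rw [Equiv.sum_comp σ (fun j => if j < σ i then 1 else 0), Finset.sum_boole, Nat.cast_id,
      ← Fin.card_Iio (σ i)]
    congr 1
    ext; simp
  have h₃ : inversionsAt σ i + (i + σ i) =
      2 * ∑ j : Fin n, if j < i ∨ σ j < σ i then 1 else 0 := by
    conv_lhs => rw [h₁, h₂]
    rw [inversionsAt, ← Finset.sum_add_distrib, ← Finset.sum_add_distrib, Finset.mul_sum]
    refine Finset.sum_congr rfl fun j _ => ?_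
    rcases lt_trichotomy j i with h | h | h
    · have : σ j ≠ σ i := fun e => h.ne (σ.injective e)
      rcases this.lt_or_gt with h' | h' <;> simp [h, h', h.not_gt, h'.not_gt]
    · simp [h]
    · have : σ j ≠ σ i := fun e => h.ne' (σ.injective e)
      rcases this.lt_or_gt with h' | h' <;> simp [h, h', h.not_gt, h'.not_gt]
  exact_mod_cast h₃ ▸ even_two_mul _

theorem sum_leaves (i : Fin (r + 1)) (f : Fin (N + 1) → ℕ) :
    ∑ a, f a = (∑ j : {j : Fin (r + 1) // j ≠ i}, f (leafLower h i j)) +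
      ∑ l : Fin (s + 1), f (leafUpper h i l) := by
  rw [← Equiv.sum_comp (leafEquiv h i) f, Fintype.sum_sum_type]
  rfl

theorem sum_ne {n : ℕ} (i : Fin n) (f : Fin n → ℕ) :
    ∑ a, f a = (∑ j : {j : Fin n // j ≠ i}, f j) + f i := by
  rw [← Finset.sum_erase_add _ _ (Finset.mem_univ i)]
  congr 1
  exact (Finset.sum_subtype _ (by simp) f)

/-- In a block permutation the letter i is replaced by s + 1 letters, so an inversion of σ involving
i is counted s + 1 times, that is, s times more than in σ itself. -/
theorem inversions_blockPerm {i : Fin (r + 1)} {σ : Equiv.Perm (Fin (r + 1))}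
    {τ : Equiv.Perm (Fin (s + 1))} {ρ : Equiv.Perm (Fin (N + 1))}
    (h₁ : ∀ l, ρ (leafUpper h i l) = leafUpper h (σ i) (τ l))
    (h₂ : ∀ j, j ≠ i → ρ (leafLower h i j) = leafLower h (σ i) (σ j)) :
    inversions ρ = inversions σ + inversions τ + s * inversionsAt σ i := by
  have e₀ : ∀ j : {j : Fin (r + 1) // j ≠ i}, (j : Fin (r + 1)) ≠ i := fun j => j.2
  have e : ∀ j : {j : Fin (r + 1) // j ≠ i}, σ j ≠ σ i := fun j e => j.2 (σ.injective e)
  have hlt : ∀ a b : Fin (s + 1), leafUpper h i a < leafUpper h i b ↔ a < b := by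
    intro a b
    simp [leafUpper]
  have hlt' : ∀ a b : Fin (s + 1), leafUpper h (σ i) a < leafUpper h (σ i) b ↔ a < b := by
    intro a b
    simp [leafUpper]
  have hat : inversionsAt σ i = ∑ j : {j : Fin (r + 1) // j ≠ i},
      ((if (j : Fin (r + 1)) < i ∧ σ i < σ j then 1 else 0) +
        (if i < (j : Fin (r + 1)) ∧ σ j < σ i then 1 else 0)) := by
    rw [inversionsAt, sum_ne i]
    simp
  have hσ : inversions σ = (∑ j : {j : Fin (r + 1) // j ≠ i}, ∑ j' : {j : Fin (r + 1) // j ≠ i},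
      if (j : Fin (r + 1)) < j' ∧ σ j' < σ j then 1 else 0) + inversionsAt σ i := by
    rw [inversions, sum_ne i, hat, sum_ne i]
    simp only [sum_ne i (fun b => if (_ : Fin (r + 1)) < b ∧ _ < _ then 1 else 0)]
    simp only [lt_self_iff_false, false_and, if_false, add_zero, Finset.sum_add_distrib]
    ring
  have hρ : inversions ρ = (∑ j : {j : Fin (r + 1) // j ≠ i},
      ∑ j' : {j : Fin (r + 1) // j ≠ i},
      if (j : Fin (r + 1)) < j' ∧ σ j' < σ j then 1 else 0) + inversions τ +
      (s + 1) * inversionsAt σ i := by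
    rw [inversions, sum_leaves h i]
    simp only [sum_leaves h i (fun b => if (_ : Fin (N + 1)) < b ∧ _ < _ then 1 else 0)]
    have e₁ : ∀ j : {j : Fin (r + 1) // j ≠ i}, ρ (leafLower h i j) =
      leafLower h (σ i) (σ j) := fun j => h₂ j j.2
    simp only [e₁, h₁, hlt, hlt', leafLower_lt_leafLower h i (e₀ _) (e₀ _),
      leafLower_lt_leafLower h (σ i) (e _) (e _), leafLower_lt_leafUpper h i (e₀ _),
      leafUpper_lt_leafLower h i (e₀ _), leafLower_lt_leafUpper h (σ i) (e _),
      leafUpper_lt_leafLower h (σ i) (e _)]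
    rw [hat, inversions]
    simp only [Finset.sum_add_distrib, Finset.sum_const, Finset.card_univ, Fintype.card_fin,
      smul_eq_mul, ← Finset.mul_sum]
    ring
  rw [hρ, hσ]
  ring

/-- The sign is multiplicative only up to a factor depending on the places of the block before and
after; the composition sign of the word operad has to absorb this factor. -/
theorem psign_blockPerm (k : Type u) [Field k] {i : Fin (r + 1)} {σ : Equiv.Perm (Fin (r + 1))}
    {τ : Equiv.Perm (Fin (s + 1))} {ρ : Equiv.Perm (Fin (N + 1))}
    (h₁ : ∀ l, ρ (leafUpper h i l) = leafUpper h (σ i) (τ l))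
    (h₂ : ∀ j, j ≠ i → ρ (leafLower h i j) = leafLower h (σ i) (σ j)) :
    psign k ρ = psign k σ * psign k τ * ksign k (s * ((i : ℕ) + (σ i : ℕ))) := by
  simp only [psign_eq_ksign, inversions_blockPerm h h₁ h₂, ← ksign_add]
  apply ksign_eq_of_even
  obtain ⟨c, hc⟩ := inversionsAt_even σ i
  refine ⟨inversions σ + inversions τ + s * c, ?_⟩
  push_cast
  linear_combination (s : ℤ) * hc

end Leaves

/-! ### Derivations of free operads -/

section Derivation

variable {k : Type u} [Field k]

/-- The two sides are Leibniz expansions, with the primed elements, left arbitrary, in the role of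
the derivatives. Raising the degree of y or of z by one changes the exponent e·c by c or by e, which
is the difference between the signs for d, `dA` and `dB`. -/
theorem derivation_parallel (O : Operad k) {r s t A B N : ℕ} (hA : r + s = A) (hAN : A + t = N)
    (hB : r + t = B) (hBN : B + s = N) {d e c dA dB D : ℤ} (hdA : d + e = dA) (hdAN : dA + c = D)
    (hdB : d + c = dB) (hdBN : dB + e = D) (i j : Fin (r + 1)) (hij : i < j)
    (x : O.V r d) (y : O.V s e) (z : O.V t c)
    (x' : O.V r (d + 1)) (y' : O.V s (e + 1)) (z' : O.V t (c + 1)) :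
    O.comp hAN (show (dA + 1) + c = D + 1 by omega) (leafLower hA i j)
        (O.comp hA (show (d + 1) + e = dA + 1 by omega) i x' y +
          ksign k d • O.comp hA (show d + (e + 1) = dA + 1 by omega) i x y') z +
      ksign k dA • O.comp hAN (show dA + (c + 1) = D + 1 by omega) (leafLower hA i j)
        (O.comp hA hdA i x y) z' =
    ksign k (e * c) • (O.comp hBN (show (dB + 1) + e = D + 1 by omega) (leafLower hB j i)
        (O.comp hB (show (d + 1) + c = dB + 1 by omega) j x' z +
          ksign k d • O.comp hB (show d + (c + 1) = dB + 1 by omega) j x z') y +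
      ksign k dB • O.comp hBN (show dB + (e + 1) = D + 1 by omega) (leafLower hB j i)
        (O.comp hB hdB j x z) y') := by
  simp only [map_add, map_smul, LinearMap.add_apply, LinearMap.smul_apply, smul_add, smul_smul]
  rw [O.parallel hA hAN hB hBN _ _ (show (d + 1) + c = dB + 1 by omega)
      (show (dB + 1) + e = D + 1 by omega) i j hij x' y z,
    O.parallel hA hAN hB hBN _ _ hdB (show dB + (e + 1) = D + 1 by omega) i j hij x y' z,
    O.parallel hA hAN hB hBN _ _ (show d + (c + 1) = dB + 1 by omega)
      (show (dB + 1) + e = D + 1 by omega) i j hij x y z', smul_smul, smul_smul]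
  have e₁ : ksign k d * ksign k ((e + 1) * c) = ksign k (e * c) * ksign k dB := by
    rw [← ksign_add, ← ksign_add]
    apply ksign_eq_of_even
    subst hdB
    refine ⟨d + c + e * c, ?_⟩
    ring
  have e₂ : ksign k dA * ksign k (e * (c + 1)) = ksign k (e * c) * ksign k d := by
    rw [← ksign_add, ← ksign_add]
    apply ksign_eq_of_even
    subst hdA
    refine ⟨d + e + e * c, ?_⟩
    ring
  rw [e₁, e₂]
  abel

theorem derivation_sequential (O : Operad k) {r s t A B N : ℕ} (hA : r + s = A) (hAN : A + t = N)
    (hB : s + t = B) (hBN : r + B = N) {d e c dA dB D : ℤ} (hdA : d + e = dA) (hdAN : dA + c = D)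
    (hdB : e + c = dB) (hdBN : d + dB = D) (i : Fin (r + 1)) (j : Fin (s + 1))
    (x : O.V r d) (y : O.V s e) (z : O.V t c)
    (x' : O.V r (d + 1)) (y' : O.V s (e + 1)) (z' : O.V t (c + 1)) :
    O.comp hBN (show (d + 1) + dB = D + 1 by omega) i x' (O.comp hB hdB j y z) +
      ksign k d • O.comp hBN (show d + (dB + 1) = D + 1 by omega) i x
        (O.comp hB (show (e + 1) + c = dB + 1 by omega) j y' z +
          ksign k e • O.comp hB (show e + (c + 1) = dB + 1 by omega) j y z') =
    O.comp hAN (show (dA + 1) + c = D + 1 by omega) (leafUpper hA i j)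
        (O.comp hA (show (d + 1) + e = dA + 1 by omega) i x' y +
          ksign k d • O.comp hA (show d + (e + 1) = dA + 1 by omega) i x y') z +
      ksign k dA • O.comp hAN (show dA + (c + 1) = D + 1 by omega) (leafUpper hA i j)
        (O.comp hA hdA i x y) z' := by
  simp only [map_add, map_smul, LinearMap.add_apply, LinearMap.smul_apply, smul_add, smul_smul]
  rw [O.sequential hA hAN hB hBN (show (d + 1) + e = dA + 1 by omega)
      (show (dA + 1) + c = D + 1 by omega) hdB _ i j x' y z,
    O.sequential hA hAN hB hBN (show d + (e + 1) = dA + 1 by omega)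
      (show (dA + 1) + c = D + 1 by omega) _ _ i j x y' z,
    O.sequential hA hAN hB hBN hdA (show dA + (c + 1) = D + 1 by omega) _ _ i j x y z',
    ← ksign_add, hdA]
  abel

variable {E : SMod k} (g : ∀ r d, E.V r d →ₗ[k] (free E).V r (d + 1))

/-- The class of a formal expression in the free operad. -/
def freeMk {r : ℕ} {d : ℤ} (x : Pre E r d) : (free E).V r d := Quotient.mk (relSetoid E r d) x

/-- The derivation of degree one extending `g`, on formal expressions. -/
def derPre : ∀ {r : ℕ} {d : ℤ}, Pre E r d → (free E).V r (d + 1)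
  | _, _, .gen x => g _ _ x
  | _, _, .zero => 0
  | _, _, .add x y => derPre x + derPre y
  | _, _, .smul c x => c • derPre x
  | _, _, .act σ x => (free E).act _ _ σ (derPre x)
  | _, _, .comp (d := d) (e := e) (D := D) h hd i x y =>
    (free E).comp h (show (d + 1) + e = D + 1 by omega) i (derPre x) (freeMk y) +
      ksign k d • (free E).comp h (show d + (e + 1) = D + 1 by omega) i (freeMk x) (derPre y)

theorem freeMk_add {r : ℕ} {d : ℤ} (x y : Pre E r d) :
    freeMk (x.add y) = freeMk x + freeMk y := rfl

theorem freeMk_smul {r : ℕ} {d : ℤ} (c : k) (x : Pre E r d) :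
    freeMk (x.smul c) = c • freeMk x := rfl

theorem freeMk_act {r : ℕ} {d : ℤ} (σ : Equiv.Perm (Fin (r + 1))) (x : Pre E r d) :
    freeMk (x.act σ) = (free E).act r d σ (freeMk x) := rfl

theorem freeMk_comp {r s N : ℕ} (h : r + s = N) {d e D : ℤ} (hd : d + e = D) (i : Fin (r + 1))
    (x : Pre E r d) (y : Pre E s e) :
    freeMk (Pre.comp h hd i x y) = (free E).comp h hd i (freeMk x) (freeMk y) := rfl

theorem freeMk_eq {r : ℕ} {d : ℤ} {x y : Pre E r d} (h : Rel E x y) : freeMk x = freeMk y :=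
  Quotient.sound h

/-- The structural relations are linear; the content is that the Leibniz rule is compatible with
equivariance and with the two associativity axioms. In the congruence for composites the
undifferentiated factors must also be replaced, whence `freeMk_eq`. -/
theorem derPre_rel
    (hg : ∀ r d (σ : Equiv.Perm (Fin (r + 1))) (x : E.V r d),
      g r d (E.act r d σ x) = (free E).act r (d + 1) σ (g r d x))
    {r : ℕ} {d : ℤ} {x y : Pre E r d} (h : Rel E x y) : derPre g x = derPre g y := by
  induction h with
  | refl => rfl
  | symm _ ih => exact ih.symm
  | trans _ _ ih₁ ih₂ => exact ih₁.trans ih₂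
  | add_congr _ _ ih₁ ih₂ => simp only [derPre, ih₁, ih₂]
  | smul_congr _ _ ih => simp only [derPre, ih]
  | act_congr _ _ ih => simp only [derPre, ih]
  | comp_congr _ _ _ h₁ h₂ ih₁ ih₂ => simp only [derPre, ih₁, ih₂, freeMk_eq h₁, freeMk_eq h₂]
  | add_assoc => simp only [derPre, add_assoc]
  | add_comm => simp only [derPre, add_comm]
  | zero_add => simp only [derPre, zero_add]
  | neg_add => simp [derPre]
  | smul_add => simp only [derPre, smul_add]
  | add_smul => simp only [derPre, add_smul]
  | mul_smul => simp only [derPre, mul_smul]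
  | one_smul => simp only [derPre, one_smul]
  | gen_add => simp only [derPre, map_add]
  | gen_smul => simp only [derPre, map_smul]
  | gen_act => simp only [derPre, hg]
  | act_add => simp only [derPre, map_add]
  | act_smul => simp only [derPre, map_smul]
  | act_one => simp [derPre]
  | act_mul => simp [derPre]
  | comp_add_left =>
    simp only [derPre, freeMk_add, map_add, LinearMap.add_apply, smul_add]
    abel
  | comp_smul_left =>
    simp only [derPre, freeMk_smul, map_smul, LinearMap.smul_apply, smul_add]
    rw [smul_comm (ksign k _)]
  | comp_add_right =>
    simp only [derPre, freeMk_add, map_add, smul_add]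
    abel
  | comp_smul_right =>
    simp only [derPre, freeMk_smul, map_smul, LinearMap.smul_apply, smul_add]
    rw [smul_comm (ksign k _)]
  | equivariant h hd i σ τ ρ h₁ h₂ x y =>
    simp only [derPre, freeMk_act, map_add, map_smul]
    rw [(free E).equivariant h _ i σ τ ρ h₁ h₂, (free E).equivariant h _ i σ τ ρ h₁ h₂]
  | parallel hA hAN hB hBN hdA hdAN hdB hdBN i j hij x y z =>
    simp only [derPre, freeMk_comp]
    exact derivation_parallel (free E) hA hAN hB hBN hdA hdAN hdB hdBN i j hij _ _ _ _ _ _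
  | sequential hA hAN hB hBN hdA hdAN hdB hdBN i j x y z =>
    simp only [derPre, freeMk_comp]
    exact derivation_sequential (free E) hA hAN hB hBN hdA hdAN hdB hdBN i j _ _ _ _ _ _

/-- The derivation of degree one extending an equivariant map on generators. -/
def freeDer (hg : ∀ r d (σ : Equiv.Perm (Fin (r + 1))) (x : E.V r d),
      g r d (E.act r d σ x) = (free E).act r (d + 1) σ (g r d x)) (r : ℕ) (d : ℤ) :
    (free E).V r d →ₗ[k] (free E).V r (d + 1) where
  toFun := Quotient.lift (derPre g) fun _ _ h => derPre_rel g hg h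
  map_add' := by
    rintro ⟨x⟩ ⟨y⟩
    rfl
  map_smul' := by
    rintro c ⟨x⟩
    rfl

/-- If the cobar differential on generators is linear and equivariant, it extends uniquely to a
derivation. -/
theorem existsUnique_isCobarDifferential (O : Operad k)
    (hadd : ∀ r d (x y : (cobarGen O).V r d),
      cobarOnGen O (x + y) = cobarOnGen O x + cobarOnGen O y)
    (hsmul : ∀ r d (c : k) (x : (cobarGen O).V r d), cobarOnGen O (c • x) = c • cobarOnGen O x)
    (hact : ∀ r d (σ : Equiv.Perm (Fin (r + 1))) (x : (cobarGen O).V r d),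
      cobarOnGen O ((cobarGen O).act r d σ x) =
        (free (cobarGen O)).act r (d + 1) σ (cobarOnGen O x)) :
    ∃! δ, IsCobarDifferential O δ := by
  refine ⟨freeDer (fun r d => ⟨⟨cobarOnGen O, hadd r d⟩, hsmul r d⟩) hact, ?_, ?_⟩
  · refine ⟨?_, ?_, ?_⟩
    · rintro r d σ ⟨x⟩
      rfl
    · rintro r s N h d e D hd i ⟨x⟩ ⟨y⟩
      rfl
    · intro r d c
      rfl
  · intro δ hδ
    funext r d
    -- Uniqueness: a derivation is determined by its values on generators, by induction on formal
    -- expressions.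
    suffices H : ∀ {r : ℕ} {d : ℤ} (x : Pre (cobarGen O) r d), δ r d (freeMk x) =
        derPre (fun r d => ⟨⟨cobarOnGen O, hadd r d⟩, hsmul r d⟩) x by
      ext ⟨x⟩
      exact H x
    intro r d x
    induction x with
    | gen x => exact hδ.on_gen _ _ x
    | zero => exact map_zero _
    | add x y ih₁ ih₂ => rw [freeMk_add, map_add, ih₁, ih₂]; rfl
    | smul c x ih => rw [freeMk_smul, map_smul, ih]; rfl
    | act σ x ih => rw [freeMk_act, hδ.equivariant, ih]; rfl
    | comp h hd i x y ih₁ ih₂ => rw [freeMk_comp, hδ.leibniz, ih₁, ih₂]; rfl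

end Derivation

/-! ### Generation by generators -/

section Generation

variable {k : Type u} [Field k]

/-- A family of subspaces of a quotient of a free operad that contains the generators and is stable
under relabelling and under composition on the right with generators is everything. -/
theorem mem_of_generators {E : SMod k} {O : Operad k} (F : OperadHom (free E) O)
    (hF : ∀ r d, Function.Surjective (F.toFun r d)) (W : ∀ r d, Submodule k (O.V r d))
    (hgen : ∀ r d (x : E.V r d), F.toFun r d (ι E x) ∈ W r d)
    (hact : ∀ r d (σ : Equiv.Perm (Fin (r + 1))) (x : O.V r d), x ∈ W r d →
      O.act r d σ x ∈ W r d)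
    (hcomp : ∀ {r s N : ℕ} (h : r + s = N) {d e D : ℤ} (hd : d + e = D) (i : Fin (r + 1))
      (x : O.V r d) (y : E.V s e), x ∈ W r d → O.comp h hd i x (F.toFun s e (ι E y)) ∈ W N D)
    {r : ℕ} {d : ℤ} (x : O.V r d) : x ∈ W r d := by
  -- The left factor is quantified after y, because the sequential axiom turns grafting a composite
  -- into two successive graftings and the first result becomes the new left factor.
  have key : ∀ {s : ℕ} {e : ℤ} (y : Pre E s e) {r N : ℕ} (h : r + s = N) {d D : ℤ}
      (hd : d + e = D) (i : Fin (r + 1)) (x : O.V r d), x ∈ W r d →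
      O.comp h hd i x (F.toFun s e (freeMk y)) ∈ W N D := by
    intro s e y
    induction y with
    | gen y => exact fun h _ _ hd i x hx => hcomp h hd i x y hx
    | zero =>
      intro r N h d D hd i x hx
      change O.comp h hd i x (F.toFun _ _ 0) ∈ W N D
      rw [map_zero, map_zero]
      exact zero_mem _
    | add y z ih₁ ih₂ =>
      intro r N h d D hd i x hx
      rw [freeMk_add, map_add, map_add]
      exact add_mem (ih₁ h hd i x hx) (ih₂ h hd i x hx)
    | smul c y ih =>
      intro r N h d D hd i x hx
      rw [freeMk_smul, map_smul, map_smul]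
      exact Submodule.smul_mem _ _ (ih h hd i x hx)
    | act τ y ih =>
      intro r N h d D hd i x hx
      obtain ⟨ρ, h₁, h₂⟩ := exists_blockPerm h i 1 τ
      have := O.equivariant h hd i 1 τ ρ h₁ h₂ x (F.toFun _ _ (freeMk y))
      rw [map_one] at this
      rw [freeMk_act, F.map_act]
      exact this ▸ hact _ _ _ _ (ih h hd i x hx)
    | comp h' hd' j y z ih₁ ih₂ =>
      intro r N h d D hd i x hx
      rw [freeMk_comp, F.map_comp,
        O.sequential rfl (by omega) h' h rfl (by omega) hd' hd i j]
      exact ih₂ _ _ _ _ (ih₁ _ _ _ _ hx)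
  suffices H : ∀ {r : ℕ} {d : ℤ} (y : Pre E r d), F.toFun r d (freeMk y) ∈ W r d by
    obtain ⟨⟨y⟩, rfl⟩ := hF r d x
    exact H y
  intro r d y
  induction y with
  | gen y => exact hgen _ _ y
  | zero => exact (map_zero (F.toFun _ _)).symm ▸ zero_mem _
  | add y z ih₁ ih₂ => rw [freeMk_add, map_add]; exact add_mem ih₁ ih₂
  | smul c y ih => rw [freeMk_smul, map_smul]; exact Submodule.smul_mem _ _ ih
  | act τ y ih => rw [freeMk_act, F.map_act]; exact hact _ _ _ _ ih
  | comp h hd i y z ih₁ ih₂ => rw [freeMk_comp, F.map_comp]; exact key z h hd i _ ih₁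

end Generation

/-! ### Substitution of words -/

section Words

theorem leafLower_val {r s N : ℕ} (h : r + s = N) (i j : Fin (r + 1)) :
    (leafLower h i j : ℕ) = if (j : ℕ) < i then (j : ℕ) else j + s := by
  unfold leafLower
  split_ifs with h₁ h₂ h₂ <;> first | rfl | exact absurd h₁ h₂ | exact absurd h₂ h₁

theorem leafUpper_val {r s N : ℕ} (h : r + s = N) (i : Fin (r + 1)) (l : Fin (s + 1)) :
    (leafUpper h i l : ℕ) = i + l := rfl

/-- Substitution of the word `B` for the letter `i` of `A`, relabelled as in a composite. -/
def wsubst {r s N : ℕ} (h : r + s = N) (i : Fin (r + 1)) (A : List (Fin (r + 1)))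
    (B : List (Fin (s + 1))) : List (Fin (N + 1)) :=
  A.flatMap fun j => if j = i then B.map (leafUpper h i) else [leafLower h i j]

/-- The length minus one, and `0` for the empty word. -/
def weight {α : Type*} (L : List α) : ℕ := L.length - 1

theorem weight_map {α β : Type*} (f : α → β) (L : List α) : weight (L.map f) = weight L := by
  simp [weight]

theorem idxOf_map_of_injective {α β : Type*} [DecidableEq α] [DecidableEq β] {f : α → β}
    (hf : Function.Injective f) (a : α) (L : List α) : (L.map f).idxOf (f a) = L.idxOf a := by
  induction L with
  | nil => rfl
  | cons b L ih =>
    have : (f b == f a) = (b == a) := by rw [Bool.eq_iff_iff]; simp [hf.eq_iff]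
    rw [List.map_cons, List.idxOf_cons, List.idxOf_cons, ih, this]

variable {r s N : ℕ} (h : r + s = N) (i : Fin (r + 1))

theorem wsubst_append (A A' : List (Fin (r + 1))) (B : List (Fin (s + 1))) :
    wsubst h i (A ++ A') B = wsubst h i A B ++ wsubst h i A' B := by
  simp [wsubst]

theorem wsubst_cons_self (A : List (Fin (r + 1))) (B : List (Fin (s + 1))) :
    wsubst h i (i :: A) B = B.map (leafUpper h i) ++ wsubst h i A B := by
  simp [wsubst]

theorem wsubst_cons_of_ne {a : Fin (r + 1)} (ha : a ≠ i) (A : List (Fin (r + 1)))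
    (B : List (Fin (s + 1))) :
    wsubst h i (a :: A) B = leafLower h i a :: wsubst h i A B := by
  simp [wsubst, ha]

theorem wsubst_of_notMem {A : List (Fin (r + 1))} (hA : i ∉ A) (B : List (Fin (s + 1))) :
    wsubst h i A B = A.map (leafLower h i) := by
  induction A with
  | nil => rfl
  | cons a A ih =>
    simp only [List.mem_cons, not_or] at hA
    rw [wsubst_cons_of_ne h i (Ne.symm hA.1), ih hA.2, List.map_cons]

theorem leafUpper_mem_wsubst {A : List (Fin (r + 1))} {B : List (Fin (s + 1))} {l : Fin (s + 1)} :
    leafUpper h i l ∈ wsubst h i A B ↔ i ∈ A ∧ l ∈ B := by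
  simp only [wsubst, List.mem_flatMap]
  constructor
  · rintro ⟨a, ha, hl⟩
    split_ifs at hl with e
    · subst e
      obtain ⟨l', hl', e⟩ := List.mem_map.1 hl
      exact ⟨ha, leafUpper_injective h a e ▸ hl'⟩
    · exact (leafLower_ne_leafUpper h i e l (List.mem_singleton.1 hl).symm).elim
  · rintro ⟨hi, hl⟩
    exact ⟨i, hi, by simpa using ⟨l, hl, rfl⟩⟩

theorem leafLower_mem_wsubst {A : List (Fin (r + 1))} {B : List (Fin (s + 1))} {j : Fin (r + 1)}
    (hj : j ≠ i) : leafLower h i j ∈ wsubst h i A B ↔ j ∈ A := by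
  simp only [wsubst, List.mem_flatMap]
  constructor
  · rintro ⟨a, ha, hl⟩
    split_ifs at hl with e
    · obtain ⟨l', -, e'⟩ := List.mem_map.1 hl
      exact (leafLower_ne_leafUpper h i hj l' e'.symm).elim
    · exact leafLower_injOn h i hj e (List.mem_singleton.1 hl) ▸ ha
  · intro hj'
    exact ⟨j, hj', by simp [hj]⟩

theorem nodup_wsubst {A : List (Fin (r + 1))} {B : List (Fin (s + 1))} (hA : A.Nodup)
    (hB : B.Nodup) : (wsubst h i A B).Nodup := by
  induction A with
  | nil => simp [wsubst]
  | cons a A ih =>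
    rw [List.nodup_cons] at hA
    by_cases ha : a = i
    · subst ha
      rw [wsubst_cons_self, List.nodup_append']
      refine ⟨hB.map (leafUpper_injective h a), ih hA.2, ?_⟩
      intro x hx hx'
      obtain ⟨l, -, rfl⟩ := List.mem_map.1 hx
      exact hA.1 ((leafUpper_mem_wsubst h a).1 hx').1
    · rw [wsubst_cons_of_ne h i ha, List.nodup_cons, leafLower_mem_wsubst h i ha]
      exact ⟨hA.1, ih hA.2⟩

theorem length_wsubst {A : List (Fin (r + 1))} (hA : A.Nodup) (B : List (Fin (s + 1))) :
    (wsubst h i A B).length + (if i ∈ A then 1 else 0) =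
      A.length + if i ∈ A then B.length else 0 := by
  induction A with
  | nil => simp [wsubst]
  | cons a A ih =>
    rw [List.nodup_cons] at hA
    by_cases ha : a = i
    · subst ha
      have := ih hA.2
      rw [wsubst_cons_self]
      simp only [hA.1, if_false, List.length_append, List.length_map, List.mem_cons_self,
        if_true, List.length_cons] at this ⊢
      omega
    · have := ih hA.2
      rw [wsubst_cons_of_ne h i ha]
      have e : (i ∈ a :: A) = (i ∈ A) := by simp [Ne.symm ha]
      simp only [e, List.length_cons]
      omega

/-- The hypothesis excludes substituting an empty word for a letter that occurs, or a non-empty word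
for one that does not; in these cases the truncated subtraction in `weight` can spoil additivity. -/
theorem weight_wsubst {A : List (Fin (r + 1))} (hA : A.Nodup) {B : List (Fin (s + 1))}
    (hi : i ∈ A ↔ B ≠ []) : weight (wsubst h i A B) = weight A + weight B := by
  have := length_wsubst h i hA B
  unfold weight
  by_cases hB : B = []
  · subst hB
    simp only [ne_eq, not_true_eq_false, iff_false] at hi
    simp only [hi, if_false] at this
    simp only [List.length_nil]
    omega
  · have hB' := List.length_pos_of_ne_nil hB
    have hi' := hi.2 hB
    have hA' := List.length_pos_of_mem hi'
    simp only [hi', if_true] at this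
    omega

theorem wsubst_ne_nil {A : List (Fin (r + 1))} {B : List (Fin (s + 1))} (hi : i ∈ A ↔ B ≠ []) :
    wsubst h i A B ≠ [] ↔ A ≠ [] := by
  constructor
  · rintro hh rfl
    exact hh rfl
  · intro hA
    cases A with
    | nil => exact (hA rfl).elim
    | cons a A =>
      by_cases ha : a = i
      · subst ha
        rw [wsubst_cons_self]
        simp [hi.1 List.mem_cons_self]
      · rw [wsubst_cons_of_ne h i ha]
        simp

theorem idxOf_leafUpper {A : List (Fin (r + 1))} {B : List (Fin (s + 1))} {j : Fin (s + 1)}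
    (hi : i ∈ A) (hj : j ∈ B) :
    (wsubst h i A B).idxOf (leafUpper h i j) = A.idxOf i + B.idxOf j := by
  obtain ⟨A₁, A₂, rfl, hi₁⟩ := List.eq_append_cons_of_mem hi
  have h₁ : leafUpper h i j ∉ wsubst h i A₁ B := fun hh => hi₁ ((leafUpper_mem_wsubst h i).1 hh).1
  rw [wsubst_append, wsubst_cons_self, List.idxOf_append_of_notMem h₁,
    List.idxOf_append_of_mem (List.mem_map_of_mem hj),
    idxOf_map_of_injective (leafUpper_injective h i), List.idxOf_append_of_notMem hi₁,
    wsubst_of_notMem h i hi₁]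
  simp

/-- Only letters after i move, by the length of B minus one. If i does not occur, its index is the
length of A, so that nothing counts as lying after it. The correction terms stand on both sides to
avoid subtraction. -/
theorem idxOf_leafLower {A : List (Fin (r + 1))} (hA : A.Nodup) (B : List (Fin (s + 1)))
    {j : Fin (r + 1)} (hji : j ≠ i) (hj : j ∈ A) :
    (wsubst h i A B).idxOf (leafLower h i j) + (if A.idxOf i < A.idxOf j then 1 else 0) =
      A.idxOf j + if A.idxOf i < A.idxOf j then B.length else 0 := by
  obtain ⟨A₁, A₂, rfl, hj₁⟩ := List.eq_append_cons_of_mem hj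
  have h₁ : leafLower h i j ∉ wsubst h i A₁ B :=
    fun hh => hj₁ ((leafLower_mem_wsubst h i hji).1 hh)
  have h₂ := length_wsubst h i (List.nodup_append'.1 hA).1 B
  rw [wsubst_append, wsubst_cons_of_ne h i hji, List.idxOf_append_of_notMem h₁,
    List.idxOf_append_of_notMem hj₁]
  by_cases hi : i ∈ A₁
  · have h₃ := List.idxOf_lt_length_of_mem hi
    rw [List.idxOf_append_of_mem hi]
    simpa [hi, h₃] using h₂
  · rw [List.idxOf_append_of_notMem hi]
    simpa [hi] using h₂

theorem wsubst_map {σ : Equiv.Perm (Fin (r + 1))} {τ : Equiv.Perm (Fin (s + 1))}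
    {ρ : Equiv.Perm (Fin (N + 1))}
    (h₁ : ∀ l, ρ (leafUpper h i l) = leafUpper h (σ i) (τ l))
    (h₂ : ∀ j, j ≠ i → ρ (leafLower h i j) = leafLower h (σ i) (σ j))
    (A : List (Fin (r + 1))) (B : List (Fin (s + 1))) :
    wsubst h (σ i) (A.map σ) (B.map τ) = (wsubst h i A B).map ρ := by
  induction A with
  | nil => rfl
  | cons a A ih =>
    by_cases ha : a = i
    · subst ha
      rw [List.map_cons, wsubst_cons_self, wsubst_cons_self, ih, List.map_append, List.map_map,
        List.map_map]
      congr 2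
      ext1 l
      exact (h₁ l).symm
    · rw [List.map_cons, wsubst_cons_of_ne h _ (σ.injective.ne ha), wsubst_cons_of_ne h i ha,
        List.map_cons, ih, h₂ a ha]

end Words

/-! ### Associativity of word substitution -/

section WordAssociativity

variable {r s t A B N : ℕ}

theorem leafUpper_leafUpper (hA : r + s = A) (hAN : A + t = N) (hB : s + t = B)
    (hBN : r + B = N) (i : Fin (r + 1)) (j : Fin (s + 1)) (l : Fin (t + 1)) :
    leafUpper hBN i (leafUpper hB j l) = leafUpper hAN (leafUpper hA i j) l := by
  simp only [leafUpper, Fin.mk.injEq]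
  omega

theorem leafUpper_leafLower (hA : r + s = A) (hAN : A + t = N) (hB : s + t = B)
    (hBN : r + B = N) (i : Fin (r + 1)) (j b : Fin (s + 1)) :
    leafUpper hBN i (leafLower hB j b) =
      leafLower hAN (leafUpper hA i j) (leafUpper hA i b) := by
  apply Fin.ext
  simp only [leafLower_val, leafUpper_val, add_lt_add_iff_left]
  split_ifs <;> omega

theorem leafLower_leafLower_upper (hA : r + s = A) (hAN : A + t = N)
    (hBN : r + B = N) (i : Fin (r + 1)) (j : Fin (s + 1)) {a : Fin (r + 1)} (ha : a ≠ i) :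
    leafLower hBN i a = leafLower hAN (leafUpper hA i j) (leafLower hA i a) := by
  have ha' : (a : ℕ) ≠ i := fun e => ha (Fin.ext e)
  apply Fin.ext
  simp only [leafLower_val, leafUpper_val]
  split_ifs <;> omega

theorem leafLower_leafLower (hA : r + s = A) (hAN : A + t = N) (hB : r + t = B)
    (hBN : B + s = N) {i j a : Fin (r + 1)} (hij : i ≠ j) (ha : a ≠ i) (ha' : a ≠ j) :
    leafLower hAN (leafLower hA i j) (leafLower hA i a) =
      leafLower hBN (leafLower hB j i) (leafLower hB j a) := by
  have h₁ : (a : ℕ) ≠ i := fun e => ha (Fin.ext e)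
  have h₂ : (a : ℕ) ≠ j := fun e => ha' (Fin.ext e)
  have h₃ : (i : ℕ) ≠ j := fun e => hij (Fin.ext e)
  apply Fin.ext
  simp only [leafLower_val]
  split_ifs <;> omega

theorem leafLower_leafUpper (hA : r + s = A) (hAN : A + t = N) (hB : r + t = B)
    (hBN : B + s = N) {i j : Fin (r + 1)} (hij : i ≠ j) (l : Fin (s + 1)) :
    leafLower hAN (leafLower hA i j) (leafUpper hA i l) =
      leafUpper hBN (leafLower hB j i) l := by
  have h₃ : (i : ℕ) ≠ j := fun e => hij (Fin.ext e)
  apply Fin.ext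
  simp only [leafLower_val, leafUpper_val]
  split_ifs <;> omega

theorem wsubst_wsubst_upper (hA : r + s = A) (hAN : A + t = N) (hB : s + t = B)
    (hBN : r + B = N) (i : Fin (r + 1)) (j : Fin (s + 1)) (X : List (Fin (r + 1)))
    (Y : List (Fin (s + 1))) (Z : List (Fin (t + 1))) :
    wsubst hBN i X (wsubst hB j Y Z) =
      wsubst hAN (leafUpper hA i j) (wsubst hA i X Y) Z := by
  -- The same identity for the single block that replaces the letter i of X.
  have hY : (wsubst hB j Y Z).map (leafUpper hBN i) =
      wsubst hAN (leafUpper hA i j) (Y.map (leafUpper hA i)) Z := by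
    induction Y with
    | nil => rfl
    | cons y Y ih =>
      by_cases hy : y = j
      · subst hy
        rw [wsubst_cons_self, List.map_append, ih, List.map_cons, wsubst_cons_self, List.map_map]
        congr 2
        ext1 l
        exact leafUpper_leafUpper hA hAN hB hBN i y l
      · rw [wsubst_cons_of_ne hB j hy, List.map_cons, ih, List.map_cons,
          wsubst_cons_of_ne hAN _ ((leafUpper_injective hA i).ne hy),
          leafUpper_leafLower hA hAN hB hBN]
  induction X with
  | nil => rfl
  | cons x X ih =>
    by_cases hx : x = i
    · subst hx
      rw [wsubst_cons_self, wsubst_cons_self, wsubst_append, ih, hY]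
    · rw [wsubst_cons_of_ne hBN i hx, wsubst_cons_of_ne hA i hx,
        wsubst_cons_of_ne hAN _ (leafLower_ne_leafUpper hA i hx j), ih,
        leafLower_leafLower_upper hA hAN hBN i j hx]

theorem wsubst_wsubst_lower (hA : r + s = A) (hAN : A + t = N) (hB : r + t = B)
    (hBN : B + s = N) {i j : Fin (r + 1)} (hij : i ≠ j) (X : List (Fin (r + 1)))
    (Y : List (Fin (s + 1))) (Z : List (Fin (t + 1))) :
    wsubst hAN (leafLower hA i j) (wsubst hA i X Y) Z =
      wsubst hBN (leafLower hB j i) (wsubst hB j X Z) Y := by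
  have key : ∀ {r s t A B N : ℕ} (hA : r + s = A) (hAN : A + t = N) (hB : r + t = B)
      (hBN : B + s = N) {i j : Fin (r + 1)} (_ : i ≠ j) (Y : List (Fin (s + 1)))
      (Z : List (Fin (t + 1))), wsubst hAN (leafLower hA i j) (Y.map (leafUpper hA i)) Z =
        Y.map (leafUpper hBN (leafLower hB j i)) := by
    intro r s t A B N hA hAN hB hBN i j hij Y Z
    rw [wsubst_of_notMem, List.map_map]
    · congr 1
      ext1 l
      exact leafLower_leafUpper hA hAN hB hBN hij l
    · intro hh
      obtain ⟨l, -, e⟩ := List.mem_map.1 hh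
      exact leafLower_ne_leafUpper hA i hij.symm l e.symm
  induction X with
  | nil => rfl
  | cons x X ih =>
    by_cases hx : x = i
    · subst hx
      rw [wsubst_cons_self, wsubst_append, ih, wsubst_cons_of_ne hB j hij, wsubst_cons_self,
        key hA hAN hB hBN hij]
    · by_cases hx' : x = j
      · subst hx'
        rw [wsubst_cons_self hB, wsubst_append, ← ih, wsubst_cons_of_ne hA i hx, wsubst_cons_self,
          key hB hBN hA hAN hij.symm]
      · rw [wsubst_cons_of_ne hA i hx, wsubst_cons_of_ne hB j hx', wsubst_cons_of_ne,
          wsubst_cons_of_ne, ih, leafLower_leafLower hA hAN hB hBN hij hx hx']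
        · exact fun e => hx (leafLower_injOn hB j hx' hij e)
        · exact fun e => hx' (leafLower_injOn hA i hx hij.symm e)

end WordAssociativity

/-! ### The operad of words

A word `L` in the letters `0, …, r`, without repetition, is the operation that multiplies, in this
order, the inputs in `L` and lets the other ones act as scalars of odd degree; the empty word is
the product of all scalars. -/

section WordOperad

variable (k : Type u) [Field k]

/-- The condition for the composite of two words (in degrees `d` and `e`) to be non-zero. -/
def WordCompat {r s : ℕ} (d e : ℤ) (i : Fin (r + 1)) (A : List (Fin (r + 1)))
    (B : List (Fin (s + 1))) : Prop :=
  A.Nodup ∧ B.Nodup ∧ (i ∈ A ↔ B ≠ []) ∧ (r : ℤ) - weight A = d ∧ (s : ℤ) - weight B = e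

instance {r s : ℕ} (d e : ℤ) (i : Fin (r + 1)) (A : List (Fin (r + 1)))
    (B : List (Fin (s + 1))) : Decidable (WordCompat d e i A B) := by
  unfold WordCompat
  infer_instance

/-- The sign of the composite of two words. -/
def wordSign {r s : ℕ} (d : ℤ) (i : Fin (r + 1)) (A : List (Fin (r + 1)))
    (B : List (Fin (s + 1))) : k :=
  ksign k (s * (r - (i : ℕ)) + weight B * (d + A.idxOf i))

/-- The composite of two words. -/
def wordTerm {r s N : ℕ} (h : r + s = N) (d e : ℤ) (i : Fin (r + 1)) (A : List (Fin (r + 1)))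
    (B : List (Fin (s + 1))) : List (Fin (N + 1)) →₀ k :=
  if WordCompat d e i A B then Finsupp.single (wsubst h i A B) (wordSign k d i A B) else 0

/-- The bilinear extension of the composition of words. -/
def wordComp {r s N : ℕ} (h : r + s = N) (d e : ℤ) (i : Fin (r + 1)) :
    (List (Fin (r + 1)) →₀ k) →ₗ[k] (List (Fin (s + 1)) →₀ k) →ₗ[k] List (Fin (N + 1)) →₀ k :=
  Finsupp.linearCombination k fun A => Finsupp.linearCombination k fun B => wordTerm k h d e i A B

theorem wordComp_single {r s N : ℕ} (h : r + s = N) (d e : ℤ) (i : Fin (r + 1))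
    (A : List (Fin (r + 1))) (B : List (Fin (s + 1))) (a b : k) :
    wordComp k h d e i (Finsupp.single A a) (Finsupp.single B b) =
      (a * b) • wordTerm k h d e i A B := by
  simp [wordComp, mul_smul]

/-- The action of permutations on words. -/
def wordAct (r : ℕ) : Representation k (Equiv.Perm (Fin (r + 1))) (List (Fin (r + 1)) →₀ k) where
  toFun σ := psign k σ • Finsupp.lmapDomain k k (List.map σ)
  map_one' := by
    refine Finsupp.lhom_ext fun L b => ?_
    simp [psign_one]
  map_mul' σ τ := by
    refine Finsupp.lhom_ext fun L b => ?_
    simp only [psign_mul, LinearMap.smul_apply, Finsupp.lmapDomain_apply,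
      Finsupp.mapDomain_single, Finsupp.smul_single, smul_eq_mul, Module.End.mul_apply, mul_assoc,
      List.map_map, Equiv.Perm.coe_mul]

theorem wordAct_single {r : ℕ} (σ : Equiv.Perm (Fin (r + 1))) (L : List (Fin (r + 1))) (b : k) :
    wordAct k r σ (Finsupp.single L b) = psign k σ • Finsupp.single (L.map σ) b := by
  simp [wordAct, Finsupp.mapDomain_single]

variable {k}

theorem WordCompat.map_iff {r s : ℕ} {d e : ℤ} {i : Fin (r + 1)} {A : List (Fin (r + 1))}
    {B : List (Fin (s + 1))} (σ : Equiv.Perm (Fin (r + 1))) (τ : Equiv.Perm (Fin (s + 1))) :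
    WordCompat d e (σ i) (A.map σ) (B.map τ) ↔ WordCompat d e i A B := by
  simp only [WordCompat, List.nodup_map_iff σ.injective, List.nodup_map_iff τ.injective,
    weight_map, List.mem_map_of_injective σ.injective, ne_eq, List.map_eq_nil_iff]

/-- The summand s(r − i) of the composition sign compensates the factor s(i + σ i) from
`psign_blockPerm`; the remaining summand is unchanged, since relabelling preserves lengths and
positions in words. -/
theorem wordTerm_equivariant {r s N : ℕ} (h : r + s = N) (d e : ℤ) (i : Fin (r + 1))
    (σ : Equiv.Perm (Fin (r + 1))) (τ : Equiv.Perm (Fin (s + 1))) (ρ : Equiv.Perm (Fin (N + 1)))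
    (h₁ : ∀ l, ρ (leafUpper h i l) = leafUpper h (σ i) (τ l))
    (h₂ : ∀ j, j ≠ i → ρ (leafLower h i j) = leafLower h (σ i) (σ j))
    (A : List (Fin (r + 1))) (B : List (Fin (s + 1))) :
    (psign k σ * psign k τ) • wordTerm k h d e (σ i) (A.map σ) (B.map τ) =
      wordAct k N ρ (wordTerm k h d e i A B) := by
  unfold wordTerm
  by_cases hc : WordCompat d e i A B
  · rw [if_pos hc, if_pos ((WordCompat.map_iff σ τ).2 hc), wordAct_single,
      wsubst_map h i h₁ h₂, Finsupp.smul_single, Finsupp.smul_single, psign_blockPerm h k h₁ h₂]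
    congr 1
    simp only [smul_eq_mul, wordSign, weight_map, idxOf_map_of_injective σ.injective, mul_assoc,
      ← ksign_add]
    congr 2
    apply ksign_eq_of_even
    refine ⟨s * r + weight B * (d + A.idxOf i), ?_⟩
    ring
  · rw [if_neg hc, if_neg fun h => hc ((WordCompat.map_iff σ τ).1 h), smul_zero, map_zero]

/-- Substituting for i affects neither the occurrence of j nor, by additivity of weights, the degree
condition; so both orders of grafting are non-zero under the same conditions. -/
theorem WordCompat.parallel {r s t A : ℕ} (hA : r + s = A) {d e c dA : ℤ}
    (hdA : d + e = dA) {i j : Fin (r + 1)} (hij : i ≠ j)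
    {X : List (Fin (r + 1))} {Y : List (Fin (s + 1))} {Z : List (Fin (t + 1))} :
    WordCompat d e i X Y ∧ WordCompat dA c (leafLower hA i j) (wsubst hA i X Y) Z ↔
      WordCompat d e i X Y ∧ WordCompat d c j X Z := by
  refine and_congr_right fun h₁ => ?_
  obtain ⟨hX, hY, hi, h₂, h₃⟩ := h₁
  simp only [WordCompat, leafLower_mem_wsubst hA i hij.symm, nodup_wsubst hA i hX hY,
    weight_wsubst hA i hX hi, hX, h₂]
  have : ((A : ℤ) - ((weight X + weight Y : ℕ) : ℤ) = dA) ↔ True := by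
    simp only [iff_true]
    push_cast
    omega
  rw [this]

theorem WordCompat.sequential {r s t A B : ℕ} (hA : r + s = A) (hB : s + t = B) {d e c dA dB : ℤ}
    (hdA : d + e = dA) (hdB : e + c = dB) {i : Fin (r + 1)} {j : Fin (s + 1)}
    {X : List (Fin (r + 1))} {Y : List (Fin (s + 1))} {Z : List (Fin (t + 1))} :
    WordCompat e c j Y Z ∧ WordCompat d dB i X (wsubst hB j Y Z) ↔
      WordCompat d e i X Y ∧ WordCompat dA c (leafUpper hA i j) (wsubst hA i X Y) Z := by
  constructor
  · rintro ⟨⟨hY, hZ, hj, h₁, h₂⟩, ⟨hX, -, hi, h₃, -⟩⟩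
    rw [wsubst_ne_nil hB j hj] at hi
    refine ⟨⟨hX, hY, hi, h₃, h₁⟩, nodup_wsubst hA i hX hY, hZ, ?_, ?_, h₂⟩
    · rw [leafUpper_mem_wsubst, hj, hi]
      refine ⟨fun h => h.2, fun h => ⟨?_, h⟩⟩
      exact List.ne_nil_of_mem (hj.2 h)
    · rw [weight_wsubst hA i hX hi]
      push_cast
      omega
  · rintro ⟨⟨hX, hY, hi, h₁, h₂⟩, ⟨-, hZ, hj, h₃, h₄⟩⟩
    have hj' : j ∈ Y ↔ Z ≠ [] := by
      rw [← hj, leafUpper_mem_wsubst, hi]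
      exact ⟨fun h => ⟨List.ne_nil_of_mem h, h⟩, fun h => h.2⟩
    refine ⟨⟨hY, hZ, hj', h₂, h₄⟩, hX, nodup_wsubst hB j hY hZ, ?_, h₁, ?_⟩
    · rw [wsubst_ne_nil hB j hj', hi]
    · rw [weight_wsubst hB j hY hj']
      push_cast
      omega

theorem mem_of_weight_pos {r s : ℕ} {d e : ℤ} {i : Fin (r + 1)} {A : List (Fin (r + 1))}
    {B : List (Fin (s + 1))} (h : WordCompat d e i A B) (hB : weight B ≠ 0) : i ∈ A := by
  refine h.2.2.1.2 ?_
  rintro rfl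
  exact hB rfl

/-- The index of a letter is meaningful only if the letter occurs. If Z has weight zero its index is
multiplied by zero; otherwise Z is non-empty, the letters occur, and positions add up by
`idxOf_leafUpper`. -/
theorem wordSign_sequential {r s t A B : ℕ} (hA : r + s = A) (hB : s + t = B) {d e c dA dB : ℤ}
    (hdA : d + e = dA) {i : Fin (r + 1)} {j : Fin (s + 1)}
    {X : List (Fin (r + 1))} {Y : List (Fin (s + 1))} {Z : List (Fin (t + 1))}
    (h₁ : WordCompat e c j Y Z) (h₂ : WordCompat d dB i X (wsubst hB j Y Z)) :
    wordSign k e j Y Z * wordSign k d i X (wsubst hB j Y Z) =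
      wordSign k d i X Y * wordSign k dA (leafUpper hA i j) (wsubst hA i X Y) Z := by
  simp only [wordSign, ← ksign_add, weight_wsubst hB j h₁.1 h₁.2.2.1]
  apply ksign_eq_of_even
  rw [leafUpper_val]
  subst hA hB hdA
  by_cases hZ : weight Z = 0
  · rw [hZ]
    refine ⟨s * (r - (i : ℕ)) + weight Y * (d + X.idxOf i) + t * (s - j) + t * (r - i), ?_⟩
    push_cast
    ring
  · have hj := mem_of_weight_pos h₁ hZ
    have hi : i ∈ X := h₂.2.2.1.2 ((wsubst_ne_nil rfl j h₁.2.2.1).2 (List.ne_nil_of_mem hj))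
    rw [idxOf_leafUpper rfl i hi hj]
    refine ⟨s * (r - (i : ℕ)) + weight Y * (d + X.idxOf i) + t * (s - j) + t * (r - i)
      + weight Z * (d + e + X.idxOf i + Y.idxOf j), ?_⟩
    push_cast
    ring

/-- The Koszul exponent is e·c with e = s − weight Y and c = t − weight Z. Its part s·t comes from
the shift of the places of grafting, the mixed parts from the degrees, and weight Y · weight Z from
the shift of the position of the later letter in X. Words of weight zero are treated apart because
their letters need not occur in X. -/
theorem wordSign_parallel {r s t A B : ℕ} (hA : r + s = A) (hB : r + t = B) {d e c dA dB : ℤ}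
    (hdA : d + e = dA) (hdB : d + c = dB) {i j : Fin (r + 1)} (hij : i < j)
    {X : List (Fin (r + 1))} {Y : List (Fin (s + 1))} {Z : List (Fin (t + 1))}
    (h₁ : WordCompat d e i X Y) (h₂ : WordCompat d c j X Z) :
    wordSign k d i X Y * wordSign k dA (leafLower hA i j) (wsubst hA i X Y) Z =
      ksign k (e * c) *
        (wordSign k d j X Z * wordSign k dB (leafLower hB j i) (wsubst hB j X Z) Y) := by
  simp only [wordSign, ← ksign_add]
  apply ksign_eq_of_even
  have hij' : (i : ℕ) < j := hij
  rw [leafLower_val, leafLower_val, if_neg (by omega), if_pos hij']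
  have he := h₁.2.2.2.2
  have hc := h₂.2.2.2.2
  subst hA hB hdA hdB
  by_cases hY : weight Y = 0
  · by_cases hZ : weight Z = 0
    · subst he hc
      rw [hY, hZ]
      refine ⟨s * t + s * (r - i) + t * (r - j), ?_⟩
      push_cast
      ring
    · have hj := mem_of_weight_pos h₂ hZ
      have hidx := idxOf_leafLower (rfl : r + s = r + s) i h₁.1 Y hij.ne' hj
      have hidx' : (wsubst rfl i X Y).idxOf (leafLower (rfl : r + s = r + s) i j) =
          X.idxOf j := by
        by_cases hlt : X.idxOf i < X.idxOf j
        · have hi : i ∈ X :=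
            List.idxOf_lt_length_iff.1 (hlt.trans (List.idxOf_lt_length_iff.2 hj))
          have := List.length_pos_of_ne_nil (h₁.2.2.1.1 hi)
          simp only [hlt, if_true] at hidx
          simp only [weight] at hY
          omega
        · simpa [hlt] using hidx
      subst he hc
      rw [hidx', hY]
      refine ⟨s * t + s * (r - i) + t * (r - j) + weight Z * (d + X.idxOf j), ?_⟩
      push_cast
      ring
  · have hi := mem_of_weight_pos h₁ hY
    have hidx := idxOf_leafLower (rfl : r + t = r + t) j h₂.1 Z hij.ne hi
    by_cases hZ : weight Z = 0
    · have hidx' : (wsubst rfl j X Z).idxOf (leafLower (rfl : r + t = r + t) j i) =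
          X.idxOf i := by
        by_cases hlt : X.idxOf j < X.idxOf i
        · have hj : j ∈ X :=
            List.idxOf_lt_length_iff.1 (hlt.trans (List.idxOf_lt_length_iff.2 hi))
          have := List.length_pos_of_ne_nil (h₂.2.2.1.1 hj)
          simp only [hlt, if_true] at hidx
          simp only [weight] at hZ
          omega
        · simpa [hlt] using hidx
      subst he hc
      rw [hidx', hZ]
      refine ⟨s * t + s * (r - i) + t * (r - j) + weight Y * (d + X.idxOf i), ?_⟩
      push_cast
      ring
    · have hj := mem_of_weight_pos h₂ hZ
      have hidx₂ := idxOf_leafLower (rfl : r + s = r + s) i h₁.1 Y hij.ne' hj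
      have hne : X.idxOf i ≠ X.idxOf j := fun e => hij.ne ((List.idxOf_inj hi).1 e)
      have hYl : Y.length = weight Y + 1 := by
        simp only [weight] at hY ⊢
        omega
      have hZl : Z.length = weight Z + 1 := by
        simp only [weight] at hZ ⊢
        omega
      subst he hc
      -- Whichever letter comes second in X is shifted by the weight of the word substituted for the
      -- first; by symmetry both orders contribute the same parity.
      rcases hne.lt_or_gt with hlt | hlt
      · simp only [hlt, hlt.not_gt, if_true, if_false, add_zero, hYl] at hidx hidx₂
        have hidx₃ : (wsubst rfl i X Y).idxOf (leafLower (rfl : r + s = r + s) i j) =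
          X.idxOf j + weight Y := by omega
        rw [hidx, hidx₃]
        refine ⟨s * t + s * (r - i) + t * (r - j) + weight Y * (d + X.idxOf i)
          + weight Z * (d + X.idxOf j), ?_⟩
        push_cast
        ring
      · simp only [hlt, hlt.not_gt, if_true, if_false, add_zero, hZl] at hidx hidx₂
        have hidx₃ : (wsubst rfl j X Z).idxOf (leafLower (rfl : r + t = r + t) j i) =
          X.idxOf i + weight Z := by omega
        rw [hidx₂, hidx₃]
        refine ⟨s * t + s * (r - i) + t * (r - j) + weight Y * (d + X.idxOf i)
          + weight Z * (d + X.idxOf j), ?_⟩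
        push_cast
        ring

variable (k)

/-- The operad of words. -/
def wordOperad : Operad k where
  V r _ := List (Fin (r + 1)) →₀ k
  act r _ := wordAct k r
  comp {_ _ _} h {d e _} _ i := wordComp k h d e i
  equivariant := by
    intro r s N h d e D hd i σ τ ρ h₁ h₂ f g
    induction f using Finsupp.induction_linear with
    | zero => simp
    | add f f' ih ih' => simp only [map_add, LinearMap.add_apply, ih, ih']
    | single A a =>
      induction g using Finsupp.induction_linear with
      | zero => simp
      | add f f' ih ih' => simp only [map_add, ih, ih']
      | single B b =>
        rw [wordComp_single, map_smul, ← wordTerm_equivariant h d e i σ τ ρ h₁ h₂, wordAct_single,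
          wordAct_single, Finsupp.smul_single, Finsupp.smul_single, wordComp_single, smul_smul]
        congr 1
        simp only [smul_eq_mul]
        ring
  parallel := by
    intro r s t A B N hA hAN hB hBN d e c dA dB D hdA hdAN hdB hdBN i j hij f g g'
    induction f using Finsupp.induction_linear with
    | zero => simp
    | add f f' ih ih' => simp only [map_add, LinearMap.add_apply, ih, ih', smul_add]
    | single X x =>
    induction g using Finsupp.induction_linear with
    | zero => simp
    | add f f' ih ih' => simp only [map_add, LinearMap.add_apply, ih, ih', smul_add]
    | single Y y =>
    induction g' using Finsupp.induction_linear with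
    | zero => simp
    | add f f' ih ih' => simp only [map_add, LinearMap.add_apply, ih, ih', smul_add]
    | single Z z =>
      have hp := WordCompat.parallel (e := e) (c := c) (Y := Y) (Z := Z) hA hdA hij.ne (X := X)
      have hp' := WordCompat.parallel (e := c) (c := e) (Y := Z) (Z := Y) hB hdB hij.ne' (X := X)
      rw [wordComp_single, wordComp_single]
      by_cases hc : WordCompat d e i X Y ∧ WordCompat d c j X Z
      · have h₁ := (hp.2 hc).2
        have h₂ := (hp'.2 hc.symm).2
        have hs := wordSign_parallel (k := k) hA hB hdA hdB hij hc.1 hc.2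
        simp only [wordTerm, if_pos hc.1, if_pos hc.2, Finsupp.smul_single, wordComp_single,
          if_pos h₁, if_pos h₂, wsubst_wsubst_lower hA hAN hB hBN hij.ne, smul_eq_mul]
        congr 1
        linear_combination (x * y * z) * hs
      -- If some compatibility condition fails, both iterated composites vanish.
      · have e₁ : wordComp k hAN dA c (leafLower hA i j)
            ((x * y) • wordTerm k hA d e i X Y) (Finsupp.single Z z) = 0 := by
          unfold wordTerm
          split_ifs with h₁
          · rw [Finsupp.smul_single, wordComp_single, wordTerm,
              if_neg fun h₂ => hc (hp.1 ⟨h₁, h₂⟩), smul_zero]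
          · simp
        have e₂ : wordComp k hBN dB e (leafLower hB j i)
            ((x * z) • wordTerm k hB d c j X Z) (Finsupp.single Y y) = 0 := by
          unfold wordTerm
          split_ifs with h₁
          · rw [Finsupp.smul_single, wordComp_single, wordTerm,
              if_neg fun h₂ => hc (hp'.1 ⟨h₁, h₂⟩).symm, smul_zero]
          · simp
        rw [e₁, e₂, smul_zero]
  sequential := by
    intro r s t A B N hA hAN hB hBN d e c dA dB D hdA hdAN hdB hdBN i j f g g'
    induction f using Finsupp.induction_linear with
    | zero => simp
    | add f f' ih ih' => simp only [map_add, LinearMap.add_apply, ih, ih']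
    | single X x =>
    induction g using Finsupp.induction_linear with
    | zero => simp
    | add f f' ih ih' => simp only [map_add, LinearMap.add_apply, ih, ih']
    | single Y y =>
    induction g' using Finsupp.induction_linear with
    | zero => simp
    | add f f' ih ih' => simp only [map_add, ih, ih']
    | single Z z =>
      have hp := WordCompat.sequential (i := i) (j := j) hA hB hdA hdB (X := X) (Y := Y) (Z := Z)
      rw [wordComp_single, wordComp_single]
      by_cases hc : WordCompat e c j Y Z ∧ WordCompat d dB i X (wsubst hB j Y Z)
      · have h₁ := hp.1 hc
        have hs := wordSign_sequential (k := k) hA hB hdA hc.1 hc.2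
        simp only [wordTerm, if_pos hc.1, if_pos hc.2, Finsupp.smul_single, wordComp_single,
          if_pos h₁.1, if_pos h₁.2, wsubst_wsubst_upper hA hAN hB hBN, smul_eq_mul]
        congr 1
        linear_combination (x * y * z) * hs
      · have e₁ : wordComp k hBN d dB i (Finsupp.single X x)
            ((y * z) • wordTerm k hB e c j Y Z) = 0 := by
          unfold wordTerm
          split_ifs with h₁
          · rw [Finsupp.smul_single, wordComp_single, wordTerm,
              if_neg fun h₂ => hc ⟨h₁, h₂⟩, smul_zero]
          · simp
        have e₂ : wordComp k hAN dA c (leafUpper hA i j)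
            ((x * y) • wordTerm k hA d e i X Y) (Finsupp.single Z z) = 0 := by
          unfold wordTerm
          split_ifs with h₁
          · rw [Finsupp.smul_single, wordComp_single, wordTerm,
              if_neg fun h₂ => hc (hp.2 ⟨h₁, h₂⟩), smul_zero]
          · simp
        rw [e₁, e₂]

end WordOperad

/-! ### Sums over dual bases -/

section DualBasis

variable {k : Type u} [Field k] {V W Z : Type*} [AddCommGroup V] [Module k V] [AddCommGroup W]
  [Module k W] [AddCommGroup Z] [Module k Z]

theorem sum_dual_smul_apply_coord {κ : Type*} [Fintype κ] (w : Basis κ k W) (φ : Dual k W)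
    (β : Dual k W →ₗ[k] Z) : ∑ j, φ (w j) • β (w.coord j) = β φ := by
  simp only [← map_smul, ← map_sum]
  rw [Basis.sum_dual_apply_smul_coord]

/-- The canonical element `∑ vᵢ* ⊗ vᵢ` does not depend on the basis. -/
theorem sum_coord_apply_basis {ι ι' : Type*} [Fintype ι] [Fintype ι'] (v : Basis ι k V)
    (v' : Basis ι' k V) (β : Dual k V →ₗ[k] V →ₗ[k] Z) :
    ∑ i, β (v.coord i) (v i) = ∑ j, β (v'.coord j) (v' j) := by
  have h : ∀ i, β (v.coord i) (v i) = ∑ j, v'.coord j (v i) • β (v.coord i) (v' j) := by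
    intro i
    conv_lhs => arg 2; rw [← v'.sum_repr (v i)]
    simp only [map_sum, map_smul, Basis.coord_apply]
  simp_rw [h]
  rw [Finset.sum_comm]
  refine Finset.sum_congr rfl fun j _ => ?_
  exact sum_dual_smul_apply_coord v (v'.coord j) (β.flip (v' j))

theorem sum_sum_dualBasis {ι κ : Type*} [Fintype ι] [Fintype κ] (v : Basis ι k V) (w : Basis κ k W)
    (B : V →ₗ[k] W →ₗ[k] k) (β : Dual k V →ₗ[k] Dual k W →ₗ[k] Z) :
    ∑ i, ∑ j, B (v i) (w j) • β (v.coord i) (w.coord j) = ∑ i, β (v.coord i) (B (v i)) :=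
  Finset.sum_congr rfl fun i _ => sum_dual_smul_apply_coord w (B (v i)) (β (v.coord i))

/-- This replaces the arbitrary bases in `dualTrees` and `cobarOnGen` by convenient ones; finite
dimension turns the `finsum`s into genuine sums, and the canonical element of V* ⊗ V is independent
of the basis. -/
theorem finsum_finsum_dualBasis [FiniteDimensional k V] [FiniteDimensional k W] {ι κ : Type*}
    [Fintype ι] [Fintype κ] (v : Basis ι k V) (w : Basis κ k W)
    (B : V →ₗ[k] W →ₗ[k] k) (β : Dual k V →ₗ[k] Dual k W →ₗ[k] Z) :
    ∑ᶠ a : Basis.ofVectorSpaceIndex k V, ∑ᶠ b : Basis.ofVectorSpaceIndex k W,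
      B (Basis.ofVectorSpace k V a) (Basis.ofVectorSpace k W b) •
        β ((Basis.ofVectorSpace k V).coord a) ((Basis.ofVectorSpace k W).coord b) =
    ∑ i, ∑ j, B (v i) (w j) • β (v.coord i) (w.coord j) := by
  rw [finsum_eq_sum_of_fintype]
  simp_rw [finsum_eq_sum_of_fintype]
  rw [sum_sum_dualBasis, sum_sum_dualBasis]
  exact sum_coord_apply_basis (Basis.ofVectorSpace k V) v (β.compr₂ (LinearMap.id) |>.compl₂ B)

end DualBasis

/-! ### Two-vertex trees -/

section TreeLin

variable {k : Type u} [Field k] {N : ℕ} (J : Finset (Fin (N + 1)))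

/-- `tree` as a bilinear map. -/
def treeLin (O : Operad k) (D : ℤ) (r s : ℕ) (d e : ℤ) :
    O.V r d →ₗ[k] O.V s e →ₗ[k] O.V N D :=
  if h : r + s = N ∧ #J = s + 1 ∧ d + e = D then
    (O.comp h.1 h.2.2 0).compr₂ (O.act N D (treePerm J))
  else 0

theorem tree_eq_treeLin (O : Operad k) (D : ℤ) {r s : ℕ} {d e : ℤ} (x : O.V r d) (y : O.V s e) :
    tree J O D x y = treeLin J O D r s d e x y := by
  unfold tree treeLin
  split_ifs <;> rfl

theorem tree_of (O : Operad k) {D : ℤ} {r s : ℕ} {d e : ℤ} (h : r + s = N) (hJ : #J = s + 1)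
    (hd : d + e = D) (x : O.V r d) (y : O.V s e) :
    tree J O D x y = O.act N D (treePerm J) (O.comp h hd 0 x y) := by
  rw [tree, dif_pos ⟨h, hJ, hd⟩]

theorem treePerm_of_lt {a : Fin (N + 1)} (ha : (a : ℕ) < #J) :
    treePerm J a = J.orderEmbOfFin rfl ⟨a, ha⟩ := by
  have : finSumFinEquiv.symm (finCongr (show N + 1 = #J + #Jᶜ by
      rw [card_add_card_compl, Fintype.card_fin]) a) = Sum.inl ⟨a, ha⟩ := by
    rw [Equiv.symm_apply_eq]
    ext
    simp
  simp only [treePerm, Equiv.trans_apply, this, splitEquiv, finSumEquivOfFinset_inl]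

theorem treePerm_of_le {a : Fin (N + 1)} (ha : #J ≤ (a : ℕ)) :
    treePerm J a = Jᶜ.orderEmbOfFin rfl ⟨a - #J, by
      have := card_add_card_compl J
      rw [Fintype.card_fin] at this
      omega⟩ := by
  have : finSumFinEquiv.symm (finCongr (show N + 1 = #J + #Jᶜ by
      rw [card_add_card_compl, Fintype.card_fin]) a) = Sum.inr ⟨a - #J, by
      have := card_add_card_compl J
      rw [Fintype.card_fin] at this
      omega⟩ := by
    rw [Equiv.symm_apply_eq]
    ext
    simp [ha]
  simp only [treePerm, Equiv.trans_apply, this, splitEquiv, finSumEquivOfFinset_inr]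

/-- Characterization of `treePerm`. -/
theorem treePerm_eq {σ : Equiv.Perm (Fin (N + 1))} (h₁ : ∀ a : Fin (N + 1), (a : ℕ) < #J → σ a ∈ J)
    (h₂ : ∀ a b : Fin (N + 1), a < b → (b : ℕ) < #J → σ a < σ b)
    (h₃ : ∀ a b : Fin (N + 1), a < b → #J ≤ (a : ℕ) → σ a < σ b) : treePerm J = σ := by
  have hc := card_add_card_compl J
  rw [Fintype.card_fin] at hc
  -- By counting, σ maps the first #J positions onto J, so later positions are sent outside J.
  have h₁' : ∀ a : Fin (N + 1), #J ≤ (a : ℕ) → σ a ∉ J := by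
    intro a ha haJ
    have hsub : (univ.filter fun b : Fin (N + 1) => (b : ℕ) < #J).map σ.toEmbedding ⊆ J := by
      intro b hb
      obtain ⟨c, hc, rfl⟩ := Finset.mem_map.1 hb
      exact h₁ c (Finset.mem_filter.1 hc).2
    have hcard : #(univ.filter fun b : Fin (N + 1) => (b : ℕ) < #J) = #J := by
      rw [Fin.card_filter_val_lt]
      omega
    have heq := Finset.eq_of_subset_of_card_le hsub (by rw [Finset.card_map, hcard])
    rw [← heq] at haJ
    obtain ⟨c, hc, e⟩ := Finset.mem_map.1 haJ
    have := σ.injective e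
    subst this
    exact absurd (Finset.mem_filter.1 hc).2 (by omega)
  ext1 a
  by_cases ha : (a : ℕ) < #J
  · rw [treePerm_of_lt J ha]
    have := Finset.orderEmbOfFin_unique (s := J) rfl
      (f := fun b : Fin #J => σ ⟨b, by omega⟩) (fun b => h₁ _ b.2)
      (fun b c hbc => h₂ _ _ hbc c.2)
    exact (congrFun this ⟨a, ha⟩).symm
  · rw [treePerm_of_le J (not_lt.1 ha)]
    have := Finset.orderEmbOfFin_unique (s := Jᶜ) rfl
      (f := fun b : Fin #Jᶜ => σ ⟨b + #J, by omega⟩)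
      (fun b => Finset.mem_compl.2 (h₁' _ (Nat.le_add_left _ _)))
      (fun b c hbc => h₃ _ _ (Nat.add_lt_add_right hbc _) (Nat.le_add_left _ _))
    rw [← congrFun this]
    congr 1
    ext
    simp only
    omega

end TreeLin

/-! ### Arity three -/

section ArityThree

variable {k : Type u} [Field k]

theorem treePerm_three_zero_one : treePerm ({0, 1} : Finset (Fin (2 + 1))) = 1 :=
  treePerm_eq _ (by decide) (by decide) (by decide)

theorem treePerm_three_zero_two : treePerm ({0, 2} : Finset (Fin (2 + 1))) = Equiv.swap 1 2 :=
  treePerm_eq _ (by decide) (by decide) (by decide)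

theorem treePerm_three_one_two : treePerm ({1, 2} : Finset (Fin (2 + 1))) = finRotate 3 :=
  treePerm_eq _ (by decide) (by decide) (by decide)

theorem sum_powersetCard_three {M : Type*} [AddCommMonoid M] (g : Finset (Fin (2 + 1)) → M) :
    ∑ J ∈ powersetCard 2 (univ : Finset (Fin 3)), g J = g {0, 1} + g {0, 2} + g {1, 2} := by
  have : powersetCard 2 (univ : Finset (Fin 3)) = {{0, 1}, {0, 2}, {1, 2}} := by decide
  rw [this, Finset.sum_insert (by decide), Finset.sum_insert (by decide), Finset.sum_singleton,
    add_assoc]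

/-- The grouping is by cosets of the exchange of the first two inputs; the representatives are the
three permutations `treePerm J` with #J = 2. -/
theorem sum_perm_three {M : Type*} [AddCommMonoid M] (g : Equiv.Perm (Fin 3) → M) :
    ∑ σ, g σ = (g 1 + g (Equiv.swap 0 1)) +
      (g (Equiv.swap 1 2) + g (Equiv.swap 1 2 * Equiv.swap 0 1)) +
      (g (finRotate 3) + g (finRotate 3 * Equiv.swap 0 1)) := by
  have : (univ : Finset (Equiv.Perm (Fin 3))) = {1, Equiv.swap 0 1, Equiv.swap 1 2,
    Equiv.swap 1 2 * Equiv.swap 0 1, finRotate 3, finRotate 3 * Equiv.swap 0 1} := by decide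
  rw [this, Finset.sum_insert (by decide), Finset.sum_insert (by decide),
    Finset.sum_insert (by decide), Finset.sum_insert (by decide), Finset.sum_insert (by decide),
    Finset.sum_singleton]
  abel

theorem sum_perm_two {M : Type*} [AddCommMonoid M] (g : Equiv.Perm (Fin 2) → M) :
    ∑ σ, g σ = g 1 + g (Equiv.swap 0 1) := by
  have : (univ : Finset (Equiv.Perm (Fin 2))) = {1, Equiv.swap 0 1} := by decide
  rw [this, Finset.sum_insert (by decide), Finset.sum_singleton]

/-- Exchanging the inputs of the lower operation moves the place of grafting from the second to the
first input, so that composition at the first input suffices in arity three. -/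
theorem comp_one_eq (O : Operad k) {d e D : ℤ} (hd : d + e = D) (x : O.V 1 d) (y : O.V 1 e) :
    O.comp (rfl : 1 + 1 = 2) hd 1 x y = O.act 2 D (finRotate 3)
      (O.comp (rfl : 1 + 1 = 2) hd 0 (O.act 1 d (Equiv.swap 0 1) x) y) := by
  have := O.equivariant (rfl : 1 + 1 = 2) hd 1 (Equiv.swap 0 1) 1 (finRotate 3)⁻¹
    (by decide) (by decide) x y
  simp only [map_one, Module.End.one_apply, Equiv.swap_apply_right] at this
  rw [this, ← Module.End.mul_apply, ← map_mul]
  simp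

theorem comp_zero_swap (O : Operad k) {d e D : ℤ} (hd : d + e = D) (x : O.V 1 d) (y : O.V 1 e) :
    O.comp (rfl : 1 + 1 = 2) hd 0 x (O.act 1 e (Equiv.swap 0 1) y) =
      O.act 2 D (Equiv.swap 0 1) (O.comp (rfl : 1 + 1 = 2) hd 0 x y) := by
  have := O.equivariant (rfl : 1 + 1 = 2) hd 0 1 (Equiv.swap 0 1) (Equiv.swap 0 1)
    (by decide) (by decide) x y
  simpa using this

theorem comp_one_swap (O : Operad k) {d e D : ℤ} (hd : d + e = D) (x : O.V 1 d) (y : O.V 1 e) :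
    O.comp (rfl : 1 + 1 = 2) hd 1 x (O.act 1 e (Equiv.swap 0 1) y) =
      O.act 2 D (Equiv.swap 1 2) (O.comp (rfl : 1 + 1 = 2) hd 1 x y) := by
  have := O.equivariant (rfl : 1 + 1 = 2) hd 1 1 (Equiv.swap 0 1) (Equiv.swap 1 2)
    (by decide) (by decide) x y
  simpa using this

end ArityThree

/-! ### The binary generators and their duals -/

section Generators

variable (k : Type u) [Field k]

/-- The planar corolla with two inputs in the order `0, 1`. -/
def mulCorolla : Corolla 1 := .mixed 2 le_rfl (Function.Embedding.refl _)

/-- The space corolla with two inputs. -/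
def braCorolla : Corolla 1 := .space le_rfl

theorem smul_mulCorolla_degree (τ : Equiv.Perm (Fin (1 + 1))) : (τ • mulCorolla).degree = 0 := rfl

theorem braCorolla_degree : braCorolla.degree = -1 := rfl

theorem mulCorolla_degree : mulCorolla.degree = -0 := rfl

theorem smul_mulCorolla_injective :
    Function.Injective fun τ : Equiv.Perm (Fin (1 + 1)) => τ • mulCorolla := by
  intro τ τ' h
  have h' : (Corolla.mixed 2 le_rfl ((Function.Embedding.refl _).trans τ.toEmbedding) : Corolla 1) =
    Corolla.mixed 2 le_rfl ((Function.Embedding.refl _).trans τ'.toEmbedding) := h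
  rw [Corolla.mixed.injEq] at h'
  have h'' := eq_of_heq h'.2
  ext1 a
  exact DFunLike.congr_fun h'' a

theorem corolla_one_cases (c : Corolla 1) : c = braCorolla ∨
    ∃ τ : Equiv.Perm (Fin (1 + 1)), c = τ • mulCorolla := by
  cases c with
  | space hr => exact Or.inl rfl
  | mixed p hp f =>
    right
    have hp' : p ≤ 2 := by simpa using Fintype.card_le_of_embedding f
    obtain rfl : p = 2 := le_antisymm hp' hp
    refine ⟨Equiv.ofBijective f (Finite.injective_iff_bijective.1 f.injective), ?_⟩
    change _ = Corolla.mixed 2 le_rfl _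
    congr 1

/-- The planar corollas as a basis of the degree-zero generators. -/
def mulBasis {d : ℤ} (hd : d = 0) :
    Basis (Equiv.Perm (Fin (1 + 1))) k ((gerstGen k).V 1 d) :=
  (Finsupp.basisSingleOne (R := k)).reindex (Equiv.ofBijective
    (fun τ => (⟨τ • mulCorolla, rfl, (smul_mulCorolla_degree τ).trans hd.symm⟩ : {c : Corolla 1 //
        1 = 1 ∧ c.degree = d}))
    ⟨fun _ _ h => smul_mulCorolla_injective (congrArg Subtype.val h), by
      rintro ⟨c, -, hc⟩
      rcases corolla_one_cases c with rfl | ⟨τ, rfl⟩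
      · rw [hd] at hc
        exact absurd hc (by decide)
      · exact ⟨τ, rfl⟩⟩).symm

/-- The space corolla as a basis of the generators of degree `-1`. -/
def braBasis {d : ℤ} (hd : d = -1) : Basis Unit k ((gerstGen k).V 1 d) :=
  (Finsupp.basisSingleOne (R := k)).reindex (Equiv.ofBijective
    (fun _ => (⟨braCorolla, rfl, braCorolla_degree.trans hd.symm⟩ : {c : Corolla 1 // 1 = 1 ∧
        c.degree = d}))
    ⟨fun _ _ _ => rfl, by
      rintro ⟨c, -, hc⟩
      rcases corolla_one_cases c with rfl | ⟨τ, rfl⟩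
      · exact ⟨(), rfl⟩
      · rw [hd, smul_mulCorolla_degree] at hc
        exact absurd hc (by decide)⟩).symm

theorem mulBasis_apply {d : ℤ} (hd : d = 0) (τ : Equiv.Perm (Fin (1 + 1))) :
    mulBasis k hd τ =
      corollaVec k (fun r => r = 1) (τ • mulCorolla) rfl ((smul_mulCorolla_degree τ).trans hd.symm)
          := by
  exact (Basis.reindex_apply (Finsupp.basisSingleOne (R := k)) _ τ).trans
    (congrFun Finsupp.coe_basisSingleOne _)

theorem braBasis_apply {d : ℤ} (hd : d = -1) (a : Unit) :
    braBasis k hd a = corollaVec k (fun r => r = 1) braCorolla rfl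
        (braCorolla_degree.trans hd.symm) := by
  exact (Basis.reindex_apply (Finsupp.basisSingleOne (R := k)) _ a).trans
    (congrFun Finsupp.coe_basisSingleOne _)

/-- The linear form dual to a binary corolla. -/
def dualVec {d : ℤ} (c : Corolla 1) (hc : c.degree = -d) : (gerstGen k).hatDual.V 1 d :=
  (Finsupp.lapply (⟨c, rfl, hc⟩ : {c : Corolla 1 // 1 = 1 ∧ c.degree = -d}) :
    ({c : Corolla 1 // 1 = 1 ∧ c.degree = -d} →₀ k) →ₗ[k] k)

theorem mulBasis_coord {d : ℤ} (hd : -d = 0) (τ : Equiv.Perm (Fin (1 + 1))) :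
    (mulBasis k hd).coord τ =
      dualVec k (τ • mulCorolla) ((smul_mulCorolla_degree τ).trans hd.symm) :=
  rfl

theorem braBasis_coord {d : ℤ} (hd : -d = -1) (a : Unit) :
    (braBasis k hd).coord a = dualVec k braCorolla (braCorolla_degree.trans hd.symm) :=
  rfl

theorem gen_subsingleton {d : ℤ} (h₀ : d ≠ 0) (h₁ : d ≠ -1) :
    Subsingleton ((gerstGen k).V 1 d) := by
  have : IsEmpty {c : Corolla 1 // 1 = 1 ∧ c.degree = d} := by
    refine ⟨fun ⟨c, _, hc⟩ => ?_⟩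
    rcases corolla_one_cases c with rfl | ⟨τ, rfl⟩
    · exact h₁ hc.symm
    · exact h₀ hc.symm
  exact inferInstanceAs (Subsingleton ({c : Corolla 1 // 1 = 1 ∧ c.degree = d} →₀ k))

instance gen_finite (d : ℤ) : FiniteDimensional k ((gerstGen k).V 1 d) := by
  by_cases h₀ : d = 0
  · exact Module.Finite.of_basis (mulBasis k h₀)
  · by_cases h₁ : d = -1
    · exact Module.Finite.of_basis (braBasis k h₁)
    · have := gen_subsingleton k h₀ h₁
      infer_instance

theorem hatDual_act_dualVec {d : ℤ} (τ : Equiv.Perm (Fin (1 + 1))) (c : Corolla 1)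
    (hc : c.degree = -d) : (gerstGen k).hatDual.act 1 d τ (dualVec k c hc) =
      psign k τ • dualVec k (τ • c) ((Corolla.degree_smul τ c).trans hc) := by
  change psign k τ • ((gerstGen k).act 1 (-d)).dual τ (dualVec k c hc) = _
  congr 1
  classical
  refine Finsupp.lhom_ext fun a b => ?_
  change (Finsupp.mapDomain _ (Finsupp.single a b)) _ = (Finsupp.single a b) _
  rw [Finsupp.mapDomain_single, Finsupp.single_apply, Finsupp.single_apply]
  congr 1
  simp only [Subtype.ext_iff, inv_smul_eq_iff]

end Generators

/-! ### The pairing of two-vertex trees -/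

section DualTrees

variable {k : Type u} [Field k]

theorem dualTrees_summand (E : SMod k) (J : Finset (Fin (2 + 1))) (D d : ℤ)
    (f : Dual k ((free E).V 2 (-D)))
    [FiniteDimensional k (E.V 1 (-d))] [FiniteDimensional k (E.V 1 (-(D - d)))]
    {ι' κ : Type*} [Fintype ι'] [Fintype κ] (v : Basis ι' k (E.V 1 (-d)))
    (w : Basis κ k (E.V 1 (-(D - d)))) (c : k) :
    (∑ᶠ a : Basis.ofVectorSpaceIndex k (E.V 1 (-d)),
      ∑ᶠ b : Basis.ofVectorSpaceIndex k (E.V 1 (-(D - d))),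
      (c * f (tree J (free E) (-D) (ι E (Basis.ofVectorSpace k (E.V 1 (-d)) a))
          (ι E (Basis.ofVectorSpace k (E.V 1 (-(D - d))) b)))) •
      tree J (free E.hatDual) D
        (ι E.hatDual (r := 1) (d := d) ((Basis.ofVectorSpace k (E.V 1 (-d))).coord a))
        (ι E.hatDual (r := 1) (d := D - d)
          ((Basis.ofVectorSpace k (E.V 1 (-(D - d)))).coord b))) =
    ∑ i, ∑ j, (c * f (tree J (free E) (-D) (ι E (v i)) (ι E (w j)))) •
      tree J (free E.hatDual) D (ι E.hatDual (r := 1) (d := d) (v.coord i))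
        (ι E.hatDual (r := 1) (d := D - d) (w.coord j)) := by
  simp only [tree_eq_treeLin]
  exact finsum_finsum_dualBasis v w
    (((treeLin J (free E) (-D) 1 1 (-d) (-(D - d))).compl₁₂ (ι E) (ι E)).compr₂ (c • f))
    ((treeLin J (free E.hatDual) D 1 1 d (D - d)).compl₁₂
      (ι E.hatDual (r := 1) (d := d)) (ι E.hatDual (r := 1) (d := D - d)))

theorem isEmpty_ofVectorSpaceIndex (V : Type*) [AddCommGroup V] [Module k V] [Subsingleton V] :
    IsEmpty (Basis.ofVectorSpaceIndex k V) :=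
  ⟨fun a => (Basis.ofVectorSpace k V).ne_zero a (Subsingleton.elim _ _)⟩

variable (k)

/-- The product in the dual generators. -/
def mulS : (free (gerstGen k).hatDual).V 1 0 :=
  ι (gerstGen k).hatDual (dualVec k mulCorolla mulCorolla_degree)

/-- The bracket in the dual generators. -/
def braS : (free (gerstGen k).hatDual).V 1 1 :=
  ι (gerstGen k).hatDual (dualVec k braCorolla braCorolla_degree)

theorem act_swap_brac₂ : (free (gerstGen k)).act 1 (-1) (Equiv.swap 0 1) (brac₂ k) = brac₂ k := by
  rw [brac₂, ← ι_act]
  congr 1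
  simp only [corollaVec]
  change Finsupp.mapDomain _ _ = _
  rw [Finsupp.mapDomain_single]
  rfl

theorem act_swap_braS :
    (free (gerstGen k).hatDual).act 1 1 (Equiv.swap 0 1) (braS k) = -braS k := by
  rw [braS, ← ι_act, hatDual_act_dualVec, psign_swap k (by decide), map_smul]
  simp only [neg_smul, one_smul]
  rfl

end DualTrees

/-! ### The dual trees of the binary corollas -/

section SumTrees

variable {k : Type u} [Field k]

theorem act_act (O : Operad k) {r : ℕ} {d : ℤ} (σ τ : Equiv.Perm (Fin (r + 1))) (x : O.V r d) :
    O.act r d σ (O.act r d τ x) = O.act r d (σ * τ) x := by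
  rw [map_mul, Module.End.mul_apply]

theorem act_one_apply (O : Operad k) {r : ℕ} {d : ℤ} (x : O.V r d) : O.act r d 1 x = x := by
  rw [map_one, Module.End.one_apply]

/-- A permutation of three letters is uniquely a `treePerm J` times a permutation of the two upper
inputs, and the latter can be moved onto the upper vertex. The sign of τ is inserted because
coordinate forms transform with it. -/
theorem sum_trees_right (O O' : Operad k) {d e D d' e' D' : ℤ} (hd : d + e = D) (hd' : d' + e' = D')
    (f : O.V 2 D →ₗ[k] k) (x : O.V 1 d) (y : O.V 1 e) (x' : O'.V 1 d') (y' : O'.V 1 e') :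
    ∑ J ∈ powersetCard 2 (univ : Finset (Fin 3)), ∑ τ : Equiv.Perm (Fin (1 + 1)),
      (psign k (treePerm (N := 2) J) * f (tree J O D x (O.act 1 e τ y))) •
        tree J O' D' x' (psign k τ • O'.act 1 e' τ y') =
    ∑ σ : Equiv.Perm (Fin 3), (psign k σ * f (O.act 2 D σ (O.comp (rfl : 1 + 1 = 2) hd 0 x y))) •
      O'.act 2 D' σ (O'.comp (rfl : 1 + 1 = 2) hd' 0 x' y') := by
  have hJ : ∀ J ∈ powersetCard 2 (univ : Finset (Fin 3)), ∑ τ : Equiv.Perm (Fin (1 + 1)),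
      (psign k (treePerm (N := 2) J) * f (tree J O D x (O.act 1 e τ y))) •
        tree J O' D' x' (psign k τ • O'.act 1 e' τ y') =
      (psign k (treePerm (N := 2) J) *
        f (O.act 2 D (treePerm (N := 2) J) (O.comp (rfl : 1 + 1 = 2) hd 0 x y))) •
        O'.act 2 D' (treePerm (N := 2) J) (O'.comp (rfl : 1 + 1 = 2) hd' 0 x' y') +
      (psign k (treePerm (N := 2) J * Equiv.swap 0 1) *
        f (O.act 2 D (treePerm (N := 2) J * Equiv.swap 0 1)
          (O.comp (rfl : 1 + 1 = 2) hd 0 x y))) •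
        O'.act 2 D' (treePerm (N := 2) J * Equiv.swap 0 1)
          (O'.comp (rfl : 1 + 1 = 2) hd' 0 x' y') := by
    intro J hJ
    have hJ' : #J = 1 + 1 := (mem_powersetCard.1 hJ).2
    rw [sum_perm_two]
    simp only [tree_of (N := 2) J O rfl hJ' hd, tree_of (N := 2) J O' rfl hJ' hd', map_smul,
      act_one_apply, psign_one, one_smul, comp_zero_swap, act_act, psign_mul]
    rw [smul_smul, psign_swap k (by decide), psign_swap k (by decide)]
    congr 2
    ring
  rw [Finset.sum_congr rfl hJ, sum_powersetCard_three, sum_perm_three]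
  simp only [treePerm_three_zero_one, treePerm_three_zero_two, treePerm_three_one_two, one_mul]

/-- The trivial labelling of the lower vertex gives composites at the first input. The exchanged one
gives, after a rotation, composites at the second input; their minus sign is the sign of the
exchange. -/
theorem sum_trees (O O' : Operad k) {d e D d' e' D' : ℤ} (hd : d + e = D) (hd' : d' + e' = D')
    (f : O.V 2 D →ₗ[k] k) (x : O.V 1 d) (y : O.V 1 e) (x' : O'.V 1 d') (y' : O'.V 1 e') :
    ∑ J ∈ powersetCard 2 (univ : Finset (Fin 3)), ∑ τ : Equiv.Perm (Fin (1 + 1)),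
      ∑ τ' : Equiv.Perm (Fin (1 + 1)),
      (psign k (treePerm (N := 2) J) * f (tree J O D (O.act 1 d τ x) (O.act 1 e τ' y))) •
        tree J O' D' (psign k τ • O'.act 1 d' τ x') (psign k τ' • O'.act 1 e' τ' y') =
    ∑ σ : Equiv.Perm (Fin 3),
      ((psign k σ * f (O.act 2 D σ (O.comp (rfl : 1 + 1 = 2) hd 0 x y))) •
        O'.act 2 D' σ (O'.comp (rfl : 1 + 1 = 2) hd' 0 x' y') -
      (psign k σ * f (O.act 2 D σ (O.comp (rfl : 1 + 1 = 2) hd 1 x y))) •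
        O'.act 2 D' σ (O'.comp (rfl : 1 + 1 = 2) hd' 1 x' y')) := by
  rw [Finset.sum_comm]
  simp_rw [sum_trees_right O O' hd hd']
  rw [sum_perm_two, Finset.sum_sub_distrib, sub_eq_add_neg]
  simp only [act_one_apply, psign_one, one_smul]
  congr 1
  rw [← Finset.sum_neg_distrib]
  -- The rotation relating the two composites is even, so reindexing by it costs no sign.
  refine (Equiv.sum_comp (Equiv.mulRight (finRotate 3)) _).symm.trans
    (Finset.sum_congr rfl fun σ _ => ?_)
  have hs : psign k (finRotate 3) = 1 := by
    rw [psign, show Equiv.Perm.sign (finRotate 3) = 1 by decide]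
    simp
  simp only [comp_one_eq, act_act, map_smul, LinearMap.smul_apply, Equiv.coe_mulRight, psign_mul,
    hs, mul_one]
  rw [psign_swap k (by decide), neg_smul, one_smul, smul_neg]

end SumTrees

/-! ### Dual trees of the binary corollas, by degree -/

section DualTreesFormula

variable (k : Type u) [Field k]

/-- The product of the generators, in a degree that is propositionally zero. -/
def prodAt {d : ℤ} (hd : d = 0) : (free (gerstGen k)).V 1 d :=
  ι (gerstGen k) (corollaVec k _ mulCorolla rfl (mulCorolla_degree.trans hd.symm))

/-- The bracket of the generators, in a degree that is propositionally `-1`. -/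
def bracAt {d : ℤ} (hd : d = -1) : (free (gerstGen k)).V 1 d :=
  ι (gerstGen k) (corollaVec k _ braCorolla rfl (braCorolla_degree.trans hd.symm))

/-- The product of the dual generators, in a degree that is propositionally zero. -/
def mulAt {d : ℤ} (hd : -d = 0) : (free (gerstGen k).hatDual).V 1 d :=
  ι (gerstGen k).hatDual (dualVec k mulCorolla (mulCorolla_degree.trans hd.symm))

/-- The bracket of the dual generators, in a degree that is propositionally `1`. -/
def braAt {d : ℤ} (hd : -d = -1) : (free (gerstGen k).hatDual).V 1 d :=
  ι (gerstGen k).hatDual (dualVec k braCorolla (braCorolla_degree.trans hd.symm))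

theorem act_corollaVec (P : ℕ → Prop) {r : ℕ} {d : ℤ} (σ : Equiv.Perm (Fin (r + 1)))
    (c : Corolla r) (hP : P r) (hd : c.degree = d) :
    (corollaMod k P).act r d σ (corollaVec k P c hP hd) =
      corollaVec k P (σ • c) hP ((Corolla.degree_smul σ c).trans hd) := by
  change Finsupp.mapDomain _ _ = _
  simp only [corollaVec]
  rw [Finsupp.mapDomain_single]

theorem ι_mulBasis {d : ℤ} (hd : d = 0) (τ : Equiv.Perm (Fin (1 + 1))) :
    ι (gerstGen k) (mulBasis k hd τ) = (free (gerstGen k)).act 1 d τ (prodAt k hd) := by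
  rw [mulBasis_apply, prodAt, ← ι_act, act_corollaVec]

theorem ι_braBasis {d : ℤ} (hd : d = -1) (a : Unit) :
    ι (gerstGen k) (braBasis k hd a) = bracAt k hd := by
  rw [braBasis_apply, bracAt]

theorem ι_mulBasis_coord {d : ℤ} (hd : -d = 0) (τ : Equiv.Perm (Fin (1 + 1))) :
    ι (gerstGen k).hatDual (r := 1) (d := d) ((mulBasis k hd).coord τ) =
      psign k τ • (free (gerstGen k).hatDual).act 1 d τ (mulAt k hd) := by
  rw [mulBasis_coord, mulAt, ← ι_act, hatDual_act_dualVec, map_smul, smul_smul, psign_sq, one_smul]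

theorem ι_braBasis_coord {d : ℤ} (hd : -d = -1) (a : Unit) :
    ι (gerstGen k).hatDual (r := 1) (d := d) ((braBasis k hd).coord a) = braAt k hd := by
  rw [braBasis_coord, braAt]

theorem act_bracAt {d : ℤ} (hd : d = -1) (τ : Equiv.Perm (Fin (1 + 1))) :
    (free (gerstGen k)).act 1 d τ (bracAt k hd) = bracAt k hd := by
  rw [bracAt, ← ι_act, act_corollaVec]
  rfl

theorem psign_act_braAt {d : ℤ} (hd : -d = -1) (τ : Equiv.Perm (Fin (1 + 1))) :
    psign k τ • (free (gerstGen k).hatDual).act 1 d τ (braAt k hd) = braAt k hd := by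
  rw [braAt, ← ι_act, hatDual_act_dualVec, map_smul, smul_smul, psign_sq, one_smul]
  rfl

/-- The part of `dualTrees` with lower vertex of degree `d` and upper leaves `J`. -/
def dualTreesPart (D : ℤ) (f : Dual k ((free (gerstGen k)).V 2 (-D))) (J : Finset (Fin (2 + 1)))
    (d : ℤ) : (free (gerstGen k).hatDual).V 2 D :=
  ∑ᶠ a : Basis.ofVectorSpaceIndex k ((gerstGen k).V 1 (-d)),
    ∑ᶠ b : Basis.ofVectorSpaceIndex k ((gerstGen k).V 1 (-(D - d))),
      (psign k (treePerm J) *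
        f (tree J (free (gerstGen k)) (-D)
          (ι (gerstGen k) (Basis.ofVectorSpace k ((gerstGen k).V 1 (-d)) a))
          (ι (gerstGen k) (Basis.ofVectorSpace k ((gerstGen k).V 1 (-(D - d))) b)))) •
      tree J (free (gerstGen k).hatDual) D
        (ι (gerstGen k).hatDual (r := 1) (d := d)
          ((Basis.ofVectorSpace k ((gerstGen k).V 1 (-d))).coord a))
        (ι (gerstGen k).hatDual (r := 1) (d := D - d)
          ((Basis.ofVectorSpace k ((gerstGen k).V 1 (-(D - d)))).coord b))

theorem dualTreesPart_eq_zero (D : ℤ) (f : Dual k ((free (gerstGen k)).V 2 (-D)))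
    (J : Finset (Fin (2 + 1))) (d : ℤ) (h : d ≠ 0 ∧ d ≠ 1 ∨ D - d ≠ 0 ∧ D - d ≠ 1) :
    dualTreesPart k D f J d = 0 := by
  unfold dualTreesPart
  rcases h with h | h
  · have := gen_subsingleton k (d := -d) (by omega) (by omega)
    have := isEmpty_ofVectorSpaceIndex (k := k) ((gerstGen k).V 1 (-d))
    exact finsum_of_isEmpty _
  · have := gen_subsingleton k (d := -(D - d)) (by omega) (by omega)
    have := isEmpty_ofVectorSpaceIndex (k := k) ((gerstGen k).V 1 (-(D - d)))
    simp only [finsum_of_isEmpty, finsum_zero]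

theorem dualTrees_eq (D : ℤ) (f : Dual k ((free (gerstGen k)).V 2 (-D))) :
    dualTrees (gerstGen k) D f = ∑ J ∈ powersetCard 2 (univ : Finset (Fin 3)),
      (dualTreesPart k D f J 0 + dualTreesPart k D f J 1) := by
  change ∑ J ∈ powersetCard 2 (univ : Finset (Fin 3)), ∑ᶠ d : ℤ, dualTreesPart k D f J d = _
  refine Finset.sum_congr rfl fun J _ => ?_
  rw [finsum_eq_sum_of_support_subset (s := {0, 1}), Finset.sum_pair zero_ne_one]
  intro d hd
  by_contra hn
  refine hd (dualTreesPart_eq_zero k D f J d (Or.inl ?_))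
  simpa using hn

theorem dualTrees_other {D : ℤ} (h₀ : D ≠ 0) (h₁ : D ≠ 1) (h₂ : D ≠ 2)
    (f : Dual k ((free (gerstGen k)).V 2 (-D))) : dualTrees (gerstGen k) D f = 0 := by
  rw [dualTrees_eq]
  refine Finset.sum_eq_zero fun J _ => ?_
  rw [dualTreesPart_eq_zero k D f J 0 (Or.inr (by omega)),
    dualTreesPart_eq_zero k D f J 1 (Or.inr (by omega)), add_zero]

theorem dualTrees_zero (f : Dual k ((free (gerstGen k)).V 2 (-0))) :
    dualTrees (gerstGen k) 0 f = ∑ σ : Equiv.Perm (Fin 3),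
      ((psign k σ * f ((free (gerstGen k)).act 2 (-0) σ
          ((free (gerstGen k)).comp (rfl : 1 + 1 = 2) (add_zero 0) 0 (prod₂ k) (prod₂ k)))) •
        (free (gerstGen k).hatDual).act 2 0 σ ((free (gerstGen k).hatDual).comp (rfl : 1 + 1 = 2)
          (add_zero 0) 0 (mulS k) (mulS k)) -
      (psign k σ * f ((free (gerstGen k)).act 2 (-0) σ
          ((free (gerstGen k)).comp (rfl : 1 + 1 = 2) (add_zero 0) 1 (prod₂ k) (prod₂ k)))) •
        (free (gerstGen k).hatDual).act 2 0 σ ((free (gerstGen k).hatDual).comp (rfl : 1 + 1 = 2)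
          (add_zero 0) 1 (mulS k) (mulS k))) := by
  rw [dualTrees_eq]
  simp_rw [fun J => dualTreesPart_eq_zero k 0 f J 1 (Or.inr (by omega)), add_zero]
  have h : ∀ J, dualTreesPart k 0 f J 0 = _ := fun J => dualTrees_summand (gerstGen k) J 0 0 f
    (mulBasis k (by norm_num)) (mulBasis k (by norm_num)) (psign k (treePerm J))
  simp_rw [h, ι_mulBasis, ι_mulBasis_coord]
  exact sum_trees _ _ (by norm_num) (by norm_num) f _ _ _ _

/-- The bracket has a one-element basis, so a tree with a bracket on top occurs once for each set of
upper leaves, whereas a sum over all permutations meets it twice. The factor 2 makes that sum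
available; it is divided out later, in characteristic zero. -/
theorem two_smul_dualTrees_one (f : Dual k ((free (gerstGen k)).V 2 (-1))) :
    (2 : k) • dualTrees (gerstGen k) 1 f = ∑ σ : Equiv.Perm (Fin 3),
      ((2 * (psign k σ * f ((free (gerstGen k)).act 2 (-1) σ
          ((free (gerstGen k)).comp (rfl : 1 + 1 = 2) (add_zero (-1)) 0 (brac₂ k) (prod₂ k))))) •
        (free (gerstGen k).hatDual).act 2 1 σ ((free (gerstGen k).hatDual).comp (rfl : 1 + 1 = 2)
          (add_zero 1) 0 (braS k) (mulS k)) +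
      ((psign k σ * f ((free (gerstGen k)).act 2 (-1) σ
          ((free (gerstGen k)).comp (rfl : 1 + 1 = 2) (zero_add (-1)) 0 (prod₂ k) (brac₂ k)))) •
        (free (gerstGen k).hatDual).act 2 1 σ ((free (gerstGen k).hatDual).comp (rfl : 1 + 1 = 2)
          (zero_add 1) 0 (mulS k) (braS k)) -
      (psign k σ * f ((free (gerstGen k)).act 2 (-1) σ
          ((free (gerstGen k)).comp (rfl : 1 + 1 = 2) (zero_add (-1)) 1 (prod₂ k) (brac₂ k)))) •
        (free (gerstGen k).hatDual).act 2 1 σ ((free (gerstGen k).hatDual).comp (rfl : 1 + 1 = 2)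
          (zero_add 1) 1 (mulS k) (braS k)))) := by
  rw [dualTrees_eq, Finset.sum_add_distrib, smul_add, Finset.sum_add_distrib, add_comm]
  have h₁ : ∀ J, dualTreesPart k 1 f J 1 = _ := fun J => dualTrees_summand (gerstGen k) J 1 1 f
    (braBasis k (by norm_num)) (mulBasis k (by norm_num)) (psign k (treePerm J))
  have h₀ : ∀ J, dualTreesPart k 1 f J 0 = _ := fun J => dualTrees_summand (gerstGen k) J 1 0 f
    (mulBasis k (by norm_num)) (braBasis k (by norm_num)) (psign k (treePerm J))
  congr 1
  · simp_rw [mul_smul (2 : k), ← Finset.smul_sum]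
    congr 1
    simp_rw [h₁, ι_mulBasis, ι_mulBasis_coord, ι_braBasis, ι_braBasis_coord,
      Fintype.sum_unique]
    exact sum_trees_right _ _ (by norm_num) (by norm_num) f _ _ _ _
  · simp_rw [h₀, ι_mulBasis, ι_mulBasis_coord, ι_braBasis, ι_braBasis_coord, Fintype.sum_unique]
    -- Each tree is written as two equal terms: exchanging the inputs of the upper bracket fixes it
    -- in the free operad and, up to the inserted sign, in the dual one.
    refine Eq.trans ?_ (sum_trees _ _ (by norm_num) (by norm_num) f _ _ _ _)
    rw [two_smul, ← Finset.sum_add_distrib]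
    refine Finset.sum_congr rfl fun J _ => ?_
    rw [← Finset.sum_add_distrib]
    refine Finset.sum_congr rfl fun τ _ => ?_
    rw [sum_perm_two]
    simp only [act_one_apply, psign_one, one_smul]
    refine congrArg₂ (· + ·) rfl ?_
    have e₁ := act_bracAt k (d := -(1 - 0)) (by norm_num) (Equiv.swap 0 1)
    have e₂ := psign_act_braAt k (d := 1 - 0) (by norm_num) (Equiv.swap 0 1)
    exact congrArg₂ (fun u v => (psign k (treePerm (N := 2) J) * f
        (tree J _ _ _ u)) • tree J _ _ _ v)
      e₁.symm e₂.symm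

theorem two_smul_dualTrees_two (f : Dual k ((free (gerstGen k)).V 2 (-2))) :
    (2 : k) • dualTrees (gerstGen k) 2 f = ∑ σ : Equiv.Perm (Fin 3),
      (psign k σ * f ((free (gerstGen k)).act 2 (-2) σ
          ((free (gerstGen k)).comp (rfl : 1 + 1 = 2) (by norm_num) 0 (brac₂ k) (brac₂ k)))) •
        (free (gerstGen k).hatDual).act 2 2 σ ((free (gerstGen k).hatDual).comp (rfl : 1 + 1 = 2)
          (by norm_num) 0 (braS k) (braS k)) := by
  rw [dualTrees_eq]
  simp_rw [fun J => dualTreesPart_eq_zero k 2 f J 0 (Or.inr (by omega)), zero_add]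
  have h₁ : ∀ J, dualTreesPart k 2 f J 1 = _ := fun J => dualTrees_summand (gerstGen k) J 2 1 f
    (braBasis k (by norm_num)) (braBasis k (by norm_num)) (psign k (treePerm J))
  simp_rw [h₁, ι_braBasis, ι_braBasis_coord, Fintype.sum_unique]
  refine Eq.trans ?_ (sum_trees_right _ _ (by norm_num) (by norm_num) f _ _ _ _)
  rw [two_smul, ← Finset.sum_add_distrib]
  refine Finset.sum_congr rfl fun J _ => ?_
  rw [sum_perm_two]
  simp only [act_one_apply, psign_one, one_smul]
  refine congrArg₂ (· + ·) rfl ?_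
  have e₁ := act_bracAt k (d := -(2 - 1)) (by norm_num) (Equiv.swap 0 1)
  have e₂ := psign_act_braAt k (d := 2 - 1) (by norm_num) (Equiv.swap 0 1)
  exact congrArg₂ (fun u v => (psign k (treePerm (N := 2) J) * f (tree J _ _ _ u)) • tree J _ _ _ v)
    e₁.symm e₂.symm

end DualTreesFormula

/-! ### The relations of the Koszul dual -/

section Relations

variable {k : Type u} [Field k]

/-- The relations between a product `m` of degree `0` and a skew bracket `e` of degree `1` that
present the Koszul dual of the operad of non-commutative Gerstenhaber algebras. -/
structure DualRelations (P : Operad k) (m : P.V 1 0) (e : P.V 1 1) : Prop where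
  swap_bracket : P.act 1 1 (Equiv.swap 0 1) e = -e
  assoc : P.comp (rfl : 1 + 1 = 2) (add_zero 0) 0 m m = P.comp (rfl : 1 + 1 = 2) (add_zero 0) 1 m m
  bracket_left : P.comp (rfl : 1 + 1 = 2) (zero_add 1) 0 m e =
    P.act 2 1 (Equiv.swap 1 2) (P.comp (rfl : 1 + 1 = 2) (add_zero 1) 0 e m) -
      P.act 2 1 (finRotate 3) (P.comp (rfl : 1 + 1 = 2) (add_zero 1) 0 e m)
  bracket_right : P.comp (rfl : 1 + 1 = 2) (zero_add 1) 1 m e =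
    P.comp (rfl : 1 + 1 = 2) (add_zero 1) 0 e m -
      P.act 2 1 (Equiv.swap 1 2) (P.comp (rfl : 1 + 1 = 2) (add_zero 1) 0 e m)
  swap_bracket_bracket : P.act 2 2 (Equiv.swap 1 2)
      (P.comp (rfl : 1 + 1 = 2) (show (1 : ℤ) + 1 = 2 by norm_num) 0 e e) =
    -P.comp (rfl : 1 + 1 = 2) (show (1 : ℤ) + 1 = 2 by norm_num) 0 e e

theorem sum_psign_act_act (P : Operad k) {r : ℕ} {d : ℤ} (ρ : Equiv.Perm (Fin (r + 1)))
    (c : Equiv.Perm (Fin (r + 1)) → k) (x : P.V r d) :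
    ∑ σ, (psign k σ * c σ) • P.act r d σ (P.act r d ρ x) =
      ∑ σ, (psign k ρ * (psign k σ * c (σ * ρ⁻¹))) • P.act r d σ x := by
  refine (Equiv.sum_comp (Equiv.mulRight ρ⁻¹) _).symm.trans (Finset.sum_congr rfl fun σ _ => ?_)
  rw [Equiv.coe_mulRight, act_act, inv_mul_cancel_right, psign_mul, psign_inv]
  congr 1
  ring

theorem psign_finRotate_three : psign k (finRotate 3) = 1 := by
  rw [psign, show Equiv.Perm.sign (finRotate 3) = 1 by decide]
  simp

variable [CharZero k]

/-- For a form f killing the relations, the `DualRelations` rewrite the image of its dual trees in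
terms of m∘m, e∘m or e∘e, according to the degree. The coefficients that remain are values of f on
associativity, Poisson and Jacobi relations. -/
theorem orthRel_le_ker {P : Operad k} (F : OperadHom (free (gerstGen k).hatDual) P)
    (h : DualRelations P (F.toFun 1 0 (mulS k)) (F.toFun 1 1 (braS k))) {D : ℤ}
    {y : (free (gerstGen k).hatDual).V 2 D} (hy : y ∈ orthRel (gerstGen k) (gerstRel k) D) :
    F.toFun 2 D y = 0 := by
  have h2 : (2 : k) ≠ 0 := two_ne_zero
  refine Submodule.span_induction (p := fun y _ => F.toFun 2 D y = 0) ?_ (map_zero _)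
    (fun x y _ _ hx hy => by rw [map_add, hx, hy, add_zero])
    (fun c x _ hx => by rw [map_smul, hx, smul_zero]) hy
  rintro _ ⟨f, hf, rfl⟩
  by_cases h₀ : D = 0
  · subst h₀
    rw [dualTrees_zero, map_sum]
    refine Finset.sum_eq_zero fun σ _ => ?_
    have hfσ := hf _ (Submodule.subset_span (GerstRel.assoc σ))
    rw [map_sub, map_sub, sub_eq_zero] at hfσ
    rw [map_sub, map_smul, map_smul, F.map_act, F.map_act, F.map_comp, F.map_comp, h.assoc]
    exact sub_eq_zero.2 (congrArg (fun c => (psign k σ * c) • _) hfσ)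
  by_cases h₁ : D = 1
  · subst h₁
    refine (smul_eq_zero_iff_right h2).1 ?_
    rw [← map_smul, two_smul_dualTrees_one, map_sum]
    simp only [map_add, map_sub, map_smul, F.map_act, F.map_comp]
    -- Every term is now a relabelling of the bracket of a product; for each σ the total coefficient
    -- is a multiple of f on the Poisson relation.
    rw [h.bracket_left, h.bracket_right]
    simp only [map_sub, smul_sub, Finset.sum_sub_distrib, Finset.sum_add_distrib]
    simp only [sum_psign_act_act, psign_finRotate_three, one_mul]
    simp only [← Finset.sum_sub_distrib, ← Finset.sum_add_distrib, ← sub_smul, ← add_smul]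
    refine Finset.sum_eq_zero fun σ _ => ?_
    have hfσ := hf _ (Submodule.subset_span (GerstRel.poisson σ))
    have e₁ := comp_one_swap (free (gerstGen k)) (zero_add (-1)) (prod₂ k) (brac₂ k)
    have e₂ := comp_zero_swap (free (gerstGen k)) (zero_add (-1)) (prod₂ k) (brac₂ k)
    rw [act_swap_brac₂] at e₁ e₂
    rw [map_sub, map_sub, map_sub, map_sub, act_act] at hfσ
    rw [psign_swap k (by decide)]
    have e₃ := congrArg (fun z => f ((free (gerstGen k)).act 2 (-1) σ z)) e₁
    have e₄ := congrArg (fun z => f ((free (gerstGen k)).act 2 (-1) (σ * Equiv.swap 1 2) z)) e₂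
    simp only [act_act, mul_assoc] at e₃ e₄
    rw [show (Equiv.swap 1 2 * Equiv.swap 0 1 : Equiv.Perm (Fin 3)) = (finRotate 3)⁻¹ by decide]
      at e₄
    rw [Equiv.swap_inv, ← e₃, ← e₄]
    convert zero_smul k _ using 2
    linear_combination (2 * psign k σ) * hfσ
  by_cases h₂ : D = 2
  · subst h₂
    refine (smul_eq_zero_iff_right h2).1 ?_
    rw [← map_smul, two_smul_dualTrees_two, map_sum]
    simp only [map_smul, F.map_act, F.map_comp]
    have e₁ := comp_zero_swap P (show (1 : ℤ) + 1 = 2 by norm_num) (F.toFun 1 1 (braS k))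
      (F.toFun 1 1 (braS k))
    rw [h.swap_bracket, map_neg] at e₁
    have e₂ := h.swap_bracket_bracket
    have e₃ := comp_zero_swap (free (gerstGen k)) (show (-1 : ℤ) + -1 = -2 by norm_num) (brac₂ k)
      (brac₂ k)
    rw [act_swap_brac₂] at e₃
    have hfσ := hf _ (Submodule.subset_span GerstRel.jacobi)
    -- By skewness all six terms are multiples of one double bracket, and the total coefficient is
    -- twice f of the Jacobi relation.
    rw [sum_perm_three]
    simp only [psign_mul, psign_one, psign_finRotate_three, psign_swap k (show (0 : Fin 3) ≠ 1 by
      decide), psign_swap k (show (1 : Fin 3) ≠ 2 by decide)]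
    simp only [← act_act, ← e₁, ← e₃, act_one_apply]
    rw [show finRotate 3 = (Equiv.swap 0 1 * Equiv.swap 1 2 : Equiv.Perm (Fin 3)) by decide]
    simp only [← act_act, map_neg, e₂, ← e₁]
    rw [map_sum, Fin.sum_univ_three] at hfσ
    simp only [Fin.val_zero, Fin.val_one, Fin.val_two, pow_zero, pow_one, act_one_apply] at hfσ
    rw [show (finRotate 3 ^ 2) = (Equiv.swap 1 2 * Equiv.swap 0 1 : Equiv.Perm (Fin 3)) by decide,
      show finRotate 3 = (Equiv.swap 0 1 * Equiv.swap 1 2 : Equiv.Perm (Fin 3)) by decide] at hfσ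
    simp only [← act_act, ← e₃] at hfσ
    simp only [smul_neg, ← neg_smul, ← add_smul]
    convert zero_smul k _ using 2
    linear_combination 2 * hfσ
  · rw [dualTrees_other k h₀ h₁ h₂, map_zero]

end Relations

/-! ### A model of the two-vertex trees

To produce linear forms on the free operad in arity three we map it to an operad of binary terms
in which all composites of more than two operations vanish. -/

/-- Terms with two binary operations. -/
inductive Term (α : Type) : Type
  | leaf (a : α) : Term α
  | node (b : Bool) (x y : Term α) : Term α

namespace Term

/-- Equality of terms is decidable. -/
def decEq {α : Type} [DecidableEq α] : ∀ x y : Term α, Decidable (x = y)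
  | leaf a, leaf b => decidable_of_iff (a = b) (by rw [leaf.injEq])
  | leaf _, node _ _ _ => isFalse fun h => by cases h
  | node _ _ _, leaf _ => isFalse fun h => by cases h
  | node b x y, node b' x' y' =>
    have := decEq x x'
    have := decEq y y'
    decidable_of_iff (b = b' ∧ x = x' ∧ y = y') (by rw [node.injEq])

instance {α : Type} [DecidableEq α] : DecidableEq (Term α) := decEq

/-- The number of operations. -/
def size {α : Type} : Term α → ℕ
  | leaf _ => 0
  | node _ x y => x.size + y.size + 1

/-- Renaming of the leaves. -/
def map {α β : Type} (f : α → β) : Term α → Term β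
  | leaf a => leaf (f a)
  | node b x y => node b (x.map f) (y.map f)

/-- Substitution for the leaves. -/
def bind {α β : Type} (f : α → Term β) : Term α → Term β
  | leaf a => f a
  | node b x y => node b (x.bind f) (y.bind f)

theorem map_id {α : Type} (x : Term α) : x.map id = x := by
  induction x with
  | leaf a => rfl
  | node b x y hx hy => simp only [map, hx, hy]

theorem map_map {α β γ : Type} (f : α → β) (g : β → γ) (x : Term α) :
    (x.map f).map g = x.map (g ∘ f) := by
  induction x with
  | leaf a => rfl
  | node b x y hx hy => simp only [map, hx, hy]

theorem size_map {α β : Type} (f : α → β) (x : Term α) : (x.map f).size = x.size := by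
  induction x with
  | leaf a => rfl
  | node b x y hx hy => simp only [map, size, hx, hy]

theorem map_bind {α β γ : Type} (f : α → Term β) (g : β → γ) (x : Term α) :
    (x.bind f).map g = x.bind fun a => (f a).map g := by
  induction x with
  | leaf a => rfl
  | node b x y hx hy => simp only [map, bind, hx, hy]

theorem bind_map {α β γ : Type} (f : α → β) (g : β → Term γ) (x : Term α) :
    (x.map f).bind g = x.bind (g ∘ f) := by
  induction x with
  | leaf a => rfl
  | node b x y hx hy => simp only [map, bind, hx, hy]

/-- Grafting of terms. -/
def graft {r s N : ℕ} (h : r + s = N) (i : Fin (r + 1)) (x : Term (Fin (r + 1)))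
    (y : Term (Fin (s + 1))) : Term (Fin (N + 1)) :=
  x.bind fun j => if j = i then y.map (leafUpper h i) else leaf (leafLower h i j)

theorem graft_map {r s N : ℕ} (h : r + s = N) (i : Fin (r + 1))
    {σ : Equiv.Perm (Fin (r + 1))} {τ : Equiv.Perm (Fin (s + 1))} {ρ : Equiv.Perm (Fin (N + 1))}
    (h₁ : ∀ l, ρ (leafUpper h i l) = leafUpper h (σ i) (τ l))
    (h₂ : ∀ j, j ≠ i → ρ (leafLower h i j) = leafLower h (σ i) (σ j))
    (x : Term (Fin (r + 1))) (y : Term (Fin (s + 1))) :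
    graft h (σ i) (x.map σ) (y.map τ) = (graft h i x y).map ρ := by
  rw [graft, graft, map_bind, bind_map]
  congr 1
  funext j
  by_cases hj : j = i
  · subst hj
    simp only [Function.comp_apply, if_true, map_map]
    congr 1
    funext l
    exact (h₁ l).symm
  · simp only [Function.comp_apply, σ.injective.eq_iff, hj, if_false, map, h₂ j hj]

end Term

section TermOperad

variable (k : Type u) [Field k]

/-- The composite of terms, zero unless it has exactly two operations. -/
def termGraft {r s N : ℕ} (h : r + s = N) (i : Fin (r + 1)) (x : Term (Fin (r + 1)))
    (y : Term (Fin (s + 1))) : Term (Fin (N + 1)) →₀ k :=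
  if x.size = 1 ∧ y.size = 1 ∧ (x.graft h i y).size = 2 then Finsupp.single (x.graft h i y) 1 else 0

/-- The bilinear extension of `termGraft`. -/
def termComp {r s N : ℕ} (h : r + s = N) (i : Fin (r + 1)) :
    (Term (Fin (r + 1)) →₀ k) →ₗ[k] (Term (Fin (s + 1)) →₀ k) →ₗ[k] Term (Fin (N + 1)) →₀ k :=
  Finsupp.linearCombination k fun x => Finsupp.linearCombination k fun y => termGraft k h i x y

theorem termComp_single {r s N : ℕ} (h : r + s = N) (i : Fin (r + 1))
    (x : Term (Fin (r + 1))) (y : Term (Fin (s + 1))) (a b : k) :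
    termComp k h i (Finsupp.single x a) (Finsupp.single y b) = (a * b) • termGraft k h i x y := by
  simp [termComp, mul_smul]

/-- Only terms of size one can be composed, and a non-zero composite has size two. Iterated
composites therefore vanish, and both associativity axioms of `termOperad` hold trivially. -/
theorem termComp_graft_left {r s N t M : ℕ} (h : r + s = N) (i : Fin (r + 1)) (h' : N + t = M)
    (j : Fin (N + 1)) (x : Term (Fin (r + 1))) (y : Term (Fin (s + 1)))
    (z : Term (Fin (t + 1)) →₀ k) : termComp k h' j (termGraft k h i x y) z = 0 := by
  unfold termGraft
  split_ifs with hc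
  · induction z using Finsupp.induction_linear with
    | zero => simp
    | add f f' ih ih' => rw [map_add, ih, ih', add_zero]
    | single Z z =>
      rw [termComp_single, termGraft, if_neg fun h => by omega, smul_zero]
  · simp

theorem termComp_graft_right {r s N t M : ℕ} (h : r + s = N) (i : Fin (r + 1)) (h' : t + N = M)
    (j : Fin (t + 1)) (x : Term (Fin (r + 1))) (y : Term (Fin (s + 1)))
    (z : Term (Fin (t + 1)) →₀ k) : termComp k h' j z (termGraft k h i x y) = 0 := by
  unfold termGraft
  split_ifs with hc
  · induction z using Finsupp.induction_linear with
    | zero => simp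
    | add f f' ih ih' => rw [map_add, LinearMap.add_apply, ih, ih', add_zero]
    | single Z z =>
      rw [termComp_single, termGraft, if_neg fun h => by omega, smul_zero]
  · simp

theorem termComp_termComp_left {r s N t M : ℕ} (h : r + s = N) (i : Fin (r + 1)) (h' : N + t = M)
    (j : Fin (N + 1)) (x : Term (Fin (r + 1)) →₀ k) (y : Term (Fin (s + 1)) →₀ k)
    (z : Term (Fin (t + 1)) →₀ k) : termComp k h' j (termComp k h i x y) z = 0 := by
  induction x using Finsupp.induction_linear with
  | zero => simp
  | add f f' ih ih' => simp only [map_add, LinearMap.add_apply, ih, ih', add_zero]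
  | single X x =>
    induction y using Finsupp.induction_linear with
    | zero => simp
    | add f f' ih ih' => simp only [map_add, LinearMap.add_apply, ih, ih', add_zero]
    | single Y y =>
      rw [termComp_single, map_smul, LinearMap.smul_apply, termComp_graft_left, smul_zero]

theorem termComp_termComp_right {r s N t M : ℕ} (h : r + s = N) (i : Fin (r + 1)) (h' : t + N = M)
    (j : Fin (t + 1)) (x : Term (Fin (r + 1)) →₀ k) (y : Term (Fin (s + 1)) →₀ k)
    (z : Term (Fin (t + 1)) →₀ k) : termComp k h' j z (termComp k h i x y) = 0 := by
  induction x using Finsupp.induction_linear with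
  | zero => simp
  | add f f' ih ih' => simp only [map_add, LinearMap.add_apply, ih, ih', add_zero]
  | single X x =>
    induction y using Finsupp.induction_linear with
    | zero => simp
    | add f f' ih ih' => simp only [map_add, ih, ih', add_zero]
    | single Y y =>
      rw [termComp_single, map_smul, termComp_graft_right, smul_zero]

/-- The operad of binary terms with at most two operations. -/
def termOperad : Operad k where
  V r _ := Term (Fin (r + 1)) →₀ k
  act r _ :=
    { toFun := fun σ => Finsupp.lmapDomain k k (Term.map σ)
      map_one' := by
        refine Finsupp.lhom_ext fun L b => ?_
        simp only [Finsupp.lmapDomain_apply, Finsupp.mapDomain_single, Equiv.Perm.coe_one,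
          Term.map_id, Module.End.one_apply]
      map_mul' := fun σ τ => by
        refine Finsupp.lhom_ext fun L b => ?_
        simp only [Finsupp.lmapDomain_apply, Finsupp.mapDomain_single, Module.End.mul_apply,
          Term.map_map, Equiv.Perm.coe_mul] }
  comp {_ _ _} h {_ _ _} _ i := termComp k h i
  equivariant := by
    intro r s N h d e D hd i σ τ ρ h₁ h₂ f g
    change termComp k h (σ i) (Finsupp.mapDomain _ f) (Finsupp.mapDomain _ g) =
      Finsupp.mapDomain (Term.map ρ) (termComp k h i f g)
    induction f using Finsupp.induction_linear with
    | zero => simp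
    | add f f' ih ih' => simp only [map_add, LinearMap.add_apply, Finsupp.mapDomain_add, ih, ih']
    | single A a =>
      induction g using Finsupp.induction_linear with
      | zero => simp
      | add f f' ih ih' => simp only [map_add, Finsupp.mapDomain_add, ih, ih']
      | single B b =>
        rw [Finsupp.mapDomain_single, Finsupp.mapDomain_single, termComp_single, termComp_single,
          Finsupp.mapDomain_smul, termGraft, termGraft, Term.graft_map h i h₁ h₂, Term.size_map,
          Term.size_map, Term.size_map]
        split_ifs
        · rw [Finsupp.mapDomain_single]
        · rw [Finsupp.mapDomain_zero]
  parallel := by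
    intro r s t A B N hA hAN hB hBN d e c dA dB D hdA hdAN hdB hdBN i j hij f g g'
    rw [termComp_termComp_left, termComp_termComp_left, smul_zero]
  sequential := by
    intro r s t A B N hA hAN hB hBN d e c dA dB D hdA hdAN hdB hdBN i j f g g'
    rw [termComp_termComp_left, termComp_termComp_right]

/-- The terms of a corolla. -/
def corollaTerm {r : ℕ} : Corolla r → Term (Fin (r + 1)) →₀ k
  | .space _ => Finsupp.single (.node false (.leaf 0) (.leaf (Fin.last r))) 1 +
      Finsupp.single (.node false (.leaf (Fin.last r)) (.leaf 0)) 1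
  | .mixed p hp f => Finsupp.single
      (.node true (.leaf (f ⟨0, by omega⟩)) (.leaf (f ⟨1, by omega⟩))) 1

/-- Restricted to two inputs: in higher arity the term of a space corolla singles out the first and
the last input and is not invariant. The generators live in arity two, so this is enough. -/
theorem corollaTerm_smul (σ : Equiv.Perm (Fin (1 + 1))) (c : Corolla 1) :
    corollaTerm k (σ • c) = Finsupp.mapDomain (Term.map σ) (corollaTerm k c) := by
  cases c with
  | mixed p hp f =>
    change Finsupp.single _ _ = Finsupp.mapDomain _ (Finsupp.single _ _)
    rw [Finsupp.mapDomain_single]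
    rfl
  | space hr =>
    change Finsupp.single _ _ + Finsupp.single _ _ =
      Finsupp.mapDomain _ (Finsupp.single _ _ + Finsupp.single _ _)
    rw [Finsupp.mapDomain_add, Finsupp.mapDomain_single, Finsupp.mapDomain_single]
    have : ∀ σ : Equiv.Perm (Fin 2), σ = 1 ∨ σ = Equiv.swap 0 1 := by decide
    rcases this σ with rfl | rfl
    · rfl
    · exact add_comm _ _

/-- The generators as terms. -/
def genTerm (r : ℕ) (d : ℤ) : (gerstGen k).V r d →ₗ[k] (termOperad k).V r d :=
  (Finsupp.linearCombination k fun c => corollaTerm k c.1 :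
    ({c : Corolla r // r = 1 ∧ c.degree = d} →₀ k) →ₗ[k] Term (Fin (r + 1)) →₀ k)

theorem genTerm_corollaVec {d : ℤ} (c : Corolla 1) (hd : c.degree = d) :
    genTerm k 1 d (corollaVec k _ c rfl hd) = corollaTerm k c := by
  have h : Finsupp.linearCombination k
      (fun c : {c : Corolla 1 // 1 = 1 ∧ c.degree = d} => corollaTerm k c.1)
      (Finsupp.single ⟨c, rfl, hd⟩ 1) = corollaTerm k c := by
    rw [Finsupp.linearCombination_single, one_smul]
  exact h

theorem genTerm_act (r : ℕ) (d : ℤ) (σ : Equiv.Perm (Fin (r + 1))) (x : (gerstGen k).V r d) :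
    genTerm k r d ((gerstGen k).act r d σ x) = (termOperad k).act r d σ (genTerm k r d x) := by
  have : (genTerm k r d).comp ((gerstGen k).act r d σ) =
      ((termOperad k).act r d σ).comp (genTerm k r d) := by
    refine Finsupp.lhom_ext' fun c => LinearMap.ext_ring ?_
    obtain ⟨c, h, hd⟩ := c
    change r = 1 at h
    subst h
    change genTerm k 1 d ((gerstGen k).act 1 d σ (corollaVec k _ c rfl hd)) =
      (termOperad k).act 1 d σ (genTerm k 1 d (corollaVec k _ c rfl hd))
    rw [act_corollaVec, genTerm_corollaVec, genTerm_corollaVec, corollaTerm_smul]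
    rfl
  exact LinearMap.congr_fun this x

/-- The map from the free operad to the operad of terms. -/
def toTerm : OperadHom (free (gerstGen k)) (termOperad k) :=
  freeLift (genTerm k) (genTerm_act k)

theorem toTerm_prod₂ : (toTerm k).toFun 1 0 (prod₂ k) =
    (Finsupp.single (.node true (.leaf 0) (.leaf 1)) 1 : Term (Fin (1 + 1)) →₀ k) :=
  genTerm_corollaVec k mulCorolla rfl

theorem toTerm_brac₂ : (toTerm k).toFun 1 (-1) (brac₂ k) =
    (Finsupp.single (.node false (.leaf 0) (.leaf 1)) 1 +
      Finsupp.single (.node false (.leaf 1) (.leaf 0)) 1 : Term (Fin (1 + 1)) →₀ k) :=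
  genTerm_corollaVec k braCorolla rfl

/-- The linear form on the free operad given by a function on terms. -/
def termForm (w : Term (Fin 3) → ℤ) (d : ℤ) : Dual k ((free (gerstGen k)).V 2 d) :=
  (Finsupp.linearCombination k fun t => (w t : k)).comp ((toTerm k).toFun 2 d)

theorem termForm_act_comp (w : Term (Fin 3) → ℤ) (σ : Equiv.Perm (Fin 3)) {d e D : ℤ}
    (hd : d + e = D) (i : Fin 2) (x : (free (gerstGen k)).V 1 d) (y : (free (gerstGen k)).V 1 e) :
    termForm k w D ((free (gerstGen k)).act 2 D σ
      ((free (gerstGen k)).comp (rfl : 1 + 1 = 2) hd i x y)) =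
    Finsupp.linearCombination k (fun t => (w (t.map σ) : k))
      (termComp k (rfl : 1 + 1 = 2) i ((toTerm k).toFun 1 d x) ((toTerm k).toFun 1 e y)) := by
  change Finsupp.linearCombination k _ ((toTerm k).toFun 2 D _) = _
  rw [(toTerm k).map_act, (toTerm k).map_comp]
  exact Finsupp.linearCombination_mapDomain k _ _

theorem linearCombination_termComp (w : Term (Fin 3) → k) (i : Fin 2)
    (x y : Term (Fin 2)) (h : x.size = 1 ∧ y.size = 1 ∧ (x.graft (rfl : 1 + 1 = 2) i y).size = 2) :
    Finsupp.linearCombination k w (termComp k (rfl : 1 + 1 = 2) i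
      (Finsupp.single x (1 : k)) (Finsupp.single y (1 : k))) =
      w (x.graft (rfl : 1 + 1 = 2) i y) := by
  rw [termComp_single, termGraft, if_pos h, one_mul, one_smul, Finsupp.linearCombination_single,
    one_smul]

open Term in
theorem termForm_prod_prod_zero (w : Term (Fin 3) → ℤ) (σ : Equiv.Perm (Fin 3)) :
    termForm k w 0 ((free (gerstGen k)).act 2 0 σ
      ((free (gerstGen k)).comp (rfl : 1 + 1 = 2) (add_zero 0) 0 (prod₂ k) (prod₂ k))) =
    (w ((node true (node true (leaf 0) (leaf 1)) (leaf 2)).map σ) : k) := by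
  rw [termForm_act_comp, toTerm_prod₂, linearCombination_termComp _ _ _ _ _ (by decide)]
  rfl

open Term in
theorem termForm_prod_prod_one (w : Term (Fin 3) → ℤ) (σ : Equiv.Perm (Fin 3)) :
    termForm k w 0 ((free (gerstGen k)).act 2 0 σ
      ((free (gerstGen k)).comp (rfl : 1 + 1 = 2) (add_zero 0) 1 (prod₂ k) (prod₂ k))) =
    (w ((node true (leaf 0) (node true (leaf 1) (leaf 2))).map σ) : k) := by
  rw [termForm_act_comp, toTerm_prod₂, linearCombination_termComp _ _ _ _ _ (by decide)]
  rfl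

open Term in
theorem termForm_prod_brac_zero (w : Term (Fin 3) → ℤ) (σ : Equiv.Perm (Fin 3)) :
    termForm k w (-1) ((free (gerstGen k)).act 2 (-1) σ
      ((free (gerstGen k)).comp (rfl : 1 + 1 = 2) (zero_add (-1)) 0 (prod₂ k) (brac₂ k))) =
    ((w ((node true (node false (leaf 0) (leaf 1)) (leaf 2)).map σ) +
      w ((node true (node false (leaf 1) (leaf 0)) (leaf 2)).map σ) : ℤ) : k) := by
  rw [termForm_act_comp, toTerm_prod₂, toTerm_brac₂]
  simp only [map_add]
  rw [linearCombination_termComp _ _ _ _ _ (by decide),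
    linearCombination_termComp _ _ _ _ _ (by decide), Int.cast_add]
  rfl

open Term in
theorem termForm_prod_brac_one (w : Term (Fin 3) → ℤ) (σ : Equiv.Perm (Fin 3)) :
    termForm k w (-1) ((free (gerstGen k)).act 2 (-1) σ
      ((free (gerstGen k)).comp (rfl : 1 + 1 = 2) (zero_add (-1)) 1 (prod₂ k) (brac₂ k))) =
    ((w ((node true (leaf 0) (node false (leaf 1) (leaf 2))).map σ) +
      w ((node true (leaf 0) (node false (leaf 2) (leaf 1))).map σ) : ℤ) : k) := by
  rw [termForm_act_comp, toTerm_prod₂, toTerm_brac₂]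
  simp only [map_add]
  rw [linearCombination_termComp _ _ _ _ _ (by decide),
    linearCombination_termComp _ _ _ _ _ (by decide), Int.cast_add]
  rfl

open Term in
theorem termForm_brac_prod (w : Term (Fin 3) → ℤ) (σ : Equiv.Perm (Fin 3)) :
    termForm k w (-1) ((free (gerstGen k)).act 2 (-1) σ
      ((free (gerstGen k)).comp (rfl : 1 + 1 = 2) (add_zero (-1)) 0 (brac₂ k) (prod₂ k))) =
    ((w ((node false (node true (leaf 0) (leaf 1)) (leaf 2)).map σ) +
      w ((node false (leaf 2) (node true (leaf 0) (leaf 1))).map σ) : ℤ) : k) := by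
  rw [termForm_act_comp, toTerm_prod₂, toTerm_brac₂]
  simp only [map_add, LinearMap.add_apply]
  rw [linearCombination_termComp _ _ _ _ _ (by decide),
    linearCombination_termComp _ _ _ _ _ (by decide), Int.cast_add]
  rfl

open Term in
theorem termForm_brac_brac (w : Term (Fin 3) → ℤ) (σ : Equiv.Perm (Fin 3)) :
    termForm k w (-2) ((free (gerstGen k)).act 2 (-2) σ
      ((free (gerstGen k)).comp (rfl : 1 + 1 = 2) (by norm_num) 0 (brac₂ k) (brac₂ k))) =
    ((w ((node false (node false (leaf 0) (leaf 1)) (leaf 2)).map σ) +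
      w ((node false (leaf 2) (node false (leaf 0) (leaf 1))).map σ) +
      (w ((node false (node false (leaf 1) (leaf 0)) (leaf 2)).map σ) +
      w ((node false (leaf 2) (node false (leaf 1) (leaf 0))).map σ)) : ℤ) : k) := by
  rw [termForm_act_comp, toTerm_brac₂]
  simp only [map_add, LinearMap.add_apply]
  rw [linearCombination_termComp _ _ _ _ _ (by decide),
    linearCombination_termComp _ _ _ _ _ (by decide),
    linearCombination_termComp _ _ _ _ _ (by decide),
    linearCombination_termComp _ _ _ _ _ (by decide)]
  push_cast
  rfl

open Term in
/-- The condition on a function on terms for its linear form to vanish on the relations. -/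
def TermOrth (w : Term (Fin 3) → ℤ) : Prop :=
  (∀ σ : Equiv.Perm (Fin 3), w ((node true (node true (leaf 0) (leaf 1)) (leaf 2)).map σ) =
    w ((node true (leaf 0) (node true (leaf 1) (leaf 2))).map σ)) ∧
  (∑ i : Fin 3, (w ((node false (node false (leaf 0) (leaf 1)) (leaf 2)).map (finRotate 3 ^ i.1)) +
      w ((node false (leaf 2) (node false (leaf 0) (leaf 1))).map (finRotate 3 ^ i.1)) +
      (w ((node false (node false (leaf 1) (leaf 0)) (leaf 2)).map (finRotate 3 ^ i.1)) +
      w ((node false (leaf 2) (node false (leaf 1) (leaf 0))).map (finRotate 3 ^ i.1)))) = 0) ∧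
  ∀ σ : Equiv.Perm (Fin 3), w ((node false (node true (leaf 0) (leaf 1)) (leaf 2)).map σ) +
      w ((node false (leaf 2) (node true (leaf 0) (leaf 1))).map σ) =
    w ((node true (node false (leaf 0) (leaf 1)) (leaf 2)).map (σ * Equiv.swap 1 2 : Equiv.Perm
        (Fin 3))) +
      w ((node true (node false (leaf 1) (leaf 0)) (leaf 2)).map (σ * Equiv.swap 1 2 : Equiv.Perm
          (Fin 3))) +
    (w ((node true (leaf 0) (node false (leaf 1) (leaf 2))).map σ) +
      w ((node true (leaf 0) (node false (leaf 2) (leaf 1))).map σ))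

/-- The values of the form on the relations are explicit sums of values of w, so orthogonality to
all relations is a finite condition, decidable for a concrete w. -/
theorem TermOrth.eq_zero {w : Term (Fin 3) → ℤ} (hw : TermOrth w) {d : ℤ}
    {x : (free (gerstGen k)).V 2 d} (hx : x ∈ gerstRel k d) : termForm k w d x = 0 := by
  refine Submodule.span_induction (p := fun y _ => termForm k w d y = 0) ?_ (map_zero _)
    (fun x y _ _ hx hy => by rw [map_add, hx, hy, add_zero])
    (fun c x _ hx => by rw [map_smul, hx, smul_zero]) hx
  intro y hy
  cases hy with
  | assoc σ =>
    rw [map_sub, map_sub, termForm_prod_prod_zero, termForm_prod_prod_one, hw.1, sub_self]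
  | jacobi =>
    rw [map_sum]
    simp_rw [termForm_brac_brac]
    rw [← Int.cast_sum, hw.2.1, Int.cast_zero]
  | poisson σ =>
    rw [map_sub, map_sub, map_sub, map_sub, act_act, termForm_brac_prod, termForm_prod_brac_zero,
      termForm_prod_brac_one, hw.2.2 σ]
    push_cast
    ring

end TermOperad

/-! ### The relations hold in the Koszul dual -/

section KoszulDual

variable (k : Type u) [Field k]

/-- The product in the Koszul dual. -/
def dualMul : (gerstDual k).V 1 0 := toQuotient _ _ (mulS k)

/-- The bracket in the Koszul dual. -/
def dualBra : (gerstDual k).V 1 1 := toQuotient _ _ (braS k)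

/-- The projection from the free operad to the Koszul dual. -/
def dualProj : OperadHom (free (gerstGen k).hatDual) (gerstDual k) :=
  quotientHom _ _

theorem dualProj_eq_zero {D : ℤ} {y : (free (gerstGen k).hatDual).V 2 D}
    (hy : y ∈ orthRel (gerstGen k) (gerstRel k) D) : (dualProj k).toFun 2 D y = 0 :=
  (Submodule.Quotient.mk_eq_zero _).2 (IdealMem.of (QuadRel.mk hy))

theorem dualProj_dualTrees (w : Term (Fin 3) → ℤ) (hw : TermOrth w) (D : ℤ) :
    (dualProj k).toFun 2 D (dualTrees (gerstGen k) D (termForm k w (-D))) = 0 :=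
  dualProj_eq_zero k (Submodule.subset_span ⟨_, fun _ hx => hw.eq_zero k hx, rfl⟩)

theorem dualProj_mulS : (dualProj k).toFun 1 0 (mulS k) = dualMul k := rfl

theorem dualProj_braS : (dualProj k).toFun 1 1 (braS k) = dualBra k := rfl

/-- The function on terms dual to the terms in `pos` minus those in `neg`. -/
def termIndicator (pos neg : List (Term (Fin 3))) (t : Term (Fin 3)) : ℤ :=
  (pos.count t : ℤ) - neg.count t

theorem act_swap_dualBra :
    (gerstDual k).act 1 1 (Equiv.swap 0 1) (dualBra k) = -dualBra k := by
  have := congrArg ((dualProj k).toFun 1 1) (act_swap_braS k)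
  rwa [(dualProj k).map_act, map_neg] at this

theorem intCast_eq_of_eq {a : ℤ} (b : ℤ) {c : k} (h : a = b) (hc : (b : k) = c) : (a : k) = c := by
  rw [h, hc]

/-- The forms used below take non-zero values at very few permutations; this extracts the surviving
terms of the sum over all permutations. -/
theorem sum_psign_indicator {V : Type*} [AddCommGroup V] [Module k V] (a b : Equiv.Perm (Fin 3))
    (c : k) (x : Equiv.Perm (Fin 3) → V) :
    ∑ σ, (psign k σ * (((if σ = a then 1 else 0) + c * (if σ = b then 1 else 0)))) • x σ =
      psign k a • x a + (psign k b * c) • x b := by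
  simp [mul_add, add_smul, Finset.sum_add_distrib]

open Term in
theorem dualMul_assoc : (gerstDual k).comp (rfl : 1 + 1 = 2) (add_zero 0) 0 (dualMul k)
    (dualMul k) =
    (gerstDual k).comp (rfl : 1 + 1 = 2) (add_zero 0) 1 (dualMul k) (dualMul k) := by
  -- The form takes the value 1 on both bracketings of x₀x₁x₂, so it kills associativity; its dual
  -- tree is the difference of the two composites of m with itself.
  set w := termIndicator [node true (node true (leaf 0) (leaf 1)) (leaf 2),
    node true (leaf 0) (node true (leaf 1) (leaf 2))] [] with hw
  have h := dualProj_dualTrees k w (by rw [hw]; unfold TermOrth; decide) 0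
  -- The vanishing second summand only gives the value the shape required by `sum_psign_indicator`.
  have h₁ : ∀ σ, termForm k w (-0) ((free (gerstGen k)).act 2 (-0) σ
      ((free (gerstGen k)).comp (rfl : 1 + 1 = 2) (add_zero 0) 0 (prod₂ k) (prod₂ k))) =
      ((if σ = 1 then 1 else 0) + 0 * (if σ = 1 then 1 else 0)) := fun σ => by
    refine (termForm_prod_prod_zero k w σ).trans (intCast_eq_of_eq k
      (if σ = 1 then 1 else 0) ?_ (by simp))
    revert σ
    rw [hw]
    decide
  have h₂ : ∀ σ, termForm k w (-0) ((free (gerstGen k)).act 2 (-0) σ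
      ((free (gerstGen k)).comp (rfl : 1 + 1 = 2) (add_zero 0) 1 (prod₂ k) (prod₂ k))) =
      ((if σ = 1 then 1 else 0) + 0 * (if σ = 1 then 1 else 0)) := fun σ => by
    refine (termForm_prod_prod_one k w σ).trans (intCast_eq_of_eq k
      (if σ = 1 then 1 else 0) ?_ (by simp))
    revert σ
    rw [hw]
    decide
  rw [dualTrees_zero, map_sum] at h
  simp only [map_sub, map_smul, (dualProj k).map_act, (dualProj k).map_comp, dualProj_mulS, h₁, h₂,
    Finset.sum_sub_distrib, sum_psign_indicator] at h
  rw [psign_one, one_smul, act_one_apply, act_one_apply, one_smul, mul_zero, zero_smul, zero_smul,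
    add_zero, add_zero, sub_eq_zero] at h
  exact h

theorem dualRel_one {w : Term (Fin 3) → ℤ} (hw : TermOrth w) :
    ∑ σ : Equiv.Perm (Fin 3),
      ((2 * (psign k σ * termForm k w (-1) ((free (gerstGen k)).act 2 (-1) σ
          ((free (gerstGen k)).comp (rfl : 1 + 1 = 2) (add_zero (-1)) 0 (brac₂ k) (prod₂ k))))) •
        (gerstDual k).act 2 1 σ ((gerstDual k).comp (rfl : 1 + 1 = 2)
          (add_zero 1) 0 (dualBra k) (dualMul k)) +
      ((psign k σ * termForm k w (-1) ((free (gerstGen k)).act 2 (-1) σ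
          ((free (gerstGen k)).comp (rfl : 1 + 1 = 2) (zero_add (-1)) 0 (prod₂ k) (brac₂ k)))) •
        (gerstDual k).act 2 1 σ ((gerstDual k).comp (rfl : 1 + 1 = 2)
          (zero_add 1) 0 (dualMul k) (dualBra k)) -
      (psign k σ * termForm k w (-1) ((free (gerstGen k)).act 2 (-1) σ
          ((free (gerstGen k)).comp (rfl : 1 + 1 = 2) (zero_add (-1)) 1 (prod₂ k) (brac₂ k)))) •
        (gerstDual k).act 2 1 σ ((gerstDual k).comp (rfl : 1 + 1 = 2)
          (zero_add 1) 1 (dualMul k) (dualBra k)))) = 0 := by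
  have h := congrArg ((2 : k) • ·) (dualProj_dualTrees k w hw 1)
  simp only [smul_zero] at h
  rw [← map_smul, two_smul_dualTrees_one, map_sum] at h
  simp only [map_add, map_sub, map_smul, (dualProj k).map_act, (dualProj k).map_comp, dualProj_mulS,
    dualProj_braS] at h
  exact h

variable [CharZero k]

open Term in
theorem dualMul_dualBra_right : (gerstDual k).comp (rfl : 1 + 1 = 2) (zero_add 1) 1 (dualMul k)
      (dualBra k) =
    (gerstDual k).comp (rfl : 1 + 1 = 2) (add_zero 1) 0 (dualBra k) (dualMul k) -
      (gerstDual k).act 2 1 (Equiv.swap 1 2)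
        ((gerstDual k).comp (rfl : 1 + 1 = 2) (add_zero 1) 0 (dualBra k) (dualMul k)) := by
  -- The form dual to x₀[x₁,x₂], extended so as to respect Poisson: it is also 1 on [x₀x₁,x₂] and
  -- [x₀x₂,x₁], the brackets whose expansion contains x₀[x₁,x₂].
  set w := termIndicator [node true (leaf 0) (node false (leaf 1) (leaf 2)),
    node false (node true (leaf 0) (leaf 1)) (leaf 2),
    node false (node true (leaf 0) (leaf 2)) (leaf 1)] [] with hw
  have h := dualRel_one k (w := w) (by rw [hw]; unfold TermOrth; decide)
  have h₀ : ∀ σ, termForm k w (-1) ((free (gerstGen k)).act 2 (-1) σ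
      ((free (gerstGen k)).comp (rfl : 1 + 1 = 2) (add_zero (-1)) 0 (brac₂ k) (prod₂ k))) =
      ((if σ = 1 then 1 else 0) + 1 * (if σ = Equiv.swap 1 2 then 1 else 0)) := fun σ => by
    refine (termForm_brac_prod k w σ).trans (intCast_eq_of_eq k
      ((if σ = 1 then (1 : ℤ) else 0) + if σ = Equiv.swap 1 2 then 1 else 0) ?_ (by simp))
    revert σ
    rw [hw]
    decide
  have h₁ : ∀ σ, termForm k w (-1) ((free (gerstGen k)).act 2 (-1) σ
      ((free (gerstGen k)).comp (rfl : 1 + 1 = 2) (zero_add (-1)) 0 (prod₂ k) (brac₂ k))) = 0 :=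
    fun σ => by
    refine (termForm_prod_brac_zero k w σ).trans (intCast_eq_of_eq k
      ((0 : ℤ)) ?_ (by simp))
    revert σ
    rw [hw]
    decide
  have h₂ : ∀ σ, termForm k w (-1) ((free (gerstGen k)).act 2 (-1) σ
      ((free (gerstGen k)).comp (rfl : 1 + 1 = 2) (zero_add (-1)) 1 (prod₂ k) (brac₂ k))) =
      ((if σ = 1 then 1 else 0) + 1 * (if σ = Equiv.swap 1 2 then 1 else 0)) := fun σ => by
    refine (termForm_prod_brac_one k w σ).trans (intCast_eq_of_eq k
      ((if σ = 1 then (1 : ℤ) else 0) + if σ = Equiv.swap 1 2 then 1 else 0) ?_ (by simp))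
    revert σ
    rw [hw]
    decide
  have e₁ := comp_one_swap (gerstDual k) (zero_add 1) (dualMul k) (dualBra k)
  rw [act_swap_dualBra, map_neg] at e₁
  simp only [h₀, h₁, h₂, mul_zero, zero_smul, zero_sub, Finset.sum_add_distrib,
    Finset.sum_neg_distrib, mul_smul (2 : k), ← Finset.smul_sum, sum_psign_indicator] at h
  simp only [psign_one, psign_swap k (show (1 : Fin 3) ≠ 2 by decide), mul_one, one_smul, neg_smul,
    act_one_apply, ← e₁, neg_neg] at h
  -- The composite of m with e was counted for both labellings of the bracket; together with the
  -- factor in `dualRel_one` the relation carries an overall 2.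
  have h2 : (2 : k) ≠ 0 := two_ne_zero
  refine smul_right_injective _ h2 ?_
  dsimp only
  rw [smul_sub, two_smul k ((gerstDual k).comp _ _ 1 _ _), eq_comm, ← sub_eq_zero, ← h]
  module

open Term in
theorem dualMul_dualBra_left : (gerstDual k).comp (rfl : 1 + 1 = 2) (zero_add 1) 0 (dualMul k)
      (dualBra k) =
    (gerstDual k).act 2 1 (Equiv.swap 1 2)
        ((gerstDual k).comp (rfl : 1 + 1 = 2) (add_zero 1) 0 (dualBra k) (dualMul k)) -
      (gerstDual k).act 2 1 (finRotate 3)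
        ((gerstDual k).comp (rfl : 1 + 1 = 2) (add_zero 1) 0 (dualBra k) (dualMul k)) := by
  -- The form dual to [x₀,x₁]x₂; by Poisson it must also be 1 on [x₀x₂,x₁] and [x₁x₂,x₀].
  set w := termIndicator [node true (node false (leaf 0) (leaf 1)) (leaf 2),
    node false (node true (leaf 0) (leaf 2)) (leaf 1),
    node false (node true (leaf 1) (leaf 2)) (leaf 0)] [] with hw
  have h := dualRel_one k (w := w) (by rw [hw]; unfold TermOrth; decide)
  have h₀ : ∀ σ, termForm k w (-1) ((free (gerstGen k)).act 2 (-1) σ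
      ((free (gerstGen k)).comp (rfl : 1 + 1 = 2) (add_zero (-1)) 0 (brac₂ k) (prod₂ k))) =
      ((if σ = Equiv.swap 1 2 then 1 else 0) + 1 * (if σ = finRotate 3 then 1 else 0)) :=
    fun σ => by
    refine (termForm_brac_prod k w σ).trans (intCast_eq_of_eq k
      ((if σ = Equiv.swap 1 2 then (1 : ℤ) else 0) + if σ = finRotate 3 then 1 else 0) ?_ (by simp))
    revert σ
    rw [hw]
    decide
  have h₁ : ∀ σ, termForm k w (-1) ((free (gerstGen k)).act 2 (-1) σ
      ((free (gerstGen k)).comp (rfl : 1 + 1 = 2) (zero_add (-1)) 0 (prod₂ k) (brac₂ k))) =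
      ((if σ = 1 then 1 else 0) + 1 * (if σ = Equiv.swap 0 1 then 1 else 0)) := fun σ => by
    refine (termForm_prod_brac_zero k w σ).trans (intCast_eq_of_eq k
      ((if σ = 1 then (1 : ℤ) else 0) + if σ = Equiv.swap 0 1 then 1 else 0) ?_ (by simp))
    revert σ
    rw [hw]
    decide
  have h₂ : ∀ σ, termForm k w (-1) ((free (gerstGen k)).act 2 (-1) σ
      ((free (gerstGen k)).comp (rfl : 1 + 1 = 2) (zero_add (-1)) 1 (prod₂ k) (brac₂ k))) = 0 :=
    fun σ => by
    refine (termForm_prod_brac_one k w σ).trans (intCast_eq_of_eq k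
      ((0 : ℤ)) ?_ (by simp))
    revert σ
    rw [hw]
    decide
  have e₁ := comp_zero_swap (gerstDual k) (zero_add 1) (dualMul k) (dualBra k)
  rw [act_swap_dualBra, map_neg] at e₁
  simp only [h₀, h₁, h₂, mul_zero, zero_smul, sub_zero, Finset.sum_add_distrib,
    mul_smul (2 : k), ← Finset.smul_sum, sum_psign_indicator] at h
  simp only [psign_one, psign_swap k (show (1 : Fin 3) ≠ 2 by decide),
    psign_swap k (show (0 : Fin 3) ≠ 1 by decide), psign_finRotate_three, mul_one, one_smul,
    neg_smul, act_one_apply, ← e₁, neg_neg] at h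
  have h2 : (2 : k) ≠ 0 := two_ne_zero
  refine smul_right_injective _ h2 ?_
  dsimp only
  rw [smul_sub, two_smul k ((gerstDual k).comp _ _ 0 (dualMul k) _), ← sub_eq_zero, ← h]
  module

open Term in
theorem act_swap_dualBra_dualBra : (gerstDual k).act 2 2 (Equiv.swap 1 2)
      ((gerstDual k).comp (rfl : 1 + 1 = 2) (show (1 : ℤ) + 1 = 2 by norm_num) 0 (dualBra k)
        (dualBra k)) =
    -(gerstDual k).comp (rfl : 1 + 1 = 2) (show (1 : ℤ) + 1 = 2 by norm_num) 0 (dualBra k)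
      (dualBra k) := by
  -- The values 1 and −1 on two of the three double brackets add up to zero on the Jacobi relation.
  set w := termIndicator [node false (node false (leaf 0) (leaf 1)) (leaf 2)]
    [node false (node false (leaf 0) (leaf 2)) (leaf 1)] with hw
  have h := congrArg ((2 : k) • ·)
    (dualProj_dualTrees k w (by rw [hw]; unfold TermOrth; decide) 2)
  simp only [smul_zero] at h
  rw [← map_smul, two_smul_dualTrees_two, map_sum] at h
  simp only [map_smul, (dualProj k).map_act, (dualProj k).map_comp, dualProj_braS] at h
  have h₀ : ∀ σ, termForm k w (-2) ((free (gerstGen k)).act 2 (-2) σ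
      ((free (gerstGen k)).comp (rfl : 1 + 1 = 2) (by norm_num) 0 (brac₂ k) (brac₂ k))) =
      ((if σ = 1 then 1 else 0) + -1 * (if σ = Equiv.swap 1 2 then 1 else 0)) +
      ((if σ = Equiv.swap 0 1 then 1 else 0) +
        -1 * (if σ = Equiv.swap 1 2 * Equiv.swap 0 1 then 1 else 0)) := fun σ => by
    refine (termForm_brac_brac k w σ).trans (intCast_eq_of_eq k
      (((if σ = 1 then (1 : ℤ) else 0) + -1 * (if σ = Equiv.swap 1 2 then 1 else 0)) +
        ((if σ = Equiv.swap 0 1 then 1 else 0) +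
          -1 * (if σ = Equiv.swap 1 2 * Equiv.swap 0 1 then 1 else 0))) ?_ (by push_cast; rfl))
    revert σ
    rw [hw]
    decide
  have e₁ := comp_zero_swap (gerstDual k) (show (1 : ℤ) + 1 = 2 by norm_num) (dualBra k) (dualBra k)
  rw [act_swap_dualBra, map_neg] at e₁
  simp only [h₀, mul_add (psign k _) (_ + _) (_ + _), add_smul, Finset.sum_add_distrib] at h
  simp only [sum_psign_indicator, psign_mul] at h
  simp only [psign_one, psign_swap k (show (1 : Fin 3) ≠ 2 by decide),
    psign_swap k (show (0 : Fin 3) ≠ 1 by decide), one_smul,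
    neg_smul, act_one_apply, ← act_act, ← e₁, neg_neg, map_neg] at h
  have h2 : (2 : k) ≠ 0 := two_ne_zero
  refine smul_right_injective _ h2 ?_
  dsimp only
  rw [← sub_eq_zero, ← h]
  module

theorem dualRelations_gerstDual : DualRelations (gerstDual k) (dualMul k) (dualBra k) where
  swap_bracket := act_swap_dualBra k
  assoc := dualMul_assoc k
  bracket_left := dualMul_dualBra_left k
  bracket_right := dualMul_dualBra_right k
  swap_bracket_bracket := act_swap_dualBra_dualBra k

end KoszulDual

/-! ### The map from the Koszul dual to the operad of words -/

instance corolla_finite (r : ℕ) : Finite (Corolla r) := by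
  let F : Corolla r → Option (Σ p : Fin (r + 2), Fin p ↪ Fin (r + 1)) := fun c => match c with
    | .space _ => none
    | .mixed p _ f => some ⟨⟨p, by
        have := Fintype.card_le_of_embedding f
        simp only [Fintype.card_fin] at this
        omega⟩, f⟩
  refine Finite.of_injective F ?_
  rintro (hr | ⟨p, hp, f⟩) (hr' | ⟨p', hp', f'⟩) h
  · rfl
  · exact absurd h (by simp [F])
  · exact absurd h (by simp [F])
  · simp only [F, Option.some.injEq, Sigma.mk.injEq, Fin.mk.injEq] at h
    obtain ⟨rfl, h⟩ := h
    rw [eq_of_heq h]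

instance corolla_fintype (r : ℕ) : Fintype (Corolla r) := Fintype.ofFinite _

section ToWord

variable (k : Type u) [Field k]

/-- The words of a corolla. -/
def corollaWord {r : ℕ} : Corolla r → List (Fin (r + 1)) →₀ k
  | .space _ => -(Finsupp.single [] 1 + ∑ j, Finsupp.single [j] 1)
  | .mixed _ _ f => Finsupp.single (List.ofFn f) 1

theorem wordAct_corollaWord {r : ℕ} (σ : Equiv.Perm (Fin (r + 1))) (c : Corolla r) :
    wordAct k r σ (corollaWord k c) = psign k σ • corollaWord k (σ • c) := by
  cases c with
  | mixed p hp f =>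
    change wordAct k r σ (Finsupp.single _ _) = psign k σ • Finsupp.single _ _
    rw [wordAct_single, List.map_ofFn]
    rfl
  | space hr =>
    change wordAct k r σ (-(_ + _)) = psign k σ • -(_ + _)
    simp only [map_neg, map_add, map_sum, wordAct_single, smul_neg, smul_add, Finset.smul_sum,
      List.map_nil, List.map_cons]
    congr 2
    exact Equiv.sum_comp σ fun j => psign k σ • Finsupp.single [j] (1 : k)

/-- Linear combinations of the words of the binary corollas of degree `d`. -/
def sumWord (r : ℕ) (d : ℤ) : ({c : Corolla r // r = 1 ∧ c.degree = d} → k) →ₗ[k]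
    List (Fin (r + 1)) →₀ k :=
  Fintype.linearCombination k fun c => corollaWord k c.1

theorem sumWord_apply (r : ℕ) (d : ℤ) (a : {c : Corolla r // r = 1 ∧ c.degree = d} → k) :
    sumWord k r d a = ∑ c, a c • corollaWord k c.1 :=
  rfl

/-- The values of a linear form on the binary corollas. -/
def genValue {r : ℕ} {d : ℤ} (φ : (gerstGen k).hatDual.V r d)
    (c : {c : Corolla r // r = 1 ∧ c.degree = -d}) : k :=
  (show Dual k ((gerstGen k).V r (-d)) from φ) (corollaVec k (fun r => r = 1) c.1 c.2.1 c.2.2)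

/-- The dual generators as words. -/
def genWord (r : ℕ) (d : ℤ) : (gerstGen k).hatDual.V r d →ₗ[k] (wordOperad k).V r d where
  toFun φ := sumWord k r (-d) (genValue k φ)
  map_add' φ ψ := map_add (sumWord k r (-d)) (genValue k φ) (genValue k ψ)
  map_smul' a φ := map_smul (sumWord k r (-d)) a (genValue k φ)

theorem genValue_act {r : ℕ} {d : ℤ} (σ : Equiv.Perm (Fin (r + 1)))
    (φ : (gerstGen k).hatDual.V r d) (c : {c : Corolla r // r = 1 ∧ c.degree = -d}) :
    genValue k ((gerstGen k).hatDual.act r d σ φ) c = psign k σ *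
      genValue k φ ⟨σ⁻¹ • c.1, c.2.1, (Corolla.degree_smul _ _).trans c.2.2⟩ := by
  unfold genValue
  rw [← act_corollaVec]
  rfl

theorem genWord_act (r : ℕ) (d : ℤ) (σ : Equiv.Perm (Fin (r + 1)))
    (φ : (gerstGen k).hatDual.V r d) :
    genWord k r d ((gerstGen k).hatDual.act r d σ φ) =
      (wordOperad k).act r d σ (genWord k r d φ) := by
  change sumWord k r (-d) (genValue k _) = wordAct k r σ (sumWord k r (-d) (genValue k φ))
  rw [sumWord_apply, sumWord_apply, map_sum]
  let e : {c : Corolla r // r = 1 ∧ c.degree = -d} ≃ {c : Corolla r // r = 1 ∧ c.degree = -d} :=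
    (MulAction.toPerm σ).subtypeEquiv fun c => by
      rw [MulAction.toPerm_apply, Corolla.degree_smul]
  refine (Equiv.sum_comp e _).symm.trans (Finset.sum_congr rfl fun c _ => ?_)
  rw [map_smul, wordAct_corollaWord, smul_smul, mul_comm, genValue_act]
  refine congrArg₂ (· • ·) (congrArg (psign k σ * genValue k φ ·) (Subtype.ext ?_)) rfl
  exact inv_smul_smul σ c.1

/-- The map from the free operad to words. -/
def freeToWord : OperadHom (free (gerstGen k).hatDual) (wordOperad k) :=
  freeLift (genWord k) (genWord_act k)

theorem genWord_dualVec {d : ℤ} (c : Corolla 1) (hc : c.degree = -d) :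
    genWord k 1 d (dualVec k c hc) = corollaWord k c := by
  classical
  change sumWord k 1 (-d) (genValue k (dualVec k c hc)) = _
  have h : genValue k (dualVec k c hc) = Pi.single ⟨c, rfl, hc⟩ 1 := by
    funext c'
    rw [Pi.single_apply]
    exact Finsupp.single_apply
  rw [h]
  simp [sumWord]

theorem freeToWord_mulS : (freeToWord k).toFun 1 0 (mulS k) =
    (Finsupp.single [0, 1] 1 : List (Fin (1 + 1)) →₀ k) :=
  (genWord_dualVec k mulCorolla mulCorolla_degree).trans rfl

theorem freeToWord_braS : (freeToWord k).toFun 1 1 (braS k) =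
    (-(Finsupp.single [] 1 + (Finsupp.single [0] 1 + Finsupp.single [1] 1)) :
      List (Fin (1 + 1)) →₀ k) := by
  refine (genWord_dualVec k braCorolla braCorolla_degree).trans ?_
  change -(_ + _) = _
  rw [Fin.sum_univ_two]
  rfl

variable {k} in
theorem wordTerm_of_even {r s N : ℕ} (h : r + s = N) {d e : ℤ} {i : Fin (r + 1)}
    {A : List (Fin (r + 1))} {B : List (Fin (s + 1))} {L : List (Fin (N + 1))}
    (hc : WordCompat d e i A B) (hL : wsubst h i A B = L)
    (hs : Even ((s : ℤ) * (r - (i : ℕ)) + weight B * (d + A.idxOf i))) :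
    wordTerm k h d e i A B = Finsupp.single L 1 := by
  rw [wordTerm, if_pos hc, hL, wordSign, ksign, if_pos hs]

variable {k} in
theorem wordTerm_of_odd {r s N : ℕ} (h : r + s = N) {d e : ℤ} {i : Fin (r + 1)}
    {A : List (Fin (r + 1))} {B : List (Fin (s + 1))} {L : List (Fin (N + 1))}
    (hc : WordCompat d e i A B) (hL : wsubst h i A B = L)
    (hs : ¬ Even ((s : ℤ) * (r - (i : ℕ)) + weight B * (d + A.idxOf i))) :
    wordTerm k h d e i A B = Finsupp.single L (-1) := by
  rw [wordTerm, if_pos hc, hL, wordSign, ksign, if_neg hs]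

variable {k} in
theorem wordTerm_of_not {r s N : ℕ} (h : r + s = N) {d e : ℤ} {i : Fin (r + 1)}
    {A : List (Fin (r + 1))} {B : List (Fin (s + 1))} (hc : ¬ WordCompat d e i A B) :
    wordTerm k h d e i A B = 0 := by
  rw [wordTerm, if_neg hc]

/-- The bracket is minus the sum of "both inputs scalar" and "one input scalar, acting on the
other". In the bracket of a product only the word 0 of e is compatible, because the product is an
algebra element and the remaining input must be a scalar. The other relations are checked in the
same way, word by word. -/
theorem dualRelations_word : DualRelations (wordOperad k)
    (Finsupp.single [0, 1] 1 : List (Fin (1 + 1)) →₀ k)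
    (-(Finsupp.single [] 1 + (Finsupp.single [0] 1 + Finsupp.single [1] 1)) :
      List (Fin (1 + 1)) →₀ k) := by
  have hm : ∀ i d e, wordComp k (rfl : 1 + 1 = 2) d e i (Finsupp.single [0, 1] 1)
    (-(Finsupp.single [] 1 + (Finsupp.single [0] 1 + Finsupp.single [1] 1))) =
      -(wordTerm k rfl d e i [0, 1] [] + (wordTerm k rfl d e i [0, 1] [0] +
        wordTerm k rfl d e i [0, 1] [1])) := by
    intro i d e
    simp only [map_neg, map_add, wordComp_single, mul_one, one_smul]
  have he : wordComp k (rfl : 1 + 1 = 2) 1 0 0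
      (-(Finsupp.single [] 1 + (Finsupp.single [0] 1 + Finsupp.single [1] 1)))
      (Finsupp.single [0, 1] 1) = -Finsupp.single [0, 1] 1 := by
    simp only [map_neg, map_add, wordComp_single, mul_one, one_smul, LinearMap.add_apply,
      LinearMap.neg_apply]
    rw [wordTerm_of_not rfl (by decide), wordTerm_of_even rfl (L := [0, 1]) (by decide) (by decide)
      (by decide), wordTerm_of_not rfl (by decide), zero_add, add_zero]
  constructor
  · change wordAct k 1 _ _ = _
    simp only [map_neg, map_add, wordAct_single, psign_swap k (show (0 : Fin 2) ≠ 1 by decide),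
      neg_smul, one_smul]
    rw [← neg_add, ← neg_add, add_comm (Finsupp.single _ _) (Finsupp.single (List.map _ [1]) _)]
    rfl
  · change wordComp k (rfl : 1 + 1 = 2) _ _ _ _ _ = wordComp k (rfl : 1 + 1 = 2) _ _ _ _ _
    rw [wordComp_single, wordComp_single,
      wordTerm_of_odd rfl (L := [0, 1, 2]) (by decide) (by decide) (by decide),
      wordTerm_of_odd rfl (L := [0, 1, 2]) (by decide) (by decide) (by decide)]
  · change wordComp k (rfl : 1 + 1 = 2) _ _ _ _ _ =
      wordAct k 2 _ (wordComp k (rfl : 1 + 1 = 2) _ _ _ _ _) - wordAct k 2 _ (wordComp k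
          (rfl : 1 + 1 = 2) _ _ _ _ _)
    rw [hm, he, wordTerm_of_not rfl (by decide),
      wordTerm_of_odd rfl (L := [0, 2]) (by decide) (by decide) (by decide),
      wordTerm_of_odd rfl (L := [1, 2]) (by decide) (by decide) (by decide), map_neg, map_neg,
      wordAct_single, wordAct_single, psign_swap k (show (1 : Fin 3) ≠ 2 by decide),
      psign_finRotate_three, show List.map (Equiv.swap 1 2) [0, 1] = ([0, 2] : List
          (Fin 3)) by decide,
      show List.map (finRotate 3) [0, 1] = ([1, 2] : List (Fin 3)) by decide]
    simp only [Finsupp.single_neg, zero_add, neg_smul, one_smul]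
    abel
  · change wordComp k (rfl : 1 + 1 = 2) _ _ _ _ _ = wordComp k (rfl : 1 + 1 = 2) _ _ _ _ _ -
      wordAct k 2 _ (wordComp k (rfl : 1 + 1 = 2) _ _ _ _ _)
    rw [hm, he, wordTerm_of_not rfl (by decide),
      wordTerm_of_even rfl (L := [0, 1]) (by decide) (by decide) (by decide),
      wordTerm_of_even rfl (L := [0, 2]) (by decide) (by decide) (by decide), map_neg,
      wordAct_single, psign_swap k (show (1 : Fin 3) ≠ 2 by decide),
      show List.map (Equiv.swap 1 2) [0, 1] = ([0, 2] : List (Fin 3)) by decide]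
    simp only [zero_add, neg_smul, one_smul]
    abel
  · change wordAct k 2 _ (wordComp k (rfl : 1 + 1 = 2) _ _ _ _ _) = -wordComp k
        (rfl : 1 + 1 = 2) _ _ _ _ _
    simp only [map_neg, map_add, wordComp_single, mul_one, one_smul, LinearMap.add_apply,
      LinearMap.neg_apply]
    rw [wordTerm_of_odd rfl (A := []) (B := []) (L := []) (by decide) (by decide) (by decide),
      wordTerm_of_odd rfl (A := [1]) (B := []) (L := [2]) (by decide) (by decide) (by decide),
      wordTerm_of_odd rfl (A := [0]) (B := [0]) (L := [0]) (by decide) (by decide) (by decide),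
      wordTerm_of_odd rfl (A := [0]) (B := [1]) (L := [1]) (by decide) (by decide) (by decide),
      wordTerm_of_not rfl (A := []) (B := [0]) (by decide),
      wordTerm_of_not rfl (A := []) (B := [1]) (by decide),
      wordTerm_of_not rfl (A := [0]) (B := []) (by decide),
      wordTerm_of_not rfl (A := [1]) (B := [0]) (by decide),
      wordTerm_of_not rfl (A := [1]) (B := [1]) (by decide)]
    simp only [map_zero, map_neg, wordAct_single, psign_swap k (show (1 : Fin 3) ≠ 2 by decide),
      show List.map (Equiv.swap 1 2) [0] = ([0] : List (Fin 3)) by decide,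
      show List.map (Equiv.swap 1 2) [1] = ([2] : List (Fin 3)) by decide,
      show List.map (Equiv.swap 1 2) [2] = ([1] : List (Fin 3)) by decide, List.map_nil, neg_smul,
      one_smul, Finsupp.single_neg]
    abel

variable [CharZero k]

/-- The map from the Koszul dual to words. -/
def toWord : OperadHom (gerstDual k) (wordOperad k) :=
  quotientLift (freeToWord k) _ fun r d x hx => by
    obtain ⟨hx⟩ := hx
    refine orthRel_le_ker (freeToWord k) ?_ hx
    rw [freeToWord_mulS, freeToWord_braS]
    exact dualRelations_word k

theorem toWord_gerstDualGen {d : ℤ} (φ : Dual k ((gerstGen k).V 1 (-d))) :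
    (toWord k).toFun 1 d (gerstDualGen k φ) = sumWord k 1 (-d) (genValue k φ) :=
  rfl

theorem toWord_dualMul : (toWord k).toFun 1 0 (dualMul k) =
    (Finsupp.single [0, 1] 1 : List (Fin (1 + 1)) →₀ k) :=
  freeToWord_mulS k

theorem toWord_dualBra : (toWord k).toFun 1 1 (dualBra k) =
    (-(Finsupp.single [] 1 + (Finsupp.single [0] 1 + Finsupp.single [1] 1)) :
      List (Fin (1 + 1)) →₀ k) :=
  freeToWord_braS k

end ToWord

/-! ### Consequences of the relations in arity four -/

section ArityFour

variable {k : Type u} [Field k] {P : Operad k} {m : P.V 1 0} {e : P.V 1 1}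

theorem comp_act_left (P : Operad k) {r s N : ℕ} (h : r + s = N) {d c D : ℤ} (hd : d + c = D)
    (i : Fin (r + 1)) (σ : Equiv.Perm (Fin (r + 1))) (ρ : Equiv.Perm (Fin (N + 1)))
    (h₁ : ∀ l : Fin (s + 1), ρ (leafUpper h i l) = leafUpper h (σ i) l)
    (h₂ : ∀ j, j ≠ i → ρ (leafLower h i j) = leafLower h (σ i) (σ j))
    (f : P.V r d) (g : P.V s c) :
    P.comp h hd (σ i) (P.act r d σ f) g = P.act N D ρ (P.comp h hd i f g) := by
  have := P.equivariant h hd i σ 1 ρ (by simpa using h₁) h₂ f g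
  rwa [act_one_apply] at this

theorem comp_act_right (P : Operad k) {r s N : ℕ} (h : r + s = N) {d c D : ℤ} (hd : d + c = D)
    (i : Fin (r + 1)) (τ : Equiv.Perm (Fin (s + 1))) (ρ : Equiv.Perm (Fin (N + 1)))
    (h₁ : ∀ l : Fin (s + 1), ρ (leafUpper h i l) = leafUpper h i (τ l))
    (h₂ : ∀ j, j ≠ i → ρ (leafLower h i j) = leafLower h i j)
    (f : P.V r d) (g : P.V s c) :
    P.comp h hd i f (P.act s c τ g) = P.act N D ρ (P.comp h hd i f g) := by
  have := P.equivariant h hd i 1 τ ρ (by simpa using h₁) (by simpa using h₂) f g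
  rwa [act_one_apply] at this

theorem eq_of_map_eq (P : Operad k) {r : ℕ} {d : ℤ} {σ τ : Equiv.Perm (Fin (r + 1))} {x : P.V r d}
    (h : P.act r d σ x = P.act r d τ x) : P.act r d (σ⁻¹ * τ) x = x := by
  rw [← act_act, ← h, act_act, inv_mul_cancel, act_one_apply]

/-- The rotation of the first three of four letters. -/
def rotFour : Equiv.Perm (Fin (3 + 1)) := Equiv.swap 0 1 * Equiv.swap 1 2

/-- The exchange of the first two with the last two of four letters. -/
def blockFour : Equiv.Perm (Fin (3 + 1)) := Equiv.swap 0 2 * Equiv.swap 1 3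

namespace DualRelations

theorem comp_one (hR : DualRelations P m e) {d D : ℤ} (hd : 1 + d = D) (y : P.V 1 d) :
    P.comp (rfl : 1 + 1 = 2) hd 1 e y =
      -P.act 2 D (finRotate 3) (P.comp (rfl : 1 + 1 = 2) hd 0 e y) := by
  rw [comp_one_eq, hR.swap_bracket, map_neg, LinearMap.neg_apply, map_neg]

theorem parallel_last (P : Operad k) {r s t A B N : ℕ} (hA : r + s = A) (hAN : A + t = N)
    (hB : r + t = B) (hBN : B + s = N) {d e c dA dB D : ℤ} (hdA : d + e = dA) (hdAN : dA + c = D)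
    (hdB : d + c = dB) (hdBN : dB + e = D) (i j : Fin (r + 1)) (hij : i < j)
    (f : P.V r d) (g : P.V s e) (g' : P.V t c) (hec : e * c = 0) {i' : Fin (B + 1)}
    {j' : Fin (A + 1)} (hi : leafLower hB j i = i') (hj : leafLower hA i j = j') :
    P.comp hAN hdAN j' (P.comp hA hdA i f g) g' =
      P.comp hBN hdBN i' (P.comp hB hdB j f g') g := by
  rw [← hi, ← hj, P.parallel hA hAN hB hBN hdA hdAN hdB hdBN i j hij, hec, ksign_zero, one_smul]

/-- The composite `(x₀ x₁, x₂ x₃) ↦ [x₀ x₁, x₂ x₃]`. -/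
def quad (P : Operad k) (m : P.V 1 0) (e : P.V 1 1) : P.V 3 1 :=
  P.comp (rfl : 2 + 1 = 3) (add_zero 1) 2
    (P.comp (rfl : 1 + 1 = 2) (add_zero 1) 0 e m) m

theorem quad_eq : quad P m e = P.comp (rfl : 2 + 1 = 3) (add_zero 1) 0
    (P.comp (rfl : 1 + 1 = 2) (add_zero 1) 1 e m) m :=
  parallel_last P rfl rfl rfl rfl _ _ _ _ 0 1 (by decide) e m m (by norm_num) (by decide)
    (by decide)

theorem rotate_comp_zero (x : P.V 2 1) :
    P.comp (rfl : 2 + 1 = 3) (add_zero 1) 0 (P.act 2 1 (finRotate 3) x) m =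
      P.act 3 1 blockFour (P.comp (rfl : 2 + 1 = 3) (add_zero 1) 2 x m) := by
  have := comp_act_left P (rfl : 2 + 1 = 3) (add_zero 1) 2 (finRotate 3) blockFour (by decide)
    (by decide) x m
  rwa [show finRotate 3 2 = 0 by decide] at this

/-- Skewness of the outer bracket: exchanging its two arguments exchanges the pairs of inputs of the
two products. -/
theorem block_quad (hR : DualRelations P m e) : P.act 3 1 blockFour (quad P m e) = -quad P m e := by
  conv_rhs => rw [quad_eq, hR.comp_one, map_neg, LinearMap.neg_apply, rotate_comp_zero, neg_neg]
  rfl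

theorem bra_assoc (hR : DualRelations P m e) :
    P.comp (rfl : 2 + 1 = 3) (add_zero 1) 1 (P.comp (rfl : 1 + 1 = 2) (add_zero 1) 0 e m) m =
      P.comp (rfl : 2 + 1 = 3) (add_zero 1) 0 (P.comp (rfl : 1 + 1 = 2) (add_zero 1) 0 e m) m := by
  have h₀ := P.sequential (rfl : 1 + 1 = 2) (rfl : 2 + 1 = 3) (rfl : 1 + 1 = 2) (rfl : 1 + 2 = 3)
    (add_zero 1) (add_zero 1) (add_zero 0) (add_zero 1) 0 0 e m m
  have h₁ := P.sequential (rfl : 1 + 1 = 2) (rfl : 2 + 1 = 3) (rfl : 1 + 1 = 2) (rfl : 1 + 2 = 3)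
    (add_zero 1) (add_zero 1) (add_zero 0) (add_zero 1) 0 1 e m m
  rw [hR.assoc] at h₀
  exact h₁.symm.trans h₀

/-- By associativity ([x₀,x₁]x₂)x₃ = [x₀,x₁](x₂x₃). Both sides are expanded with the relation for a
bracket as left factor; the brackets of triple products cancel, and an identity between two
relabellings of [x₀x₁, x₂x₃] remains. -/
theorem swap_zero_two_quad (hR : DualRelations P m e) :
    P.act 3 1 (Equiv.swap 0 2) (quad P m e) = quad P m e := by
  set E := P.comp (rfl : 1 + 1 = 2) (add_zero 1) 0 e m with hE
  set T := P.comp (rfl : 2 + 1 = 3) (add_zero 1) 0 E m with hT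
  -- The expansion of [x₀x₁, x₂]x₃: a bracket of a triple product, and a bracket of two products
  -- whose sign `block_quad` corrects.
  have hmE : P.comp (rfl : 1 + 2 = 3) (zero_add 1) 0 m E =
      P.act 3 1 (Equiv.swap 2 3) T + quad P m e := by
    have := P.sequential (rfl : 1 + 1 = 2) (rfl : 2 + 1 = 3) (rfl : 1 + 1 = 2) (rfl : 1 + 2 = 3)
      (zero_add 1) (add_zero 1) (add_zero 1) (zero_add 1) 0 0 m e m
    rw [← hE, hR.bracket_left, map_sub, LinearMap.sub_apply] at this
    refine this.trans ?_
    have h₁ := comp_act_left P (rfl : 2 + 1 = 3) (add_zero 1) 0 (Equiv.swap 1 2) (Equiv.swap 2 3)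
      (by decide) (by decide) E m
    have h₂ := rotate_comp_zero (m := m) E
    have h₃ := hR.block_quad
    rw [sub_eq_add_neg]
    refine congrArg₂ (· + ·) h₁ ?_
    refine (congrArg Neg.neg h₂).trans ?_
    exact (congrArg Neg.neg h₃).trans (neg_neg _)
  have h₀ := P.sequential (rfl : 1 + 1 = 2) (rfl : 2 + 1 = 3) (rfl : 1 + 1 = 2) (rfl : 1 + 2 = 3)
    (add_zero 0) (zero_add 1) (zero_add 1) (zero_add 1) 0 0 m m e
  have h₁ := parallel_last P (rfl : 1 + 1 = 2) (rfl : 2 + 1 = 3) (rfl : 1 + 1 = 2)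
    (rfl : 2 + 1 = 3) (zero_add 1) (add_zero 1) (add_zero 0) (zero_add 1) 0 1 (by decide) m e m
    (by norm_num) (i' := 0) (j' := 2) (by decide) (by decide)
  rw [hR.assoc] at h₀
  have h := h₀.trans h₁.symm
  have ec := comp_act_left P (rfl : 2 + 1 = 3) (add_zero 1) 1 (Equiv.swap 1 2)
    (Equiv.swap 1 2 * Equiv.swap 2 3) (by decide) (by decide) E m
  have ed := comp_act_left P (rfl : 2 + 1 = 3) (add_zero 1) 1 (finRotate 3)
    (rotFour * Equiv.swap 2 3) (by decide) (by decide) E m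
  have e₁ := comp_act_right P (rfl : 1 + 2 = 3) (zero_add 1) 0 (Equiv.swap 1 2) (Equiv.swap 1 2)
    (by decide) (by decide) m E
  have e₂ := comp_act_right P (rfl : 1 + 2 = 3) (zero_add 1) 0 (finRotate 3) rotFour
    (by decide) (by decide) m E
  rw [hR.bra_assoc] at ec ed
  rw [hR.bracket_left, map_sub, map_sub, LinearMap.sub_apply, ← hE, e₁, e₂, hmE, map_add, map_add,
    act_act, act_act] at h
  have h' := h.trans (congrArg₂ (· - ·) ec ed)
  have h'' : P.act 3 1 (Equiv.swap 1 2) (quad P m e) = P.act 3 1 rotFour (quad P m e) := by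
    rw [add_sub_add_comm, add_eq_left, sub_eq_zero] at h'
    exact h'
  have := eq_of_map_eq P h''
  rwa [show (Equiv.swap 1 2)⁻¹ * rotFour = Equiv.swap 0 2 by decide] at this

/-- The mirror argument: x₀(x₁[x₂,x₃]) = (x₀x₁)[x₂,x₃], expanded with the bracket as right factor.
-/
theorem swap_one_three_quad (hR : DualRelations P m e) :
    P.act 3 1 (Equiv.swap 1 3) (quad P m e) = quad P m e := by
  set E := P.comp (rfl : 1 + 1 = 2) (add_zero 1) 0 e m with hE
  set T := P.comp (rfl : 2 + 1 = 3) (add_zero 1) 0 E m with hT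
  have hmE : P.comp (rfl : 1 + 2 = 3) (zero_add 1) 1 m E =
      T - P.act 3 1 (Equiv.swap 1 2 * Equiv.swap 1 3) (quad P m e) := by
    have := P.sequential (rfl : 1 + 1 = 2) (rfl : 2 + 1 = 3) (rfl : 1 + 1 = 2) (rfl : 1 + 2 = 3)
      (zero_add 1) (add_zero 1) (add_zero 1) (zero_add 1) 1 0 m e m
    rw [← hE, hR.bracket_right, map_sub, LinearMap.sub_apply] at this
    refine this.trans ?_
    have h₁ := comp_act_left P (rfl : 2 + 1 = 3) (add_zero 1) 2 (Equiv.swap 1 2)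
      (Equiv.swap 1 2 * Equiv.swap 1 3) (by decide) (by decide) E m
    exact congrArg₂ (· - ·) hR.bra_assoc h₁
  have h₀ := P.sequential (rfl : 1 + 1 = 2) (rfl : 2 + 1 = 3) (rfl : 1 + 1 = 2) (rfl : 1 + 2 = 3)
    (add_zero 0) (zero_add 1) (zero_add 1) (zero_add 1) 1 1 m m e
  have h₁ := parallel_last P (rfl : 1 + 1 = 2) (rfl : 2 + 1 = 3) (rfl : 1 + 1 = 2)
    (rfl : 2 + 1 = 3) (add_zero 0) (zero_add 1) (zero_add 1) (add_zero 1) 0 1 (by decide) m m e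
    (by norm_num) (i' := 0) (j' := 2) (by decide) (by decide)
  rw [← hR.assoc] at h₀
  have h := h₀.trans h₁
  have ec := comp_act_left P (rfl : 2 + 1 = 3) (add_zero 1) 0 (Equiv.swap 1 2)
    (Equiv.swap 2 3) (by decide) (by decide) E m
  have e₁ := comp_act_right P (rfl : 1 + 2 = 3) (zero_add 1) 1 (Equiv.swap 1 2) (Equiv.swap 2 3)
    (by decide) (by decide) m E
  rw [hR.bracket_right, map_sub, map_sub, LinearMap.sub_apply, ← hE, e₁, hmE, map_sub,
    act_act, ← hT] at h
  have h' := h.trans (congrArg (T - ·) ec)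
  have h'' : P.act 3 1 (Equiv.swap 1 2 * Equiv.swap 1 3) (quad P m e) =
      P.act 3 1 (Equiv.swap 2 3 * (Equiv.swap 1 2 * Equiv.swap 1 3)) (quad P m e) := by
    rw [sub_sub_sub_comm, sub_eq_self, sub_eq_zero] at h'
    exact h'
  have := eq_of_map_eq P h''
  rwa [show (Equiv.swap 1 2 * Equiv.swap 1 3)⁻¹ * (Equiv.swap 2 3 * (Equiv.swap 1 2 *
    Equiv.swap 1 3)) = (Equiv.swap 1 3 : Equiv.Perm (Fin (3 + 1))) by decide] at this

/-- Exchanging the two pairs of inputs is the composite of two exchanges that fix the element, yet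
it changes its sign; so twice the element is zero. -/
theorem quad_eq_zero [CharZero k] (hR : DualRelations P m e) : quad P m e = 0 := by
  have h := hR.block_quad
  rw [blockFour, ← act_act, hR.swap_one_three_quad, hR.swap_zero_two_quad] at h
  have h2 : (2 : k) • quad P m e = 0 := by rw [two_smul, ← eq_neg_iff_add_eq_zero, ← h]
  exact (smul_eq_zero_iff_right two_ne_zero).1 h2

end DualRelations

end ArityFour

/-! ### Skew elements -/

section Skew

variable {k : Type u} [Field k] (P : Operad k)

theorem comp_swap_right {r s N : ℕ} (h : r + s = N) {d c D : ℤ} (hd : d + c = D)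
    (i : Fin (r + 1)) (a b : Fin (s + 1)) (f : P.V r d) (g : P.V s c) :
    P.comp h hd i f (P.act s c (Equiv.swap a b) g) =
      P.act N D (Equiv.swap (leafUpper h i a) (leafUpper h i b)) (P.comp h hd i f g) := by
  refine comp_act_right P h hd i _ _ (fun l => ?_) (fun j hj => ?_) f g
  · exact ((leafUpper_injective h i).map_swap _ _ _).symm
  · exact Equiv.swap_apply_of_ne_of_ne (leafLower_ne_leafUpper h i hj _)
      (leafLower_ne_leafUpper h i hj _)

theorem comp_swap_left {r s N : ℕ} (h : r + s = N) {d c D : ℤ} (hd : d + c = D)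
    {i a b : Fin (r + 1)} (ha : a ≠ i) (hb : b ≠ i) (f : P.V r d) (g : P.V s c) :
    P.comp h hd i (P.act r d (Equiv.swap a b) f) g =
      P.act N D (Equiv.swap (leafLower h i a) (leafLower h i b)) (P.comp h hd i f g) := by
  have hi : Equiv.swap a b i = i := Equiv.swap_apply_of_ne_of_ne ha.symm hb.symm
  have := comp_act_left P h hd i (Equiv.swap a b)
    (Equiv.swap (leafLower h i a) (leafLower h i b)) (fun l => ?_) (fun j hj => ?_) f g
  · rwa [hi] at this
  · rw [hi]
    exact Equiv.swap_apply_of_ne_of_ne (leafLower_ne_leafUpper h i ha _).symm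
      (leafLower_ne_leafUpper h i hb _).symm
  · rw [hi]
    by_cases hja : j = a
    · rw [hja, Equiv.swap_apply_left, Equiv.swap_apply_left]
    by_cases hjb : j = b
    · rw [hjb, Equiv.swap_apply_right, Equiv.swap_apply_right]
    rw [Equiv.swap_apply_of_ne_of_ne hja hjb, Equiv.swap_apply_of_ne_of_ne
      (fun e => hja (leafLower_injOn h i hj ha e)) (fun e => hjb (leafLower_injOn h i hj hb e))]

variable {P}

/-- Transpositions of the inputs from the `t`-th on change the sign of `x`. -/
def SkewFrom (t : ℕ) {r : ℕ} {d : ℤ} (x : P.V r d) : Prop :=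
  ∀ a b : Fin (r + 1), t ≤ a → t ≤ b → a ≠ b → P.act r d (Equiv.swap a b) x = -x

/-- A permutation fixing the first t inputs restricts to the others, and there it is a product of
transpositions. -/
theorem SkewFrom.act_eq {t r : ℕ} {d : ℤ} {x : P.V r d} (hx : SkewFrom t x)
    {σ : Equiv.Perm (Fin (r + 1))} (hσ : ∀ a : Fin (r + 1), (a : ℕ) < t → σ a = a) :
    P.act r d σ x = psign k σ • x := by
  have h₁ : ∀ a : Fin (r + 1), t ≤ a ↔ t ≤ σ a := by
    intro a
    by_cases ha : (a : ℕ) < t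
    · rw [hσ a ha]
    · refine ⟨fun _ => ?_, fun _ => not_lt.1 ha⟩
      by_contra hn
      have := hσ (σ a) (not_le.1 hn)
      rw [σ.injective this] at hn
      exact ha (not_le.1 hn)
  have h₂ : ∀ a : Fin (r + 1), σ a ≠ a → t ≤ a := fun a ha => by
    by_contra hn
    exact ha (hσ a (not_le.1 hn))
  rw [← Equiv.Perm.ofSubtype_subtypePerm (p := fun a : Fin (r + 1) => t ≤ a) (fun a =>
      (h₁ a).symm) h₂]
  generalize σ.subtypePerm (p := fun a : Fin (r + 1) => t ≤ a) (fun a => (h₁ a).symm) = τ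
  induction τ using Equiv.Perm.swap_induction_on with
  | one => rw [map_one, act_one_apply, psign_one, one_smul]
  | swap_mul f a b hab ih =>
    have hab' : (a : Fin (r + 1)) ≠ b := fun h => hab (Subtype.ext h)
    rw [map_mul, ← act_act, ih, map_smul, Equiv.Perm.ofSubtype_swap_eq, hx a b a.2 b.2 hab',
        psign_mul,
      psign_swap k hab', smul_neg, neg_mul, one_mul, neg_smul]

/-- Grafting onto the first input of a binary operation leaves just one input outside the grafted
operation, namely the last. -/
theorem leaf_cases {s A : ℕ} (h : 1 + s = A) (i : Fin (A + 1)) :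
    (∃ i', i = leafUpper h 0 i') ∨ i = leafLower h 0 1 := by
  obtain ⟨a, rfl⟩ := (leafEquiv h 0).surjective i
  rcases a with ⟨a, ha⟩ | a
  · right
    rw [leafEquiv_inl]
    congr 1
    revert ha
    revert a
    decide
  · exact Or.inl ⟨a, rfl⟩

/-- Skewness among the inputs of x is inherited, so just one transposition involving the new input
has to be checked; the other ones are conjugate to it. -/
theorem SkewFrom.comp {t r N : ℕ} {d c D : ℤ} {x : P.V r d} (hx : SkewFrom t x) (h : 1 + r = N)
    (hd : c + d = D) (e : P.V 1 c) (ht : t ≤ r → P.act N D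
      (Equiv.swap (leafUpper h 0 (Fin.last r)) (leafLower h 0 1)) (P.comp h hd 0 e x) =
        -P.comp h hd 0 e x) : SkewFrom t (P.comp h hd 0 e x) := by
  have inner : ∀ a b : Fin (r + 1), t ≤ a → t ≤ b → a ≠ b → P.act N D
      (Equiv.swap (leafUpper h 0 a) (leafUpper h 0 b)) (P.comp h hd 0 e x) =
        -P.comp h hd 0 e x := by
    intro a b ha hb hab
    rw [← comp_swap_right, hx a b ha hb hab, map_neg]
  have outer : ∀ a : Fin (r + 1), t ≤ a → P.act N D
      (Equiv.swap (leafUpper h 0 a) (leafLower h 0 1)) (P.comp h hd 0 e x) =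
        -P.comp h hd 0 e x := by
    intro a ha
    have htr : t ≤ r := by omega
    by_cases hal : a = Fin.last r
    · rw [hal]
      exact ht htr
    · have hne : leafUpper h 0 (Fin.last r) ≠ leafLower h 0 1 :=
        (leafLower_ne_leafUpper h 0 (by decide) _).symm
      have hne' : leafUpper h 0 a ≠ leafLower h 0 1 :=
        (leafLower_ne_leafUpper h 0 (by decide) _).symm
      have hne'' : leafUpper h 0 (Fin.last r) ≠ leafUpper h 0 a :=
        fun e => hal (leafUpper_injective h 0 e).symm
      -- The exchange of a with the new input is the known exchange conjugated by that of a with the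
      -- last input of x; three minus signs result.
      rw [Equiv.swap_comm, ← Equiv.swap_mul_swap_mul_swap hne''.symm hne', ← act_act, ← act_act,
        ht htr, map_neg, inner a _ ha htr hal, neg_neg, ht htr]
  intro a b ha hb hab
  rcases leaf_cases h a with ⟨a, rfl⟩ | rfl <;> rcases leaf_cases h b with ⟨b, rfl⟩ | rfl
  · refine inner a b ?_ ?_ fun e => hab (congrArg _ e)
    · simpa [leafUpper_val] using ha
    · simpa [leafUpper_val] using hb
  · exact outer a (by simpa [leafUpper_val] using ha)
  · rw [Equiv.swap_comm]
    exact outer b (by simpa [leafUpper_val] using hb)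
  · exact absurd rfl hab

end Skew

/-! ### Standard elements -/

section Standard

variable {k : Type u} [Field k] (P : Operad k) (m : P.V 1 0) (e : P.V 1 1)

/-- The product of `r + 1` inputs. -/
def planarPow : ∀ r : ℕ, P.V r 0
  | 0 => 0
  | 1 => m
  | r + 2 => P.comp (show 1 + (r + 1) = r + 2 by omega) (add_zero 0) 0 m (planarPow (r + 1))

/-- The iterated bracket of `r + 1` inputs. -/
def spacePow : ∀ r : ℕ, P.V r r
  | 0 => 0
  | 1 => e
  | r + 2 => P.comp (show 1 + (r + 1) = r + 2 by omega)
      (show 1 + ((r + 1 : ℕ) : ℤ) = ((r + 2 : ℕ) : ℤ) by push_cast; ring) 0 e (spacePow (r + 1))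

/-- The iterated bracket of the product of `r + 1` inputs with `q` further inputs. -/
def mixedPow (r : ℕ) : ∀ q : ℕ, P.V (r + q) q
  | 0 => planarPow P m r
  | q + 1 => P.comp (show 1 + (r + q) = r + (q + 1) by omega)
      (show 1 + (q : ℤ) = ((q + 1 : ℕ) : ℤ) by push_cast; ring) 0 e (mixedPow r q)

/-- The relabellings of the iterated brackets. -/
inductive Std : ∀ {r : ℕ} {d : ℤ}, P.V r d → Prop
  | space (r : ℕ) (σ : Equiv.Perm (Fin (r + 1 + 1))) :
      Std (P.act (r + 1) ((r + 1 : ℕ) : ℤ) σ (spacePow P e (r + 1)))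
  | mixed (r q : ℕ) (σ : Equiv.Perm (Fin (r + 1 + q + 1))) :
      Std (P.act (r + 1 + q) q σ (mixedPow P m e (r + 1) q))

/-- The span of the standard elements. -/
def stdSpan (r : ℕ) (d : ℤ) : Submodule k (P.V r d) := Submodule.span k {x | Std P m e x}

variable {P m e}

theorem spacePow_mem (r : ℕ) : spacePow P e (r + 1) ∈ stdSpan P m e (r + 1) ((r + 1 : ℕ) : ℤ) := by
  have := Submodule.subset_span (R := k) (Std.space (m := m) (e := e) r 1)
  rwa [act_one_apply] at this

theorem mixedPow_mem (r q : ℕ) : mixedPow P m e (r + 1) q ∈ stdSpan P m e (r + 1 + q) q := by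
  have := Submodule.subset_span (R := k) (Std.mixed (m := m) (e := e) r q 1)
  rwa [act_one_apply] at this

theorem stdSpan_act {r : ℕ} {d : ℤ} (σ : Equiv.Perm (Fin (r + 1))) {x : P.V r d}
    (hx : x ∈ stdSpan P m e r d) : P.act r d σ x ∈ stdSpan P m e r d := by
  refine Submodule.span_induction (p := fun y _ => P.act r d σ y ∈ stdSpan P m e r d) ?_ ?_ ?_ ?_ hx
  · intro x hx
    cases hx with
    | space r τ => rw [act_act]; exact Submodule.subset_span (Std.space _ _)
    | mixed r q τ => rw [act_act]; exact Submodule.subset_span (Std.mixed _ _ _)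
  · rw [map_zero]; exact zero_mem _
  · intro x y _ _ hx hy; rw [map_add]; exact add_mem hx hy
  · intro c x _ hx; rw [map_smul]; exact Submodule.smul_mem _ _ hx

theorem stdSpan_bracket {r N : ℕ} (h : 1 + r = N) {d D : ℤ} (hd : 1 + d = D) {x : P.V r d}
    (hx : x ∈ stdSpan P m e r d) : P.comp h hd 0 e x ∈ stdSpan P m e N D := by
  refine Submodule.span_induction (p := fun y _ => P.comp h hd 0 e y ∈ stdSpan P m e N D)
    ?_ ?_ ?_ ?_ hx
  · intro x hx
    cases hx with
    | space r τ =>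
      obtain rfl : N = r + 1 + 1 := by omega
      obtain rfl : D = ((r + 1 + 1 : ℕ) : ℤ) := by push_cast at hd ⊢; omega
      obtain ⟨ρ, h₁, h₂⟩ := exists_blockPerm h 0 1 τ
      rw [comp_act_right P h hd 0 τ ρ h₁ h₂]
      exact Submodule.subset_span (Std.space (m := m) (e := e) (r + 1) ρ)
    | mixed r q τ =>
      obtain rfl : N = r + 1 + (q + 1) := by omega
      obtain rfl : D = ((q + 1 : ℕ) : ℤ) := by push_cast at hd ⊢; omega
      obtain ⟨ρ, h₁, h₂⟩ := exists_blockPerm h 0 1 τ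
      rw [comp_act_right P h hd 0 τ ρ h₁ h₂]
      exact Submodule.subset_span (Std.mixed (m := m) (e := e) r (q + 1) ρ)
  · rw [map_zero]; exact zero_mem _
  · intro x y _ _ hx hy; rw [map_add]; exact add_mem hx hy
  · intro c x _ hx; rw [map_smul]; exact Submodule.smul_mem _ _ hx

namespace DualRelations

/-- In [[Z, a], b] the exchange of a and b takes place inside the double bracket, which is skew by
`swap_bracket_bracket`. -/
theorem skew_top (hR : DualRelations P m e) {s A N : ℕ} {c dA D : ℤ} (hA : 1 + s = A)
    (hN : 1 + A = N) (hdA : 1 + c = dA)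
    (hd : 1 + dA = D) (Z : P.V s c) :
    P.act N D (Equiv.swap (leafUpper hN 0 (Fin.last A)) (leafLower hN 0 1))
      (P.comp hN hd 0 e (P.comp hA hdA 0 e Z)) = -P.comp hN hd 0 e (P.comp hA hdA 0 e Z) := by
  have hN' : 2 + s = N := by omega
  have h := P.sequential (rfl : 1 + 1 = 2) hN' hA hN (show (1 : ℤ) + 1 = 2 by norm_num)
    (show 2 + c = D by omega) hdA hd 0 0 e e Z
  rw [h]
  have h' := comp_swap_left P hN' (show 2 + c = D by omega) (i := 0) (a := 1) (b := 2) (by decide)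
    (by decide) (P.comp (rfl : 1 + 1 = 2) (show (1 : ℤ) + 1 = 2 by norm_num) 0 e e) Z
  rw [hR.swap_bracket_bracket, map_neg, LinearMap.neg_apply] at h'
  rw [show leafUpper (rfl : 1 + 1 = 2) 0 0 = 0 by decide]
  refine Eq.trans (congrArg (fun τ => P.act N D τ _) ?_) h'.symm
  congr 1
  · ext
    simp [leafUpper_val, leafLower_val]
    omega
  · ext
    simp [leafLower_val]
    omega

theorem skew_spacePow (hR : DualRelations P m e) (r : ℕ) : SkewFrom 0 (spacePow P e (r + 1)) := by
  induction r with
  | zero =>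
    intro a b _ _ hab
    have : Equiv.swap a b = Equiv.swap 0 1 := by
      revert a b
      change ∀ a b : Fin 2, _
      decide
    rw [this]
    exact hR.swap_bracket
  | succ r ih =>
    refine ih.comp _ _ e fun _ => ?_
    cases r with
    | zero => exact hR.swap_bracket_bracket
    | succ r => exact hR.skew_top _ _ _ _ _

/-- The first r + 1 inputs are the factors of the product and are not permuted. With fewer than two
further inputs there is nothing to check. -/
theorem skew_mixedPow (hR : DualRelations P m e) (r q : ℕ) : SkewFrom (r + 1)
    (mixedPow P m e r q) := by
  induction q with
  | zero =>
    intro a b ha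
    omega
  | succ q ih =>
    refine ih.comp _ _ e fun h => ?_
    cases q with
    | zero => omega
    | succ q => exact hR.skew_top _ _ _ _ _

end DualRelations

end Standard

/-! ### The standard elements span -/

section Closure

variable {k : Type u} [Field k] {P : Operad k} {m : P.V 1 0} {e : P.V 1 1}

/-- The span of the relabellings of an element. -/
def orbitSpan {r : ℕ} {d : ℤ} (x : P.V r d) : Submodule k (P.V r d) :=
  Submodule.span k (Set.range fun σ => P.act r d σ x)

theorem act_mem_orbitSpan {r : ℕ} {d : ℤ} (x : P.V r d) (σ : Equiv.Perm (Fin (r + 1))) :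
    P.act r d σ x ∈ orbitSpan x :=
  Submodule.subset_span ⟨σ, rfl⟩

theorem self_mem_orbitSpan {r : ℕ} {d : ℤ} (x : P.V r d) : x ∈ orbitSpan x := by
  have := act_mem_orbitSpan x 1
  rwa [act_one_apply] at this

theorem orbitSpan_act {r : ℕ} {d : ℤ} {x y : P.V r d} (σ : Equiv.Perm (Fin (r + 1)))
    (hy : y ∈ orbitSpan x) : P.act r d σ y ∈ orbitSpan x := by
  refine Submodule.span_induction (p := fun y _ => P.act r d σ y ∈ orbitSpan x) ?_ ?_ ?_ ?_ hy
  · rintro _ ⟨τ, rfl⟩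
    dsimp only
    rw [act_act]
    exact act_mem_orbitSpan _ _
  · rw [map_zero]; exact zero_mem _
  · intro x y _ _ hx hy; rw [map_add]; exact add_mem hx hy
  · intro c x _ hx; rw [map_smul]; exact Submodule.smul_mem _ _ hx

theorem comp_right_mem_orbitSpan {r s N : ℕ} (h : r + s = N) {d c D : ℤ} (hd : d + c = D)
    (i : Fin (r + 1)) (f : P.V r d) {x y : P.V s c} {z : P.V N D} (hy : y ∈ orbitSpan x)
    (hx : P.comp h hd i f x ∈ orbitSpan z) : P.comp h hd i f y ∈ orbitSpan z := by
  refine Submodule.span_induction (p := fun y _ => P.comp h hd i f y ∈ orbitSpan z) ?_ ?_ ?_ ?_ hy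
  · rintro _ ⟨τ, rfl⟩
    dsimp only
    obtain ⟨ρ, h₁, h₂⟩ := exists_blockPerm h i 1 τ
    rw [comp_act_right P h hd i τ ρ h₁ h₂]
    exact orbitSpan_act _ hx
  · rw [map_zero]; exact zero_mem _
  · intro x y _ _ hx hy; rw [map_add]; exact add_mem hx hy
  · intro c x _ hx; rw [map_smul]; exact Submodule.smul_mem _ _ hx

theorem exists_comp_act_left (P : Operad k) {r s N : ℕ} (h : r + s = N) {d c D : ℤ}
    (hd : d + c = D) (i : Fin (r + 1)) (σ : Equiv.Perm (Fin (r + 1))) (f : P.V r d) (g : P.V s c) :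
    ∃ ρ, P.comp h hd (σ i) (P.act r d σ f) g = P.act N D ρ (P.comp h hd i f g) := by
  obtain ⟨ρ, h₁, h₂⟩ := exists_blockPerm h i σ 1
  exact ⟨ρ, comp_act_left P h hd i σ ρ h₁ h₂ f g⟩

namespace DualRelations

/-- General associativity: the iterated product is defined with nested left factors, and inserting a
product at any place can be brought back to this form. -/
theorem planarPow_comp (hR : DualRelations P m e) (r : ℕ) (i : Fin (r + 1 + 1)) :
    P.comp (rfl : r + 1 + 1 = r + 2) (add_zero 0) i (planarPow P m (r + 1)) m =
      planarPow P m (r + 2) := by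
  induction r with
  | zero =>
    have hi : i = 0 ∨ i = 1 := by
      revert i
      decide
    rcases hi with rfl | rfl
    · rfl
    · exact hR.assoc.symm
  | succ r ih =>
    rcases leaf_cases (show 1 + (r + 1) = r + 2 by omega) i with ⟨i, rfl⟩ | rfl
    · refine (P.sequential _ _ (rfl : r + 1 + 1 = r + 2) (by omega) _ _ (add_zero 0)
          (add_zero 0) 0 i
        m _ m).symm.trans ?_
      rw [ih]
      rfl
    · refine (parallel_last P _ _ (rfl : 1 + 1 = 2) (by omega) _ _ (add_zero 0) (add_zero 0) 0 1
        (by decide) m _ m (by norm_num) (i' := 0) (by decide) rfl).trans ?_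
      rw [← hR.assoc]
      exact (P.sequential (rfl : 1 + 1 = 2) _ (show 1 + (r + 1) = r + 2 by omega)
        (show 1 + (r + 2) = r + 3 by omega) (add_zero 0) _ (add_zero 0) (add_zero 0) 0 0 m m _).symm

theorem bra_mul_planarPow (r : ℕ) (h : 2 + (r + 1) = r + 2 + 1) :
    P.comp h (add_zero 1) 0 (P.comp (rfl : 1 + 1 = 2) (add_zero 1) 0 e m)
      (planarPow P m (r + 1)) = mixedPow P m e (r + 2) 1 :=
  (P.sequential (rfl : 1 + 1 = 2) h (show 1 + (r + 1) = r + 2 by omega) (by omega)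
    (add_zero 1) (add_zero 1) (add_zero 0) (add_zero 1) 0 0 e m _).symm

/-- Brackets of two products vanish. -/
theorem quad_planarPow [CharZero k] (hR : DualRelations P m e) (r : ℕ) {N : ℕ} (h : 2 +
    (r + 1) = N) :
    P.comp h (add_zero 1) 2 (P.comp (rfl : 1 + 1 = 2) (add_zero 1) 0 e m) (planarPow P m (r + 1)) =
      0 := by
  cases r with
  | zero =>
    subst h
    exact hR.quad_eq_zero
  | succ r =>
    have h' : 3 + (r + 1) = N := by omega
    refine (P.sequential (rfl : 2 + 1 = 3) h' (show 1 + (r + 1) = r + 2 by omega) h (add_zero 1)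
      (add_zero 1) (add_zero 0) (add_zero 1) 2 0 _ m _).trans ?_
    have := hR.quad_eq_zero
    unfold quad at this
    rw [this, map_zero, LinearMap.zero_apply]

/-- The same vanishing with the long product in the first argument, which uses the other description
`quad_eq` of the bracket of two products. -/
theorem quad_planarPow_left [CharZero k] (hR : DualRelations P m e) (r : ℕ) {N : ℕ} (h : 2 +
    (r + 1) = N) :
    P.comp h (add_zero 1) 0 (P.comp (rfl : 1 + 1 = 2) (add_zero 1) 1 e m) (planarPow P m (r + 1)) =
      0 := by
  have hq := hR.quad_eq_zero
  rw [quad_eq] at hq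
  cases r with
  | zero =>
    subst h
    exact hq
  | succ r =>
    have h' : 3 + (r + 1) = N := by omega
    refine (P.sequential (rfl : 2 + 1 = 3) h' (show 1 + (r + 1) = r + 2 by omega) h (add_zero 1)
      (add_zero 1) (add_zero 0) (add_zero 1) 0 0 _ m _).trans ?_
    rw [hq, map_zero, LinearMap.zero_apply]

/-- For a product X of at least two inputs, [X, a]b expands into [Xb, a] and [ab, X]; the latter is
a bracket of two products and vanishes. -/
theorem mul_mixedPow [CharZero k] (hR : DualRelations P m e) (r : ℕ) :
    P.comp (show 1 + (r + 1 + 1) = r + 2 + 1 by omega) (zero_add 1) 0 m (mixedPow P m e (r + 1) 1) ∈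
      orbitSpan (mixedPow P m e (r + 2) 1) := by
  have h' : 2 + (r + 1) = r + 2 + 1 := by omega
  have h := P.sequential (rfl : 1 + 1 = 2) h' (show 1 + (r + 1) = r + 1 + 1 by omega)
    (show 1 + (r + 1 + 1) = r + 2 + 1 by omega) (zero_add 1) (add_zero 1) (add_zero 1) (zero_add 1)
    0 0 m e (planarPow P m (r + 1))
  refine (congrArg (· ∈ _) h).mpr ?_
  rw [hR.bracket_left, map_sub, LinearMap.sub_apply]
  refine sub_mem ?_ ?_
  · obtain ⟨ρ, hρ⟩ := exists_comp_act_left P h' (add_zero 1) 0 (Equiv.swap 1 2)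
      (P.comp (rfl : 1 + 1 = 2) (add_zero 1) 0 e m) (planarPow P m (r + 1))
    refine (congrArg (· ∈ _) hρ).mpr ?_
    rw [bra_mul_planarPow]
    exact act_mem_orbitSpan _ _
  · obtain ⟨ρ, hρ⟩ := exists_comp_act_left P h' (add_zero 1) 2 (finRotate 3)
      (P.comp (rfl : 1 + 1 = 2) (add_zero 1) 0 e m) (planarPow P m (r + 1))
    rw [show finRotate 3 2 = 0 by decide, hR.quad_planarPow, map_zero] at hρ
    refine (congrArg (· ∈ _) hρ).mpr (zero_mem _)

/-- Inside a product, a bracket can be moved outward past one factor after the other until the whole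
operation is a combination of brackets of one product with one input. -/
theorem planarPow_comp_bracket [CharZero k] (hR : DualRelations P m e) (r : ℕ) (i : Fin
    (r + 1 + 1)) :
    P.comp (rfl : r + 1 + 1 = r + 1 + 1) (zero_add 1) i (planarPow P m (r + 1)) e ∈
      orbitSpan (mixedPow P m e (r + 1) 1) := by
  induction r with
  | zero =>
    have hi : i = 0 ∨ i = 1 := by
      revert i
      decide
    rcases hi with rfl | rfl
    · refine (congrArg (· ∈ _) hR.bracket_left).mpr (sub_mem ?_ ?_)
      · exact act_mem_orbitSpan _ _
      · exact act_mem_orbitSpan _ _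
    · refine (congrArg (· ∈ _) hR.bracket_right).mpr (sub_mem ?_ ?_)
      · exact self_mem_orbitSpan _
      · exact act_mem_orbitSpan _ _
  | succ r ih =>
    rcases leaf_cases (show 1 + (r + 1) = r + 2 by omega) i with ⟨i, rfl⟩ | rfl
    · have h := P.sequential (show 1 + (r + 1) = r + 2 by omega) (rfl : r + 2 + 1 = r + 2 + 1)
        (rfl : r + 1 + 1 = r + 1 + 1) (by omega) (add_zero 0) (zero_add 1) (zero_add 1) (zero_add 1)
        0 i m (planarPow P m (r + 1)) e
      refine (congrArg (· ∈ _) h.symm).mpr ?_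
      exact comp_right_mem_orbitSpan _ _ 0 m (ih i) (hR.mul_mixedPow r)
    · have h := parallel_last P (show 1 + (r + 1) = r + 2 by omega) (rfl : r + 2 + 1 = r + 2 + 1)
        (rfl : 1 + 1 = 2) (by omega) (add_zero 0) (zero_add 1) (zero_add 1) (add_zero 1) 0 1
        (by decide) m (planarPow P m (r + 1)) e (by norm_num) (i' := 0) (by decide) rfl
      refine (congrArg (· ∈ _) h).mpr ?_
      rw [hR.bracket_right, map_sub, LinearMap.sub_apply, bra_mul_planarPow]
      refine sub_mem (self_mem_orbitSpan _) ?_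
      obtain ⟨ρ, hρ⟩ := exists_comp_act_left P (show 2 + (r + 1) = r + 2 + 1 by omega)
          (add_zero 1) 0
        (Equiv.swap 1 2) (P.comp (rfl : 1 + 1 = 2) (add_zero 1) 0 e m) (planarPow P m (r + 1))
      refine (congrArg (· ∈ _) hρ).mpr ?_
      rw [bra_mul_planarPow]
      exact act_mem_orbitSpan _ _

theorem orbitSpan_le_stdSpan (r q : ℕ) :
    orbitSpan (mixedPow P m e (r + 1) q) ≤ stdSpan P m e (r + 1 + q) q := by
  refine Submodule.span_le.2 ?_
  rintro _ ⟨σ, rfl⟩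
  exact Submodule.subset_span (Std.mixed _ _ _)

/-- Right composition with `y` preserves the span of the standard elements. -/
def RightStable (P : Operad k) (m : P.V 1 0) (e : P.V 1 1) {r : ℕ} {d c : ℤ} (x : P.V r d)
    (y : P.V 1 c) : Prop :=
  ∀ (i : Fin (r + 1)) {D : ℤ} (hd : d + c = D),
    P.comp (rfl : r + 1 = r + 1) hd i x y ∈ stdSpan P m e (r + 1) D

/-- If x is skew under the exchange of two inputs, then grafting at either of them gives the same
element up to sign and relabelling. -/
theorem comp_mem_of_swap {r N : ℕ} {d c D : ℤ} (h : r + 1 = N) (hd : d + c = D)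
    {x : P.V r d} {y : P.V 1 c} {a b : Fin (r + 1)} (hx : P.act r d (Equiv.swap a b) x = -x)
    (ha : P.comp h hd a x y ∈ stdSpan P m e N D) : P.comp h hd b x y ∈ stdSpan P m e N D := by
  obtain ⟨ρ, hρ⟩ := exists_comp_act_left P h hd a (Equiv.swap a b) x y
  rw [Equiv.swap_apply_left, hx, map_neg, LinearMap.neg_apply, neg_eq_iff_eq_neg] at hρ
  rw [hρ]
  exact neg_mem (stdSpan_act _ ha)

/-- Grafting into [x, a] either happens inside x, where induction applies and the outer bracket
stays standard, or at the new input a, which is left as a hypothesis. -/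
theorem rightStable_bracket_comp {r N : ℕ} {d c D' : ℤ} (h : 1 + r = N) (hd : 1 + d = D')
    {x : P.V r d} {y : P.V 1 c} (hx : RightStable P m e x y)
    (hlast : ∀ {D : ℤ} (hD : D' + c = D), P.comp (rfl : N + 1 = N + 1) hD
      (leafLower h 0 1) (P.comp h hd 0 e x) y ∈ stdSpan P m e (N + 1) D) :
    RightStable P m e (P.comp h hd 0 e x) y := by
  intro i D hD
  rcases leaf_cases h i with ⟨i, rfl⟩ | rfl
  · rw [← P.sequential h rfl (rfl : r + 1 = r + 1) (by omega) hd hD rfl (by omega) 0 i e x y]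
    exact stdSpan_bracket _ _ (hx i rfl)
  · exact hlast hD

theorem comp_last_mem_of_swap {r N : ℕ} {d c D' : ℤ} (h : 1 + r = N) (hd : 1 + d = D')
    {x : P.V r d} {y : P.V 1 c} (hx : RightStable P m e x y)
    (hs : P.act N D' (Equiv.swap (leafUpper h 0 (Fin.last r)) (leafLower h 0 1))
      (P.comp h hd 0 e x) = -P.comp h hd 0 e x) {D : ℤ} (hD : D' + c = D) :
    P.comp (rfl : N + 1 = N + 1) hD (leafLower h 0 1) (P.comp h hd 0 e x) y ∈
      stdSpan P m e (N + 1) D := by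
  refine comp_mem_of_swap rfl hD hs ?_
  rw [← P.sequential h rfl (rfl : r + 1 = r + 1) (by omega) hd hD rfl (by omega) 0 _ e x y]
  exact stdSpan_bracket _ _ (hx _ rfl)

/-- With two or more space inputs, skewness replaces grafting at the last one by grafting at an
earlier one. A single space input has no such partner; `h₁` isolates this case. -/
theorem rightStable_mixedPow (hR : DualRelations P m e) (r q : ℕ) {c : ℤ} {y : P.V 1 c}
    (h₀ : RightStable P m e (planarPow P m (r + 1)) y)
    (h₁ : ∀ {N : ℕ} (hN : r + 1 + 1 + 1 = N) {D D' : ℤ} (hD' : 1 + 0 = D') (hD : D' + c = D),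
      P.comp hN hD (leafLower (show 1 + (r + 1) = r + 1 + 1 by omega) 0 1)
        (P.comp (show 1 + (r + 1) = r + 1 + 1 by omega) hD' 0 e (planarPow P m (r + 1))) y ∈
          stdSpan P m e N D) :
    RightStable P m e (mixedPow P m e (r + 1) q) y := by
  induction q with
  | zero => exact h₀
  | succ q ih =>
    refine rightStable_bracket_comp _ _ ih fun hD => ?_
    cases q with
    | zero => exact h₁ rfl _ hD
    | succ q => exact comp_last_mem_of_swap _ _ ih (hR.skew_top _ _ _ _ _) hD

theorem rightStable_spacePow (hR : DualRelations P m e) (r : ℕ) {c : ℤ} {y : P.V 1 c}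
    (h₀ : RightStable P m e e y) : RightStable P m e (spacePow P e (r + 1)) y := by
  induction r with
  | zero => exact h₀
  | succ r ih =>
    refine rightStable_bracket_comp _ _ ih fun hD => comp_last_mem_of_swap _ _ ih ?_ hD
    cases r with
    | zero => exact hR.swap_bracket_bracket
    | succ r => exact hR.skew_top _ _ _ _ _

end DualRelations

end Closure

/-! ### Spanning of the Koszul dual by standard elements -/

section Spanning

variable {k : Type u} [Field k] {P : Operad k} {m : P.V 1 0} {e : P.V 1 1}

namespace DualRelations

theorem rightStable_bracket (hR : DualRelations P m e) {c : ℤ} {y : P.V 1 c}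
    (hy : ∀ {D : ℤ} (hd : 1 + c = D), P.comp (rfl : 1 + 1 = 2) hd 0 e y ∈ stdSpan P m e 2 D) :
    RightStable P m e e y := by
  intro i D hd
  have hi : i = 0 ∨ i = 1 := by
    revert i
    decide
  rcases hi with rfl | rfl
  · exact hy hd
  · refine (congrArg (· ∈ _) (hR.comp_one hd y)).mpr (neg_mem (stdSpan_act _ (hy hd)))

/-- The double bracket is skew in all three inputs, so the even rotation that relates the two
composites acts trivially, and only the sign from the skewness of e remains. -/
theorem comp_bracket_bracket (hR : DualRelations P m e) :
    P.comp (rfl : 1 + 1 = 2) (show (1 : ℤ) + 1 = 2 by norm_num) 1 e e =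
      -P.comp (rfl : 1 + 1 = 2) (show (1 : ℤ) + 1 = 2 by norm_num) 0 e e := by
  have h := (hR.skew_spacePow 1).act_eq (σ := finRotate 3) fun a ha => by omega
  rw [psign_finRotate_three, one_smul] at h
  rw [hR.comp_one]
  exact congrArg Neg.neg h

/-- Products inserted into a product are absorbed by associativity. At a single space input they
give a bracket of two products, which vanishes. -/
theorem rightStable_mul [CharZero k] (hR : DualRelations P m e) :
    (∀ r, RightStable P m e (spacePow P e (r + 1)) m) ∧
      ∀ r q, RightStable P m e (mixedPow P m e (r + 1) q) m := by
  refine ⟨fun r => hR.rightStable_spacePow r (hR.rightStable_bracket ?_), fun r q =>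
    hR.rightStable_mixedPow r q ?_ ?_⟩
  · rintro D rfl
    exact mixedPow_mem 0 1
  · rintro i D rfl
    refine (congrArg (· ∈ _) (hR.planarPow_comp r i)).mpr ?_
    exact mixedPow_mem (r + 1) 0
  · rintro N hN D D' hD' rfl
    have h := parallel_last P (show 1 + (r + 1) = r + 1 + 1 by omega) hN (rfl : 1 + 1 = 2)
        (by omega)
      hD' rfl (add_zero 1) (by omega) 0 1 (by decide) e (planarPow P m (r + 1)) m (by norm_num)
      (i' := 0) (by decide) rfl
    rw [h]
    obtain rfl : D' = 1 := by omega
    refine (congrArg (· ∈ _) (hR.quad_planarPow_left r _)).mpr (zero_mem _)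

/-- A bracket inserted into a product is handled by `planarPow_comp_bracket`; at a single space
input, [X, [a, b]] = −[[X, a], b] up to labelling. -/
theorem rightStable_bra [CharZero k] (hR : DualRelations P m e) :
    (∀ r, RightStable P m e (spacePow P e (r + 1)) e) ∧
      ∀ r q, RightStable P m e (mixedPow P m e (r + 1) q) e := by
  refine ⟨fun r => hR.rightStable_spacePow r (hR.rightStable_bracket ?_), fun r q =>
    hR.rightStable_mixedPow r q ?_ ?_⟩
  · rintro D rfl
    exact spacePow_mem 1
  · rintro i D rfl
    exact orbitSpan_le_stdSpan r 1 (hR.planarPow_comp_bracket r i)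
  · rintro N rfl D D' hD' rfl
    obtain rfl : D' = 1 := by omega
    have h := parallel_last P (show 1 + (r + 1) = r + 1 + 1 by omega) rfl (rfl : 1 + 1 = 2)
        (by omega)
      hD' rfl (show (1 : ℤ) + 1 = 2 by norm_num) (by omega) 0 1 (by decide) e
      (planarPow P m (r + 1)) e (by norm_num) (i' := 0) (by decide) rfl
    refine (congrArg (· ∈ _) h).mpr ?_
    rw [hR.comp_bracket_bracket, map_neg, LinearMap.neg_apply]
    refine neg_mem ?_
    refine (congrArg (· ∈ _) (P.sequential (rfl : 1 + 1 = 2) (by omega)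
      (show 1 + (r + 1) = r + 1 + 1 by omega) (show 1 + (r + 1 + 1) = r + 1 + 1 + 1 by omega)
      (show (1 : ℤ) + 1 = 2 by norm_num) (by norm_num) (add_zero 1)
      (show (1 : ℤ) + 1 = 1 + 1 by norm_num) 0 0 e e (planarPow P m (r + 1)))).mp ?_
    exact mixedPow_mem r 2

theorem stdSpan_comp {r N : ℕ} (h : r + 1 = N)
    {d c D : ℤ} (hd : d + c = D) (i : Fin (r + 1)) {x : P.V r d} (hx : x ∈ stdSpan P m e r d)
    {y : P.V 1 c} (hy : (∀ r, RightStable P m e (spacePow P e (r + 1)) y) ∧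
      ∀ r q, RightStable P m e (mixedPow P m e (r + 1) q) y) :
    P.comp h hd i x y ∈ stdSpan P m e N D := by
  subst h
  refine Submodule.span_induction (p := fun x _ => ∀ i, P.comp rfl hd i x y ∈
    stdSpan P m e (r + 1) D) ?_ ?_ ?_ ?_ hx i
  · intro x hx i
    cases hx with
    | space r σ =>
      obtain ⟨ρ, hρ⟩ := exists_comp_act_left P rfl hd (σ⁻¹ i) σ (spacePow P e (r + 1)) y
      rw [show σ (σ⁻¹ i) = i from σ.apply_symm_apply i] at hρ
      rw [hρ]
      exact stdSpan_act _ (hy.1 r _ hd)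
    | mixed r q σ =>
      obtain ⟨ρ, hρ⟩ := exists_comp_act_left P rfl hd (σ⁻¹ i) σ (mixedPow P m e (r + 1) q) y
      rw [show σ (σ⁻¹ i) = i from σ.apply_symm_apply i] at hρ
      rw [hρ]
      exact stdSpan_act _ (hy.2 r q _ hd)
  · intro i
    rw [map_zero, LinearMap.zero_apply]
    exact zero_mem _
  · intro x y _ _ hx hy i
    rw [map_add, LinearMap.add_apply]
    exact add_mem (hx i) (hy i)
  · intro c x _ hx i
    rw [map_smul, LinearMap.smul_apply]
    exact Submodule.smul_mem _ _ (hx i)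

end DualRelations

theorem gen_subsingleton_of_ne (k : Type u) [Field k] {r : ℕ} (hr : r ≠ 1) (d : ℤ) :
    Subsingleton ((gerstGen k).V r d) := by
  have : IsEmpty {c : Corolla r // r = 1 ∧ c.degree = d} := ⟨fun ⟨_, h, _⟩ => hr h⟩
  exact inferInstanceAs (Subsingleton ({c : Corolla r // r = 1 ∧ c.degree = d} →₀ k))

/-- The dual generators are spanned by the relabelled product and by the bracket. The formulation
with a family of subspaces in all arities and degrees allows use with the generation principle
`mem_of_generators`. -/
theorem hatDual_mem (k : Type u) [Field k]
    (U : ∀ r d, Submodule k ((gerstGen k).hatDual.V r d))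
    (hmul : ∀ τ : Equiv.Perm (Fin (1 + 1)), (gerstGen k).hatDual.act 1 0 τ
      (dualVec k mulCorolla mulCorolla_degree) ∈ U 1 0)
    (hbra : dualVec k braCorolla braCorolla_degree ∈ U 1 1) (r : ℕ) (d : ℤ)
    (φ : (gerstGen k).hatDual.V r d) : φ ∈ U r d := by
  by_cases hr : r = 1
  · subst hr
    by_cases h₀ : -d = 0
    · obtain rfl : d = 0 := by omega
      have h := (mulBasis k h₀).sum_dual_apply_smul_coord (show Dual k ((gerstGen k).V 1
          (-0)) from φ)
      rw [← h]
      refine Submodule.sum_mem _ fun τ _ => Submodule.smul_mem _ _ ?_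
      have := Submodule.smul_mem _ (psign k τ) (hmul τ)
      rw [hatDual_act_dualVec, smul_smul, psign_sq, one_smul] at this
      rw [mulBasis_coord]
      exact this
    by_cases h₁ : -d = -1
    · obtain rfl : d = 1 := by omega
      have h := (braBasis k h₁).sum_dual_apply_smul_coord (show Dual k ((gerstGen k).V 1
          (-1)) from φ)
      rw [← h]
      refine Submodule.sum_mem _ fun τ _ => Submodule.smul_mem _ _ ?_
      rw [braBasis_coord]
      exact hbra
    · have := gen_subsingleton k h₀ h₁
      have h : φ = 0 := LinearMap.ext fun x => by
        rw [Subsingleton.elim x 0]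
        exact (map_zero _).trans (map_zero _).symm
      rw [h]
      exact zero_mem _
  · have := gen_subsingleton_of_ne k hr (-d)
    have h : φ = 0 := LinearMap.ext fun x => by
      rw [Subsingleton.elim x 0]
      exact (map_zero _).trans (map_zero _).symm
    rw [h]
    exact zero_mem _

/-- Since the operad is generated by m and e, stability of the span under relabelling and under
grafting m and e on top is enough. -/
theorem mem_stdSpan (k : Type u) [Field k] [CharZero k] {r : ℕ} {d : ℤ} (x : (gerstDual k).V r d) :
    x ∈ stdSpan (gerstDual k) (dualMul k) (dualBra k) r d := by
  have hR := dualRelations_gerstDual k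
  refine mem_of_generators (dualProj k) (fun r d => Submodule.mkQ_surjective _)
    (stdSpan (gerstDual k) (dualMul k) (dualBra k)) ?_ (fun _ _ σ _ hx => stdSpan_act σ hx) ?_ x
  · refine hatDual_mem k (fun r d => (stdSpan (gerstDual k) (dualMul k) (dualBra k) r d).comap
      (((dualProj k).toFun r d).comp (ι _))) ?_ ?_
    · intro τ
      rw [Submodule.mem_comap, LinearMap.comp_apply, ι_act, (dualProj k).map_act]
      exact stdSpan_act _ (mixedPow_mem 0 0)
    · exact spacePow_mem 0
  · intro r s N h d c D hd i x y hx
    -- The arity and degree equations depend on the grafted generator, so they are built into the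
    -- subspace as an intersection over all their proofs.
    have key := hatDual_mem k (fun s c => ⨅ (D : ℤ) (hd : d + c = D) (h : r + s = N),
      (stdSpan (gerstDual k) (dualMul k) (dualBra k) N D).comap
        (((gerstDual k).comp h hd i x).comp (((dualProj k).toFun s c).comp (ι _)))) ?_ ?_ s c y
    · simp only [Submodule.mem_iInf] at key
      exact key D hd h
    · intro τ
      simp only [Submodule.mem_iInf]
      intro D hd h
      rw [Submodule.mem_comap, LinearMap.comp_apply, LinearMap.comp_apply, ι_act,
        (dualProj k).map_act]
      obtain ⟨ρ, h₁, h₂⟩ := exists_blockPerm h i 1 τ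
      rw [comp_act_right _ h hd i τ ρ h₁ h₂]
      exact stdSpan_act _ (DualRelations.stdSpan_comp h hd i hx hR.rightStable_mul)
    · simp only [Submodule.mem_iInf]
      intro D hd h
      exact DualRelations.stdSpan_comp h hd i hx hR.rightStable_bra

end Spanning

/-! ### Values of the standard elements -/

section Values

variable (k : Type u) [Field k]

/-- The word of a corolla at which it is detected. -/
def Corolla.word {r : ℕ} : Corolla r → List (Fin (r + 1))
  | .space _ => []
  | .mixed _ _ f => List.ofFn f

theorem Corolla.word_smul {r : ℕ} (σ : Equiv.Perm (Fin (r + 1))) (c : Corolla r) :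
    (σ • c).word = c.word.map σ := by
  cases c with
  | space hr => rfl
  | mixed p hp f => exact (List.map_ofFn (f := f) (g := σ)).symm

theorem Corolla.word_injective {r : ℕ} : Function.Injective (Corolla.word (r := r)) := by
  rintro (hr | ⟨p, hp, f⟩) (hr' | ⟨p', hp', f'⟩) h
  · rfl
  · have := congrArg List.length h
    simp only [Corolla.word, List.length_nil, List.length_ofFn] at this
    omega
  · have := congrArg List.length h
    simp only [Corolla.word, List.length_nil, List.length_ofFn] at this
    omega
  · have := congrArg List.length h
    simp only [Corolla.word, List.length_ofFn] at this
    subst this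
    rw [DFunLike.coe_injective (List.ofFn_injective h)]

/-- The coefficient of a corolla at its word. -/
def Corolla.coeff {r : ℕ} : Corolla r → k
  | .space _ => -1
  | .mixed _ _ _ => 1

theorem Corolla.coeff_sq {r : ℕ} (c : Corolla r) : c.coeff k * c.coeff k = 1 := by
  cases c <;> simp [Corolla.coeff]

open Classical in
-- Words of corollas with planar inputs have length at least two and determine the corolla, while
-- the space corolla involves only shorter words. So the matrix of coefficients is diagonal with
-- entries ±1.
theorem corollaWord_apply_word {r : ℕ} (c c' : Corolla r) :
    corollaWord k c c'.word = if c = c' then c.coeff k else 0 := by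
  cases c with
  | mixed p hp f =>
    change (Finsupp.single (Corolla.word (.mixed p hp f)) (1 : k)) c'.word = _
    rw [Finsupp.single_apply]
    simp only [Corolla.word_injective.eq_iff]
    rfl
  | space hr =>
    change (-(Finsupp.single [] 1 + ∑ j, Finsupp.single [j] 1) : List (Fin
        (r + 1)) →₀ k) c'.word = _
    rw [Finsupp.neg_apply, Finsupp.add_apply, Finsupp.finsetSum_apply]
    cases c' with
    | space hr' => simp [Corolla.word, Corolla.coeff]
    | mixed p hp f =>
      have h₁ : ([] : List (Fin (r + 1))) ≠ List.ofFn f := fun h => by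
        have := congrArg List.length h
        simp only [List.length_nil, List.length_ofFn] at this
        omega
      have h₂ : ∀ j, [j] ≠ List.ofFn f := fun j h => by
        have := congrArg List.length h
        simp only [List.length_cons, List.length_nil, List.length_ofFn] at this
        omega
      simp only [Corolla.word, Finsupp.single_apply, h₁, h₂, if_false, Finset.sum_const_zero,
        reduceCtorEq, add_zero, neg_zero]

/-- The first `r + 1` of `N + 1` letters. -/
def initEmb {r N : ℕ} (h : r ≤ N) : Fin (r + 1) ↪ Fin (N + 1) := Fin.castLEEmb (by omega)

theorem ofFn_initEmb_nodup {r N : ℕ} (h : r ≤ N) : (List.ofFn (initEmb h)).Nodup :=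
  List.nodup_ofFn.2 (initEmb h).injective

/-- The compatible pairs are ∅ with ∅, the new letter 1 with ∅, and the letter 0 with a single
letter. They produce each word of length at most one exactly once, with a common sign because all
weights are zero. -/
theorem wordComp_space {s N : ℕ} (h : 1 + s = N) :
    wordComp k h 1 s 0
      (Finsupp.single [] 1 + (Finsupp.single [0] 1 + Finsupp.single [1] 1))
      (Finsupp.single [] 1 + ∑ j, Finsupp.single [j] 1) =
    ksign k s • (Finsupp.single [] 1 + ∑ j, Finsupp.single [j] 1) := by
  obtain rfl : N = s + 1 := by omega
  have sign : ∀ (A : List (Fin 2)) (B : List (Fin (s + 1))), B.length ≤ 1 →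
      wordSign k (r := 1) 1 0 A B = ksign k s := by
    intro A B hB
    simp [wordSign, weight, Nat.sub_eq_zero_of_le hB]
  have term : ∀ (A : List (Fin 2)) (B : List (Fin (s + 1))), A.length ≤ 1 → B.length ≤ 1 →
      ((0 : Fin 2) ∈ A ↔ B ≠ []) →
      wordTerm k h 1 s 0 A B = ksign k s • Finsupp.single (wsubst h 0 A B) 1 := by
    intro A B hA hB h₀
    rw [wordTerm, if_pos, sign A B hB, Finsupp.smul_single, smul_eq_mul, mul_one]
    refine ⟨?_, ?_, h₀, ?_, ?_⟩
    · exact List.nodup_iff_count_le_one.2 fun a => (List.count_le_length).trans hA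
    · exact List.nodup_iff_count_le_one.2 fun a => (List.count_le_length).trans hB
    · simp [weight, Nat.sub_eq_zero_of_le hA]
    · simp [weight, Nat.sub_eq_zero_of_le hB]
  have none : ∀ (A : List (Fin 2)) (B : List (Fin (s + 1))), ¬ ((0 : Fin 2) ∈ A ↔ B ≠ []) →
      wordTerm k h 1 s 0 A B = 0 := fun A B h₀ => wordTerm_of_not h fun hc => h₀ hc.2.2.1
  simp only [map_add, map_sum, LinearMap.add_apply, wordComp_single, one_mul, one_smul]
  rw [term [] [] (by simp) (by simp) (by simp), term [1] [] (by simp) (by simp) (by simp),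
    none [0] [] (by simp)]
  simp only [none [] [_] (by simp), none [1] [_] (by simp),
    term [0] [_] (by simp) (by simp) (by simp)]
  have h₀ : ∀ j, wsubst h 0 [0] [j] = [j.castSucc] := fun j => by
    refine congrArg (fun j => [j]) (Fin.ext ?_)
    simp [leafUpper_val]
  have h₁ : wsubst h 0 [1] [] = [Fin.last (s + 1)] := by
    refine congrArg (fun j => [j]) (Fin.ext ?_)
    simp [leafLower_val]
    omega
  simp only [h₀, h₁, show wsubst h 0 [] [] = [] from rfl, Fin.sum_univ_castSucc (n := s + 1),
    add_zero, zero_add, smul_add, Finset.smul_sum]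
  abel

variable [CharZero k]

theorem toWord_comp {r s N : ℕ} (h : r + s = N) {d e D : ℤ} (hd : d + e = D) (i : Fin (r + 1))
    (x : (gerstDual k).V r d) (y : (gerstDual k).V s e) :
    (toWord k).toFun N D ((gerstDual k).comp h hd i x y) =
      wordComp k h d e i ((toWord k).toFun r d x) ((toWord k).toFun s e y) :=
  (toWord k).map_comp h hd i x y

theorem toWord_planarPow (r : ℕ) : ∃ a : k, a ≠ 0 ∧
    (toWord k).toFun (r + 1) 0 (planarPow (gerstDual k) (dualMul k) (r + 1)) =
      (Finsupp.single (List.ofFn (initEmb (le_refl (r + 1)))) a : List (Fin (r + 1 + 1)) →₀ k) := by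
  induction r with
  | zero => exact ⟨1, one_ne_zero, toWord_dualMul k⟩
  | succ r ih =>
    obtain ⟨a, ha, h⟩ := ih
    refine ⟨a * wordSign k (r := 1) 0 0 [0, 1] (List.ofFn (initEmb (le_refl (r + 1)))),
      mul_ne_zero ha (ksign_ne_zero k _), ?_⟩
    refine (toWord_comp k (show 1 + (r + 1) = r + 2 by omega) (add_zero 0) 0 _ _).trans ?_
    rw [h, toWord_dualMul, wordComp_single, wordTerm, if_pos]
    · rw [one_mul, Finsupp.smul_single, smul_eq_mul]
      congr 1
      rw [wsubst_cons_self, wsubst_cons_of_ne _ _ (show (1 : Fin 2) ≠ 0 by decide), List.map_ofFn]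
      refine Eq.trans ?_ (List.ofFn_succ' (initEmb _)).symm
      rw [List.concat_eq_append]
      refine congrArg₂ (· ++ ·) (congrArg List.ofFn (funext fun j => Fin.ext ?_))
        (congrArg (fun j => [j]) (Fin.ext ?_))
      · simp [leafUpper_val, initEmb]
      · simp [leafLower_val, initEmb]
        omega
    · refine ⟨by decide, ofFn_initEmb_nodup _, ?_, by decide, ?_⟩
      · simp
      · simp [weight]

/-- Bracketing with a further input leaves the word unchanged up to sign: the inner operation has a
non-empty word, so of the three words of the bracket only 0 is compatible. The scalar need only be
non-zero, as the basis is normalized afterwards. -/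
theorem toWord_mixedPow (r q : ℕ) : ∃ a : k, a ≠ 0 ∧
    (toWord k).toFun (r + 1 + q) q (mixedPow (gerstDual k) (dualMul k) (dualBra k) (r + 1) q) =
      (Finsupp.single (List.ofFn (initEmb (Nat.le_add_right (r + 1) q))) a :
        List (Fin (r + 1 + q + 1)) →₀ k) := by
  induction q with
  | zero => exact toWord_planarPow k r
  | succ q ih =>
    obtain ⟨a, ha, h⟩ := ih
    refine ⟨-a * wordSign k (r := 1) 1 0 [0] (List.ofFn (initEmb (Nat.le_add_right (r + 1) q))),
      mul_ne_zero (neg_ne_zero.2 ha) (ksign_ne_zero k _), ?_⟩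
    refine (toWord_comp k (show 1 + (r + 1 + q) = r + 1 + (q + 1) by omega)
      (show 1 + (q : ℤ) = ((q + 1 : ℕ) : ℤ) by push_cast; ring) 0 _ _).trans ?_
    rw [h, toWord_dualBra]
    simp only [map_neg, map_add, LinearMap.neg_apply, LinearMap.add_apply, wordComp_single, one_mul]
    rw [wordTerm_of_not, wordTerm_of_not (A := [1]), wordTerm, if_pos]
    · rw [smul_zero, add_zero, zero_add, Finsupp.smul_single, smul_eq_mul, neg_mul,
        Finsupp.single_neg]
      congr 2
      rw [wsubst_cons_self, List.map_ofFn]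
      refine (List.append_nil _).trans (congrArg List.ofFn (funext fun j => Fin.ext ?_))
      simp [leafUpper_val, initEmb]
    · refine ⟨by decide, ofFn_initEmb_nodup _, ?_, by decide, ?_⟩
      · simp
      · simp [weight]
    · rintro ⟨-, -, h, -⟩
      simp at h
    · rintro ⟨-, -, h, -⟩
      simp at h

theorem toWord_spacePow (r : ℕ) : ∃ a : k, a ≠ 0 ∧
    (toWord k).toFun (r + 1) ((r + 1 : ℕ) : ℤ) (spacePow (gerstDual k) (dualBra k) (r + 1)) =
      a • corollaWord k (.space (Nat.le_add_left 1 r)) := by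
  induction r with
  | zero =>
    refine ⟨1, one_ne_zero, ?_⟩
    rw [one_smul]
    refine (toWord_dualBra k).trans ?_
    change _ = -(_ + _)
    rw [Fin.sum_univ_two]
    rfl
  | succ r ih =>
    obtain ⟨a, ha, h⟩ := ih
    refine ⟨-a * ksign k ((r + 1 : ℕ) : ℤ), mul_ne_zero (neg_ne_zero.2 ha) (ksign_ne_zero k _), ?_⟩
    refine (toWord_comp k (show 1 + (r + 1) = r + 2 by omega)
      (show 1 + ((r + 1 : ℕ) : ℤ) = ((r + 2 : ℕ) : ℤ) by push_cast; ring) 0 _ _).trans ?_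
    rw [h, toWord_dualBra]
    change wordComp k _ _ _ 0 _ (a • -(_ + _)) = _ • -(_ + _)
    rw [map_smul, map_neg, map_neg, LinearMap.neg_apply, neg_neg, wordComp_space, smul_smul,
      smul_neg, neg_mul, neg_smul, neg_neg]

end Values

/-! ### The basis of the Koszul dual -/

section DualBasis

variable (k : Type u) [Field k]

/-- Transport of an element along equalities of arities and degrees. -/
def recast {k : Type u} [Field k] (P : Operad k) {r r' : ℕ} {d d' : ℤ} (h : r = r') (hd : d = d')
    (x : P.V r d) : P.V r' d' :=
  h ▸ hd ▸ x

/-- The first `p + 2` of `N + 1` inputs, permuted by `σ`. -/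
def planarEmb {p q N : ℕ} (h : p + 1 + q = N) (σ : Equiv.Perm (Fin (N + 1))) :
    Fin (p + 2) ↪ Fin (N + 1) :=
  (initEmb (show p + 1 ≤ N by omega)).trans σ.toEmbedding

theorem exists_planarEmb {p q N : ℕ} (h : p + 1 + q = N) (f : Fin (p + 2) ↪ Fin (N + 1)) :
    ∃ σ, planarEmb h σ = f := by
  let g : Fin (p + 2) ↪ Fin (N + 1) := initEmb (show p + 1 ≤ N by omega)
  let e : {x // x ∈ Set.range g} ≃ {x // x ∈ Set.range f} :=
    (Equiv.ofInjective g g.injective).symm.trans (Equiv.ofInjective f f.injective)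
  refine ⟨e.extendSubtype, ?_⟩
  ext1 a
  change e.extendSubtype (g a) = f a
  rw [e.extendSubtype_apply_of_mem (g a) ⟨a, rfl⟩]
  have : (Equiv.ofInjective g g.injective).symm ⟨g a, a, rfl⟩ = a :=
    (Equiv.ofInjective g g.injective).symm_apply_apply a
  change ((Equiv.ofInjective f f.injective)
    ((Equiv.ofInjective g g.injective).symm ⟨g a, a, rfl⟩) : Fin (N + 1)) = _
  rw [this]
  rfl

/-- The standard elements attached to a corolla. -/
inductive Represents {N : ℕ} {d : ℤ} : Corolla N → (gerstDual k).V N d → Prop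
  | space (hN : 1 ≤ N) (hd : (N : ℤ) = d) : Represents (.space hN)
      (recast (gerstDual k) rfl hd (spacePow (gerstDual k) (dualBra k) N))
  | mixed (p q : ℕ) (h : p + 1 + q = N) (hd : (q : ℤ) = d) (σ : Equiv.Perm (Fin (N + 1))) :
      Represents (.mixed (p + 2) (Nat.le_add_left 2 p) (planarEmb h σ))
        ((gerstDual k).act N d σ (recast (gerstDual k) h hd
          (mixedPow (gerstDual k) (dualMul k) (dualBra k) (p + 1) q)))

variable {k}

theorem Represents.degree {N : ℕ} {d : ℤ} {c : Corolla N} {y : (gerstDual k).V N d}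
    (h : Represents k c y) : c.degree = 1 - N - d := by
  cases h with
  | space hN hd => simp only [Corolla.degree]; omega
  | mixed p q h hd σ => simp only [Corolla.degree]; push_cast; omega

theorem exists_represents {N : ℕ} {d : ℤ} {c : Corolla N} (h : c.degree = 1 - N - d) :
    ∃ y : (gerstDual k).V N d, Represents k c y := by
  cases c with
  | space hN =>
    simp only [Corolla.degree] at h
    exact ⟨_, .space hN (by omega)⟩
  | mixed p hp f =>
    obtain ⟨p, rfl⟩ := Nat.exists_eq_add_of_le' hp
    simp only [Corolla.degree] at h
    have := Fintype.card_le_of_embedding f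
    simp only [Fintype.card_fin] at this
    obtain ⟨q, hq⟩ := Nat.exists_eq_add_of_le (show p + 1 ≤ N by omega)
    obtain ⟨σ, rfl⟩ := exists_planarEmb hq.symm f
    exact ⟨_, .mixed p q hq.symm (by push_cast at h; omega) σ⟩

variable [CharZero k]

/-- Two permutations with the same planar inputs differ by one that fixes the first p + 2 inputs,
and by skewness this acts by its sign. -/
theorem act_mixedPow_eq {p q N : ℕ} {d : ℤ} (h : p + 1 + q = N) (hd : (q : ℤ) = d)
    {σ τ : Equiv.Perm (Fin (N + 1))} (hσ : planarEmb h σ = planarEmb h τ) : ∃ a : k,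
    (gerstDual k).act N d σ (recast (gerstDual k) h hd
        (mixedPow (gerstDual k) (dualMul k) (dualBra k) (p + 1) q)) =
      a • (gerstDual k).act N d τ (recast (gerstDual k) h hd
        (mixedPow (gerstDual k) (dualMul k) (dualBra k) (p + 1) q)) := by
  subst h hd
  refine ⟨psign k (τ⁻¹ * σ), ?_⟩
  have := ((dualRelations_gerstDual k).skew_mixedPow (p + 1) q).act_eq (σ := τ⁻¹ * σ) fun a ha => ?_
  · change (gerstDual k).act _ _ σ (mixedPow _ _ _ _ _) =
      _ • (gerstDual k).act _ _ τ (mixedPow _ _ _ _ _)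
    rw [← map_smul, ← this, act_act, mul_inv_cancel_left]
  · have := DFunLike.congr_fun hσ ⟨a, ha⟩
    change σ a = τ a at this
    rw [Equiv.Perm.mul_apply, this]
    exact τ.symm_apply_apply a

theorem Represents.unique {N : ℕ} {d : ℤ} {c : Corolla N} {y y' : (gerstDual k).V N d}
    (h : Represents k c y) (h' : Represents k c y') : ∃ a : k, y = a • y' := by
  cases h with
  | space hN hd =>
    cases h'
    exact ⟨1, (one_smul k _).symm⟩
  | mixed p q h hd σ =>
    -- Otherwise the case analysis would have to solve an equation between two embeddings of the
    -- form `planarEmb`.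
    generalize hf : planarEmb h σ = f at h'
    cases h' with
    | mixed p' q' h' hd' τ =>
      obtain rfl : q = q' := by omega
      exact act_mixedPow_eq h hd hf

theorem toWord_recast_spacePow {N : ℕ} {d : ℤ} (hN : 1 ≤ N) (hd : (N : ℤ) = d) :
    ∃ a : k, a ≠ 0 ∧ (toWord k).toFun N d
      (recast (gerstDual k) rfl hd (spacePow (gerstDual k) (dualBra k) N)) =
        a • corollaWord k (.space hN) := by
  subst hd
  obtain ⟨r, rfl⟩ := Nat.exists_eq_add_of_le' hN
  exact toWord_spacePow k r

theorem toWord_recast_mixedPow {p q N : ℕ} {d : ℤ} (h : p + 1 + q = N) (hd : (q : ℤ) = d)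
    (σ : Equiv.Perm (Fin (N + 1))) : ∃ a : k, a ≠ 0 ∧ (toWord k).toFun N d
      ((gerstDual k).act N d σ (recast (gerstDual k) h hd
        (mixedPow (gerstDual k) (dualMul k) (dualBra k) (p + 1) q))) =
      a • corollaWord k (.mixed (p + 2) (Nat.le_add_left 2 p) (planarEmb h σ)) := by
  subst h hd
  obtain ⟨a, ha, h⟩ := toWord_mixedPow k p q
  refine ⟨a * psign k σ, mul_ne_zero ha ?_, ?_⟩
  · rcases psign_eq_one_or k σ with h | h <;> simp [h]
  · refine ((toWord k).map_act _ _ σ _).trans ?_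
    change wordAct k _ σ ((toWord k).toFun _ _ (mixedPow _ _ _ _ _)) = _
    rw [h, wordAct_single, List.map_ofFn, mul_comm, Finsupp.smul_single]
    exact (Finsupp.smul_single_one _ _).symm

theorem Represents.toWord_eq {N : ℕ} {d : ℤ} {c : Corolla N} {y : (gerstDual k).V N d}
    (h : Represents k c y) :
    ∃ a : k, a ≠ 0 ∧ (toWord k).toFun N d y = a • corollaWord k c := by
  cases h with
  | space hN hd => exact toWord_recast_spacePow hN hd
  | mixed p q h hd σ => exact toWord_recast_mixedPow h hd σ

theorem exists_represents_of_std {N : ℕ} {d : ℤ} {y : (gerstDual k).V N d}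
    (h : Std (gerstDual k) (dualMul k) (dualBra k) y) :
    ∃ (c : Corolla N) (z : (gerstDual k).V N d) (a : k), Represents k c z ∧ y = a • z := by
  cases h with
  | space r σ =>
    refine ⟨_, _, psign k σ, .space (Nat.le_add_left 1 r) rfl, ?_⟩
    exact ((dualRelations_gerstDual k).skew_spacePow r).act_eq fun a ha => by omega
  | mixed r q σ => exact ⟨_, _, 1, .mixed r q rfl rfl σ, (one_smul k _).symm⟩

variable (k) in
-- One standard element is chosen for each corolla and rescaled to have the prescribed image in
-- words. Independence follows by reading the coefficient at the word of each corolla, spanning from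
-- `mem_stdSpan` and uniqueness up to a scalar.
theorem exists_corollaBasis (r : ℕ) (δ : ℤ) :
    ∃ B : Basis {c : Corolla r // True ∧ c.degree = δ} k ((gerstDual k).V r (1 - r - δ)),
      ∀ c, (toWord k).toFun r (1 - r - δ) (B c) = corollaWord k c.1 := by
  classical
  have hy : ∀ c : {c : Corolla r // True ∧ c.degree = δ},
      ∃ y : (gerstDual k).V r (1 - r - δ), (toWord k).toFun r (1 - r - δ) y = corollaWord k c.1 ∧
        ∀ z : (gerstDual k).V r (1 - r - δ), Represents k c.1 z → ∃ a : k, z = a • y := by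
    intro c
    obtain ⟨y, hy⟩ := exists_represents (k := k) (c := c.1) (d := 1 - r - δ) (by rw [c.2.2]; ring)
    obtain ⟨a, ha, h⟩ := hy.toWord_eq
    refine ⟨a⁻¹ • y, ?_, fun z hz => ?_⟩
    · rw [map_smul, h]
      exact inv_smul_smul₀ ha (corollaWord k c.1)
    · obtain ⟨b, rfl⟩ := hz.unique hy
      exact ⟨b * a, by rw [smul_smul, mul_assoc, mul_inv_cancel₀ ha, mul_one]⟩
  choose y hy hz using hy
  have hli : LinearIndependent k y := by
    rw [linearIndependent_iff']
    intro s g hg c hc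
    let Ψ : (gerstDual k).V r (1 - r - δ) →ₗ[k] List (Fin (r + 1)) →₀ k :=
      (toWord k).toFun r (1 - r - δ)
    have h := congrArg (fun x => Ψ x c.1.word) hg
    have hΨ : ∀ c, Ψ (y c) = corollaWord k c.1 := hy
    simp only [map_sum, map_smul, hΨ, map_zero, Finsupp.finsetSum_apply, Finsupp.smul_apply,
      corollaWord_apply_word, smul_eq_mul, Finsupp.zero_apply] at h
    rw [Finset.sum_eq_single_of_mem c hc fun c' _ hne => by
      rw [if_neg fun e => hne (Subtype.ext e), mul_zero], if_pos rfl] at h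
    exact (mul_eq_zero.1 h).resolve_right (left_ne_zero_of_mul_eq_one (Corolla.coeff_sq k c.1))
  have hsp : ⊤ ≤ Submodule.span k (Set.range y) := by
    intro x _
    refine Submodule.span_le.2 ?_ (mem_stdSpan k x)
    intro w hw
    obtain ⟨c, z, a, hcz, rfl⟩ := exists_represents_of_std hw
    have hd := hcz.degree
    obtain ⟨b, rfl⟩ := hz ⟨c, trivial, by rw [hd]; ring⟩ z hcz
    exact Submodule.smul_mem _ _ (Submodule.smul_mem _ _ (Submodule.subset_span ⟨_, rfl⟩))
  refine ⟨Basis.mk hli hsp, fun c => ?_⟩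
  rw [Basis.mk_apply]
  exact hy c

end DualBasis

/-! ### The generators of the cobar construction -/

section Generators

variable (k : Type u) [Field k]

theorem Corolla.coeff_smul {r : ℕ} (σ : Equiv.Perm (Fin (r + 1))) (c : Corolla r) :
    (σ • c).coeff k = c.coeff k := by
  cases c <;> rfl

variable [CharZero k]

/-- The basis of the Koszul dual indexed by corollas. -/
def corollaBasis (r : ℕ) (δ : ℤ) :
    Basis {c : Corolla r // True ∧ c.degree = δ} k ((gerstDual k).V r (1 - r - δ)) :=
  (exists_corollaBasis k r δ).choose

theorem toWord_corollaBasis {r : ℕ} {δ : ℤ} (c : {c : Corolla r // True ∧ c.degree = δ}) :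
    (toWord k).toFun r (1 - r - δ) (corollaBasis k r δ c) = corollaWord k c.1 :=
  (exists_corollaBasis k r δ).choose_spec c

/-- The coefficient of a word, as a linear form on the Koszul dual. -/
def wordForm {r : ℕ} (d : ℤ) (L : List (Fin (r + 1))) : Dual k ((gerstDual k).V r d) :=
  (Finsupp.lapply L : (List (Fin (r + 1)) →₀ k) →ₗ[k] k) ∘ₗ (toWord k).toFun r d

theorem wordForm_apply {r : ℕ} {d : ℤ} (L : List (Fin (r + 1))) (x : (gerstDual k).V r d) :
    wordForm k d L x = (show List (Fin (r + 1)) →₀ k from (toWord k).toFun r d x) L :=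
  rfl

theorem wordForm_corollaBasis {r : ℕ} {δ : ℤ} (L : List (Fin (r + 1)))
    (c : {c : Corolla r // True ∧ c.degree = δ}) :
    wordForm k (1 - r - δ) L (corollaBasis k r δ c) = corollaWord k c.1 L := by
  rw [wordForm_apply, toWord_corollaBasis]

/-- This is how structure constants of the Koszul dual become coefficients of words; the factor is
the sign ±1 with which the corolla is detected. -/
theorem corollaBasis_coord {r : ℕ} {δ : ℤ} (c : {c : Corolla r // True ∧ c.degree = δ}) :
    (corollaBasis k r δ).coord c = c.1.coeff k • wordForm k (1 - r - δ) c.1.word := by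
  classical
  refine (corollaBasis k r δ).ext fun c' => ?_
  rw [LinearMap.smul_apply, wordForm_corollaBasis, corollaWord_apply_word, Basis.coord_apply,
    Basis.repr_self, Finsupp.single_apply, smul_eq_mul]
  by_cases h : c' = c
  · rw [if_pos h, if_pos (congrArg _ h), h, Corolla.coeff_sq]
  · rw [if_neg h, if_neg fun e => h (Subtype.ext e), mul_zero]

theorem wordForm_act {r : ℕ} {d : ℤ} (σ : Equiv.Perm (Fin (r + 1))) (L : List (Fin (r + 1)))
    (x : (gerstDual k).V r d) :
    wordForm k d (L.map σ) ((gerstDual k).act r d σ x) = psign k σ * wordForm k d L x := by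
  have h : ∀ w : List (Fin (r + 1)) →₀ k, wordAct k r σ w (L.map σ) = psign k σ * w L := by
    intro w
    induction w using Finsupp.induction_linear with
    | zero => simp
    | add v w hv hw => simp [hv, hw, mul_add]
    | single A a =>
      rw [wordAct_single, Finsupp.smul_apply, smul_eq_mul, Finsupp.single_apply,
        Finsupp.single_apply]
      simp only [(List.map_injective_iff.2 σ.injective).eq_iff]
  refine Eq.trans ?_ (h ((toWord k).toFun r d x))
  rw [wordForm_apply]
  exact congrArg (fun w : List (Fin (r + 1)) →₀ k => w (L.map σ)) ((toWord k).map_act r d σ x)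

/-- The action of a permutation on the corollas of given degree. -/
def smulCorolla {r : ℕ} {δ : ℤ} (σ : Equiv.Perm (Fin (r + 1)))
    (c : {c : Corolla r // True ∧ c.degree = δ}) : {c : Corolla r // True ∧ c.degree = δ} :=
  ⟨σ • c.1, trivial, (Corolla.degree_smul σ c.1).trans c.2.2⟩

theorem coord_smulCorolla_act {r : ℕ} {δ : ℤ} (σ : Equiv.Perm (Fin (r + 1)))
    (c : {c : Corolla r // True ∧ c.degree = δ}) (x : (gerstDual k).V r (1 - r - δ)) :
    (corollaBasis k r δ).coord (smulCorolla σ c) ((gerstDual k).act r _ σ x) =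
      psign k σ * (corollaBasis k r δ).coord c x := by
  rw [corollaBasis_coord, corollaBasis_coord, LinearMap.smul_apply, LinearMap.smul_apply,
    smul_eq_mul, smul_eq_mul, smulCorolla, Corolla.coeff_smul, Corolla.word_smul, wordForm_act]
  ring

theorem corollaBasis_act {r : ℕ} {δ : ℤ} (σ : Equiv.Perm (Fin (r + 1)))
    (c : {c : Corolla r // True ∧ c.degree = δ}) :
    (gerstDual k).act r _ σ (corollaBasis k r δ c) =
      psign k σ • corollaBasis k r δ (smulCorolla σ c) := by
  classical
  refine (corollaBasis k r δ).ext_elem fun c' => ?_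
  obtain ⟨c', rfl⟩ : ∃ c'', smulCorolla σ c'' = c' :=
    ⟨smulCorolla σ⁻¹ c', Subtype.ext (smul_inv_smul σ c'.1)⟩
  have h : smulCorolla σ c = smulCorolla σ c' ↔ c = c' :=
    ⟨fun h => Subtype.ext (MulAction.injective σ (congrArg Subtype.val h)), congrArg _⟩
  rw [← Basis.coord_apply, coord_smulCorolla_act, map_smul, Finsupp.smul_apply, Basis.coord_apply,
    Basis.repr_self, Basis.repr_self, Finsupp.single_apply, Finsupp.single_apply, smul_eq_mul]
  simp only [h]

/-- The corollas as generators of the cobar construction. -/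
def corollaEquiv (r : ℕ) (d : ℤ) :
    (corollaMod k fun _ => True).V r d ≃ₗ[k] (cobarGen (gerstDual k)).V r d :=
  open Classical in (corollaBasis k r d).dualBasis.repr.symm

theorem corollaEquiv_single {r : ℕ} {d : ℤ} (c : {c : Corolla r // True ∧ c.degree = d}) :
    corollaEquiv k r d (Finsupp.single c 1 : {c : Corolla r // True ∧ c.degree = d} →₀ k) =
      (corollaBasis k r d).coord c := by
  classical
  refine ((corollaBasis k r d).dualBasis.repr_symm_single_one (i := c)).trans ?_
  rw [Basis.coe_dualBasis]

/-- The sign by which relabelling acts on the basis of the Koszul dual cancels against the sign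
representation in the generators of the cobar construction, so corollas are permuted without signs.
-/
theorem corollaEquiv_act (r : ℕ) (d : ℤ) (σ : Equiv.Perm (Fin (r + 1)))
    (x : (corollaMod k fun _ => True).V r d) :
    corollaEquiv k r d ((corollaMod k fun _ => True).act r d σ x) =
      (cobarGen (gerstDual k)).act r d σ (corollaEquiv k r d x) := by
  have h : (corollaEquiv k r d).toLinearMap ∘ₗ (corollaMod k fun _ => True).act r d σ =
      (cobarGen (gerstDual k)).act r d σ ∘ₗ (corollaEquiv k r d).toLinearMap := by
    refine Finsupp.lhom_ext' fun c => LinearMap.ext_ring ?_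
    change corollaEquiv k r d ((corollaMod k fun _ => True).act r d σ
      (corollaVec k _ c.1 trivial c.2.2)) = (cobarGen (gerstDual k)).act r d σ
        (corollaEquiv k r d (Finsupp.single c 1 : {c : Corolla r // True ∧ c.degree = d} →₀ k))
    rw [act_corollaVec, corollaEquiv_single]
    refine (corollaEquiv_single k (smulCorolla σ c)).trans (LinearMap.ext fun x => ?_)
    change _ = psign k σ * (corollaBasis k r d).coord c ((gerstDual k).act r _ σ⁻¹ x)
    rw [← coord_smulCorolla_act, act_act, mul_inv_cancel, act_one_apply]
  exact LinearMap.congr_fun h x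

/-- The S-module of generators of the cobar construction is spanned by the corollas. -/
def corollaIso : SModIso (corollaMod k fun _ => True) (cobarGen (gerstDual k)) where
  toEquiv := corollaEquiv k
  equivariant := corollaEquiv_act k

/-- The class of φ maps to the sum of the words of the binary corollas with coefficients φ, and
reading this at the word of c returns φ of c, since the detection sign occurs twice. -/
theorem corollaIso_arity_two (c : Corolla 1) (d : ℤ) (hc : c.degree = d)
    (hc' : c.degree = -(1 - ((1 : ℕ) : ℤ) - d))
    (φ : Module.Dual k ((gerstGen k).V 1 (-(1 - ((1 : ℕ) : ℤ) - d)))) :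
    cobarEval (gerstDual k) ((corollaIso k).toEquiv 1 d (corollaVec k _ c trivial hc))
      (gerstDualGen k φ) = φ (corollaVec k _ c rfl hc') := by
  classical
  have h : cobarEval (gerstDual k) ((corollaIso k).toEquiv 1 d (corollaVec k _ c trivial hc))
      (gerstDualGen k φ) = (corollaBasis k 1 d).coord ⟨c, trivial, hc⟩ (gerstDualGen k φ) :=
    congrArg (fun ψ => cobarEval (gerstDual k) ψ (gerstDualGen k φ))
      (corollaEquiv_single k (⟨c, trivial, hc⟩ : {c : Corolla 1 // True ∧ c.degree = d}))
  rw [h, corollaBasis_coord, LinearMap.smul_apply, wordForm_apply, toWord_gerstDualGen,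
    sumWord_apply, smul_eq_mul]
  change _ * (∑ c', genValue k φ c' • corollaWord k c'.1 : List (Fin (1 + 1)) →₀ k) c.word = _
  rw [Finsupp.finsetSum_apply, Finset.sum_eq_single ⟨c, rfl, hc'⟩]
  · rw [Finsupp.smul_apply, corollaWord_apply_word, if_pos rfl, smul_eq_mul, mul_left_comm,
      Corolla.coeff_sq, mul_one]
    rfl
  · intro c' _ hne
    rw [Finsupp.smul_apply, corollaWord_apply_word, if_neg fun e => hne (Subtype.ext e), smul_zero]
  · intro h
    exact absurd (Finset.mem_univ _) h

end Generators

/-! ### The cobar differential in terms of corollas -/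

section CobarTerms

variable (k : Type u) [Field k] [CharZero k]

/-- The generator of the cobar construction given by a corolla. -/
def coordGen {r : ℕ} {d : ℤ} (c : {c : Corolla r // True ∧ c.degree = d}) :
    (cobarGen (gerstDual k)).V r d :=
  (corollaBasis k r d).coord c

variable {k} {N : ℕ} {d : ℤ}

/-- The summand of the cobar differential for the tree decorated by two corollas. -/
def cobarTerm (J : Finset (Fin (N + 1))) (ψ : (cobarGen (gerstDual k)).V N d) {r s : ℕ} {p q : ℤ}
    (c₁ : {c : Corolla r // True ∧ c.degree = p}) (c₂ : {c : Corolla s // True ∧ c.degree = q}) :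
    (free (cobarGen (gerstDual k))).V N (d + 1) :=
  (psign k (treePerm J) * ksign k (r * (1 - s - q)) * ksign k ((1 - r - p) + r) *
    cobarEval (gerstDual k) ψ (tree J (gerstDual k) (1 - N - d) (corollaBasis k r p c₁)
      (corollaBasis k s q c₂))) •
    tree J (free (cobarGen (gerstDual k))) (d + 1) (ι _ (coordGen k c₁)) (ι _ (coordGen k c₂))

theorem cobarTerm_eq_zero {J : Finset (Fin (N + 1))} (ψ : (cobarGen (gerstDual k)).V N d)
    {r s : ℕ} {p q : ℤ} (c₁ : {c : Corolla r // True ∧ c.degree = p})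
    (c₂ : {c : Corolla s // True ∧ c.degree = q}) (h : p + q ≠ d + 1) :
    cobarTerm J ψ c₁ c₂ = 0 :=
  smul_eq_zero_of_right _ (dif_neg fun hh => h hh.2.2)

theorem finsum_corolla {M : Type*} [AddCommMonoid M] {r : ℕ}
    (g : ∀ p : ℤ, {c : Corolla r // True ∧ c.degree = p} → M) :
    ∑ᶠ p : ℤ, ∑ c, g p c = ∑ c : Corolla r, g c.degree ⟨c, trivial, rfl⟩ := by
  classical
  rw [finsum_eq_sum_of_support_subset (s := univ.image Corolla.degree)]
  · rw [← Finset.sum_fiberwise_of_maps_to (s := univ) (t := univ.image Corolla.degree)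
      (g := Corolla.degree) fun c hc => Finset.mem_image_of_mem _ hc]
    refine Finset.sum_congr rfl fun p _ => ?_
    rw [Finset.sum_subtype (p := fun c : Corolla r => True ∧ c.degree = p) _ (by simp)]
    refine Finset.sum_congr rfl fun c _ => ?_
    obtain ⟨c, -, rfl⟩ := c
    rfl
  · intro p hp
    by_contra hn
    refine hp (Finset.sum_eq_zero fun c _ => absurd ?_ hn)
    exact Finset.mem_coe.2 (Finset.mem_image.2 ⟨c.1, Finset.mem_univ _, c.2.2⟩)

/-- The degree of the upper vertex is forced by that of the lower one; the sum may run over all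
corollas because terms of any other degree vanish. -/
theorem sum_corolla_degree {M : Type*} [AddCommMonoid M] {r : ℕ} (q : ℤ)
    (g : ∀ p : ℤ, {c : Corolla r // True ∧ c.degree = p} → M) (hg : ∀ p c, p ≠ q → g p c = 0) :
    ∑ c, g q c = ∑ c : Corolla r, g c.degree ⟨c, trivial, rfl⟩ := by
  rw [← finsum_corolla, finsum_eq_single _ q fun p hp => Finset.sum_eq_zero fun c _ => hg p c hp]

/-- The arbitrary bases are replaced by the corolla basis, and the sum over degrees becomes a sum
over corollas. Linearity in the generator is then evident. -/
theorem cobarOnGen_eq (ψ : (cobarGen (gerstDual k)).V N d) :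
    cobarOnGen (gerstDual k) ψ =
      ∑ rs ∈ antidiagonal N, ∑ J ∈ powersetCard (rs.2 + 1) (univ : Finset (Fin (N + 1))),
        ∑ c₁ : Corolla rs.1, ∑ c₂ : Corolla rs.2,
          cobarTerm J ψ ⟨c₁, trivial, rfl⟩ ⟨c₂, trivial, rfl⟩ := by
  unfold cobarOnGen
  refine Finset.sum_congr rfl fun rs _ => Finset.sum_congr rfl fun J _ => ?_
  refine Eq.trans (finsum_congr fun p => ?_) (finsum_corolla fun p c₁ => ∑ c₂ : Corolla rs.2,
    cobarTerm J ψ c₁ ⟨c₂, trivial, rfl⟩)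
  have hfin₁ : FiniteDimensional k ((gerstDual k).V rs.1 (1 - rs.1 - p)) :=
    (corollaBasis k rs.1 p).finiteDimensional_of_finite
  have hfin₂ : FiniteDimensional k ((gerstDual k).V rs.2 (1 - rs.2 - (d + 1 - p))) :=
    (corollaBasis k rs.2 (d + 1 - p)).finiteDimensional_of_finite
  let B : (gerstDual k).V rs.1 (1 - rs.1 - p) →ₗ[k]
      (gerstDual k).V rs.2 (1 - rs.2 - (d + 1 - p)) →ₗ[k] k :=
    (treeLin J (gerstDual k) (1 - N - d) rs.1 rs.2 (1 - rs.1 - p)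
      (1 - rs.2 - (d + 1 - p))).compr₂ ((psign k (treePerm J) *
        ksign k (rs.1 * (1 - rs.2 - (d + 1 - p))) * ksign k ((1 - rs.1 - p) + rs.1)) •
          (show Dual k ((gerstDual k).V N (1 - N - d)) from ψ))
  let β : Dual k ((gerstDual k).V rs.1 (1 - rs.1 - p)) →ₗ[k]
      Dual k ((gerstDual k).V rs.2 (1 - rs.2 - (d + 1 - p))) →ₗ[k]
        (free (cobarGen (gerstDual k))).V N (d + 1) :=
    (treeLin J (free (cobarGen (gerstDual k))) (d + 1) rs.1 rs.2 p (d + 1 - p)).compl₁₂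
      (ι (cobarGen (gerstDual k)) (r := rs.1) (d := p))
      (ι (cobarGen (gerstDual k)) (r := rs.2) (d := d + 1 - p))
  have h := finsum_finsum_dualBasis (corollaBasis k rs.1 p) (corollaBasis k rs.2 (d + 1 - p)) B β
  refine Eq.trans (finsum_congr fun a => finsum_congr fun b => ?_) (h.trans ?_)
  · rw [tree_eq_treeLin, tree_eq_treeLin]
    rfl
  · refine Finset.sum_congr rfl fun c₁ _ => ?_
    refine Eq.trans (Finset.sum_congr rfl fun c₂ _ => ?_) (sum_corolla_degree (d + 1 - p)
      (fun q c₂ => cobarTerm J ψ c₁ c₂) fun q c₂ hq => cobarTerm_eq_zero ψ c₁ c₂ (by omega))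
    rw [cobarTerm, tree_eq_treeLin, tree_eq_treeLin]
    rfl

theorem cobarTerm_add (J : Finset (Fin (N + 1))) (ψ ψ' : (cobarGen (gerstDual k)).V N d)
    {r s : ℕ} {p q : ℤ} (c₁ : {c : Corolla r // True ∧ c.degree = p})
    (c₂ : {c : Corolla s // True ∧ c.degree = q}) :
    cobarTerm J (ψ + ψ') c₁ c₂ = cobarTerm J ψ c₁ c₂ + cobarTerm J ψ' c₁ c₂ := by
  rw [cobarTerm, cobarTerm, cobarTerm, ← add_smul, ← mul_add]
  rfl

theorem cobarTerm_smul (J : Finset (Fin (N + 1))) (a : k) (ψ : (cobarGen (gerstDual k)).V N d)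
    {r s : ℕ} {p q : ℤ} (c₁ : {c : Corolla r // True ∧ c.degree = p})
    (c₂ : {c : Corolla s // True ∧ c.degree = q}) :
    cobarTerm J (a • ψ) c₁ c₂ = a • cobarTerm J ψ c₁ c₂ := by
  rw [cobarTerm, cobarTerm, smul_smul, mul_left_comm a]
  rfl

theorem cobarOnGen_add (ψ ψ' : (cobarGen (gerstDual k)).V N d) :
    cobarOnGen (gerstDual k) (ψ + ψ') =
      cobarOnGen (gerstDual k) ψ + cobarOnGen (gerstDual k) ψ' := by
  simp only [cobarOnGen_eq, cobarTerm_add, Finset.sum_add_distrib]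

theorem cobarOnGen_smul (a : k) (ψ : (cobarGen (gerstDual k)).V N d) :
    cobarOnGen (gerstDual k) (a • ψ) = a • cobarOnGen (gerstDual k) ψ := by
  simp only [cobarOnGen_eq, cobarTerm_smul, Finset.smul_sum]

end CobarTerms

/-! ### Relabelling of trees -/

section TreeSymmetry

variable {N : ℕ}

theorem treePerm_mem_iff (J : Finset (Fin (N + 1))) (a : Fin (N + 1)) :
    treePerm J a ∈ J ↔ (a : ℕ) < #J := by
  by_cases ha : (a : ℕ) < #J
  · rw [treePerm_of_lt J ha]
    exact iff_of_true (Finset.orderEmbOfFin_mem _ _ _) ha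
  · rw [treePerm_of_le J (not_lt.1 ha)]
    exact iff_of_false (Finset.mem_compl.1 (Finset.orderEmbOfFin_mem _ _ _)) ha

/-- A permutation preserving the set of the first s + 1 places is a block permutation for grafting
at the first input, with the internal edge fixed. -/
theorem exists_blocks {r s : ℕ} (h : r + s = N) {ρ : Equiv.Perm (Fin (N + 1))}
    (hρ : ∀ a : Fin (N + 1), (ρ a : ℕ) < s + 1 ↔ (a : ℕ) < s + 1) :
    ∃ (α : Equiv.Perm (Fin (r + 1))) (β : Equiv.Perm (Fin (s + 1))), α 0 = 0 ∧
      (∀ l, ρ (leafUpper h 0 l) = leafUpper h (α 0) (β l)) ∧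
      ∀ j, j ≠ 0 → ρ (leafLower h 0 j) = leafLower h (α 0) (α j) := by
  have hU : ∀ a : Fin (N + 1), (a : ℕ) < s + 1 → ∃ l, a = leafUpper h 0 l := fun a ha =>
    ⟨⟨a, ha⟩, Fin.ext (by simp [leafUpper_val])⟩
  have hL : ∀ a : Fin (N + 1), ¬ (a : ℕ) < s + 1 → ∃ j, j ≠ 0 ∧ a = leafLower h 0 j := fun a ha =>
    ⟨⟨a - s, by omega⟩, fun e => by simpa using (congrArg Fin.val e).not_gt (by simp; omega),
      Fin.ext (by simp [leafLower_val]; omega)⟩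
  have hU' : ∀ l : Fin (s + 1), (leafUpper h 0 l : ℕ) < s + 1 := fun l => by
    simp [leafUpper_val]
    omega
  have hL' : ∀ j : Fin (r + 1), j ≠ 0 → ¬ (leafLower h 0 j : ℕ) < s + 1 := fun j hj => by
    have : (j : ℕ) ≠ 0 := fun e => hj (Fin.ext e)
    simp [leafLower_val]
    omega
  choose β hβ using fun l : Fin (s + 1) => hU _ ((hρ _).2 (hU' l))
  choose α hα₀ hα using fun j : {j : Fin (r + 1) // j ≠ 0} => hL _ ((hρ _).not.2 (hL' j j.2))
  have hβi : Function.Injective β := fun a b hab => by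
    refine leafUpper_injective h 0 (ρ.injective ?_)
    rw [hβ, hβ, hab]
  let α' : Fin (r + 1) → Fin (r + 1) := fun j => if hj : j ≠ 0 then α ⟨j, hj⟩ else 0
  have hα' : ∀ j (hj : j ≠ 0), α' j = α ⟨j, hj⟩ := fun j hj => dif_pos hj
  have hα'₀ : α' 0 = 0 := dif_neg (by simp)
  have hαi : Function.Injective α' := fun a b hab => by
    by_cases ha : a = 0 <;> by_cases hb : b = 0
    · rw [ha, hb]
    · rw [ha, hα'₀, hα' b hb] at hab
      exact absurd hab.symm (hα₀ _)
    · rw [hb, hα'₀, hα' a ha] at hab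
      exact absurd hab (hα₀ _)
    · rw [hα' a ha, hα' b hb] at hab
      refine leafLower_injOn h 0 ha hb (ρ.injective ?_)
      rw [hα ⟨a, ha⟩, hα ⟨b, hb⟩, hab]
  refine ⟨Equiv.ofBijective α' (Finite.injective_iff_bijective.1 hαi),
    Equiv.ofBijective β (Finite.injective_iff_bijective.1 hβi), hα'₀, fun l => ?_, fun j hj => ?_⟩
  · rw [Equiv.ofBijective_apply, Equiv.ofBijective_apply, hα'₀]
    exact hβ l
  · rw [Equiv.ofBijective_apply, Equiv.ofBijective_apply, hα'₀, hα' j hj]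
    exact hα ⟨j, hj⟩

/-- The relabellings α and β of the vertices depend only on J and σ, not on the operad. This matters
because the same tree is formed both in the Koszul dual and in the free operad. As the internal edge
stays first, the block sign has no extra factor. -/
theorem exists_act_tree {k : Type u} [Field k] {r s : ℕ} (h : r + s = N)
    {J : Finset (Fin (N + 1))} (hJ : #J = s + 1) (σ : Equiv.Perm (Fin (N + 1))) :
    ∃ (α : Equiv.Perm (Fin (r + 1))) (β : Equiv.Perm (Fin (s + 1))),
      psign k σ * psign k (treePerm J) =
        psign k (treePerm (J.map σ.toEmbedding)) * (psign k α * psign k β) ∧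
      ∀ (O : Operad k) (D d e : ℤ) (x : O.V r d) (y : O.V s e), O.act N D σ (tree J O D x y) =
        tree (J.map σ.toEmbedding) O D (O.act r d α x) (O.act s e β y) := by
  have hJ' : #(J.map σ.toEmbedding) = s + 1 := by rw [Finset.card_map, hJ]
  set τ := treePerm (J.map σ.toEmbedding) with hτ
  have hρ : ∀ a, ((τ⁻¹ * (σ * treePerm J)) a : ℕ) < s + 1 ↔ (a : ℕ) < s + 1 := by
    intro a
    rw [← hJ', ← treePerm_mem_iff, ← hτ, ← Equiv.Perm.mul_apply, mul_inv_cancel_left,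
      Equiv.Perm.mul_apply, hJ', ← hJ, ← treePerm_mem_iff J]
    exact Finset.mem_map' σ.toEmbedding
  obtain ⟨α, β, h₀, h₁, h₂⟩ := exists_blocks h hρ
  refine ⟨α, β, ?_, fun O D d e x y => ?_⟩
  · have := psign_blockPerm h k h₁ h₂
    rw [h₀, psign_mul, psign_mul, psign_inv] at this
    rw [← one_mul (_ * _), ← psign_sq k τ, mul_assoc, this]
    simp [ksign_zero]
  · by_cases hd : d + e = D
    · rw [tree_of _ O h hJ hd, tree_of _ O h hJ' hd]
      have := O.equivariant h hd 0 α β _ h₁ h₂ x y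
      rw [h₀] at this
      rw [this, act_act, act_act, ← hτ, mul_inv_cancel_left]
    · rw [tree, tree, dif_neg fun hh => hd hh.2.2, dif_neg fun hh => hd hh.2.2, map_zero]

variable {k : Type u} [Field k] [CharZero k] {d : ℤ}

theorem act_coordGen {r : ℕ} {p : ℤ} (σ : Equiv.Perm (Fin (r + 1)))
    (c : {c : Corolla r // True ∧ c.degree = p}) :
    (cobarGen (gerstDual k)).act r p σ (coordGen k c) = coordGen k (smulCorolla σ c) := by
  refine LinearMap.ext fun x => ?_
  change psign k σ * (corollaBasis k r p).coord c ((gerstDual k).act r _ σ⁻¹ x) =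
    (corollaBasis k r p).coord (smulCorolla σ c) x
  rw [← coord_smulCorolla_act, act_act, mul_inv_cancel, act_one_apply]

/-- The signs of α and β enter through the corolla basis of the Koszul dual, that of σ through the
dual representation; together they convert the sign of the labelling for J into that for its image.
-/
theorem cobarTerm_act {r s : ℕ} (h : r + s = N) {J : Finset (Fin (N + 1))} (hJ : #J = s + 1)
    (σ : Equiv.Perm (Fin (N + 1))) (ψ : (cobarGen (gerstDual k)).V N d) :
    ∃ (α : Equiv.Perm (Fin (r + 1))) (β : Equiv.Perm (Fin (s + 1))), ∀ {p q : ℤ}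
      (c₁ : {c : Corolla r // True ∧ c.degree = p}) (c₂ : {c : Corolla s // True ∧ c.degree = q}),
      (free (cobarGen (gerstDual k))).act N (d + 1) σ (cobarTerm J ψ c₁ c₂) =
        cobarTerm (J.map σ.toEmbedding) ((cobarGen (gerstDual k)).act N d σ ψ) (smulCorolla α c₁)
          (smulCorolla β c₂) := by
  obtain ⟨α, β, hs, ht⟩ := exists_act_tree (k := k) h hJ σ
  refine ⟨α, β, fun {p q} c₁ c₂ => ?_⟩
  have hψ : ∀ z, cobarEval (gerstDual k) ((cobarGen (gerstDual k)).act N d σ ψ)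
      ((gerstDual k).act N _ σ z) = psign k σ * cobarEval (gerstDual k) ψ z := by
    intro z
    change psign k σ * cobarEval (gerstDual k) ψ ((gerstDual k).act N _ σ⁻¹
      ((gerstDual k).act N _ σ z)) = _
    rw [act_act, inv_mul_cancel, act_one_apply]
  have hY := ht (gerstDual k) (1 - N - d) _ _ (corollaBasis k r p c₁) (corollaBasis k s q c₂)
  rw [corollaBasis_act, corollaBasis_act, tree_eq_treeLin (J.map _), map_smul, map_smul,
    LinearMap.smul_apply, smul_smul, ← tree_eq_treeLin] at hY
  have hY' : cobarEval (gerstDual k) ψ (tree J (gerstDual k) (1 - N - d)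
      (corollaBasis k r p c₁) (corollaBasis k s q c₂)) = psign k σ * (psign k β * psign k α) *
        cobarEval (gerstDual k) ((cobarGen (gerstDual k)).act N d σ ψ)
          (tree (J.map σ.toEmbedding) (gerstDual k) (1 - N - d)
            (corollaBasis k r p (smulCorolla α c₁)) (corollaBasis k s q (smulCorolla β c₂))) := by
    have := hψ (tree J (gerstDual k) (1 - N - d) (corollaBasis k r p c₁) (corollaBasis k s q c₂))
    rw [hY] at this
    rw [← one_mul (cobarEval _ ψ _), ← psign_sq k σ, mul_assoc, ← this, mul_assoc]
    congr 1
    exact map_smul (show Dual k _ from (cobarGen (gerstDual k)).act N d σ ψ) _ _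
  rw [cobarTerm, cobarTerm, map_smul, ht, ← ι_act, ← ι_act, act_coordGen, act_coordGen, hY']
  congr 1
  have key : ∀ {a t b c τ u w E : k}, a * t = τ * (b * c) → b * b = 1 → c * c = 1 →
      t * u * w * (a * (c * b) * E) = τ * u * w * E := by
    intro a t b c τ u w E h hb hc
    linear_combination (c * b * u * w * E) * h + τ * u * w * E * (c * c) * hb + τ * u * w * E * hc
  exact key hs (psign_sq k α) (psign_sq k β)

theorem cobarTerm_mk (J : Finset (Fin (N + 1))) (ψ : (cobarGen (gerstDual k)).V N d) {r s : ℕ}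
    {p q : ℤ} {c₁ : Corolla r} {c₂ : Corolla s} (h₁ : c₁.degree = p) (h₂ : c₂.degree = q) :
    cobarTerm J ψ ⟨c₁, trivial, h₁⟩ ⟨c₂, trivial, h₂⟩ =
      cobarTerm J ψ ⟨c₁, trivial, rfl⟩ ⟨c₂, trivial, rfl⟩ := by
  subst h₁ h₂
  rfl

theorem cobarOnGen_act (σ : Equiv.Perm (Fin (N + 1))) (ψ : (cobarGen (gerstDual k)).V N d) :
    cobarOnGen (gerstDual k) ((cobarGen (gerstDual k)).act N d σ ψ) =
      (free (cobarGen (gerstDual k))).act N (d + 1) σ (cobarOnGen (gerstDual k) ψ) := by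
  rw [cobarOnGen_eq, cobarOnGen_eq]
  simp only [map_sum]
  refine Finset.sum_congr rfl fun rs hrs => ?_
  symm
  -- Trees are reindexed by the image of their set of upper leaves, and afterwards the decorations
  -- by α and β.
  refine Finset.sum_bij' (fun J _ => J.map σ.toEmbedding) (fun J _ => J.map σ.symm.toEmbedding)
    ?_ ?_ ?_ ?_ ?_
  · intro J hJ
    simpa using hJ
  · intro J hJ
    simpa using hJ
  · intro J _
    ext a
    simp
  · intro J _
    ext a
    simp
  · intro J hJ
    obtain ⟨α, β, h⟩ := cobarTerm_act (HasAntidiagonal.mem_antidiagonal.1 hrs)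
      (Finset.mem_powersetCard.1 hJ).2 σ ψ
    simp only [h]
    refine Eq.trans ?_ (Equiv.sum_comp (MulAction.toPerm α) _)
    refine Finset.sum_congr rfl fun c₁ _ => ?_
    refine Eq.trans ?_ (Equiv.sum_comp (MulAction.toPerm β) _)
    refine Finset.sum_congr rfl fun c₂ _ => ?_
    exact cobarTerm_mk _ _ (Corolla.degree_smul _ _) (Corolla.degree_smul _ _)

theorem existsUnique_cobarDifferential :
    ∃! δ, IsCobarDifferential (gerstDual k) δ :=
  existsUnique_isCobarDifferential (gerstDual k) (fun _ _ => cobarOnGen_add)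
    (fun _ _ => cobarOnGen_smul) fun _ _ => cobarOnGen_act

end TreeSymmetry

/-! ### Coefficients of compositions -/

section Coefficients

variable {k : Type u} [Field k] {r s N : ℕ} (h : r + s = N)

/-- `L` is obtained by substituting `B` for the letter `0` of `A`. -/
def IsSubst (A : List (Fin (r + 1))) (B : List (Fin (s + 1))) (L : List (Fin (N + 1))) : Prop :=
  A.Nodup ∧ B.Nodup ∧ (0 ∈ A ↔ B ≠ []) ∧ wsubst h 0 A B = L

variable {h}

theorem wordTerm_apply_of_not {d e : ℤ} {A : List (Fin (r + 1))} {B : List (Fin (s + 1))}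
    {L : List (Fin (N + 1))} (hn : ¬ IsSubst h A B L) : wordTerm k h d e 0 A B L = 0 := by
  rw [wordTerm]
  split_ifs with hc
  · rw [Finsupp.single_apply, if_neg]
    exact fun e => hn ⟨hc.1, hc.2.1, hc.2.2.1, e⟩
  · rfl

theorem wordComp_apply_of_not {d e : ℤ} {L : List (Fin (N + 1))} (hn : ∀ A B, ¬ IsSubst h A B L)
    (v : List (Fin (r + 1)) →₀ k) (w : List (Fin (s + 1)) →₀ k) :
    wordComp k h d e 0 v w L = 0 := by
  induction v using Finsupp.induction_linear with
  | zero => simp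
  | add v v' ih ih' => simp [ih, ih']
  | single A a =>
    induction w using Finsupp.induction_linear with
    | zero => simp
    | add w w' ih ih' => simp [ih, ih']
    | single B b => rw [wordComp_single, Finsupp.smul_apply, wordTerm_apply_of_not (hn A B),
        smul_zero]

/-- When the word decomposes as a substitution in only one way, the coefficient of a composite is a
single product of coefficients. -/
theorem wordComp_apply {d e : ℤ} {A₀ : List (Fin (r + 1))} {B₀ : List (Fin (s + 1))}
    {L : List (Fin (N + 1))} (hu : ∀ A B, IsSubst h A B L → A = A₀ ∧ B = B₀)
    (v : List (Fin (r + 1)) →₀ k) (w : List (Fin (s + 1)) →₀ k) :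
    wordComp k h d e 0 v w L = v A₀ * w B₀ * wordTerm k h d e 0 A₀ B₀ L := by
  induction v using Finsupp.induction_linear with
  | zero => simp
  | add v v' ih ih' => simp [ih, ih', add_mul]
  | single A a =>
    induction w using Finsupp.induction_linear with
    | zero => simp
    | add w w' ih ih' => simp [ih, ih', add_mul, mul_add]
    | single B b =>
      rw [wordComp_single, Finsupp.smul_apply, smul_eq_mul, Finsupp.single_apply,
        Finsupp.single_apply]
      by_cases hA : A = A₀
      · by_cases hB : B = B₀
        · rw [if_pos hA, if_pos hB, hA, hB]
        · rw [if_neg hB, wordTerm_apply_of_not fun hh => hB (hu A B hh).2]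
          ring
      · rw [if_neg hA, wordTerm_apply_of_not fun hh => hA (hu A B hh).1]
        ring

/-- Arity and weight of a word determine the degree, so the degree conditions in `WordCompat` hold
automatically wherever the coefficients are non-zero. -/
theorem weight_of_corollaWord_ne_zero {c : Corolla r} {A : List (Fin (r + 1))}
    (hA : corollaWord k c A ≠ 0) : c.degree = 1 - 2 * r + weight A := by
  cases c with
  | space hr =>
    suffices A.length ≤ 1 by
      simp only [weight, Nat.sub_eq_zero_of_le this, Corolla.degree]
      push_cast
      ring
    by_contra hn
    apply hA
    change (-(Finsupp.single [] 1 + ∑ j, Finsupp.single [j] 1) : List (Fin (r + 1)) →₀ k) A = 0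
    rw [Finsupp.neg_apply, Finsupp.add_apply, Finsupp.finsetSum_apply]
    have h₁ : [] ≠ A := fun e => hn (by simp [← e])
    have h₂ : ∀ j, [j] ≠ A := fun j e => hn (by simp [← e])
    simp [h₁, h₂]
  | mixed p hp f =>
    change (Finsupp.single (List.ofFn f) 1 : List (Fin (r + 1)) →₀ k) A ≠ 0 at hA
    rw [Finsupp.single_apply, ite_ne_right_iff] at hA
    rw [← hA.1]
    simp only [weight, Corolla.degree, List.length_ofFn]
    omega

/-- Expressing degrees through arities and weights, the signs of the cobar construction and of word
composition combine: all terms involving arities cancel modulo 2. -/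
theorem corollaWord_mul_wordTerm {c₁ : Corolla r} {c₂ : Corolla s} {A : List (Fin (r + 1))}
    {B : List (Fin (s + 1))} {L : List (Fin (N + 1))} (hS : IsSubst h A B L) :
    ksign k (r * (1 - s - c₂.degree)) * ksign k ((1 - r - c₁.degree) + r) *
      (corollaWord k c₁ A * corollaWord k c₂ B *
        wordTerm k h (1 - r - c₁.degree) (1 - s - c₂.degree) 0 A B L) =
      ksign k (weight A + weight B * (weight A + A.idxOf 0)) *
        (corollaWord k c₁ A * corollaWord k c₂ B) := by
  by_cases hA : corollaWord k c₁ A = 0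
  · simp [hA]
  by_cases hB : corollaWord k c₂ B = 0
  · simp [hB]
  have h₁ := weight_of_corollaWord_ne_zero hA
  have h₂ := weight_of_corollaWord_ne_zero hB
  rw [wordTerm, if_pos ⟨hS.1, hS.2.1, hS.2.2.1, by rw [h₁]; ring, by rw [h₂]; ring⟩, hS.2.2.2,
    Finsupp.single_eq_same, wordSign, mul_comm (corollaWord k c₁ A * _), ← mul_assoc, ← ksign_add,
    ← ksign_add]
  congr 1
  apply ksign_eq_of_even
  rw [h₁, h₂]
  refine ⟨r * s + r + weight B * A.idxOf 0, ?_⟩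
  simp only [Fin.val_zero, Nat.cast_zero]
  ring

theorem sum_corollaWord_mixed {M : Type*} [AddCommGroup M] [Module k M] {p : ℕ} (hp : 2 ≤ p)
    (f : Fin p ↪ Fin (r + 1)) (g : Corolla r → M) :
    ∑ c, corollaWord k c (List.ofFn f) • g c = g (.mixed p hp f) := by
  classical
  rw [Finset.sum_eq_single (.mixed p hp f)]
  · rw [show List.ofFn f = (Corolla.mixed p hp f).word from rfl, corollaWord_apply_word, if_pos rfl]
    exact one_smul k _
  · intro c _ hc
    rw [show List.ofFn f = (Corolla.mixed p hp f).word from rfl, corollaWord_apply_word, if_neg hc,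
      zero_smul]
  · exact fun hn => absurd (Finset.mem_univ _) hn

/-- Words of length at most one occur only in the space corolla, always with coefficient −1; in
arity one there is no corolla at all. -/
theorem sum_corollaWord_space {M : Type*} [AddCommGroup M] [Module k M] {A : List (Fin (r + 1))}
    (hA : A.length ≤ 1) (g : Corolla r → M) :
    ∑ c, corollaWord k c A • g c = if hr : 1 ≤ r then -g (.space hr) else 0 := by
  have hm : ∀ p hp f, corollaWord k (.mixed p hp f : Corolla r) A = 0 := by
    intro p hp f
    change (Finsupp.single (List.ofFn f) 1 : List (Fin (r + 1)) →₀ k) A = 0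
    rw [Finsupp.single_apply, if_neg]
    rintro rfl
    rw [List.length_ofFn] at hA
    omega
  have hs : ∀ hr, corollaWord k (.space hr : Corolla r) A = -1 := by
    intro hr
    change (-(Finsupp.single [] 1 + ∑ j, Finsupp.single [j] 1) : List (Fin (r + 1)) →₀ k) A = -1
    rw [Finsupp.neg_apply, Finsupp.add_apply, Finsupp.finsetSum_apply]
    rcases A with _ | ⟨j, _ | ⟨j', A⟩⟩
    · simp
    · simp [Finsupp.single_apply]
    · simp at hA
  split_ifs with hr
  · rw [Finset.sum_eq_single (.space hr)]
    · rw [hs, neg_smul, one_smul]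
    · rintro (hr | ⟨p, hp, f⟩) _ hc
      · exact absurd rfl hc
      · rw [hm, zero_smul]
    · exact fun hn => absurd (Finset.mem_univ _) hn
  · refine Finset.sum_eq_zero ?_
    rintro (hr' | ⟨p, hp, f⟩) _
    · exact absurd hr' hr
    · rw [hm, zero_smul]

end Coefficients

/-! ### The cobar differential of a corolla -/

section CorollaTerms

variable (k : Type u) [Field k] [CharZero k]

/-- The corollas as elements of the cobar construction. -/
def corollaGen (r : ℕ) (c : Corolla r) : (free (cobarGen (gerstDual k))).V r c.degree :=
  ι _ (coordGen k ⟨c, trivial, rfl⟩)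

variable {k} {N r s : ℕ} {J : Finset (Fin (N + 1))}

/-- The coefficient at the word of c is read off after undoing the labelling of the tree, which
costs its sign. -/
theorem coordGen_tree (h : r + s = N) (hJ : #J = s + 1) (c : Corolla N) (c₁ : Corolla r)
    (c₂ : Corolla s) (hd : c₁.degree + c₂.degree = c.degree + 1) :
    cobarEval (gerstDual k) (coordGen k ⟨c, trivial, rfl⟩) (tree J (gerstDual k) (1 - N - c.degree)
      (corollaBasis k r c₁.degree ⟨c₁, trivial, rfl⟩)
      (corollaBasis k s c₂.degree ⟨c₂, trivial, rfl⟩)) =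
    c.coeff k * (psign k (treePerm J) * wordComp k h (1 - r - c₁.degree) (1 - s - c₂.degree) 0
      (corollaWord k c₁) (corollaWord k c₂) (c.word.map (treePerm J).symm)) := by
  change (corollaBasis k N c.degree).coord ⟨c, trivial, rfl⟩ _ = _
  have hd' : 1 - (r : ℤ) - c₁.degree + (1 - s - c₂.degree) = 1 - N - c.degree := by omega
  have hw : c.word = (c.word.map (treePerm J).symm).map (treePerm J) := by simp
  rw [corollaBasis_coord, LinearMap.smul_apply, tree_of J _ h hJ hd', smul_eq_mul]
  congr 1
  change wordForm k _ c.word _ = _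
  conv_lhs => rw [hw]
  rw [wordForm_act, wordForm_apply, toWord_comp, toWord_corollaBasis, toWord_corollaBasis]

theorem cobarTerm_coordGen (h : r + s = N) (hJ : #J = s + 1) (c : Corolla N) (c₁ : Corolla r)
    (c₂ : Corolla s) :
    cobarTerm J (coordGen k ⟨c, trivial, rfl⟩) ⟨c₁, trivial, rfl⟩ ⟨c₂, trivial, rfl⟩ =
      (c.coeff k * (ksign k (r * (1 - s - c₂.degree)) * ksign k ((1 - r - c₁.degree) + r) *
        wordComp k h (1 - r - c₁.degree) (1 - s - c₂.degree) 0 (corollaWord k c₁)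
          (corollaWord k c₂) (c.word.map (treePerm J).symm))) •
      tree J (free (cobarGen (gerstDual k))) (c.degree + 1) (corollaGen k r c₁)
        (corollaGen k s c₂) := by
  by_cases hd : c₁.degree + c₂.degree = c.degree + 1
  · rw [cobarTerm, coordGen_tree h hJ c c₁ c₂ hd]
    refine congrArg (· • _) ?_
    -- The sign of the labelling occurs twice, once in the differential and once from relabelling
    -- words, and cancels.
    have key : ∀ {a t u w E : k}, t * t = 1 → t * u * w * (a * (t * E)) = a * (u * w * E) := by
      intro a t u w E ht
      linear_combination a * u * w * E * ht
    exact key (psign_sq k _)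
  · rw [cobarTerm_eq_zero _ _ _ hd]
    exact (smul_eq_zero_of_right _ (dif_neg fun hh => hd hh.2.2)).symm

variable (k J) in
/-- The part of the cobar differential of `c` on the trees with upper leaves `J`. -/
def treePart (c : Corolla N) : (free (cobarGen (gerstDual k))).V N (c.degree + 1) :=
  ∑ c₁ : Corolla #Jᶜ, ∑ c₂ : Corolla (#J - 1),
    cobarTerm J (coordGen k ⟨c, trivial, rfl⟩) ⟨c₁, trivial, rfl⟩ ⟨c₂, trivial, rfl⟩

/-- The set of upper leaves determines the arities of both vertices, so the sum runs over non-empty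
sets J alone. -/
theorem sum_antidiagonal_powersetCard {M : Type*} [AddCommMonoid M]
    (g : ℕ → ℕ → Finset (Fin (N + 1)) → M) :
    ∑ rs ∈ antidiagonal N, ∑ J ∈ powersetCard (rs.2 + 1) (univ : Finset (Fin (N + 1))),
      g rs.1 rs.2 J = ∑ J : Finset (Fin (N + 1)) with 1 ≤ #J, g #Jᶜ (#J - 1) J := by
  have hc : ∀ J : Finset (Fin (N + 1)), #J + #Jᶜ = N + 1 := fun J => by
    rw [card_add_card_compl, Fintype.card_fin]
  rw [← Finset.sum_fiberwise_of_maps_to (t := antidiagonal N) (g := fun J => (#Jᶜ, #J - 1))]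
  · refine Finset.sum_congr rfl fun rs hrs => ?_
    rw [HasAntidiagonal.mem_antidiagonal] at hrs
    refine Finset.sum_congr ?_ ?_
    · ext J
      have := hc J
      simp only [mem_powersetCard, subset_univ, true_and, mem_filter, mem_univ, Prod.ext_iff]
      omega
    · intro J hJ
      rw [Finset.mem_filter] at hJ
      rw [← hJ.2]
  · intro J hJ
    have := hc J
    have := (Finset.mem_filter.1 hJ).2
    rw [HasAntidiagonal.mem_antidiagonal]
    omega

theorem cobarOnGen_coordGen (c : Corolla N) :
    cobarOnGen (gerstDual k) (coordGen k ⟨c, trivial, rfl⟩) =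
      ∑ J : Finset (Fin (N + 1)) with 1 ≤ #J, treePart k J c := by
  rw [cobarOnGen_eq]
  exact sum_antidiagonal_powersetCard fun r s J => ∑ c₁ : Corolla r, ∑ c₂ : Corolla s,
    cobarTerm J (coordGen k ⟨c, trivial, rfl⟩) ⟨c₁, trivial, rfl⟩ ⟨c₂, trivial, rfl⟩

theorem card_compl_add (hJ : 1 ≤ #J) : #Jᶜ + (#J - 1) = N := by
  have := card_add_card_compl J
  rw [Fintype.card_fin] at this
  omega

theorem treePart_eq_zero (hJ : 1 ≤ #J) {c : Corolla N}
    (hn : ∀ A B, ¬ IsSubst (card_compl_add hJ) A B (c.word.map (treePerm J).symm)) :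
    treePart k J c = 0 := by
  refine Finset.sum_eq_zero fun c₁ _ => Finset.sum_eq_zero fun c₂ _ => ?_
  rw [cobarTerm_coordGen (card_compl_add hJ) (by omega), wordComp_apply_of_not hn, mul_zero,
    mul_zero, zero_smul]

/-- Once the substitution is unique, the words A and B are fixed and the sums over the two
decorations separate; the sign depends on A and B only. -/
theorem treePart_eq (hJ : 1 ≤ #J) {c : Corolla N} {A : List (Fin (#Jᶜ + 1))}
    {B : List (Fin (#J - 1 + 1))}
    (hS : IsSubst (card_compl_add hJ) A B (c.word.map (treePerm J).symm))
    (hu : ∀ A' B', IsSubst (card_compl_add hJ) A' B' (c.word.map (treePerm J).symm) →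
      A' = A ∧ B' = B) :
    treePart k J c = (c.coeff k * ksign k (weight A + weight B * (weight A + A.idxOf 0))) •
      ∑ c₁ : Corolla #Jᶜ, corollaWord k c₁ A • ∑ c₂ : Corolla (#J - 1), corollaWord k c₂ B •
        tree J (free (cobarGen (gerstDual k))) (c.degree + 1) (corollaGen k _ c₁)
          (corollaGen k _ c₂) := by
  simp only [Finset.smul_sum]
  refine Finset.sum_congr rfl fun c₁ _ => Finset.sum_congr rfl fun c₂ _ => ?_
  rw [cobarTerm_coordGen (card_compl_add hJ) (by omega), wordComp_apply hu,
    corollaWord_mul_wordTerm hS, smul_smul, smul_smul]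
  congr 1
  ring

end CorollaTerms

/-! ### Words on two-vertex trees -/

section TreeWords

variable {N : ℕ} {J : Finset (Fin (N + 1))}

theorem lowerIdx_of_mem {a : Fin (N + 1)} (ha : a ∈ J) : lowerIdx J a = 0 := by
  obtain ⟨x, rfl⟩ := (splitEquiv J).surjective a
  rw [lowerIdx, Equiv.symm_apply_apply]
  rcases x with i | j
  · rfl
  · rw [splitEquiv, finSumEquivOfFinset_inr] at ha
    exact absurd ha (Finset.mem_compl.1 (Finset.orderEmbOfFin_mem _ _ _))

theorem lowerIdx_ne_zero {a : Fin (N + 1)} (ha : a ∉ J) : lowerIdx J a ≠ 0 := by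
  obtain ⟨x, rfl⟩ := (splitEquiv J).surjective a
  rw [lowerIdx, Equiv.symm_apply_apply]
  rcases x with i | j
  · rw [splitEquiv, finSumEquivOfFinset_inl] at ha
    exact absurd (Finset.orderEmbOfFin_mem _ _ _) ha
  · exact Fin.succ_ne_zero j

theorem treePerm_symm_val (a : Fin (N + 1)) :
    ((treePerm J).symm a : ℕ) = finSumFinEquiv ((splitEquiv J).symm a) := by
  simp [treePerm]

theorem leafLower_lowerIdx (hJ : 1 ≤ #J) {a : Fin (N + 1)} (ha : a ∉ J) :
    leafLower (card_compl_add hJ) 0 (lowerIdx J a) = (treePerm J).symm a := by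
  refine Fin.ext ?_
  rw [treePerm_symm_val]
  obtain ⟨x, rfl⟩ := (splitEquiv J).surjective a
  rw [lowerIdx, Equiv.symm_apply_apply]
  rcases x with i | j
  · rw [splitEquiv, finSumEquivOfFinset_inl] at ha
    exact absurd (Finset.orderEmbOfFin_mem _ _ _) ha
  · simp [leafLower_val]
    omega

theorem leafUpper_upperIdx (hJ : 1 ≤ #J) {a : Fin (N + 1)} (ha : a ∈ J) :
    leafUpper (card_compl_add hJ) 0 (upperIdx J a) = (treePerm J).symm a := by
  refine Fin.ext ?_
  rw [treePerm_symm_val]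
  obtain ⟨x, rfl⟩ := (splitEquiv J).surjective a
  rw [upperIdx, Equiv.symm_apply_apply]
  rcases x with i | j
  · simp [leafUpper_val]
  · rw [splitEquiv, finSumEquivOfFinset_inr] at ha
    exact absurd ha (Finset.mem_compl.1 (Finset.orderEmbOfFin_mem _ _ _))

theorem treePerm_leafUpper_mem (hJ : 1 ≤ #J) (l : Fin (#J - 1 + 1)) :
    treePerm J (leafUpper (card_compl_add hJ) 0 l) ∈ J := by
  rw [treePerm_mem_iff, leafUpper_val]
  simp
  omega

theorem treePerm_leafLower_notMem (hJ : 1 ≤ #J) {j : Fin (#Jᶜ + 1)} (hj : j ≠ 0) :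
    treePerm J (leafLower (card_compl_add hJ) 0 j) ∉ J := by
  have : (j : ℕ) ≠ 0 := fun e => hj (Fin.ext e)
  rw [treePerm_mem_iff, leafLower_val]
  simp
  omega

theorem upperIdx_treePerm (hJ : 1 ≤ #J) (l : Fin (#J - 1 + 1)) :
    upperIdx J (treePerm J (leafUpper (card_compl_add hJ) 0 l)) = l := by
  apply leafUpper_injective (card_compl_add hJ) 0
  rw [leafUpper_upperIdx hJ (treePerm_leafUpper_mem hJ l), Equiv.symm_apply_apply]

theorem lowerIdx_treePerm (hJ : 1 ≤ #J) {j : Fin (#Jᶜ + 1)} (hj : j ≠ 0) :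
    lowerIdx J (treePerm J (leafLower (card_compl_add hJ) 0 j)) = j := by
  have hn := treePerm_leafLower_notMem hJ hj
  apply leafLower_injOn (card_compl_add hJ) 0 (lowerIdx_ne_zero hn) hj
  rw [leafLower_lowerIdx hJ hn, Equiv.symm_apply_apply]

theorem map_leafLower_lowerIdx (hJ : 1 ≤ #J) {F : List (Fin (N + 1))} (hF : ∀ a ∈ F, a ∉ J) :
    (F.map (lowerIdx J)).map (leafLower (card_compl_add hJ) 0) = F.map (treePerm J).symm := by
  rw [List.map_map]
  exact List.map_congr_left fun a ha => leafLower_lowerIdx hJ (hF a ha)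

theorem map_leafUpper_upperIdx (hJ : 1 ≤ #J) {F : List (Fin (N + 1))} (hF : ∀ a ∈ F, a ∈ J) :
    (F.map (upperIdx J)).map (leafUpper (card_compl_add hJ) 0) = F.map (treePerm J).symm := by
  rw [List.map_map]
  exact List.map_congr_left fun a ha => leafUpper_upperIdx hJ (hF a ha)

theorem zero_notMem_map_lowerIdx {F : List (Fin (N + 1))} (hF : ∀ a ∈ F, a ∉ J) :
    0 ∉ F.map (lowerIdx J) := by
  intro h
  obtain ⟨a, ha, e⟩ := List.mem_map.1 h
  exact lowerIdx_ne_zero (hF a ha) e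

theorem isSubst_nil (hJ : 1 ≤ #J) {F : List (Fin (N + 1))} (hd : F.Nodup) (hF : ∀ a ∈ F, a ∉ J) :
    IsSubst (card_compl_add hJ) (F.map (lowerIdx J)) [] (F.map (treePerm J).symm) := by
  have h₀ := zero_notMem_map_lowerIdx hF
  refine ⟨List.Nodup.of_map (leafLower (card_compl_add hJ) 0) ?_, List.nodup_nil, by simp [h₀], ?_⟩
  · rw [map_leafLower_lowerIdx hJ hF]
    exact hd.map (treePerm J).symm.injective
  · rw [wsubst_of_notMem _ _ h₀, map_leafLower_lowerIdx hJ hF]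

theorem isSubst_append (hJ : 1 ≤ #J) {F₁ F₂ F₃ : List (Fin (N + 1))} (hd : (F₁ ++ F₂ ++ F₃).Nodup)
    (hF₁ : ∀ a ∈ F₁, a ∉ J) (hF₂ : ∀ a ∈ F₂, a ∈ J) (hF₃ : ∀ a ∈ F₃, a ∉ J) (hne : F₂ ≠ []) :
    IsSubst (card_compl_add hJ) (F₁.map (lowerIdx J) ++ 0 :: F₃.map (lowerIdx J))
      (F₂.map (upperIdx J)) ((F₁ ++ F₂ ++ F₃).map (treePerm J).symm) := by
  have h₁ := zero_notMem_map_lowerIdx hF₁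
  have h₃ := zero_notMem_map_lowerIdx hF₃
  have hw : wsubst (card_compl_add hJ) 0 (F₁.map (lowerIdx J) ++ 0 :: F₃.map (lowerIdx J))
      (F₂.map (upperIdx J)) = (F₁ ++ F₂ ++ F₃).map (treePerm J).symm := by
    rw [wsubst_append, wsubst_cons_self, wsubst_of_notMem _ _ h₁, wsubst_of_notMem _ _ h₃,
      map_leafLower_lowerIdx hJ hF₁, map_leafLower_lowerIdx hJ hF₃, map_leafUpper_upperIdx hJ hF₂,
      List.map_append, List.map_append, List.append_assoc]
  have hd₁₃ : (F₁ ++ F₃).Nodup := hd.sublist (by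
    rw [List.append_assoc]
    exact List.Sublist.append_left (List.sublist_append_right _ _) _)
  have hd₂ : F₂.Nodup := (hd.of_append_left).of_append_right
  refine ⟨?_, List.Nodup.of_map (leafUpper (card_compl_add hJ) 0) ?_, ?_, hw⟩
  · rw [List.nodup_middle, List.nodup_cons, ← List.map_append]
    have hF₁₃ : ∀ a ∈ F₁ ++ F₃, a ∉ J := fun a ha =>
      (List.mem_append.1 ha).elim (hF₁ a) (hF₃ a)
    refine ⟨zero_notMem_map_lowerIdx hF₁₃,
      List.Nodup.of_map (leafLower (card_compl_add hJ) 0) ?_⟩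
    rw [map_leafLower_lowerIdx hJ hF₁₃]
    exact hd₁₃.map (treePerm J).symm.injective
  · rw [map_leafUpper_upperIdx hJ hF₂]
    exact hd₂.map (treePerm J).symm.injective
  · simp [hne]

/-- Letters of B become leaves in J, and letters of A other than 0 become leaves outside J. Hence
the letters of F lying in J form one contiguous block, placed where 0 stands in A, or do not occur
at all. -/
theorem IsSubst.cases {hJ : 1 ≤ #J} {A : List (Fin (#Jᶜ + 1))} {B : List (Fin (#J - 1 + 1))}
    {F : List (Fin (N + 1))} (hS : IsSubst (card_compl_add hJ) A B (F.map (treePerm J).symm)) :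
    ((∀ a ∈ F, a ∉ J) ∧ A = F.map (lowerIdx J) ∧ B = []) ∨
    ∃ F₁ F₂ F₃, F = F₁ ++ F₂ ++ F₃ ∧ (∀ a ∈ F₁, a ∉ J) ∧ (∀ a ∈ F₂, a ∈ J) ∧ (∀ a ∈ F₃, a ∉ J) ∧
      F₂ ≠ [] ∧ A = F₁.map (lowerIdx J) ++ 0 :: F₃.map (lowerIdx J) ∧ B = F₂.map (upperIdx J) := by
  obtain ⟨hA, hB, h₀, hw⟩ := hS
  have hF : F = (wsubst (card_compl_add hJ) 0 A B).map (treePerm J) := by simp [hw]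
  have low : ∀ {C : List (Fin (#Jᶜ + 1))}, 0 ∉ C →
      (∀ a ∈ (C.map (leafLower (card_compl_add hJ) 0)).map (treePerm J), a ∉ J) ∧
      C = ((C.map (leafLower (card_compl_add hJ) 0)).map (treePerm J)).map (lowerIdx J) := by
    intro C hC
    constructor
    · intro a ha
      simp only [List.map_map, List.mem_map] at ha
      obtain ⟨j, hj, rfl⟩ := ha
      exact treePerm_leafLower_notMem hJ fun e => hC (e ▸ hj)
    · simp only [List.map_map]
      conv_lhs => rw [← List.map_id C]
      exact List.map_congr_left fun j hj => (lowerIdx_treePerm hJ fun e => hC (e ▸ hj)).symm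
  by_cases hn : B = []
  · subst hn
    have h₀ : 0 ∉ A := fun h => h₀.1 h rfl
    rw [wsubst_of_notMem _ _ h₀] at hF
    left
    subst hF
    exact ⟨(low h₀).1, (low h₀).2, rfl⟩
  · obtain ⟨A₁, A₃, rfl, h₁⟩ := List.eq_append_cons_of_mem (h₀.2 hn)
    have h₃ : 0 ∉ A₃ := fun hh => by
      rw [List.nodup_middle, List.nodup_cons] at hA
      exact hA.1 (List.mem_append_right _ hh)
    rw [wsubst_append, wsubst_cons_self, wsubst_of_notMem _ _ h₁, wsubst_of_notMem _ _ h₃,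
      ← List.append_assoc, List.map_append, List.map_append] at hF
    refine Or.inr ⟨_, _, _, hF, (low h₁).1, ?_, (low h₃).1, by simpa using hn, ?_, ?_⟩
    · intro a ha
      simp only [List.map_map, List.mem_map] at ha
      obtain ⟨j, hj, rfl⟩ := ha
      exact treePerm_leafUpper_mem hJ j
    · rw [← (low h₁).2, ← (low h₃).2]
    · simp only [List.map_map]
      conv_lhs => rw [← List.map_id B]
      exact List.map_congr_left fun j hj => (upperIdx_treePerm hJ j).symm

/-- The place of the cut is intrinsic: it lies just before the first entry satisfying P, or at the
end if there is none. -/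
theorem append_inj_of_pred {α : Type*} {P : α → Prop} {X X' Y Y' : List α} (hX : ∀ a ∈ X, ¬ P a)
    (hX' : ∀ a ∈ X', ¬ P a) (hY : ∀ a ∈ Y.head?, P a) (hY' : ∀ a ∈ Y'.head?, P a)
    (h : X ++ Y = X' ++ Y') : X = X' ∧ Y = Y' := by
  induction X generalizing X' with
  | nil =>
    cases X' with
    | nil => exact ⟨rfl, h⟩
    | cons b X' =>
      rw [List.nil_append] at h
      subst h
      exact absurd (hY b (by simp)) (hX' b (by simp))
  | cons a X ih =>
    cases X' with
    | nil =>
      rw [List.nil_append] at h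
      subst h
      exact absurd (hY' a (by simp)) (hX a (by simp))
    | cons b X' =>
      rw [List.cons_append, List.cons_append, List.cons.injEq] at h
      obtain ⟨rfl, h⟩ := h
      obtain ⟨rfl, rfl⟩ := ih (fun c hc => hX c (by simp [hc])) (fun c hc => hX' c (by simp [hc])) h
      exact ⟨rfl, rfl⟩

theorem append_append_inj {F₁ F₂ F₃ G₁ G₂ G₃ : List (Fin (N + 1))}
    (hF₁ : ∀ a ∈ F₁, a ∉ J) (hF₂ : ∀ a ∈ F₂, a ∈ J) (hF₃ : ∀ a ∈ F₃, a ∉ J) (hF : F₂ ≠ [])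
    (hG₁ : ∀ a ∈ G₁, a ∉ J) (hG₂ : ∀ a ∈ G₂, a ∈ J) (hG₃ : ∀ a ∈ G₃, a ∉ J) (hG : G₂ ≠ [])
    (h : F₁ ++ F₂ ++ F₃ = G₁ ++ G₂ ++ G₃) : F₁ = G₁ ∧ F₂ = G₂ ∧ F₃ = G₃ := by
  rw [List.append_assoc, List.append_assoc] at h
  have head : ∀ {X Y : List (Fin (N + 1))}, X ≠ [] → (∀ a ∈ X, a ∈ J) →
      ∀ a ∈ (X ++ Y).head?, a ∈ J := by
    intro X Y hX hXJ a ha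
    obtain ⟨b, X, rfl⟩ := List.exists_cons_of_ne_nil hX
    simp only [List.cons_append, List.head?_cons, Option.mem_some_iff] at ha
    exact ha ▸ hXJ b (by simp)
  obtain ⟨rfl, h'⟩ := append_inj_of_pred (P := (· ∈ J)) hF₁ hG₁ (head hF hF₂) (head hG hG₂) h
  obtain ⟨rfl, rfl⟩ := append_inj_of_pred (P := (· ∉ J)) (fun a ha => not_not.2 (hF₂ a ha))
    (fun a ha => not_not.2 (hG₂ a ha)) (fun a ha => hF₃ a (List.mem_of_mem_head? ha))
    (fun a ha => hG₃ a (List.mem_of_mem_head? ha)) h'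
  exact ⟨rfl, rfl, rfl⟩

theorem isSubst_nil_unique (hJ : 1 ≤ #J) {F : List (Fin (N + 1))} (hF : ∀ a ∈ F, a ∉ J)
    {A : List (Fin (#Jᶜ + 1))} {B : List (Fin (#J - 1 + 1))}
    (hS : IsSubst (card_compl_add hJ) A B (F.map (treePerm J).symm)) :
    A = F.map (lowerIdx J) ∧ B = [] := by
  rcases IsSubst.cases (hJ := hJ) hS with ⟨-, h⟩ | ⟨F₁, F₂, F₃, rfl, -, h₂, -, hne, -⟩
  · exact h
  · obtain ⟨b, F₂, rfl⟩ := List.exists_cons_of_ne_nil hne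
    exact absurd (h₂ b (by simp)) (hF b (by simp))

theorem isSubst_append_unique (hJ : 1 ≤ #J) {F₁ F₂ F₃ : List (Fin (N + 1))}
    (hF₁ : ∀ a ∈ F₁, a ∉ J) (hF₂ : ∀ a ∈ F₂, a ∈ J) (hF₃ : ∀ a ∈ F₃, a ∉ J) (hne : F₂ ≠ [])
    {A : List (Fin (#Jᶜ + 1))} {B : List (Fin (#J - 1 + 1))}
    (hS : IsSubst (card_compl_add hJ) A B ((F₁ ++ F₂ ++ F₃).map (treePerm J).symm)) :
    A = F₁.map (lowerIdx J) ++ 0 :: F₃.map (lowerIdx J) ∧ B = F₂.map (upperIdx J) := by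
  rcases IsSubst.cases (hJ := hJ) hS with ⟨h, -⟩ | ⟨G₁, G₂, G₃, e, h₁, h₂, h₃, hne', h⟩
  · obtain ⟨b, F₂, rfl⟩ := List.exists_cons_of_ne_nil hne
    exact absurd (hF₂ b (by simp)) (h b (by simp))
  · obtain ⟨rfl, rfl, rfl⟩ := append_append_inj hF₁ hF₂ hF₃ hne h₁ h₂ h₃ hne' e
    exact h

end TreeWords

/-! ### Intervals of planar inputs -/

section Intervals

variable {N p : ℕ} {J : Finset (Fin (N + 1))} {f : Fin p ↪ Fin (N + 1)}

theorem atNat_of_lt (f : Fin p → Fin (N + 1)) {n : ℕ} (h : n < p) : atNat f n = f ⟨n, h⟩ :=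
  dif_pos h

variable {l m t : ℕ}

theorem ofFn_eq_append (hlm : l + m = p + 1) (ht : t < m) (f : Fin p → Fin (N + 1)) :
    List.ofFn f = List.ofFn (fun u : Fin t => atNat f u) ++
      List.ofFn (fun u : Fin l => atNat f (t + u)) ++
      List.ofFn (fun u : Fin (m - 1 - t) => atNat f (t + l + u)) := by
  refine List.ext_getElem (by simp; omega) fun n h₁ h₂ => ?_
  rw [List.length_ofFn] at h₁
  simp only [List.getElem_append, List.getElem_ofFn, List.length_append, List.length_ofFn]
  split_ifs with h₃ h₄
  · rw [atNat_of_lt f h₁]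
  · rw [show t + (n - t) = n by omega, atNat_of_lt f h₁]
  · rw [show t + l + (n - (t + l)) = n by omega, atNat_of_lt f h₁]

/-- At u = t the formula evaluates `lowerIdx` at the first leaf of the block; this leaf sits on the
upper vertex, so the value is 0, the internal edge. Later entries skip the rest of the block. -/
theorem ofFn_lowerIdx_eq (hl : 1 ≤ l) (ht : t < m) (f : Fin p → Fin (N + 1))
    (h₀ : atNat f t ∈ J) :
    List.ofFn (fun u : Fin m => lowerIdx J (atNat f (if (u : ℕ) ≤ t then u else u + l - 1))) =
      (List.ofFn fun u : Fin t => atNat f u).map (lowerIdx J) ++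
        0 :: (List.ofFn fun u : Fin (m - 1 - t) => atNat f (t + l + u)).map (lowerIdx J) := by
  refine List.ext_getElem (by simp; omega) fun n h₁ h₂ => ?_
  simp only [List.getElem_append, List.getElem_ofFn, List.length_map, List.length_ofFn,
    List.getElem_map, List.getElem_cons]
  split_ifs with h₃ h₄ h₅ h₄ h₅
  · rfl
  · rw [show n = t by omega, lowerIdx_of_mem h₀]
  · omega
  · omega
  · omega
  · rw [show t + l + (n - t - 1) = n + l - 1 by omega]

theorem interval_conditions (hlm : l + m = p + 1) (ht : t < m)
    (hK : ∀ q : Fin p, f q ∈ J ↔ t ≤ (q : ℕ) ∧ (q : ℕ) < t + l) :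
    (∀ a ∈ List.ofFn (fun u : Fin t => atNat f u), a ∉ J) ∧
    (∀ a ∈ List.ofFn (fun u : Fin l => atNat f (t + u)), a ∈ J) ∧
    ∀ a ∈ List.ofFn (fun u : Fin (m - 1 - t) => atNat f (t + l + u)), a ∉ J := by
  simp only [List.mem_ofFn, forall_exists_index, forall_apply_eq_imp_iff]
  refine ⟨fun u => ?_, fun u => ?_, fun u => ?_⟩
  · rw [atNat_of_lt f (show (u : ℕ) < p by omega), hK]
    simp
  · rw [atNat_of_lt f (show t + (u : ℕ) < p by omega), hK]
    simp
  · rw [atNat_of_lt f (show t + l + (u : ℕ) < p by omega), hK]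
    simp

/-- The substitution of words for an interval of planar inputs on the upper vertex. -/
theorem isSubst_interval (hJ : 1 ≤ #J) (hlm : l + m = p + 1) (hl : 1 ≤ l) (ht : t < m)
    (hK : ∀ q : Fin p, f q ∈ J ↔ t ≤ (q : ℕ) ∧ (q : ℕ) < t + l) :
    IsSubst (card_compl_add hJ)
      (List.ofFn fun u : Fin m => lowerIdx J (atNat f (if (u : ℕ) ≤ t then u else u + l - 1)))
      (List.ofFn fun u : Fin l => upperIdx J (atNat f (t + u)))
      ((List.ofFn f).map (treePerm J).symm) ∧
    (List.ofFn fun u : Fin m =>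
      lowerIdx J (atNat f (if (u : ℕ) ≤ t then u else u + l - 1))).idxOf 0 = t ∧
    ∀ A B, IsSubst (card_compl_add hJ) A B ((List.ofFn f).map (treePerm J).symm) →
      A = (List.ofFn fun u : Fin m =>
        lowerIdx J (atNat f (if (u : ℕ) ≤ t then u else u + l - 1))) ∧
      B = List.ofFn fun u : Fin l => upperIdx J (atNat f (t + u)) := by
  obtain ⟨h₁, h₂, h₃⟩ := interval_conditions hlm ht hK
  have h₀ : atNat f t ∈ J := by
    rw [atNat_of_lt f (show t < p by omega), hK]
    simp
    omega
  have hB : (List.ofFn fun u : Fin l => upperIdx J (atNat f (t + u))) =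
      (List.ofFn fun u : Fin l => atNat f (t + u)).map (upperIdx J) := by
    rw [List.map_ofFn]
    rfl
  have hne : List.ofFn (fun u : Fin l => atNat f (t + u)) ≠ [] := by
    intro e
    have := congrArg List.length e
    simp only [List.length_ofFn, List.length_nil] at this
    omega
  have hd : (List.ofFn f).Nodup := List.nodup_ofFn.2 f.injective
  rw [ofFn_lowerIdx_eq hl ht f h₀, hB]
  rw [ofFn_eq_append hlm ht] at hd ⊢
  refine ⟨isSubst_append hJ hd h₁ h₂ h₃ hne, ?_, fun A B hS =>
    isSubst_append_unique hJ h₁ h₂ h₃ hne hS⟩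
  rw [List.idxOf_append_of_notMem (zero_notMem_map_lowerIdx h₁)]
  simp

/-- A substitution can only occur for an interval of planar inputs. -/
theorem IsSubst.interval {hJ : 1 ≤ #J} {A : List (Fin (#Jᶜ + 1))} {B : List (Fin (#J - 1 + 1))}
    (hS : IsSubst (card_compl_add hJ) A B ((List.ofFn f).map (treePerm J).symm)) :
    (∀ q, f q ∉ J) ∨ ∃ l m t, l + m = p + 1 ∧ 1 ≤ l ∧ t < m ∧
      ∀ q : Fin p, f q ∈ J ↔ t ≤ (q : ℕ) ∧ (q : ℕ) < t + l := by
  rcases IsSubst.cases (hJ := hJ) hS with ⟨h, -⟩ | ⟨F₁, F₂, F₃, e, h₁, h₂, h₃, hne, -⟩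
  · exact Or.inl fun q => h _ (List.mem_ofFn.2 ⟨q, rfl⟩)
  · right
    have hlen := congrArg List.length e
    simp only [List.length_ofFn, List.length_append] at hlen
    have hl := List.length_pos_of_ne_nil hne
    -- The lower vertex keeps the planar inputs outside the block and one more for the internal
    -- edge, hence m = p + 1 − l.
    refine ⟨F₂.length, p + 1 - F₂.length, F₁.length, by omega, hl, by omega, fun q => ?_⟩
    have hq : f q = (F₁ ++ F₂ ++ F₃)[(q : ℕ)]'(by simp only [List.length_append]; omega) := by
      simp [← e]
    rw [hq]
    by_cases hq₁ : (q : ℕ) < F₁.length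
    · rw [List.getElem_append_left (by simp; omega), List.getElem_append_left hq₁]
      exact iff_of_false (h₁ _ (List.getElem_mem _)) (by omega)
    · by_cases hq₂ : (q : ℕ) < F₁.length + F₂.length
      · rw [List.getElem_append_left (by simpa using hq₂), List.getElem_append_right (by omega)]
        exact iff_of_true (h₂ _ (List.getElem_mem _)) (by omega)
      · rw [List.getElem_append_right (by simp; omega)]
        exact iff_of_false (h₃ _ (List.getElem_mem _)) (by omega)

end Intervals

/-! ### The parts of the cobar differential -/

section TreeParts

variable {k : Type u} [Field k] {N : ℕ} {J : Finset (Fin (N + 1))}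

local notation "F∞" => free (cobarGen (gerstDual k))

theorem spaceC_of_le (O : Operad k) (x : ∀ (r : ℕ) (c : Corolla r), O.V r c.degree) {r : ℕ}
    (hr : 1 ≤ r) : spaceC O x r = x r (.space hr) := by
  unfold spaceC
  exact dif_pos hr

theorem mixedC_of (O : Operad k) (x : ∀ (r : ℕ) (c : Corolla r), O.V r c.degree) {r p : ℕ}
    (hp : 2 ≤ p) {g : Fin p → Fin (r + 1)} (hg : Function.Injective g) :
    mixedC O x r p g = x r (.mixed p hp ⟨g, hg⟩) := by
  unfold mixedC
  exact dif_pos (c := 2 ≤ p ∧ Function.Injective g) ⟨hp, hg⟩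

theorem tree_zero_left (O : Operad k) (D : ℤ) {r s : ℕ} {d e : ℤ} (y : O.V s e) :
    tree J O D (0 : O.V r d) y = 0 := by
  rw [tree_eq_treeLin, map_zero, LinearMap.zero_apply]

theorem tree_zero_right (O : Operad k) (D : ℤ) {r s : ℕ} {d e : ℤ} (x : O.V r d) :
    tree J O D x (0 : O.V s e) = 0 := by
  rw [tree_eq_treeLin, map_zero]

variable [CharZero k]

theorem sum_tree_space_right (D : ℤ) {r s : ℕ} {d : ℤ} (y : (F∞).V r d) {B : List (Fin (s + 1))}
    (hB : B.length ≤ 1) :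
    ∑ c : Corolla s, corollaWord k c B • tree J F∞ D y (corollaGen k s c) =
      -tree J F∞ D y (spaceC F∞ (corollaGen k) s) := by
  rw [sum_corollaWord_space hB fun c => tree J F∞ D y (corollaGen k s c)]
  split_ifs with hs
  · exact congrArg (fun z => -tree J F∞ D y z) (spaceC_of_le _ _ hs).symm
  · rw [show spaceC F∞ (corollaGen k) s = 0 from dif_neg hs, tree_zero_right, neg_zero]

theorem sum_tree_space_left (D : ℤ) {r s : ℕ} {e : ℤ} (z : (F∞).V s e) {A : List (Fin (r + 1))}
    (hA : A.length ≤ 1) :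
    ∑ c : Corolla r, corollaWord k c A • tree J F∞ D (corollaGen k r c) z =
      -tree J F∞ D (spaceC F∞ (corollaGen k) r) z := by
  rw [sum_corollaWord_space hA fun c => tree J F∞ D (corollaGen k r c) z]
  split_ifs with hr
  · exact congrArg (fun y => -tree J F∞ D y z) (spaceC_of_le _ _ hr).symm
  · rw [show spaceC F∞ (corollaGen k) r = 0 from dif_neg hr, tree_zero_left, neg_zero]

theorem sum_tree_mixed_right (D : ℤ) {r s p : ℕ} {d : ℤ} (y : (F∞).V r d) (hp : 2 ≤ p)
    {g : Fin p → Fin (s + 1)} (hg : (List.ofFn g).Nodup) :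
    ∑ c : Corolla s, corollaWord k c (List.ofFn g) • tree J F∞ D y (corollaGen k s c) =
      tree J F∞ D y (mixedC F∞ (corollaGen k) s p g) := by
  have hi := List.nodup_ofFn.1 hg
  refine (sum_corollaWord_mixed hp ⟨g, hi⟩ fun c => tree J F∞ D y (corollaGen k s c)).trans ?_
  exact congrArg (fun z => tree J F∞ D y z) (mixedC_of _ _ hp hi).symm

theorem sum_tree_mixed_left (D : ℤ) {r s p : ℕ} {e : ℤ} (z : (F∞).V s e) (hp : 2 ≤ p)
    {g : Fin p → Fin (r + 1)} (hg : (List.ofFn g).Nodup) :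
    ∑ c : Corolla r, corollaWord k c (List.ofFn g) • tree J F∞ D (corollaGen k r c) z =
      tree J F∞ D (mixedC F∞ (corollaGen k) r p g) z := by
  have hi := List.nodup_ofFn.1 hg
  refine (sum_corollaWord_mixed hp ⟨g, hi⟩ fun c => tree J F∞ D (corollaGen k r c) z).trans ?_
  exact congrArg (fun y => tree J F∞ D y z) (mixedC_of _ _ hp hi).symm

/-- Both words are empty. The three space corollas contribute three factors −1, which matches the
sign of two odd decorations ordered from top to bottom. -/
theorem treePart_space (hJ : 1 ≤ #J) (hN : 1 ≤ N) :
    treePart k J (.space hN) = topTree F∞ J _ (spaceC F∞ (corollaGen k) #Jᶜ)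
      (spaceC F∞ (corollaGen k) (#J - 1)) := by
  have hS := isSubst_nil (J := J) hJ (F := []) List.nodup_nil (by simp)
  have hu := fun A B => isSubst_nil_unique (J := J) hJ (F := []) (by simp) (A := A) (B := B)
  rw [treePart_eq (c := .space hN) hJ hS hu, topTree]
  simp only [sum_tree_space_right _ _ (show ([] : List (Fin (#J - 1 + 1))).length ≤ 1 by simp),
    smul_neg, Finset.sum_neg_distrib]
  rw [sum_tree_space_left _ _ (by simp), smul_neg, neg_neg]
  refine congrArg (· • _) ?_
  change (-1 : k) * ksign k (((0 : ℕ) : ℤ) + ((0 : ℕ) : ℤ) * _) = _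
  rw [Nat.cast_zero, zero_mul, add_zero, ksign_zero, mul_one, ← ksign_one]
  refine ksign_eq_of_even k ⟨1 - #Jᶜ - ((#J - 1 : ℕ) : ℤ) + 2 * (#Jᶜ * ((#J - 1 : ℕ) : ℤ)), ?_⟩
  ring

variable {p : ℕ} {hp : 2 ≤ p} {f : Fin p ↪ Fin (N + 1)}

/-- Here B is empty and A is the full planar word, of weight p − 1. With the −1 of the upper space
corolla the sign is (−1)^p, the same as that of ordering decorations of degrees of parity p and 1.
-/
theorem treePart_lower (hJ : 1 ≤ #J) (hf : ∀ q, f q ∉ J) :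
    treePart k J (.mixed p hp f) = topTree F∞ J _ (mixedC F∞ (corollaGen k) #Jᶜ p (lowerIdx J ∘ f))
      (spaceC F∞ (corollaGen k) (#J - 1)) := by
  have hF : ∀ a ∈ List.ofFn f, a ∉ J := by
    intro a ha
    obtain ⟨q, rfl⟩ := List.mem_ofFn.1 ha
    exact hf q
  have hS := isSubst_nil hJ (List.nodup_ofFn.2 f.injective) hF
  have hu := fun A B => isSubst_nil_unique hJ hF (A := A) (B := B)
  rw [List.map_ofFn (f := f) (g := lowerIdx J)] at hS hu
  rw [treePart_eq (c := .mixed p hp f) hJ hS hu, topTree]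
  simp only [sum_tree_space_right _ _ (show ([] : List (Fin (#J - 1 + 1))).length ≤ 1 by simp),
    smul_neg, Finset.sum_neg_distrib]
  rw [sum_tree_mixed_left _ _ hp hS.1, ← neg_smul]
  refine congrArg (· • _) ?_
  change -((1 : k) * ksign k (_ + ((0 : ℕ) : ℤ) * _)) = _
  simp only [weight, List.length_ofFn]
  rw [one_mul, ← neg_one_mul, ← ksign_one k, ← ksign_add, Nat.cast_sub (by omega : 1 ≤ p)]
  refine ksign_eq_of_even k ⟨p - p * ((#J - 1 : ℕ) : ℤ) - #Jᶜ + 2 * (#Jᶜ * ((#J - 1 : ℕ) : ℤ)), ?_⟩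
  push_cast
  ring

theorem treePart_none (hJ : 1 ≤ #J) (h₀ : ∃ q, f q ∈ J)
    (hn : ∀ l m t, l + m = p + 1 → 1 ≤ l → t < m →
      ¬ ∀ q : Fin p, f q ∈ J ↔ t ≤ (q : ℕ) ∧ (q : ℕ) < t + l) :
    treePart k J (.mixed p hp f) = 0 := by
  refine treePart_eq_zero hJ fun A B hS => ?_
  rcases IsSubst.interval (f := f) (hJ := hJ) hS with h | ⟨l, m, t, h₁, h₂, h₃, h₄⟩
  · obtain ⟨q, hq⟩ := h₀
    exact h q hq
  · exact hn l m t h₁ h₂ h₃ h₄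

/-! ### Trees with planar inputs on the upper vertex -/

section Interval

variable {l m t : ℕ}

/-- The words have weights m − 1 and l − 1, and the internal edge is in position t. The exponent (m
− 1) + (l − 1)(m − 1 + t) agrees modulo 2 with l + t(l + 1) plus the product lm of the parities of
the degrees. -/
theorem treePart_interval (hJ : 1 ≤ #J) (hlm : l + m = p + 1) (hl : 2 ≤ l) (hm : 2 ≤ m) (ht : t < m)
    (hK : ∀ q : Fin p, f q ∈ J ↔ t ≤ (q : ℕ) ∧ (q : ℕ) < t + l) :
    treePart k J (.mixed p hp f) = ksign k (l + t * (l + 1)) • topTree F∞ J _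
      (mixedC F∞ (corollaGen k) #Jᶜ m fun u =>
        lowerIdx J (atNat f (if (u : ℕ) ≤ t then u else u + l - 1)))
      (mixedC F∞ (corollaGen k) (#J - 1) l fun u => upperIdx J (atNat f (t + u))) := by
  obtain ⟨hS, hi, hu⟩ := isSubst_interval hJ hlm (by omega) ht hK
  rw [treePart_eq (c := .mixed p hp f) hJ hS hu, topTree, hi]
  simp only [sum_tree_mixed_right _ _ hl hS.2.1]
  rw [sum_tree_mixed_left _ _ hm hS.1, smul_smul, ← ksign_add]
  refine congrArg (· • _) ((one_mul _).trans ?_)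
  simp only [weight, List.length_ofFn]
  rw [Nat.cast_sub (by omega : 1 ≤ l), Nat.cast_sub (by omega : 1 ≤ m)]
  refine ksign_eq_of_even k ⟨l * m + l * t - m * ((#J - 1 : ℕ) : ℤ) - #Jᶜ * l +
    2 * (#Jᶜ * ((#J - 1 : ℕ) : ℤ)), ?_⟩
  push_cast
  ring

/-- An interval of length one: B is a single letter, of weight zero, so the upper vertex must be a
space corolla and the sign is computed as for an empty B. -/
theorem treePart_singleton (hJ : 1 ≤ #J) (t : Fin p) (hK : ∀ q : Fin p, f q ∈ J ↔ q = t) :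
    treePart k J (.mixed p hp f) = topTree F∞ J _ (mixedC F∞ (corollaGen k) #Jᶜ p (lowerIdx J ∘ f))
      (spaceC F∞ (corollaGen k) (#J - 1)) := by
  obtain ⟨hS, hi, hu⟩ := isSubst_interval (l := 1) (m := p) (t := t) (f := f) hJ (by omega) le_rfl
    t.2 (fun q => by rw [hK, Fin.ext_iff]; omega)
  have hA : (fun u : Fin p => lowerIdx J (atNat f (if (u : ℕ) ≤ t then u else u + 1 - 1))) =
      lowerIdx J ∘ f := by
    funext u
    rw [Nat.add_sub_cancel, ite_self, atNat_of_lt f u.2]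
    rfl
  simp only [hA] at hS hi hu
  rw [treePart_eq (c := .mixed p hp f) hJ hS hu, topTree, hi]
  simp only [sum_tree_space_right _ _ (show (List.ofFn fun u : Fin 1 =>
    upperIdx J (atNat f (t + u))).length ≤ 1 by simp), smul_neg, Finset.sum_neg_distrib]
  rw [sum_tree_mixed_left _ _ hp hS.1, ← neg_smul]
  refine congrArg (· • _) ?_
  simp only [weight, List.length_ofFn]
  change -((1 : k) * ksign k (_ + ((0 : ℕ) : ℤ) * _)) = _
  rw [one_mul, ← neg_one_mul, ← ksign_one k, ← ksign_add, Nat.cast_sub (by omega : 1 ≤ p)]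
  refine ksign_eq_of_even k ⟨p - p * ((#J - 1 : ℕ) : ℤ) - #Jᶜ + 2 * (#Jᶜ * ((#J - 1 : ℕ) : ℤ)), ?_⟩
  push_cast
  ring

/-- The full interval: A is the single letter 0, of weight zero, so the lower vertex must be a space
corolla. Its −1 is the only sign, and (−1)^p compensates the ordering of the decorations. -/
theorem treePart_upper (hJ : 1 ≤ #J) (hK : ∀ q : Fin p, f q ∈ J) :
    treePart k J (.mixed p hp f) = -(ksign k p • topTree F∞ J _ (spaceC F∞ (corollaGen k) #Jᶜ)
      (mixedC F∞ (corollaGen k) (#J - 1) p (upperIdx J ∘ f))) := by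
  obtain ⟨hS, hi, hu⟩ := isSubst_interval (l := p) (m := 1) (t := 0) (f := f) hJ rfl (by omega)
    one_pos (fun q => by simp [hK])
  have hB : (fun u : Fin p => upperIdx J (atNat f (0 + u))) = upperIdx J ∘ f := by
    funext u
    rw [zero_add, atNat_of_lt f u.2]
    rfl
  simp only [hB] at hS hi hu
  rw [treePart_eq (c := .mixed p hp f) hJ hS hu, topTree, hi]
  simp only [sum_tree_mixed_right _ _ hp hS.2.1]
  rw [sum_tree_space_left _ _ (by simp), smul_smul, smul_neg, ← ksign_add]
  refine congrArg (-·) (congrArg (· • _) ((one_mul _).trans ?_))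
  simp only [weight, List.length_ofFn]
  rw [Nat.cast_sub (by omega : 1 ≤ p)]
  refine ksign_eq_of_even k ⟨p - ((#J - 1 : ℕ) : ℤ) - #Jᶜ * p + 2 * (#Jᶜ * ((#J - 1 : ℕ) : ℤ)), ?_⟩
  push_cast
  ring

end Interval

end TreeParts

/-! ### Reorganization of sums -/

section Sums

variable {M : Type*} [AddCommMonoid M] {N p : ℕ}

/-- The interval of length `l` starting at `t`. -/
def interval (p l t : ℕ) : Finset (Fin p) :=
  univ.filter fun q : Fin p => t ≤ (q : ℕ) ∧ (q : ℕ) < t + l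

theorem mem_interval {l t : ℕ} {q : Fin p} : q ∈ interval p l t ↔ t ≤ (q : ℕ) ∧
    (q : ℕ) < t + l := by
  simp [interval]

theorem interval_inj {l m t l' m' t' : ℕ} (hl : 1 ≤ l) (ht : t < m) (hlm : l + m = p + 1)
    (hl' : 1 ≤ l') (ht' : t' < m') (hlm' : l' + m' = p + 1)
    (h : interval p l t = interval p l' t') : l = l' ∧ t = t' := by
  have key : ∀ n, n < p → ((t ≤ n ∧ n < t + l) ↔ (t' ≤ n ∧ n < t' + l')) := fun n hn => by
    have := Finset.ext_iff.1 h ⟨n, hn⟩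
    rwa [mem_interval, mem_interval] at this
  have h₁ := key t (by omega)
  have h₂ := key t' (by omega)
  have h₃ := key (t + l - 1) (by omega)
  have h₄ := key (t' + l' - 1) (by omega)
  omega

/-- Length and starting point are determined by a non-empty interval, so the double sum lists each
of them once. The second index m = p + 1 − l is the number of possible starting points. -/
theorem sum_intervals (h : Finset (Fin p) → M)
    (hh : ∀ K, K ≠ ∅ → (∀ l m t, l + m = p + 1 → 1 ≤ l → t < m → K ≠ interval p l t) → h K = 0) :
    ∑ K, h K = h ∅ + ∑ lm ∈ antidiagonal (p + 1) with 1 ≤ lm.1 ∧ 1 ≤ lm.2, ∑ t ∈ range lm.2,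
      h (interval p lm.1 t) := by
  classical
  rw [Finset.sum_sigma']
  set Q := ((antidiagonal (p + 1)).filter fun lm : ℕ × ℕ => 1 ≤ lm.1 ∧ 1 ≤ lm.2).sigma
    fun lm => range lm.2 with hQ
  have hmem : ∀ x : (_ : ℕ × ℕ) × ℕ, x ∈ Q ↔ (x.1.1 + x.1.2 = p + 1 ∧ 1 ≤ x.1.1 ∧ 1 ≤ x.1.2) ∧
      x.2 < x.1.2 := fun x => by
    simp only [hQ, Finset.mem_sigma, Finset.mem_filter, HasAntidiagonal.mem_antidiagonal,
      Finset.mem_range]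
  have himg : ∑ x ∈ Q, h (interval p x.1.1 x.2) =
      ∑ K ∈ Q.image fun x => interval p x.1.1 x.2, h K := by
    refine (Finset.sum_image ?_).symm
    rintro ⟨⟨l, m⟩, t⟩ hx ⟨⟨l', m'⟩, t'⟩ hx' e
    have hx := (hmem _).1 (Finset.mem_coe.1 hx)
    have hx' := (hmem _).1 (Finset.mem_coe.1 hx')
    simp only at hx hx' e
    obtain ⟨rfl, rfl⟩ := interval_inj hx.1.2.1 hx.2 hx.1.1 hx'.1.2.1 hx'.2 hx'.1.1 e
    obtain rfl : m = m' := by omega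
    rfl
  have hne : ∅ ∉ Q.image fun x => interval p x.1.1 x.2 := by
    intro he
    obtain ⟨⟨⟨l, m⟩, t⟩, hx, e⟩ := Finset.mem_image.1 he
    have hx := (hmem _).1 hx
    simp only at hx e
    have : (⟨t, by omega⟩ : Fin p) ∈ interval p l t := mem_interval.2 (by simp; omega)
    rw [e] at this
    exact absurd this (Finset.notMem_empty _)
  rw [himg, ← Finset.sum_insert hne]
  refine (Finset.sum_subset (Finset.subset_univ _) fun K _ hK => hh K ?_ ?_).symm
  · rintro rfl
    exact hK (Finset.mem_insert_self _ _)
  · rintro l m t h₁ h₂ h₃ rfl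
    refine hK (Finset.mem_insert_of_mem (Finset.mem_image.2 ⟨⟨⟨l, m⟩, t⟩, (hmem _).2 ?_, rfl⟩))
    exact ⟨⟨h₁, h₂, by simp only; omega⟩, h₃⟩

/-- The extreme cases l = 1 and m = 1 correspond to a space corolla on the upper or on the lower
vertex; they are distinct since p ≥ 2. -/
theorem sum_antidiagonal_split (hp : 2 ≤ p) (g : ℕ × ℕ → M) :
    ∑ lm ∈ antidiagonal (p + 1) with 1 ≤ lm.1 ∧ 1 ≤ lm.2, g lm =
      g (1, p) + (g (p, 1) + ∑ lm ∈ antidiagonal (p + 1) with 2 ≤ lm.1 ∧ 2 ≤ lm.2, g lm) := by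
  have : (antidiagonal (p + 1)).filter (fun lm : ℕ × ℕ => 1 ≤ lm.1 ∧ 1 ≤ lm.2) =
      insert (1, p) (insert (p, 1)
        ((antidiagonal (p + 1)).filter fun lm : ℕ × ℕ => 2 ≤ lm.1 ∧ 2 ≤ lm.2)) := by
    ext ⟨l, m⟩
    simp only [Finset.mem_filter, HasAntidiagonal.mem_antidiagonal, Finset.mem_insert,
        Prod.mk.injEq]
    omega
  rw [this, Finset.sum_insert, Finset.sum_insert]
  · simp
  · simp only [Finset.mem_insert, Finset.mem_filter, HasAntidiagonal.mem_antidiagonal,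
      Prod.mk.injEq]
    omega

theorem mem_map_union_iff {f : Fin p ↪ Fin (N + 1)} {I : Finset (Fin (N + 1))}
    (hI : I ∈ (univ \ univ.map f).powerset) (K : Finset (Fin p)) (q : Fin p) :
    f q ∈ K.map f ∪ I ↔ q ∈ K := by
  have : f q ∉ I := fun h => by
    have := Finset.mem_powerset.1 hI h
    simp at this
  simp [this]

/-- A set of upper leaves consists of planar inputs, recorded by their positions K, and of space
inputs I. -/
theorem sum_finset_split (f : Fin p ↪ Fin (N + 1)) (T : Finset (Fin (N + 1)) → M) :
    ∑ J, T J = ∑ I ∈ (univ \ univ.map f).powerset, ∑ K : Finset (Fin p), T (K.map f ∪ I) := by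
  rw [← Finset.sum_product']
  have hinv : ∀ J : Finset (Fin (N + 1)),
      (univ.filter fun q => f q ∈ J).map f ∪ (J \ univ.map f) = J := by
    intro J
    ext a
    simp only [Finset.mem_union, Finset.mem_map, Finset.mem_filter, Finset.mem_univ, true_and,
      Finset.mem_sdiff]
    constructor
    · rintro (⟨q, hq, rfl⟩ | h)
      · exact hq
      · exact h.1
    · intro ha
      by_cases h : ∃ q, f q = a
      · obtain ⟨q, rfl⟩ := h
        exact Or.inl ⟨q, ha, rfl⟩
      · exact Or.inr ⟨ha, h⟩
  refine Finset.sum_bij' (fun J _ => (J \ univ.map f, univ.filter fun q => f q ∈ J))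
    (fun x _ => x.2.map f ∪ x.1) ?_ ?_ ?_ ?_ ?_
  · intro J _
    simp only [Finset.mem_product, Finset.mem_powerset, Finset.mem_univ, and_true]
    exact Finset.sdiff_subset_sdiff (Finset.subset_univ _) subset_rfl
  · intro x _
    exact Finset.mem_univ _
  · intro J _
    exact hinv J
  · rintro ⟨I, K⟩ hx
    have hI := (Finset.mem_product.1 hx).1
    refine Prod.ext ?_ ?_
    · ext a
      have h₁ : a ∈ I → a ∉ univ.map f := fun h =>
        (Finset.mem_sdiff.1 (Finset.mem_powerset.1 hI h)).2
      have h₂ : a ∈ K.map f → a ∈ univ.map f := fun h =>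
        Finset.map_subset_map.2 (Finset.subset_univ K) h
      simp only [Finset.mem_sdiff, Finset.mem_union]
      tauto
    · ext q
      simp only [Finset.mem_filter, Finset.mem_univ, true_and]
      exact mem_map_union_iff hI K q
  · intro J _
    exact congrArg T (hinv J).symm

end Sums

/-! ### The formula -/

section Formula

variable {k : Type u} [Field k] {N : ℕ} {J : Finset (Fin (N + 1))}

local notation "F∞" => free (cobarGen (gerstDual k))

theorem topTree_space_right (O : Operad k) (x : ∀ (r : ℕ) (c : Corolla r), O.V r c.degree) (D : ℤ)
    {r s : ℕ} {d : ℤ} (y : O.V r d) (hs : ¬ 1 ≤ s) : topTree O J D y (spaceC O x s) = 0 := by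
  rw [show spaceC O x s = 0 from dif_neg hs, topTree, tree_zero_right, smul_zero]

theorem topTree_space_left (O : Operad k) (x : ∀ (r : ℕ) (c : Corolla r), O.V r c.degree) (D : ℤ)
    {r s : ℕ} {e : ℤ} (z : O.V s e) (hr : ¬ 1 ≤ r) : topTree O J D (spaceC O x r) z = 0 := by
  rw [show spaceC O x r = 0 from dif_neg hr, topTree, tree_zero_left, smul_zero]

variable [CharZero k]

/-- All non-empty J contribute the same expression. For a single upper leaf, or for no leaf on the
lower vertex, it contains a space corolla with one input, which is zero by convention; this explains
the bounds in the formula. -/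
theorem cobarOnGen_space (hN : 1 ≤ N) :
    cobarOnGen (gerstDual k) (coordGen k ⟨.space hN, trivial, rfl⟩) =
      corollaDiff F∞ (corollaGen k) (.space hN) := by
  rw [cobarOnGen_coordGen, corollaDiff, Finset.powerset_univ]
  symm
  refine Eq.trans (Finset.sum_subset ?_ ?_) (Finset.sum_congr rfl fun J hJ =>
    (treePart_space (Finset.mem_filter.1 hJ).2 hN).symm)
  · intro J hJ
    have := (Finset.mem_filter.1 hJ).2
    exact Finset.mem_filter.2 ⟨Finset.mem_univ _, by omega⟩
  · intro J _ hJ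
    rw [Finset.mem_filter, not_and] at hJ
    have := hJ (Finset.mem_univ _)
    by_cases h : 1 ≤ #Jᶜ
    · exact topTree_space_right _ _ _ _ (by omega)
    · exact topTree_space_left _ _ _ _ h

variable {p : ℕ}

theorem cobarOnGen_mixed (hp : 2 ≤ p) (f : Fin p ↪ Fin (N + 1)) :
    cobarOnGen (gerstDual k) (coordGen k ⟨.mixed p hp f, trivial, rfl⟩) =
      corollaDiff F∞ (corollaGen k) (.mixed p hp f) := by
  -- Extended by zero to the empty set, which carries no tree.
  set T : Finset (Fin (N + 1)) → (F∞).V N ((Corolla.mixed p hp f).degree + 1) := fun J =>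
    if 1 ≤ #J then treePart k J (.mixed p hp f) else 0 with hT
  have hT₁ : ∀ J, 1 ≤ #J → T J = treePart k J (.mixed p hp f) := fun J hJ => if_pos hJ
  have hne : ∀ {I : Finset (Fin (N + 1))} {K : Finset (Fin p)}, K.Nonempty →
      1 ≤ #(K.map f ∪ I) := fun {I K} hK =>
    Finset.card_pos.2 ((hK.map (f := f)).mono Finset.subset_union_left)
  rw [cobarOnGen_coordGen, Finset.sum_filter, sum_finset_split f]
  change ∑ I ∈ (univ \ univ.map f).powerset, ∑ K : Finset (Fin p), T (K.map f ∪ I) = _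
  -- For fixed space inputs on top, the planar inputs on top are none, exactly one, all, or an
  -- interval of at least two that leaves at least one below. Other subsets contribute zero.
  have hI : ∀ I ∈ (univ \ univ.map f).powerset, ∑ K : Finset (Fin p), T (K.map f ∪ I) =
      T I + ((∑ t : Fin p, T ({f t} ∪ I)) + (T (univ.map f ∪ I) +
        ∑ lm ∈ antidiagonal (p + 1) with 2 ≤ lm.1 ∧ 2 ≤ lm.2, ∑ t ∈ range lm.2,
          T ((interval p lm.1 t).map f ∪ I))) := by
    intro I hI
    rw [sum_intervals, sum_antidiagonal_split hp]
    · congr 1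
      · rw [Finset.map_empty, Finset.empty_union]
      · congr 1
        · rw [← Fin.sum_univ_eq_sum_range fun t => T ((interval p 1 t).map f ∪ I)]
          refine Finset.sum_congr rfl fun t _ => ?_
          rw [show interval p 1 t = {t} by ext q; simp [mem_interval, Fin.ext_iff]; omega,
            Finset.map_singleton]
        · rw [Finset.sum_range_one, show interval p p 0 = univ by ext q; simp [mem_interval]]
    · intro K hK hn
      rw [hT₁ _ (hne (Finset.nonempty_iff_ne_empty.2 hK))]
      obtain ⟨q, hq⟩ := Finset.nonempty_iff_ne_empty.2 hK
      refine treePart_none (hne ⟨q, hq⟩) ⟨q, (mem_map_union_iff hI K q).2 hq⟩ ?_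
      intro l m t h₁ h₂ h₃ h₄
      refine hn l m t h₁ h₂ h₃ (Finset.ext fun q => ?_)
      rw [← mem_map_union_iff hI K q, h₄, mem_interval]
  rw [Finset.sum_congr rfl hI]
  simp only [Finset.sum_add_distrib]
  -- Sets with one element may be dropped, since the upper space corolla would have one input.
  have e₁ : ∑ I ∈ (univ \ univ.map f).powerset, T I =
      ∑ I ∈ (univ \ univ.map f).powerset with 2 ≤ #I, topTree F∞ I _
        (mixedC F∞ (corollaGen k) #Iᶜ p (lowerIdx I ∘ f)) (spaceC F∞ (corollaGen k) (#I - 1)) := by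
    rw [Finset.sum_filter]
    refine Finset.sum_congr rfl fun I hI => ?_
    by_cases h : 1 ≤ #I
    · rw [hT₁ I h, treePart_lower h fun q hq => by
        have := Finset.mem_powerset.1 hI hq
        simp at this]
      split_ifs with h₂
      · rfl
      · exact topTree_space_right _ _ _ _ (by omega)
    · rw [if_neg (by omega)]
      exact if_neg h
  -- If no space input remained below, the lower space corolla would have the internal edge as its
  -- only input; such terms vanish.
  have e₂ : ∑ I ∈ (univ \ univ.map f).powerset, T (univ.map f ∪ I) = -(ksign k p •
      ∑ I ∈ (univ \ univ.map f).powerset with 1 ≤ #((univ \ univ.map f) \ I),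
        topTree F∞ (univ.map f ∪ I) _ (spaceC F∞ (corollaGen k) #(univ.map f ∪ I)ᶜ)
          (mixedC F∞ (corollaGen k) (#(univ.map f ∪ I) - 1) p (upperIdx
              (univ.map f ∪ I) ∘ f))) := by
    rw [Finset.sum_filter, Finset.smul_sum, ← Finset.sum_neg_distrib]
    refine Finset.sum_congr rfl fun I hI => ?_
    have h1 : 1 ≤ #(univ.map f ∪ I) := hne ⟨⟨0, by omega⟩, Finset.mem_univ _⟩
    rw [hT₁ _ h1, treePart_upper h1 fun q => (mem_map_union_iff hI _ q).2 (Finset.mem_univ _)]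
    congr 2
    split_ifs with h₂
    · rfl
    · refine topTree_space_left _ _ _ _ fun h₃ => h₂ ?_
      rwa [show (univ \ univ.map f) \ I = (univ.map f ∪ I)ᶜ by ext a; simp]
  -- For empty I the upper space corolla would carry only the planar input f t, so the term vanishes
  -- and I may be required to be non-empty.
  have e₃ : ∑ I ∈ (univ \ univ.map f).powerset, ∑ t : Fin p, T ({f t} ∪ I) =
      ∑ I ∈ (univ \ univ.map f).powerset with 1 ≤ #I, ∑ t : Fin p, topTree F∞ ({f t} ∪ I) _
        (mixedC F∞ (corollaGen k) #({f t} ∪ I)ᶜ p (lowerIdx ({f t} ∪ I) ∘ f))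
        (spaceC F∞ (corollaGen k) (#({f t} ∪ I) - 1)) := by
    rw [Finset.sum_filter]
    refine Finset.sum_congr rfl fun I hI => ?_
    have key : ∀ t : Fin p, T ({f t} ∪ I) = topTree F∞ ({f t} ∪ I) _
        (mixedC F∞ (corollaGen k) #({f t} ∪ I)ᶜ p (lowerIdx ({f t} ∪ I) ∘ f))
        (spaceC F∞ (corollaGen k) (#({f t} ∪ I) - 1)) := by
      intro t
      have h1 : 1 ≤ #({f t} ∪ I) := Finset.card_pos.2 ⟨f t, by simp⟩
      rw [hT₁ _ h1]
      refine treePart_singleton h1 t fun q => ?_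
      have := mem_map_union_iff hI {t} q
      rwa [Finset.map_singleton, Finset.mem_singleton] at this
    split_ifs with h₂
    · exact Finset.sum_congr rfl fun t _ => key t
    · refine Finset.sum_eq_zero fun t _ => ?_
      rw [key]
      refine topTree_space_right _ _ _ _ ?_
      have : I = ∅ := Finset.card_eq_zero.1 (by omega)
      simp [this]
  have e₄ : ∑ I ∈ (univ \ univ.map f).powerset, ∑ lm ∈ antidiagonal (p + 1) with
      2 ≤ lm.1 ∧ 2 ≤ lm.2, ∑ t ∈ range lm.2, T ((interval p lm.1 t).map f ∪ I) =
      ∑ I ∈ (univ \ univ.map f).powerset, ∑ lm ∈ antidiagonal (p + 1) with 2 ≤ lm.1 ∧ 2 ≤ lm.2,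
        ∑ t ∈ range lm.2, ksign k (lm.1 + t * (lm.1 + 1)) •
          topTree F∞ ((interval p lm.1 t).map f ∪ I) _
            (mixedC F∞ (corollaGen k) #((interval p lm.1 t).map f ∪ I)ᶜ lm.2 fun u =>
              lowerIdx ((interval p lm.1 t).map f ∪ I)
                (atNat f (if (u : ℕ) ≤ t then u else u + lm.1 - 1)))
            (mixedC F∞ (corollaGen k) (#((interval p lm.1 t).map f ∪ I) - 1) lm.1 fun u =>
              upperIdx ((interval p lm.1 t).map f ∪ I) (atNat f (t + u))) := by
    refine Finset.sum_congr rfl fun I hI => Finset.sum_congr rfl fun lm hlm =>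
      Finset.sum_congr rfl fun t ht => ?_
    rw [Finset.mem_filter, HasAntidiagonal.mem_antidiagonal] at hlm
    rw [Finset.mem_range] at ht
    have h1 : 1 ≤ #((interval p lm.1 t).map f ∪ I) :=
      hne ⟨⟨t, by omega⟩, mem_interval.2 (by simp; omega)⟩
    rw [hT₁ _ h1]
    refine treePart_interval h1 hlm.1 hlm.2.1 hlm.2.2 ht fun q => ?_
    rw [mem_map_union_iff hI, mem_interval]
  rw [e₁, e₂, e₃, e₄, corollaDiff]
  simp only [interval]
  abel

theorem cobarOnGen_corolla (c : Corolla N) :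
    cobarOnGen (gerstDual k) (coordGen k ⟨c, trivial, rfl⟩) =
      corollaDiff F∞ (corollaGen k) c := by
  cases c with
  | space hN => exact cobarOnGen_space hN
  | mixed p hp f => exact cobarOnGen_mixed hp f

theorem ι_corollaIso (r : ℕ) (c : Corolla r) :
    ι _ ((corollaIso k).toEquiv r c.degree (corollaVec k _ c trivial rfl)) = corollaGen k r c :=
  congrArg (ι (cobarGen (gerstDual k)) (r := r) (d := c.degree))
    (corollaEquiv_single k ⟨c, trivial, rfl⟩)

end Formula

end GerstInfty
end

theorem proposition3p6p1 (k : Type u) [Field k] [CharZero k] :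
    (∃! δ, IsCobarDifferential (gerstDual k) δ) ∧
    ∃ θ : SModIso (corollaMod k fun _ => True) (cobarGen (gerstDual k)),
      (∀ (c : Corolla 1) (d : ℤ) (hc : c.degree = d)
          (hc' : c.degree = -(1 - ((1 : ℕ) : ℤ) - d))
          (φ : Module.Dual k ((gerstGen k).V 1 (-(1 - ((1 : ℕ) : ℤ) - d)))),
        cobarEval (gerstDual k) (θ.toEquiv 1 d (corollaVec k _ c trivial hc))
            (gerstDualGen k φ) =
          φ (corollaVec k _ c rfl hc')) ∧
      ∀ δ, IsCobarDifferential (gerstDual k) δ → ∀ (r : ℕ) (c : Corolla r),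
        δ r c.degree (ι _ (θ.toEquiv r c.degree (corollaVec k _ c trivial rfl))) =
          corollaDiff (free (cobarGen (gerstDual k)))
            (fun s c' => ι _ (θ.toEquiv s c'.degree (corollaVec k _ c' trivial rfl))) c := by
  refine ⟨existsUnique_cobarDifferential, corollaIso k, corollaIso_arity_two k,
    fun δ hδ r c => ?_⟩
  have hx : (fun s c' => ι _ ((corollaIso k).toEquiv s c'.degree
      (corollaVec k _ c' trivial rfl))) = corollaGen k :=
    funext fun s => funext fun c' => ι_corollaIso s c'
  rw [hx, hδ.on_gen, ← cobarOnGen_corolla]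
  exact congrArg (cobarOnGen (gerstDual k)) (corollaEquiv_single k ⟨c, trivial, rfl⟩)
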